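/- **Setting.** Let $\mathcal R=(X,R_0,Y,R_0^\vee,F_0)$ be a reduced based root datum ($X,Y$ dual lattices of finite rank, $R_0$ finite and not necessarily spanning), with Weyl group $W_0$. Let $q$ be a parameter function, i.e. a $W_0$-invariant map $R_{nr}^\vee\to\mathbb C^\times$, where $R_{nr}^\vee=R_0^\vee\cup\{\alpha^\vee/2:\alpha^\vee\in 2Y\}$; put $q(s_\alpha)=q_{\alpha^\vee}q_{\alpha^\vee/2}$ if $\alpha^\vee\in 2Y$ and $q(s_\alpha)=q_{\alpha^\vee}$ otherwise. Fix $W_0$-invariant square roots $q(s_\alpha)^{1/2}$ and $q_{\alpha^\vee}^{1/2}$ (equal to each other if $\alpha^\vee\notin 2Y$). The affine Hecke algebra $\mathcal H=\mathcal H(\mathcal R,q)$ is the complex algebra generated by $\theta_x$ ($x\in X$) and $N_{s_\alpha}$ ($\alpha\in F_0$), with the relations $\theta_0=1$, $\theta_{x+y}=\theta_x\theta_y$, $(N_{s_\alpha}-q(s_\alpha)^{1/2})(N_{s_\alpha}+q(s_\alpha)^{-1/2})=0$, the braid relations of $W_0$, and $$fN_{s_\alpha}-N_{s_\alpha}s_\alpha(f)=\big(q(s_\alpha)^{1/2}-q(s_\alpha)^{-1/2}+(q_{\alpha^\vee}^{1/2}-q_{\alpha^\vee}^{-1/2})\theta_{-\alpha}\big)\frac{f-s_\alpha(f)}{\theta_0-\theta_{-2\alpha}}\qquad(f\in\mathbb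 C[X]).$$ Let $\Gamma$ be a finite group acting on $\mathcal R$ by automorphisms that stabilize $F_0$ and preserve the parameters and their square roots. It acts on $\mathcal H$ by $\psi_\gamma(\theta_x)=\theta_{\gamma x}$, $\psi_\gamma(N_{s_\alpha})=N_{s_{\gamma\alpha}}$, which gives the crossed product $\mathcal H\rtimes\Gamma$. Write $T=\mathrm{Hom}(X,\mathbb C^\times)$, $\mathfrak a=\mathrm{Hom}(X,\mathbb R)$, and $\log|t|\in\mathfrak a$ for $x\mapsto\log|t(x)|$. For $P\subseteq F_0$ let $\mathcal H^P$ and $\mathcal H_P$ be the affine Hecke algebras defined in the same way from $(X,P,P^\vee)$ and from $(X_P,P,P^\vee)$, $X_P=X/(X\cap (P^\vee)^\perp)$, with the restricted parameters. There are homomorphisms $\mathcal H^P\to\mathcal H$, a quotient map $\mathcal H^P\to\mathcal H_P$, and for $t\in T^P=\mathrm{Hom}(X/(X\cap\mathbb QP),\mathbb C^\times)$ an automorphism $\phi_t$ of $\mathcal H^P$ with $\phi_t(\theta_x)=t(x)\theta_x$, $\phi_t(N_{s_\alpha})=N_{s_\alpha}$. A weight of a representation is a $t\in T$ for which some $v\neq0$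 satisfies $\theta_xv=t(x)v$ for all $x$. A representation of $\mathcal H$ or of $\mathcal H\rtimes\Gamma$ is tempered if $\log|t|\in\{\sum_{\alpha\in F_0}\lambda_\alpha\alpha^\vee:\lambda_\alpha\le0\}$ for all its weights $t$; for $\mathcal H_P$ the same with $P$ instead of $F_0$ and $X_P$ instead of $X$. A *Langlands datum for $\mathcal H$* is a triple $(P,\sigma,t)$ with $P\subseteq F_0$, $\sigma$ an irreducible tempered $\mathcal H_P$-representation, $t\in T^P$ and $|t(\alpha)|>1$ for all $\alpha\in F_0\setminus P$. Regard $\sigma\circ\phi_t$ as an $\mathcal H^P$-representation. Two data $(P,\sigma,t)$, $(P',\sigma',t')$ are equivalent if $P=P'$ and $\sigma\circ\phi_t\cong\sigma'\circ\phi_{t'}$. The group $\Gamma$ acts by $\gamma(P,\sigma,t)=(\gamma(P),\sigma\circ\psi_\gamma^{-1},\gamma(t))$; let $\Gamma_{P,\sigma,t}$ be the isotropy group of the equivalence class of $(P,\sigma,t)$. A choice of linear bijections $I_\delta$ ($\delta\in\Gamma_{P,\sigma,t}$) of $V_\sigma$ that intertwine $\sigma\circ\phi_t$ with $\sigma\circ\phi_t\circ\psi_\delta$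 determines a 2-cocycle $\kappa$ by $I_{\delta\varepsilon}=\kappa(\delta,\varepsilon)I_\delta I_\varepsilon$. A *Langlands datum for $\mathcal H\rtimes\Gamma$* is a quadruple $(P,\sigma,t,\rho)$ with $(P,\sigma,t)$ as above and $\rho$ an irreducible projective representation of $\Gamma_{P,\sigma,t}$ with $\rho(\delta)\rho(\varepsilon)=\kappa(\delta,\varepsilon)\rho(\delta\varepsilon)$, i.e. an irreducible representation of $\mathbb C[\Gamma_{P,\sigma,t},\kappa]$. Then $\mathcal H^P\rtimes\Gamma_{P,\sigma,t}$ acts on $(\sigma\circ\phi_t)\otimes\rho$, with $\delta$ acting by $I_\delta\otimes\rho(\delta)$. Put $$\pi(P,\sigma,t)=\mathrm{Ind}_{\mathcal H^P}^{\mathcal H}(\sigma\circ\phi_t),\qquad \pi^\Gamma(P,\sigma,t,\rho)=\mathrm{Ind}_{\mathcal H^P\rtimes\Gamma_{P,\sigma,t}}^{\mathcal H\rtimes\Gamma}\big((\sigma\circ\phi_t)\otimes\rho\big).$$ **Theorem (Langlands classification for $\mathcal H$).** For every Langlands datum for $\mathcal H$, $\pi(P,\sigma,t)$ has a unique irreducible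 quotient $L(P,\sigma,t)$. Every irreducible $\mathcal H$-representation is isomorphic to some $L(P,\sigma,t)$, and $L(P,\sigma,t)\cong L(P',\sigma',t')$ if and only if the two data are equivalent. **Corollary (extended Langlands classification).** For every Langlands datum for $\mathcal H$, operators $I_\delta$ and a cocycle $\kappa$ as above exist. Moreover: (a) For every Langlands datum for $\mathcal H\rtimes\Gamma$, $\pi^\Gamma(P,\sigma,t,\rho)$ has a unique irreducible quotient $L^\Gamma(P,\sigma,t,\rho)$. (b) For every irreducible $\mathcal H\rtimes\Gamma$-representation $\pi$ there is a Langlands datum $(P,\sigma,t)$ for $\mathcal H$ such that, whatever the choice of the $I_\delta$, $\pi\cong L^\Gamma(P,\sigma,t,\rho)$ for some $\rho$. Moreover $L^\Gamma(P,\sigma,t,\rho)\cong L^\Gamma(P',\sigma',t',\rho')$ if and only if the two data are in the same $\Gamma$-orbit, up to equivalence: there is $\gamma\in\Gamma$ such that $\gamma(P,\sigma,t)$ is equivalent to $(P',\sigma',t')$ and $\rho'$ is isomorphic to the image of $\rho$ under the isomorphism of twisted group algebras induced by $\gamma$ and this equivalence. (c) $L^\Gamma(P,\sigma,t,\rho)$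 is tempered if and only if $P=F_0$ and $t$ is unitary ($|t(x)|=1$ for all $x\in X$); and $\pi^\Gamma(P,\sigma,t,\rho)$ is tempered if and only if the same condition holds. -/

import Mathlib

universe v w

noncomputable section

namespace AffineHecke

open scoped TensorProduct Pointwise



/-! ### Representations of complex associative algebras -/

section Representations

variable {A : Type*} [Ring A] [Algebra ℂ A]
variable {B : Type*} [Ring B] [Algebra ℂ B]
variable {V : Type*} [AddCommGroup V] [Module ℂ V]
variable {W : Type*} [AddCommGroup W] [Module ℂ W]

/-- The subspace `U` of the representation `π` is stable under the algebra. -/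
def IsInvariant (π : A →ₐ[ℂ] Module.End ℂ V) (U : Submodule ℂ V) : Prop :=
  ∀ a : A, ∀ v ∈ U, π a v ∈ U

/-- Irreducibility: nonzero, with no invariant subspaces except `0` and the whole space. -/
def IsIrred (π : A →ₐ[ℂ] Module.End ℂ V) : Prop :=
  Nontrivial V ∧ ∀ U : Submodule ℂ V, IsInvariant π U → U = ⊥ ∨ U = ⊤

/-- Equivalence (isomorphism) of representations. -/
def RepEquiv (π : A →ₐ[ℂ] Module.End ℂ V) (π' : A →ₐ[ℂ] Module.End ℂ W) : Prop :=
  ∃ e : V ≃ₗ[ℂ] W, ∀ (a : A) (v : V), e (π a v) = π' a (e v)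

/-- The quotient representation of `π` by an invariant subspace. -/
def quotRep (π : A →ₐ[ℂ] Module.End ℂ V) (U : Submodule ℂ V) (hU : IsInvariant π U) :
    A →ₐ[ℂ] Module.End ℂ (V ⧸ U) :=
  AlgHom.ofLinearMap
    { toFun := fun a => U.mapQ U (π a) (fun v hv => hU a v hv)
      map_add' := fun a b => by ext v; simp
      map_smul' := fun c a => by ext v; simp }
    (by ext v; simp)
    (fun a b => by ext v; simp)

/-- The sum of all proper invariant subspaces. -/
def radical (π : A →ₐ[ℂ] Module.End ℂ V) : Submodule ℂ V :=
  sSup {U : Submodule ℂ V | IsInvariant π U ∧ U ≠ ⊤}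

lemma isInvariant_radical (π : A →ₐ[ℂ] Module.End ℂ V) : IsInvariant π (radical π) := by
  intro a
  change radical π ≤ (radical π).comap (π a)
  refine sSup_le fun U hU v hv => ?_
  exact (le_sSup hU : U ≤ radical π) (hU.1 a v hv)

/-- The quotient of `π` by the sum of all its proper invariant subspaces. When `π` has a unique
irreducible quotient and finite dimension, this is that quotient. -/
def headRep (π : A →ₐ[ℂ] Module.End ℂ V) : A →ₐ[ℂ] Module.End ℂ (V ⧸ radical π) :=
  quotRep π (radical π) (isInvariant_radical π)

/-- `headRep π` is the unique irreducible quotient of `π`: it is irreducible, and every invariant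
subspace with an irreducible quotient is the one that `headRep π` is the quotient by. -/
def HasUniqueIrredQuotient (π : A →ₐ[ℂ] Module.End ℂ V) : Prop :=
  IsIrred (headRep π) ∧
    ∀ (U : Submodule ℂ V) (hU : IsInvariant π U), IsIrred (quotRep π U hU) → U = radical π

/-- The relations `a f(b) ⊗ v = a ⊗ b v` that define `A ⊗_B V` as a quotient of `A ⊗_ℂ V`. -/
def indRel (f : B →ₐ[ℂ] A) (π : B →ₐ[ℂ] Module.End ℂ V) : Submodule ℂ (A ⊗[ℂ] V) :=
  Submodule.span ℂ {z | ∃ (a : A) (b : B) (v : V), z = (a * f b) ⊗ₜ[ℂ] v - a ⊗ₜ[ℂ] π b v}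

/-- The space `A ⊗_B V` of the induced representation. -/
def IndSpace (f : B →ₐ[ℂ] A) (π : B →ₐ[ℂ] Module.End ℂ V) : Type _ :=
  (A ⊗[ℂ] V) ⧸ indRel f π

instance (f : B →ₐ[ℂ] A) (π : B →ₐ[ℂ] Module.End ℂ V) : AddCommGroup (IndSpace f π) :=
  Submodule.Quotient.addCommGroup (indRel f π)

instance (f : B →ₐ[ℂ] A) (π : B →ₐ[ℂ] Module.End ℂ V) : Module ℂ (IndSpace f π) :=
  Submodule.Quotient.module (indRel f π)

/-- Left multiplication by `A` on `A ⊗_ℂ V`. -/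
def leftMul (V : Type*) [AddCommGroup V] [Module ℂ V] (A : Type*) [Ring A] [Algebra ℂ A] :
    A →ₐ[ℂ] Module.End ℂ (A ⊗[ℂ] V) :=
  AlgHom.ofLinearMap
    { toFun := fun a => LinearMap.rTensor V (LinearMap.mulLeft ℂ a)
      map_add' := fun a b => by ext x v; simp [add_mul, TensorProduct.add_tmul]
      map_smul' := fun c a => by ext x v; simp [TensorProduct.smul_tmul'] }
    (by ext x v; simp)
    (fun a b => by ext x v; simp)

@[simp] lemma leftMul_tmul (a x : A) (v : V) :
    leftMul V A a (x ⊗ₜ[ℂ] v) = (a * x) ⊗ₜ[ℂ] v := by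
  simp [leftMul]

lemma isInvariant_indRel (f : B →ₐ[ℂ] A) (π : B →ₐ[ℂ] Module.End ℂ V) :
    IsInvariant (leftMul V A) (indRel f π) := by
  intro a
  change indRel f π ≤ (indRel f π).comap (leftMul V A a)
  refine Submodule.span_le.2 ?_
  rintro _ ⟨x, b, v, rfl⟩
  refine Submodule.subset_span ⟨a * x, b, v, ?_⟩
  simp [mul_assoc]

/-- The induced representation `Ind_B^A(π) = A ⊗_B V` along an algebra homomorphism `B → A`. -/
def indRep (f : B →ₐ[ℂ] A) (π : B →ₐ[ℂ] Module.End ℂ V) :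
    A →ₐ[ℂ] Module.End ℂ (IndSpace f π) :=
  quotRep (leftMul V A) (indRel f π) (isInvariant_indRel f π)

end Representations

/-! ### Crossed products -/

section Crossed

variable {A : Type*} [Ring A] [Algebra ℂ A] {G : Type*} [Group G]

/-- An action of a group on an algebra by algebra endomorphisms, as a Mathlib action. -/
@[reducible] def actionOf (ρ : G →* (A →ₐ[ℂ] A)) : MulSemiringAction G A where
  smul g a := ρ g a
  one_smul a := by change ρ 1 a = a; simp
  mul_smul g h a := by change ρ (g * h) a = ρ g (ρ h a); simp
  smul_zero g := map_zero (ρ g)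
  smul_add g := map_add (ρ g)
  smul_one g := map_one (ρ g)
  smul_mul g := map_mul (ρ g)

lemma smulComm_actionOf (ρ : G →* (A →ₐ[ℂ] A)) :
    letI := actionOf ρ; SMulCommClass G ℂ A :=
  letI := actionOf ρ
  ⟨fun g c a => map_smul (ρ g) c a⟩

/-- The crossed product `A ⋊ G`: finite sums `∑ a_g g`, with `g a = (g • a) g`. -/
def Crossed (_ρ : G →* (A →ₐ[ℂ] A)) : Type _ := SkewMonoidAlgebra A G

namespace Crossed

variable (ρ : G →* (A →ₐ[ℂ] A))

instance : Ring (Crossed ρ) :=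
  @SkewMonoidAlgebra.instRing A G _ _ (actionOf ρ)

instance : Algebra ℂ (Crossed ρ) :=
  @SkewMonoidAlgebra.instAlgebraOfSMulCommClass ℂ G _ _ A _ _ (actionOf ρ) (smulComm_actionOf ρ)

/-- The inclusion `A → A ⋊ G`. -/
def of : A →ₐ[ℂ] Crossed ρ :=
  letI := actionOf ρ
  letI := smulComm_actionOf ρ
  AlgHom.ofLinearMap
    (show A →ₗ[ℂ] SkewMonoidAlgebra A G from
      { toFun := fun a => SkewMonoidAlgebra.single 1 a
        map_add' := fun a b => SkewMonoidAlgebra.single_add 1 a b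
        map_smul' := fun c a => (SkewMonoidAlgebra.smul_single c 1 a).symm })
    rfl
    (fun a b => by
      change SkewMonoidAlgebra.single (1 : G) (a * b) =
        SkewMonoidAlgebra.single (1 : G) a * SkewMonoidAlgebra.single (1 : G) b
      simp [SkewMonoidAlgebra.single_mul_single])

/-- The inclusion `G → A ⋊ G`. -/
def gp : G →* Crossed ρ :=
  letI := actionOf ρ
  SkewMonoidAlgebra.of A G

lemma gp_mul_of (g : G) (a : A) : gp ρ g * of ρ a = of ρ (ρ g a) * gp ρ g := by
  let _ := actionOf ρ
  change SkewMonoidAlgebra.single g (1 : A) * SkewMonoidAlgebra.single (1 : G) a =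
    SkewMonoidAlgebra.single (1 : G) (ρ g a) * SkewMonoidAlgebra.single g (1 : A)
  simp [SkewMonoidAlgebra.single_mul_single]
  rfl

/-- The homomorphism on `A ⋊ G` given by compatible homomorphisms on `A` and on `G`. -/
def lift {B : Type*} [Ring B] [Algebra ℂ B] (f : A →ₐ[ℂ] B) (φ : G →* B)
    (h : ∀ g a, φ g * f a = f (ρ g a) * φ g) : Crossed ρ →ₐ[ℂ] B :=
  @SkewMonoidAlgebra.liftNCAlgHom ℂ G _ _ A B _ _ _ _ (actionOf ρ) (smulComm_actionOf ρ) f φ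
    (fun {x y} => (h y x).symm)

end Crossed

end Crossed

/-! ### Affine Hecke algebras in the Bernstein presentation -/

/-- The part of a based root datum with parameters that enters the Bernstein presentation:
the lattice `X`, the simple roots `α_i` and simple coroots `α_i^∨` (as functionals on `X`), the
orders `m i j` of the products `s_i s_j` of simple reflections, and the square roots
`q i = q(s_{α_i})^{1/2}`, `qStar i = q_{α_i^∨}^{1/2}` of the parameters. -/
structure BernsteinDatum (F X : Type*) [AddCommGroup X] where
  root : F → X
  coroot : F → (X →+ ℤ)
  m : F → F → ℕ
  q : F → ℂˣ
  qStar : F → ℂˣ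

namespace BernsteinDatum

section Algebra

variable {F X : Type*} [AddCommGroup X] (D : BernsteinDatum F X)

/-- The simple reflection `s_i(x) = x - ⟨x, α_i^∨⟩ α_i`. -/
def refl (i : F) : X →+ X where
  toFun x := x - D.coroot i x • D.root i
  map_zero' := by simp
  map_add' x y := by simp only [map_add, add_smul]; abel

/-- The element `θ_x` of the group algebra `ℂ[X]`. -/
def mono {X : Type*} (x : X) : AddMonoidAlgebra ℂ X := AddMonoidAlgebra.single x 1

/-- The action of the simple reflection `s_i` on the group algebra `ℂ[X]`. -/
def reflAlg (i : F) : AddMonoidAlgebra ℂ X →+* AddMonoidAlgebra ℂ X :=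
  AddMonoidAlgebra.mapDomainRingHom ℂ (D.refl i)

/-- The numerator `(q^{1/2} - q^{-1/2}) + (q_{α^∨}^{1/2} - q_{α^∨}^{-1/2}) θ_{-α}`. -/
def numer (i : F) : AddMonoidAlgebra ℂ X :=
  ((D.q i : ℂ) - ((D.q i)⁻¹ : ℂˣ)) • mono 0 +
    ((D.qStar i : ℂ) - ((D.qStar i)⁻¹ : ℂˣ)) • mono (-D.root i)

/-- The generator `θ_x` of the free algebra. -/
def genTheta (F : Type*) {X : Type*} (x : X) : FreeAlgebra ℂ (X ⊕ F) := FreeAlgebra.ι ℂ (Sum.inl x)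

/-- The generator `N_{s_i}` of the free algebra. -/
def genN {F : Type*} (X : Type*) (i : F) : FreeAlgebra ℂ (X ⊕ F) := FreeAlgebra.ι ℂ (Sum.inr i)

/-- The linear combination of the generators `θ_x` given by an element of `ℂ[X]`. -/
def genThetaLin (F : Type*) {X : Type*} (f : AddMonoidAlgebra ℂ X) : FreeAlgebra ℂ (X ⊕ F) :=
  Finsupp.linearCombination ℂ (genTheta F) f.coeff

/-- The alternating product `a b a ⋯` with `n` factors. -/
def altProd {M : Type*} [Monoid M] (a b : M) (n : ℕ) : M :=
  ((List.range n).map fun k => if Even k then a else b).prod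

/-- The defining relations: `x ↦ θ_x` is multiplicative, the quadratic and braid relations of the
finite Weyl group, and the Bernstein relation
`f N_s - N_s s(f) = (numerator) (f - s(f)) / (1 - θ_{-2α})` for `f ∈ ℂ[X]`, in which `g` stands for
the right-hand side (it is unique, as `ℂ[X]` has no zero divisors). When `q i = qStar i`, a factor
`1 + θ_{-α}` cancels and the right-hand side is
`(q(s_α)^{1/2} - q(s_α)^{-1/2}) (f - s(f)) / (1 - θ_{-α})`. -/
inductive Rel : FreeAlgebra ℂ (X ⊕ F) → FreeAlgebra ℂ (X ⊕ F) → Prop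
  | theta_zero : Rel (genTheta F 0) 1
  | theta_add (x y : X) : Rel (genTheta F (x + y)) (genTheta F x * genTheta F y)
  | quadratic (i : F) :
      Rel ((genN X i - algebraMap ℂ _ (D.q i : ℂ)) *
        (genN X i + algebraMap ℂ _ (((D.q i)⁻¹ : ℂˣ) : ℂ))) 0
  | braid (i j : F) :
      Rel (altProd (genN X i) (genN X j) (D.m i j)) (altProd (genN X j) (genN X i) (D.m i j))
  | bernstein (i : F) (f g : AddMonoidAlgebra ℂ X)
      (h : g * (mono 0 - mono (-(2 : ℤ) • D.root i)) = D.numer i * (f - D.reflAlg i f)) :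
      Rel (genThetaLin F f * genN X i - genN X i * genThetaLin F (D.reflAlg i f)) (genThetaLin F g)

/-- The affine Hecke algebra. -/
abbrev Hecke : Type _ := RingQuot D.Rel

/-- The element `θ_x`. -/
def theta (x : X) : D.Hecke := RingQuot.mkAlgHom ℂ D.Rel (genTheta F x)

/-- The element `N_{s_i}`. -/
def N (i : F) : D.Hecke := RingQuot.mkAlgHom ℂ D.Rel (genN X i)

lemma theta_zero : D.theta 0 = 1 := by
  rw [theta, RingQuot.mkAlgHom_rel ℂ (Rel.theta_zero (D := D)), map_one]

lemma theta_add (x y : X) : D.theta (x + y) = D.theta x * D.theta y := by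
  rw [theta, RingQuot.mkAlgHom_rel ℂ (Rel.theta_add (D := D) x y), map_mul]; rfl

lemma quadratic (i : F) :
    (D.N i - algebraMap ℂ _ (D.q i : ℂ)) * (D.N i + algebraMap ℂ _ (((D.q i)⁻¹ : ℂˣ) : ℂ)) = 0 := by
  have := RingQuot.mkAlgHom_rel ℂ (Rel.quadratic (D := D) i)
  simp only [map_mul, map_sub, map_add, AlgHom.commutes, map_zero] at this
  exact this

lemma map_altProd {M M' H : Type*} [Monoid M] [Monoid M'] [FunLike H M M'] [MonoidHomClass H M M']
    (f : H) (a b : M) (n : ℕ) : f (altProd a b n) = altProd (f a) (f b) n := by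
  simp only [altProd, map_list_prod, List.map_map]
  congr 2
  ext k
  simp only [Function.comp]
  split_ifs <;> rfl

lemma braid (i j : F) : altProd (D.N i) (D.N j) (D.m i j) = altProd (D.N j) (D.N i) (D.m i j) := by
  have := RingQuot.mkAlgHom_rel ℂ (Rel.braid (D := D) i j)
  simp only [map_altProd] at this
  exact this

/-- The homomorphism `ℂ[X] → ℋ`, `x ↦ θ_x`, onto the commutative subalgebra `𝒜`. -/
def thetaHom : AddMonoidAlgebra ℂ X →ₐ[ℂ] D.Hecke :=
  AddMonoidAlgebra.lift ℂ D.Hecke X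
    { toFun := fun x => D.theta x.toAdd
      map_one' := D.theta_zero
      map_mul' := fun x y => D.theta_add x.toAdd y.toAdd }

lemma thetaHom_mono (x : X) : D.thetaHom (mono x) = D.theta x := by
  simp [thetaHom, mono]

lemma mk_genThetaLin (f : AddMonoidAlgebra ℂ X) :
    RingQuot.mkAlgHom ℂ D.Rel (genThetaLin F f) = D.thetaHom f := by
  rw [genThetaLin, Finsupp.linearCombination_apply, thetaHom, AddMonoidAlgebra.lift_apply,
    Finsupp.sum, map_sum]
  exact Finset.sum_congr rfl fun x _ => map_smul _ _ _

lemma bernstein (i : F) (f g : AddMonoidAlgebra ℂ X)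
    (h : g * (mono 0 - mono (-(2 : ℤ) • D.root i)) = D.numer i * (f - D.reflAlg i f)) :
    D.thetaHom f * D.N i - D.N i * D.thetaHom (D.reflAlg i f) = D.thetaHom g := by
  have := RingQuot.mkAlgHom_rel ℂ (Rel.bernstein (D := D) i f g h)
  simp only [map_mul, map_sub, mk_genThetaLin] at this
  exact this

variable {D} in
/-- Algebra homomorphisms on `ℋ` are determined by their values on the generators. -/
lemma hecke_ext {B : Type*} [Semiring B] [Algebra ℂ B] {f g : D.Hecke →ₐ[ℂ] B}
    (hθ : ∀ x, f (D.theta x) = g (D.theta x)) (hN : ∀ i, f (D.N i) = g (D.N i)) : f = g := by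
  apply RingQuot.ringQuot_ext'
  ext z
  rcases z with x | i
  · exact hθ x
  · exact hN i

end Algebra

/-! ### Homomorphisms between affine Hecke algebras -/

/-- Maps of lattices and of simple roots, and a character of the source lattice that is trivial on
the simple roots, compatible with all the structure. -/
structure Hom {F X F' X' : Type*} [AddCommGroup X] [AddCommGroup X']
    (D : BernsteinDatum F X) (D' : BernsteinDatum F' X') where
  onX : X →+ X'
  onF : F → F'
  char : AddChar X ℂ
  char_root : ∀ i, char (D.root i) = 1
  map_root : ∀ i, onX (D.root i) = D'.root (onF i)
  map_coroot : ∀ i x, D'.coroot (onF i) (onX x) = D.coroot i x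
  map_m : ∀ i j, D'.m (onF i) (onF j) = D.m i j
  map_q : ∀ i, D'.q (onF i) = D.q i
  map_qStar : ∀ i, D'.qStar (onF i) = D.qStar i

namespace Hom

variable {F X F' X' : Type*} [AddCommGroup X] [AddCommGroup X']
variable {D : BernsteinDatum F X} {D' : BernsteinDatum F' X'} (φ : Hom D D')

/-- The induced map on group algebras, `θ_x ↦ t(x) θ_{φ(x)}`. -/
def onAlg : AddMonoidAlgebra ℂ X →ₐ[ℂ] AddMonoidAlgebra ℂ X' :=
  AddMonoidAlgebra.lift ℂ (AddMonoidAlgebra ℂ X') X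
    { toFun := fun x => AddMonoidAlgebra.single (φ.onX x.toAdd) (φ.char x.toAdd)
      map_one' := by simp [AddMonoidAlgebra.one_def]
      map_mul' := fun x y => by
        simp [AddMonoidAlgebra.single_mul_single, AddChar.map_add_eq_mul] }

lemma onAlg_single (x : X) (c : ℂ) : φ.onAlg (AddMonoidAlgebra.single x c) =
    AddMonoidAlgebra.single (φ.onX x) (c * φ.char x) := by
  simp [onAlg]

lemma onAlg_mono (x : X) (hx : φ.char x = 1) : φ.onAlg (mono x) = mono (φ.onX x) := by
  rw [mono, onAlg_single, hx, mul_one]; rfl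

lemma char_zsmul_root (i : F) (n : ℤ) : φ.char (n • D.root i) = 1 := by
  rw [AddChar.map_zsmul_eq_zpow, φ.char_root, one_zpow]

lemma onX_refl (i : F) (x : X) : φ.onX (D.refl i x) = D'.refl (φ.onF i) (φ.onX x) := by
  simp [refl, φ.map_root, φ.map_coroot]

lemma char_refl (i : F) (x : X) : φ.char (D.refl i x) = φ.char x := by
  have h : D.refl i x = x + (-(D.coroot i x)) • D.root i := by
    simp [refl, sub_eq_add_neg]
  rw [h, AddChar.map_add_eq_mul, char_zsmul_root, mul_one]

lemma onAlg_reflAlg (i : F) (f : AddMonoidAlgebra ℂ X) :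
    φ.onAlg (D.reflAlg i f) = D'.reflAlg (φ.onF i) (φ.onAlg f) := by
  suffices h : (φ.onAlg : AddMonoidAlgebra ℂ X →+* _).comp (D.reflAlg i) =
      (D'.reflAlg (φ.onF i)).comp (φ.onAlg : AddMonoidAlgebra ℂ X →+* _) from
    RingHom.congr_fun h f
  refine AddMonoidAlgebra.ringHom_ext (fun c => ?_) (fun x => ?_) <;>
  simp [reflAlg, onAlg_single, onX_refl, char_refl]

lemma onAlg_numer (i : F) : φ.onAlg (D.numer i) = D'.numer (φ.onF i) := by
  have h0 : φ.char (0 : X) = 1 := AddChar.map_zero_eq_one _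
  have h1 : φ.char (-D.root i) = 1 := by
    simpa using φ.char_zsmul_root i (-1)
  simp only [numer, map_add, map_smul, onAlg_mono _ _ h0, onAlg_mono _ _ h1, map_zero, map_neg,
    φ.map_root, φ.map_q, φ.map_qStar]

/-- The images of the generators. -/
def onGen : FreeAlgebra ℂ (X ⊕ F) →ₐ[ℂ] D'.Hecke :=
  FreeAlgebra.lift ℂ (Sum.elim (fun x => φ.char x • D'.theta (φ.onX x)) (fun i => D'.N (φ.onF i)))

lemma onGen_theta (x : X) : φ.onGen (genTheta F x) = φ.char x • D'.theta (φ.onX x) := by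
  simp [onGen, genTheta]

lemma onGen_N (i : F) : φ.onGen (genN X i) = D'.N (φ.onF i) := by
  simp [onGen, genN]

lemma onGen_thetaLin (f : AddMonoidAlgebra ℂ X) :
    φ.onGen (genThetaLin F f) = D'.thetaHom (φ.onAlg f) := by
  rw [genThetaLin, Finsupp.linearCombination_apply, onAlg, AddMonoidAlgebra.lift_apply,
    Finsupp.sum, Finsupp.sum, map_sum, map_sum]
  refine Finset.sum_congr rfl fun x _ => ?_
  rw [map_smul, map_smul, onGen_theta]
  congr 1
  simp [thetaHom]

lemma onGen_rel ⦃a b : FreeAlgebra ℂ (X ⊕ F)⦄ (h : D.Rel a b) : φ.onGen a = φ.onGen b := by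
  induction h with
  | theta_zero => simp [onGen_theta, theta_zero]
  | theta_add x y =>
    rw [map_mul, onGen_theta, onGen_theta, onGen_theta, map_add φ.onX, theta_add,
      AddChar.map_add_eq_mul, Algebra.smul_mul_assoc, Algebra.mul_smul_comm, smul_smul]
  | quadratic i =>
    have := D'.quadratic (φ.onF i)
    rw [φ.map_q] at this
    simpa only [map_mul, map_sub, map_add, AlgHom.commutes, map_zero, onGen_N] using this
  | braid i j =>
    have := D'.braid (φ.onF i) (φ.onF j)
    rw [φ.map_m] at this
    simpa only [map_altProd, onGen_N] using this
  | bernstein i f g h =>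
    have h' := congrArg φ.onAlg h
    rw [map_mul, map_mul, map_sub, map_sub, onAlg_numer, onAlg_reflAlg,
      onAlg_mono _ _ (AddChar.map_zero_eq_one _), onAlg_mono _ _ (φ.char_zsmul_root i _),
      map_zero, map_zsmul, φ.map_root] at h'
    have := D'.bernstein (φ.onF i) _ _ h'
    simpa only [map_mul, map_sub, onGen_N, onGen_thetaLin, onAlg_reflAlg] using this

/-- The homomorphism `θ_x N_w ↦ t(x) θ_{φ(x)} N_{φ(w)}` of affine Hecke algebras. -/
def map : D.Hecke →ₐ[ℂ] D'.Hecke :=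
  RingQuot.liftAlgHom ℂ ⟨φ.onGen, φ.onGen_rel⟩

@[simp] lemma map_theta (x : X) : φ.map (D.theta x) = φ.char x • D'.theta (φ.onX x) := by
  rw [map, theta, RingQuot.liftAlgHom_mkAlgHom_apply, onGen_theta]

@[simp] lemma map_N (i : F) : φ.map (D.N i) = D'.N (φ.onF i) := by
  rw [map, N, RingQuot.liftAlgHom_mkAlgHom_apply, onGen_N]

end Hom

/-! ### Weights and temperedness -/

section Weights

variable {F X : Type*} [AddCommGroup X] (D : BernsteinDatum F X)
variable {V : Type*} [AddCommGroup V] [Module ℂ V]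

/-- `t ∈ T = Hom(X, ℂ^×)` is an `𝒜`-weight of `π`. -/
def IsWeight (π : D.Hecke →ₐ[ℂ] Module.End ℂ V) (t : AddChar X ℂ) : Prop :=
  ∃ v : V, v ≠ 0 ∧ ∀ x : X, π (D.theta x) v = t x • v

/-- The cone `𝔞^-` of nonpositive real combinations of the simple coroots, in
`𝔞 = Hom(X, ℝ)`. -/
def negCone : Set (X →+ ℝ) :=
  {μ | ∃ c : F → ℝ, (∀ i, c i ≤ 0) ∧ ∀ x : X, μ x = ∑ᶠ i, c i * (D.coroot i x : ℝ)}

end Weights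

end BernsteinDatum

/-- `log |t| ∈ 𝔞 = Hom(X, ℝ)` for a character `t ∈ T = Hom(X, ℂ^×)`. -/
def logAbs {X : Type*} [AddCommGroup X] (t : AddChar X ℂ) : X →+ ℝ where
  toFun x := Real.log ‖t x‖
  map_zero' := by simp
  map_add' x y := by
    have h : ∀ z, ‖t z‖ ≠ 0 := fun z hz => by
      have h1 : t z * t (-z) = 1 := by
        rw [← AddChar.map_add_eq_mul, add_neg_cancel, AddChar.map_zero_eq_one]
      rw [norm_eq_zero.1 hz, zero_mul] at h1
      exact zero_ne_one h1
    rw [AddChar.map_add_eq_mul, norm_mul, Real.log_mul (h x) (h y)]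

/-- A representation is tempered if `|t| ∈ T^- = exp(𝔞^-)` for all its `𝒜`-weights `t`. -/
def BernsteinDatum.IsTempered {F X : Type*} [AddCommGroup X] (D : BernsteinDatum F X)
    {V : Type*} [AddCommGroup V] [Module ℂ V] (π : D.Hecke →ₐ[ℂ] Module.End ℂ V) : Prop :=
  ∀ t : AddChar X ℂ, D.IsWeight π t → logAbs t ∈ D.negCone

/-! ### Root data with parameters and diagram automorphisms -/

/-- A reduced based root datum `(X, R₀, Y, R₀^∨, F₀)` (`F₀` is `base`), with a parameter function
and a group `Γ` of diagram automorphisms.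

A parameter function is a `W₀`-invariant map `R_nr^∨ → ℂ^×`, where `R_nr^∨` is the union of
`R₀^∨` and `{α^∨ / 2 : α^∨ ∈ 2Y}`. Here it is given with the square roots used in the Hecke algebra:
`q i = q(s_α)^{1/2}` and `qStar i = q_{α^∨}^{1/2}` for `α = root i`. One has
`q(s_α) = q_{α^∨} q_{α^∨/2}` if `α^∨ ∈ 2Y` and `q(s_α) = q_{α^∨}` otherwise.

The group `Γ` acts on the root datum, and permutes the simple roots. -/
structure ExtendedDatum (ι X Y Γ : Type*) [AddCommGroup X] [AddCommGroup Y] [Group Γ] where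
  R : RootDatum ι X Y
  reduced : R.IsReduced
  base : R.Base
  q : ι → ℂˣ
  qStar : ι → ℂˣ
  q_invariant : ∀ i j, q (R.reflectionPerm i j) = q j
  qStar_invariant : ∀ i j, qStar (R.reflectionPerm i j) = qStar j
  qStar_eq_q : ∀ i, (¬ ∃ y : Y, R.coroot i = (2 : ℤ) • y) → qStar i = q i
  act : Γ →* R.Aut
  act_base : ∀ γ, act γ • (base.support : Set ι) = base.support
  q_act : ∀ γ i, q (act γ • i) = q i
  qStar_act : ∀ γ i, qStar (act γ • i) = qStar i

lemma coroot'_smul {ι X Y : Type*} [AddCommGroup X] [AddCommGroup Y] (R : RootDatum ι X Y)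
    (g : R.Aut) (i : ι) (x : X) : R.coroot' (g • i) (g • x) = R.coroot' i x := by
  have h1 := LinearMap.congr_fun (RootPairing.Hom.weight_coweight_transpose_apply R R
    (R.coroot (g • i)) g.toHom) x
  have h2 := RootPairing.Hom.coroot_coweightMap_apply R R (g • i) g.toHom
  have h3 : g.toHom.indexEquiv.symm (g • i) = i := g.toHom.indexEquiv.symm_apply_apply i
  rw [h2, h3] at h1
  exact h1

lemma root_smul {ι X Y : Type*} [AddCommGroup X] [AddCommGroup Y] (R : RootDatum ι X Y)
    (g : R.Aut) (i : ι) : R.root (g • i) = g • R.root i :=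
  (RootPairing.Hom.root_weightMap_apply R R i g.toHom).symm

lemma reflection_smul_index {ι X Y : Type*} [AddCommGroup X] [AddCommGroup Y]
    (R : RootDatum ι X Y) (g : R.Aut) (i : ι) :
    R.reflection (g • i) = RootPairing.Equiv.weightHom R g * R.reflection i *
      (RootPairing.Equiv.weightHom R g)⁻¹ := by
  rw [eq_mul_inv_iff_mul_eq]
  ext x
  change R.reflection (g • i) (g • x) = g • (R.reflection i x)
  rw [RootPairing.reflection_apply, RootPairing.reflection_apply, coroot'_smul, root_smul,
    smul_sub, smul_comm]

namespace ExtendedDatum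

variable {ι X Y Γ : Type*} [AddCommGroup X] [AddCommGroup Y] [Group Γ]
variable (S : ExtendedDatum ι X Y Γ)

/-- The set `F₀` of simple roots (as a set of indices). -/
def simple : Set ι := S.base.support

lemma act_simple (γ : Γ) : S.act γ • S.simple = S.simple := S.act_base γ

/-- The data `(X, P, P^∨, q^P)` that give the parabolic algebra `ℋ^P = ℋ(𝓡^P, q^P)` with
`𝓡^P = (X, R_P, Y, R_P^∨, P)`. For `P = F₀` this gives `ℋ` itself. -/
def upper (P : Set ι) : BernsteinDatum P X where
  root i := S.R.root i
  coroot i := (S.R.coroot' i).toAddMonoidHom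
  m i j := orderOf (S.R.reflection i * S.R.reflection j)
  q i := S.q i
  qStar i := S.qStar i

/-- The subgroup `X ∩ (P^∨)^⊥`. -/
def perp (P : Set ι) : AddSubgroup X where
  carrier := {x | ∀ i ∈ P, S.R.coroot' i x = 0}
  zero_mem' i _ := map_zero _
  add_mem' {x y} hx hy i hi := by rw [map_add, hx i hi, hy i hi, add_zero]
  neg_mem' {x} hx i hi := by rw [map_neg, hx i hi, neg_zero]

/-- The data that give the parabolic algebra `ℋ_P = ℋ(𝓡_P, q_P)` with
`𝓡_P = (X_P, R_P, Y_P, R_P^∨, P)` and `X_P = X / (X ∩ (P^∨)^⊥)`. -/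
def lower (P : Set ι) : BernsteinDatum P (X ⧸ S.perp P) where
  root i := QuotientAddGroup.mk' (S.perp P) (S.R.root i)
  coroot i := QuotientAddGroup.lift (S.perp P) (S.R.coroot' i).toAddMonoidHom
    (fun _ hx => hx i i.2)
  m i j := orderOf (S.R.reflection i * S.R.reflection j)
  q i := S.q i
  qStar i := S.qStar i

/-- The inclusion `ℋ^P → ℋ^Q` for `P ⊆ Q`. -/
def incl {P Q : Set ι} (h : P ⊆ Q) : (S.upper P).Hecke →ₐ[ℂ] (S.upper Q).Hecke :=
  BernsteinDatum.Hom.map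
    { onX := AddMonoidHom.id X
      onF := Set.inclusion h
      char := 1
      char_root := fun _ => rfl
      map_root := fun _ => rfl
      map_coroot := fun _ _ => rfl
      map_m := fun _ _ => rfl
      map_q := fun _ => rfl
      map_qStar := fun _ => rfl }

/-- The quotient map `ℋ^P → ℋ_P`, `θ_x N_w ↦ θ_{x_P} N_w`. -/
def quot (P : Set ι) : (S.upper P).Hecke →ₐ[ℂ] (S.lower P).Hecke :=
  BernsteinDatum.Hom.map
    { onX := QuotientAddGroup.mk' (S.perp P)
      onF := id
      char := 1
      char_root := fun _ => rfl
      map_root := fun _ => rfl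
      map_coroot := fun _ _ => rfl
      map_m := fun _ _ => rfl
      map_q := fun _ => rfl
      map_qStar := fun _ => rfl }

/-- The subgroup `T^P = Hom(X / (X ∩ ℚP), ℂ^×)` of `T = Hom(X, ℂ^×)`. -/
def torusUpper (P : Set ι) : Set (AddChar X ℂ) :=
  {t | ∀ x : X, (∃ n : ℤ, n ≠ 0 ∧ n • x ∈ AddSubgroup.closure (S.R.root '' P)) → t x = 1}

lemma torusUpper_root {P : Set ι} {t : AddChar X ℂ} (ht : t ∈ S.torusUpper P) (i : P) :
    t (S.R.root i) = 1 :=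
  ht _ ⟨1, one_ne_zero, by
    rw [one_smul]; exact AddSubgroup.subset_closure ⟨i, i.2, rfl⟩⟩

/-- The automorphism `φ_t` of `ℋ^P`, `θ_x N_w ↦ t(x) θ_x N_w`, for `t ∈ T^P`. -/
def twist {P : Set ι} {t : AddChar X ℂ} (ht : t ∈ S.torusUpper P) :
    (S.upper P).Hecke →ₐ[ℂ] (S.upper P).Hecke :=
  BernsteinDatum.Hom.map
    { onX := AddMonoidHom.id X
      onF := id
      char := t
      char_root := S.torusUpper_root ht
      map_root := fun _ => rfl
      map_coroot := fun _ _ => rfl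
      map_m := fun _ _ => rfl
      map_q := fun _ => rfl
      map_qStar := fun _ => rfl }

/-- The isomorphism `ψ_γ : ℋ^P → ℋ^Q`, `θ_x N_w ↦ θ_{γ x} N_{γ w γ⁻¹}`, for `γ ∈ Γ` with
`γ(P) = Q`. -/
def psi (γ : Γ) {P Q : Set ι} (h : S.act γ • P = Q) :
    (S.upper P).Hecke →ₐ[ℂ] (S.upper Q).Hecke :=
  BernsteinDatum.Hom.map
    { onX := DistribSMul.toAddMonoidHom X (S.act γ)
      onF := fun i => ⟨S.act γ • (i : ι), h ▸ Set.smul_mem_smul_set i.2⟩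
      char := 1
      char_root := fun _ => rfl
      map_root := fun i => (root_smul S.R (S.act γ) i).symm
      map_coroot := fun i x => coroot'_smul S.R (S.act γ) i x
      map_m := fun i j => by
        change orderOf (S.R.reflection (S.act γ • (i : ι)) * S.R.reflection (S.act γ • (j : ι))) =
          orderOf (S.R.reflection i * S.R.reflection j)
        rw [reflection_smul_index, reflection_smul_index]
        rw [show ∀ a b c : X ≃ₗ[ℤ] X, a * b * a⁻¹ * (a * c * a⁻¹) = MulAut.conj a (b * c) from
          fun a b c => by simp [MulAut.conj_apply, mul_assoc]]
        exact orderOf_injective (MulAut.conj _).toMonoidHom (MulAut.conj _).injective _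
      map_q := fun i => S.q_act γ i
      map_qStar := fun i => S.qStar_act γ i }

@[simp] lemma psi_theta (γ : Γ) {P Q : Set ι} (h : S.act γ • P = Q) (x : X) :
    S.psi γ h ((S.upper P).theta x) = (S.upper Q).theta (S.act γ • x) := by
  rw [psi, BernsteinDatum.Hom.map_theta]
  exact one_smul ℂ _

@[simp] lemma psi_N (γ : Γ) {P Q : Set ι} (h : S.act γ • P = Q) (i : P) :
    S.psi γ h ((S.upper P).N i) =
      (S.upper Q).N ⟨S.act γ • (i : ι), h ▸ Set.smul_mem_smul_set i.2⟩ := by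
  rw [psi, BernsteinDatum.Hom.map_N]

@[simp] lemma incl_theta {P Q : Set ι} (h : P ⊆ Q) (x : X) :
    S.incl h ((S.upper P).theta x) = (S.upper Q).theta x := by
  rw [incl, BernsteinDatum.Hom.map_theta]
  exact one_smul ℂ _

@[simp] lemma incl_N {P Q : Set ι} (h : P ⊆ Q) (i : P) :
    S.incl h ((S.upper P).N i) = (S.upper Q).N (Set.inclusion h i) := by
  rw [incl, BernsteinDatum.Hom.map_N]

lemma psi_one {P : Set ι} (h : S.act 1 • P = P) (a : (S.upper P).Hecke) : S.psi 1 h a = a := by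
  suffices H : S.psi 1 h = AlgHom.id ℂ _ from DFunLike.congr_fun H a
  refine BernsteinDatum.hecke_ext (fun x => ?_) (fun i => ?_)
  · simp
  · rw [psi_N]
    simp

lemma psi_mul (γ δ : Γ) {P Q Q' : Set ι} (hδ : S.act δ • P = Q) (hγ : S.act γ • Q = Q')
    (h : S.act (γ * δ) • P = Q') (a : (S.upper P).Hecke) :
    S.psi (γ * δ) h a = S.psi γ hγ (S.psi δ hδ a) := by
  suffices H : S.psi (γ * δ) h = (S.psi γ hγ).comp (S.psi δ hδ) from DFunLike.congr_fun H a
  refine BernsteinDatum.hecke_ext (fun x => ?_) (fun i => ?_)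
  · simp only [AlgHom.comp_apply, psi_theta, map_mul]
    rw [mul_smul]
  · simp only [AlgHom.comp_apply, psi_N, map_mul]
    congr 1

lemma smul_mul_eq {γ δ : Γ} {P Q Q' : Set ι} (hδ : S.act δ • P = Q) (hγ : S.act γ • Q = Q') :
    S.act (γ * δ) • P = Q' := by rw [map_mul, mul_smul, hδ, hγ]

lemma smul_inv_eq {γ : Γ} {P Q : Set ι} (h : S.act γ • P = Q) : S.act γ⁻¹ • Q = P := by
  rw [map_inv, ← h, inv_smul_smul]

/-- The action `ψ` on `ℋ^P` of a group `G` that maps to the stabilizer of `P` in `Γ`. -/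
def psiHom (P : Set ι) {G : Type*} [Group G] (f : G →* Γ) (hf : ∀ g, S.act (f g) • P = P) :
    G →* ((S.upper P).Hecke →ₐ[ℂ] (S.upper P).Hecke) where
  toFun g := S.psi (f g) (hf g)
  map_one' := by
    refine AlgHom.ext fun a => ?_
    have h1 : S.act 1 • P = P := by rw [map_one, one_smul]
    have : ∀ (γ : Γ) (hγ : S.act γ • P = P), γ = 1 → S.psi γ hγ a = a := by
      rintro _ hγ rfl
      exact S.psi_one h1 a
    exact this (f 1) (hf 1) (map_one f)
  map_mul' g g' := by
    refine AlgHom.ext fun a => ?_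
    have : ∀ (γ : Γ) (hγ : S.act γ • P = P), γ = f g * f g' →
        S.psi γ hγ a = S.psi (f g) (hf g) (S.psi (f g') (hf g') a) := by
      rintro _ hγ rfl
      exact S.psi_mul _ _ _ _ _ a
    exact this (f (g * g')) (hf (g * g')) (map_mul f g g')

/-- The affine Hecke algebra `ℋ = ℋ(𝓡, q)`. -/
abbrev H : Type _ := (S.upper S.simple).Hecke

/-- The crossed product `ℋ ⋊ Γ`. -/
abbrev HΓ : Type _ := Crossed (S.psiHom S.simple (MonoidHom.id Γ) S.act_simple)

/-- Temperedness of a representation of `ℋ ⋊ Γ`, through the `𝒜`-weights. -/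
def IsTempered {V : Type*} [AddCommGroup V] [Module ℂ V] (π : S.HΓ →ₐ[ℂ] Module.End ℂ V) : Prop :=
  (S.upper S.simple).IsTempered (π.comp (Crossed.of _))

/-- The open cone `𝔞^{P++}` in `𝔞^P`. -/
def posCone (P : Set ι) : Set (X →+ ℝ) :=
  {μ | (∀ i ∈ P, μ (S.R.root i) = 0) ∧ ∀ i ∈ S.simple \ P, 0 < μ (S.R.root i)}

/-! ### Langlands data -/

/-- A Langlands datum `(P, σ, t)` for `ℋ`: a set `P` of simple roots, an irreducible tempered
representation `σ` of `ℋ_P` on a space `V`, and `t ∈ T^P` with `|t| ∈ T^{P++} = exp(𝔞^{P++})`. -/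
structure LanglandsDatum where
  P : Set ι
  P_subset : P ⊆ S.simple
  V : Type v
  [instAddCommGroup : AddCommGroup V]
  [instModule : Module ℂ V]
  σ : (S.lower P).Hecke →ₐ[ℂ] Module.End ℂ V
  irred : IsIrred σ
  tempered : (S.lower P).IsTempered σ
  t : AddChar X ℂ
  t_mem : t ∈ S.torusUpper P
  t_pos : logAbs t ∈ S.posCone P

attribute [instance] LanglandsDatum.instAddCommGroup LanglandsDatum.instModule

namespace LanglandsDatum

variable {S}

/-- The `ℋ^P`-representation `σ ∘ φ_t`. -/
def rep (L : LanglandsDatum.{v} S) : (S.upper L.P).Hecke →ₐ[ℂ] Module.End ℂ L.V :=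
  (L.σ.comp (S.quot L.P)).comp (S.twist L.t_mem)

/-- The `ℋ`-representation `π(P, σ, t) = Ind_{ℋ^P}^ℋ (σ ∘ φ_t)`. -/
def standard (L : LanglandsDatum.{v} S) :
    S.H →ₐ[ℂ] Module.End ℂ (IndSpace (S.incl L.P_subset) L.rep) :=
  indRep (S.incl L.P_subset) L.rep

/-- Equivalence of Langlands data: `P = P'` and `σ ∘ φ_t ≅ σ' ∘ φ_{t'}`. -/
def Equivalent (L L' : LanglandsDatum.{v} S) : Prop :=
  ∃ (h : L.P = L'.P) (e : L.V ≃ₗ[ℂ] L'.V),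
    ∀ a v, e (L.rep a v) = L'.rep (S.incl h.subset a) (e v)

/-- `e` is an isomorphism `(σ ∘ φ_t) ∘ ψ_γ⁻¹ ≅ σ' ∘ φ_{t'}` of `ℋ^{P'}`-representations, where
`γ(P) = P'`. -/
def Intertwines (L L' : LanglandsDatum.{v} S) (γ : Γ) (h : S.act γ • L.P = L'.P)
    (e : L.V ≃ₗ[ℂ] L'.V) : Prop :=
  ∀ a v, e (L.rep a v) = L'.rep (S.psi γ h a) (e v)

/-- `γ (P, σ, t) = (γ(P), σ ∘ ψ_γ⁻¹, γ(t))` is equivalent to `(P', σ', t')`. Observe that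
`(σ ∘ ψ_γ⁻¹) ∘ φ_{γ(t)} = (σ ∘ φ_t) ∘ ψ_γ⁻¹`. -/
def Moves (γ : Γ) (L L' : LanglandsDatum.{v} S) : Prop :=
  ∃ (h : S.act γ • L.P = L'.P) (e : L.V ≃ₗ[ℂ] L'.V), L.Intertwines L' γ h e

lemma Moves.refl (L : LanglandsDatum.{v} S) : Moves 1 L L :=
  ⟨by rw [map_one, one_smul], LinearEquiv.refl ℂ _, fun a v => by rw [psi_one]; rfl⟩

lemma Moves.trans {γ δ : Γ} {L L' L'' : LanglandsDatum.{v} S} (h : Moves δ L L')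
    (h' : Moves γ L' L'') : Moves (γ * δ) L L'' := by
  obtain ⟨h1, e1, H1⟩ := h
  obtain ⟨h2, e2, H2⟩ := h'
  refine ⟨S.smul_mul_eq h1 h2, e1.trans e2, fun a v => ?_⟩
  rw [S.psi_mul γ δ h1 h2]
  change e2 (e1 _) = L''.rep _ (e2 (e1 v))
  rw [H1, H2]

lemma Moves.symm {γ : Γ} {L L' : LanglandsDatum.{v} S} (h : Moves γ L L') : Moves γ⁻¹ L' L := by
  obtain ⟨h, e, H⟩ := h
  refine ⟨S.smul_inv_eq h, e.symm, fun a v => ?_⟩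
  rw [LinearEquiv.symm_apply_eq, H, LinearEquiv.apply_symm_apply,
    ← S.psi_mul γ γ⁻¹ (S.smul_inv_eq h) h (by rw [mul_inv_cancel, map_one, one_smul])]
  have : ∀ (δ : Γ) (hδ : S.act δ • L'.P = L'.P), δ = 1 → S.psi δ hδ a = a := by
    rintro _ hδ rfl
    exact S.psi_one hδ a
  rw [this _ _ (mul_inv_cancel γ)]

/-- The isotropy group `Γ_{P,σ,t}` of (the equivalence class of) a Langlands datum. -/
def isotropy (L : LanglandsDatum.{v} S) : Subgroup Γ where
  carrier := {γ | Moves γ L L}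
  one_mem' := Moves.refl L
  mul_mem' h h' := Moves.trans h' h
  inv_mem' h := Moves.symm h

lemma isotropy_smul (L : LanglandsDatum.{v} S) (δ : L.isotropy) : S.act (δ : Γ) • L.P = L.P :=
  δ.2.choose

/-- If `γ` moves `L` to `L'` then conjugation by `γ` maps the isotropy group of `L` to that
of `L'`. -/
def conj {γ : Γ} {L L' : LanglandsDatum.{v} S} (h : Moves γ L L') (δ : L.isotropy) : L'.isotropy :=
  ⟨γ * δ * γ⁻¹, (h.symm.trans δ.2).trans h |> fun H => by
    change Moves _ _ _
    rwa [mul_assoc]⟩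

/-- A choice of intertwining operators `I_δ : σ ∘ φ_t → (σ ∘ φ_t) ∘ ψ_δ` for `δ ∈ Γ_{P,σ,t}`, and
the 2-cocycle `κ` that it determines. -/
structure Cocycle (L : LanglandsDatum.{v} S) where
  I : L.isotropy → (L.V ≃ₗ[ℂ] L.V)
  intertwines : ∀ δ : L.isotropy, L.Intertwines L δ (L.isotropy_smul δ) (I δ)
  κ : L.isotropy → L.isotropy → ℂˣ
  I_mul : ∀ δ ε v, I (δ * ε) v = (κ δ ε : ℂ) • I δ (I ε v)

/-- An irreducible projective representation `ρ` of `Γ_{P,σ,t}` with cocycle `κ`, that is, an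
irreducible representation of the twisted group algebra `ℂ[Γ_{P,σ,t}, κ]`. With `L` and the
choice `K` this makes up a Langlands datum `(P, σ, t, ρ)` for `ℋ ⋊ Γ`. -/
structure ProjRep {L : LanglandsDatum.{v} S} (K : L.Cocycle) where
  W : Type v
  [instAddCommGroup : AddCommGroup W]
  [instModule : Module ℂ W]
  ρ : L.isotropy → (W ≃ₗ[ℂ] W)
  ρ_mul : ∀ δ ε w, ρ δ (ρ ε w) = (K.κ δ ε : ℂ) • ρ (δ * ε) w
  nontrivial : Nontrivial W
  irred : ∀ U : Submodule ℂ W, (∀ δ, ∀ w ∈ U, ρ δ w ∈ U) → U = ⊥ ∨ U = ⊤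

attribute [instance] ProjRep.instAddCommGroup ProjRep.instModule

/-- The algebra `ℋ^P ⋊ Γ_{P,σ,t}`. -/
abbrev HP (L : LanglandsDatum.{v} S) : Type _ :=
  Crossed (S.psiHom L.P L.isotropy.subtype L.isotropy_smul)

lemma incl_psi (L : LanglandsDatum.{v} S) (δ : L.isotropy) (a : (S.upper L.P).Hecke) :
    S.incl L.P_subset (S.psi δ (L.isotropy_smul δ) a) =
      S.psi δ (S.act_simple δ) (S.incl L.P_subset a) := by
  suffices h : (S.incl L.P_subset).comp (S.psi δ (L.isotropy_smul δ)) =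
      (S.psi (δ : Γ) (S.act_simple δ)).comp (S.incl L.P_subset) from DFunLike.congr_fun h a
  refine BernsteinDatum.hecke_ext (fun x => ?_) (fun i => ?_)
  · rw [AlgHom.comp_apply, AlgHom.comp_apply, psi_theta, incl_theta, incl_theta]
    exact (S.psi_theta (δ : Γ) (S.act_simple δ) x).symm
  · rw [AlgHom.comp_apply, AlgHom.comp_apply, psi_N, incl_N, incl_N]
    exact (S.psi_N (δ : Γ) (S.act_simple δ) (Set.inclusion L.P_subset i)).symm

/-- The inclusion `ℋ^P ⋊ Γ_{P,σ,t} → ℋ ⋊ Γ`. -/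
def inclHP (L : LanglandsDatum.{v} S) : L.HP →ₐ[ℂ] S.HΓ :=
  Crossed.lift _ ((Crossed.of _).comp (S.incl L.P_subset))
    ((Crossed.gp _).comp L.isotropy.subtype)
    (fun δ a => by
      change Crossed.gp _ (δ : Γ) * Crossed.of _ (S.incl L.P_subset a) =
        Crossed.of _ (S.incl L.P_subset (S.psi δ (L.isotropy_smul δ) a)) * Crossed.gp _ (δ : Γ)
      rw [Crossed.gp_mul_of, incl_psi]
      rfl)

variable {L : LanglandsDatum.{v} S} {K : L.Cocycle}

/-- The action `δ ↦ I_δ ⊗ ρ(δ)` of `Γ_{P,σ,t}` on `V_σ ⊗ V_ρ`. -/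
def ProjRep.groupAct (ρ : ProjRep K) : L.isotropy →* Module.End ℂ (L.V ⊗[ℂ] ρ.W) :=
  (LinearEquiv.automorphismGroup.toLinearMapMonoidHom (R := ℂ) (M := L.V ⊗[ℂ] ρ.W)).comp
    (MonoidHom.mk' (fun δ => TensorProduct.congr (K.I δ) (ρ.ρ δ)) (fun δ ε => by
      apply LinearEquiv.toLinearMap_injective
      refine TensorProduct.ext' fun v w => ?_
      change K.I (δ * ε) v ⊗ₜ[ℂ] ρ.ρ (δ * ε) w = K.I δ (K.I ε v) ⊗ₜ[ℂ] ρ.ρ δ (ρ.ρ ε w)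
      rw [K.I_mul, ρ.ρ_mul, TensorProduct.tmul_smul, TensorProduct.smul_tmul']))

/-- The `ℋ^P ⋊ Γ_{P,σ,t}`-representation `(σ ∘ φ_t) ⊗ ρ`, in which `a ∈ ℋ^P` acts by
`σ(φ_t(a)) ⊗ 1` and `δ` acts by `I_δ ⊗ ρ(δ)`. -/
def ProjRep.tensorRep (ρ : ProjRep K) : L.HP →ₐ[ℂ] Module.End ℂ (L.V ⊗[ℂ] ρ.W) :=
  Crossed.lift _ ((Module.End.rTensorAlgHom ℂ L.V ρ.W).comp L.rep) ρ.groupAct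
    (fun δ a => TensorProduct.ext' fun v w => by
      change K.I δ (L.rep a v) ⊗ₜ[ℂ] ρ.ρ δ w = L.rep (S.psi δ (L.isotropy_smul δ) a) (K.I δ v) ⊗ₜ[ℂ] ρ.ρ δ w
      rw [K.intertwines δ])

/-- The `ℋ ⋊ Γ`-representation
`π^Γ(P, σ, t, ρ) = Ind_{ℋ^P ⋊ Γ_{P,σ,t}}^{ℋ ⋊ Γ} ((σ ∘ φ_t) ⊗ ρ)`. -/
def ProjRep.standard (ρ : ProjRep K) :
    S.HΓ →ₐ[ℂ] Module.End ℂ (IndSpace L.inclHP ρ.tensorRep) :=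
  indRep L.inclHP ρ.tensorRep

/-- The Langlands data `(P, σ, t, ρ)` and `(P', σ', t', ρ')` for `ℋ ⋊ Γ` are in the same
`Γ`-orbit: some `γ` moves `(P, σ, t)` to `(P', σ', t')` (up to the equivalence `e`), and `ρ'` is
equivalent to the image of `ρ` under the induced isomorphism
`ℂ[Γ_{P,σ,t}, κ] ≅ ℂ[Γ_{P',σ',t'}, κ']`. That isomorphism maps the basis element of `δ` to a
multiple of the one of `γ δ γ⁻¹`, the scalar `c δ` being determined by the comparison of
`e I_δ e⁻¹` with `I'_{γ δ γ⁻¹}`. -/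
def ProjRep.Conjugate {L L' : LanglandsDatum.{v} S} {K : L.Cocycle} {K' : L'.Cocycle}
    (ρ : ProjRep K) (ρ' : ProjRep K') : Prop :=
  ∃ (γ : Γ) (h : S.act γ • L.P = L'.P) (e : L.V ≃ₗ[ℂ] L'.V) (he : L.Intertwines L' γ h e)
    (g : ρ.W ≃ₗ[ℂ] ρ'.W) (c : L.isotropy → ℂˣ), ∀ δ : L.isotropy,
      (∀ v, e (K.I δ v) = (c δ : ℂ) • K'.I (conj ⟨h, e, he⟩ δ) (e v)) ∧
      (∀ w, g (ρ.ρ δ w) = ((c δ)⁻¹ : ℂˣ) • ρ'.ρ (conj ⟨h, e, he⟩ δ) (g w))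

end LanglandsDatum

end ExtendedDatum

end AffineHecke

end

open AffineHecke

/-!
# The Langlands classification for affine Hecke algebras and their crossed products

Write `𝔞 = Hom(X, ℝ)` and call `log |t| ∈ 𝔞` the exponent of a weight `t`. Choose an inner product on
`𝔞` that is invariant under the Weyl group and `Γ`. Every `λ ∈ 𝔞` is the orthogonal sum of a dominant
element `dom λ`, its projection to the dominant cone, and a nonpositive combination of simple coroots
(`IsDec`, `exists_isDec`). The norm of `dom λ` is the *size* of `λ`. A weight has the behaviour required
in tempered representations exactly when its exponent has size `0` (`size_eq_zero`). For a Langlands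
datum `(P, σ, t)`, the weights of `σ ∘ φ_t` have exponents in `log |t| + (cone of P)`, and
`log |t|`, which is dominant, is their dominant part (`mem_negCone_of_weight`, `dom_add`).

The central estimate is `size_aact_lt`: if `u ≠ 1` is a representative of minimal length of a coset of
`W_P`, then `u` strictly decreases the size of these exponents. Since `ℋ` is spanned by the `N_w ℂ[X]`,
and `θ_x` commutes with `N_w` up to shorter terms, a representation that is generated by images `E` of
Langlands data filters by length, and the weights in its steps are `u t` with `t` a weight of `E`
(`LanglandsGenerated`, `mem_filtration_or`). So the weights of maximal size occur in `E` only
(`weight_cases`). This gives all statements about `ℋ`.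

* A proper invariant subspace of `π(P, σ, t)` cannot meet the irreducible subspace `σ ∘ φ_t`, so its
  weights have strictly smaller size. This property is stable under sums, hence there is a largest
  proper invariant subspace (`LanglandsDatum.hasUniqueIrredQuotient`).
* In a representation of finite dimension, take a weight of maximal size. The simple roots orthogonal to
  its dominant part form `P`, and an irreducible `ℋ^P`-subrepresentation of the eigenspace of the central
  elements `θ_x`, `x ⊥ P^∨`, is of the form `σ ∘ φ_t`: maximality of the size forces the exponents of `σ`
  into the cone (`mem_negC_of_size_le`, `exists_langlandsDatum`).
* If two data map to one irreducible representation, their exponents have the same norm. Each is then the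
  dominant part of a weight of the other, and the two representations of `ℋ^P` occur in the same space
  (`LanglandsDatum.equivalent_of_maps`).

The standard representations are large enough for this because `ℋ` is free over `ℋ^P`: induction embeds
the inducing representation (`indUnit_incl_injective`). This rests on the basis `N_w θ_x` of `ℋ`, which
is not visible in a presentation by generators and relations. The elements `N_w` exist by Matsumoto's
theorem (`prod_eq_of_reduced`). They are independent over `ℂ[X]` (`eq_zero_of_sum_Nw`) because `ℋ` acts
on `ℂ(X)` by Demazure–Lusztig operators, in which `N_w` has leading term `w`, and distinct automorphisms
of a field are independent. The braid relations of these operators (`braid_demK`) are checked in rank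
two, where a suitable combination of both sides is the full symmetrizer of the dihedral group.

For `ℋ ⋊ Γ`, let `J` map `(σ ∘ φ_t) ⊗ ρ` to a representation that its image generates. As a
representation of `ℋ` it is generated by the spaces `γ J(V ⊗ W)`, to which the same estimates apply. An
irreducible constituent among these spaces is conjugate to `σ ∘ φ_t` (`ExtMap.exists_repEquiv`), the
multiplicity space of `σ ∘ φ_t` is exactly `ρ` (`ExtMap.exists_eq_tmul`), and temperedness means that the
size vanishes (`ExtMap.isTempered_iff`). Existence follows from an irreducible projective
subrepresentation of the multiplicity space `Hom(σ ∘ φ_t, π)` (`LanglandsDatum.exists_projRep`), and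
uniqueness from a comparison of multiplicity spaces (`LanglandsDatum.conjugate_of_extMap`). The cocycle
`κ` comes from Schur's lemma (`LanglandsDatum.nonempty_cocycle`).
-/

set_option linter.unusedSectionVars false
set_option linter.unusedSimpArgs false

-- This lemma would rewrite products in the automorphism group of the root datum as compositions.
attribute [-simp] RootPairing.Equiv.mul_eq_comp

noncomputable section
namespace AffineHecke
open scoped TensorProduct Pointwise

/-! ### Positive roots and the length function -/

section Length

open RootPairing

variable {ι X Y : Type*} [AddCommGroup X] [AddCommGroup Y] {R : RootDatum ι X Y}

/-- The simple reflection `s_i` as an automorphism of the root datum. -/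
abbrev srefl (R : RootDatum ι X Y) (i : ι) : R.Aut := Equiv.reflection R i

lemma srefl_smul_index (i j : ι) : srefl R i • j = R.reflectionPerm i j := rfl

lemma srefl_smul (i : ι) (x : X) : srefl R i • x = x - R.coroot' i x • R.root i := by
  change R.reflection i x = _
  rw [reflection_apply]

@[simp] lemma srefl_mul_self (i : ι) : srefl R i * srefl R i = 1 := by
  rw [mul_eq_one_iff_inv_eq]; exact Equiv.reflection_inv R i

lemma srefl_inv (i : ι) : (srefl R i)⁻¹ = srefl R i := Equiv.reflection_inv R i

@[simp] lemma srefl_smul_smul (i : ι) {α : Type*} [MulAction R.Aut α] (a : α) :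
    srefl R i • srefl R i • a = a := by
  rw [smul_smul, srefl_mul_self, one_smul]

/-- An automorphism of the root datum conjugates the reflection in a root to the reflection in the
image of that root. -/
lemma srefl_smul_conj (g : R.Aut) (i : ι) : srefl R (g • i) = g * srefl R i * g⁻¹ := by
  apply Equiv.weightHom_injective R
  rw [map_mul, map_mul, map_inv]
  have h : ∀ j, Equiv.weightHom R (srefl R j) = R.reflection j := Equiv.reflection_weightEquiv R
  rw [h, h]
  exact reflection_smul_index R g i

variable (b : R.Base)

lemma root_neg_index (i : ι) : R.root (R.reflectionPerm i i) = -R.root i := by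
  rw [root_reflectionPerm, reflection_apply_self]

lemma isPos_iff_mem [Finite ι] {i : ι} :
    b.IsPos i ↔ R.root i ∈ AddSubmonoid.closure (R.root '' b.support) := by
  obtain ⟨f, -, h⟩ := b.exists_root_eq_sum_nat_or_neg i
  have hmem : ∀ f : ι → ℕ, ( ∑ j ∈ b.support, f j • R.root j ∈
      AddSubmonoid.closure (R.root '' b.support)) := fun f =>
    sum_mem fun j hj => nsmul_mem (AddSubmonoid.subset_closure (Set.mem_image_of_mem _ hj)) _
  have key : ∀ (f : ι → ℕ) (k : ι), R.root k = ∑ j ∈ b.support, f j • R.root j → b.IsPos k := by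
    intro f k hk
    rw [Base.isPos_iff', Base.height_eq_sum (f := fun j => (f j : ℤ)) (by simpa using hk)]
    exact Finset.sum_nonneg fun j _ => by positivity
  constructor
  · intro hi
    rcases h with h | h
    · rw [h]; exact hmem f
    · exfalso
      have h1 := key f (R.reflectionPerm i i) (by rw [root_neg_index, h, neg_neg])
      let _ := R.indexNeg
      exact (Base.IsPos.neg_iff_not b i).1 h1 hi
  · intro hi
    obtain ⟨g, -, hg⟩ : ∃ g : ι → ℕ, True ∧ R.root i = ∑ j ∈ b.support, g j • R.root j := by
      generalize R.root i = x at hi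
      induction hi using AddSubmonoid.closure_induction with
      | zero => exact ⟨0, trivial, by simp⟩
      | mem x hx =>
        obtain ⟨j, hj, rfl⟩ := hx
        classical
        refine ⟨Pi.single j 1, trivial, ?_⟩
        rw [Finset.sum_eq_single_of_mem j hj fun k _ hk => by simp [hk]]
        simp
      | add x y _ _ hx hy =>
        obtain ⟨f, -, rfl⟩ := hx
        obtain ⟨g, -, rfl⟩ := hy
        exact ⟨f + g, trivial, by simp [add_smul, Finset.sum_add_distrib]⟩
    exact key g i hg

lemma not_isPos_iff {i : ι} : ¬ b.IsPos i ↔ b.IsPos (R.reflectionPerm i i) := by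
  let _ := R.indexNeg
  exact (Base.IsPos.neg_iff_not b i).symm

lemma smul_neg_index (g : R.Aut) (i : ι) :
    g • (R.reflectionPerm i i) = R.reflectionPerm (g • i) (g • i) := by
  rw [← srefl_smul_index, ← srefl_smul_index, srefl_smul_conj, mul_smul, mul_smul, inv_smul_smul]

lemma neg_index_neg_index (i : ι) :
    R.reflectionPerm (R.reflectionPerm i i) (R.reflectionPerm i i) = i := by
  let _ := R.indexNeg
  exact neg_neg i

lemma isPos_smul_neg_index {g : R.Aut} {i : ι} :
    b.IsPos (g • R.reflectionPerm i i) ↔ ¬ b.IsPos (g • i) := by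
  rw [smul_neg_index, not_isPos_iff]

/-- The length of an automorphism: the number of positive roots that it makes negative. -/
def len (w : R.Aut) : ℕ := Set.ncard {j : ι | b.IsPos j ∧ ¬ b.IsPos (w • j)}

lemma len_one : len b 1 = 0 := by
  rw [len]
  convert Set.ncard_empty ι
  ext j; simp

variable [Finite ι]

lemma len_inv (w : R.Aut) : len b w⁻¹ = len b w := by
  refine Set.ncard_congr (fun j _ => w⁻¹ • R.reflectionPerm j j) ?_ ?_ ?_
  · rintro j ⟨h1, h2⟩
    refine ⟨(isPos_smul_neg_index b).2 h2, ?_⟩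
    rw [smul_inv_smul, ← not_isPos_iff, not_not]; exact h1
  · rintro i j _ _ h
    have := smul_left_cancel _ h
    rw [← neg_index_neg_index (R := R) i, this, neg_index_neg_index]
  · rintro j ⟨h1, h2⟩
    refine ⟨w • R.reflectionPerm j j, ⟨?_, ?_⟩, ?_⟩
    · exact (isPos_smul_neg_index b).2 h2
    · rw [inv_smul_smul, ← not_isPos_iff, not_not]; exact h1
    · simp only [smul_neg_index, neg_index_neg_index, inv_smul_smul]

variable [R.IsReduced]

lemma isPos_srefl_smul {i j : ι} (hi : i ∈ b.support) (hj : b.IsPos j) (hij : j ≠ i) :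
    b.IsPos (srefl R i • j) := hj.reflectionPerm hi hij

variable {b}

lemma isPos_simple {i : ι} (hi : i ∈ b.support) : b.IsPos i := Base.isPos_of_mem_support hi

lemma not_isPos_srefl_self {i : ι} (hi : i ∈ b.support) : ¬ b.IsPos (srefl R i • i) := by
  rw [srefl_smul_index, ← not_isPos_iff, not_not]; exact isPos_simple hi

/-- A positive root that a simple reflection makes negative is the simple root itself. -/
lemma eq_of_srefl_smul {i j : ι} (hi : i ∈ b.support) (hj : b.IsPos j)
    (h : ¬ b.IsPos (srefl R i • j)) : j = i := by
  by_contra hij; exact h (isPos_srefl_smul b hi hj hij)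

lemma len_mul_srefl {w : R.Aut} {i : ι} (hi : i ∈ b.support) (h : b.IsPos (w • i)) :
    len b (w * srefl R i) = len b w + 1 := by
  have hset : {j : ι | b.IsPos j ∧ ¬ b.IsPos ((w * srefl R i) • j)} =
      insert i ((fun j => srefl R i • j) '' {j : ι | b.IsPos j ∧ ¬ b.IsPos (w • j)}) := by
    ext j
    simp only [Set.mem_ofPred_eq, Set.mem_insert_iff, Set.mem_image, mul_smul]
    constructor
    · rintro ⟨h1, h2⟩
      by_cases hj : j = i
      · exact Or.inl hj
      · exact Or.inr ⟨srefl R i • j, ⟨isPos_srefl_smul b hi h1 hj, h2⟩, by simp⟩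
    · rintro (rfl | ⟨j, ⟨h1, h2⟩, rfl⟩)
      · refine ⟨isPos_simple hi, ?_⟩
        rw [srefl_smul_index, isPos_smul_neg_index, not_not]; exact h
      · refine ⟨isPos_srefl_smul b hi h1 ?_, by simpa using h2⟩
        rintro rfl; exact h2 h
  rw [len, hset, Set.ncard_insert_of_notMem, Set.ncard_image_of_injective]
  · rfl
  · exact MulAction.injective _
  · rintro ⟨j, ⟨h1, h2⟩, h3⟩
    replace h3 : srefl R i • j = i := h3
    have : ¬ b.IsPos (srefl R i • j) → False := fun h => h (by rw [h3]; exact isPos_simple hi)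
    by_cases hj : j = i
    · subst hj; exact this (not_isPos_srefl_self hi)
    · have h4 : j = srefl R i • i := by
        rw [← srefl_smul_smul (R := R) i j, h3]
      rw [h4] at h1
      exact not_isPos_srefl_self hi h1

lemma len_mul_srefl_of_not {w : R.Aut} {i : ι} (hi : i ∈ b.support) (h : ¬ b.IsPos (w • i)) :
    len b (w * srefl R i) + 1 = len b w := by
  have h1 : b.IsPos ((w * srefl R i) • i) := by
    rw [mul_smul, srefl_smul_index, isPos_smul_neg_index]; exact h
  have := len_mul_srefl hi h1
  rw [mul_assoc, srefl_mul_self, mul_one] at this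
  exact this.symm

lemma len_srefl_mul {w : R.Aut} {i : ι} (hi : i ∈ b.support) (h : b.IsPos (w⁻¹ • i)) :
    len b (srefl R i * w) = len b w + 1 := by
  rw [← len_inv, mul_inv_rev, srefl_inv, len_mul_srefl hi h, len_inv]

lemma len_srefl_mul_of_not {w : R.Aut} {i : ι} (hi : i ∈ b.support) (h : ¬ b.IsPos (w⁻¹ • i)) :
    len b (srefl R i * w) + 1 = len b w := by
  rw [← len_inv, mul_inv_rev, srefl_inv, len_mul_srefl_of_not hi h, len_inv]

/-! ### Reduced words and Matsumoto's theorem -/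

variable {P : Set ι}

/-- The product of the simple reflections in a word. -/
def wordProd (R : RootDatum ι X Y) (l : List P) : R.Aut := (l.map fun i : P => srefl R (i : ι)).prod

@[simp] lemma wordProd_nil : wordProd R ([] : List P) = 1 := rfl

@[simp] lemma wordProd_cons (i : P) (l : List P) :
    wordProd R (i :: l) = srefl R (i : ι) * wordProd R l := by simp [wordProd]

@[simp] lemma wordProd_append (l l' : List P) :
    wordProd R (l ++ l') = wordProd R l * wordProd R l' := by simp [wordProd]

variable (R P) in
/-- The parabolic subgroup `W_P` of the Weyl group. -/
def parab : Subgroup R.Aut := Subgroup.closure (srefl R '' P)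

lemma srefl_mem_parab {i : ι} (hi : i ∈ P) : srefl R i ∈ parab R P :=
  Subgroup.subset_closure ⟨i, hi, rfl⟩

lemma wordProd_mem (l : List P) : wordProd R l ∈ parab R P := by
  induction l with
  | nil => exact one_mem _
  | cons i l ih => rw [wordProd_cons]; exact mul_mem (srefl_mem_parab i.2) ih

lemma exists_word {w : R.Aut} (hw : w ∈ parab R P) : ∃ l : List P, wordProd R l = w := by
  induction hw using Subgroup.closure_induction with
  | mem x hx => obtain ⟨i, hi, rfl⟩ := hx; exact ⟨[⟨i, hi⟩], by simp⟩
  | one => exact ⟨[], rfl⟩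
  | mul x y _ _ hx hy =>
    obtain ⟨l, rfl⟩ := hx; obtain ⟨l', rfl⟩ := hy; exact ⟨l ++ l', by simp⟩
  | inv x h hx =>
    obtain ⟨l, rfl⟩ := hx
    refine ⟨l.reverse, ?_⟩
    clear h
    induction l with
    | nil => simp
    | cons i l ih =>
      rw [List.reverse_cons, wordProd_append, ih, wordProd_cons, wordProd_cons, wordProd_nil,
        mul_inv_rev, srefl_inv, mul_one]

variable (hP : P ⊆ b.support)
include hP

lemma len_wordProd_le (l : List P) : len b (wordProd R l) ≤ l.length := by
  induction l with
  | nil => simp [len_one]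
  | cons i l ih =>
    rw [wordProd_cons, List.length_cons]
    by_cases h : b.IsPos ((wordProd R l)⁻¹ • (i : ι))
    · rw [len_srefl_mul (hP i.2) h]; omega
    · have := len_srefl_mul_of_not (hP i.2) h; omega

/-- The exchange condition. -/
lemma exchange {i : ι} (hi : i ∈ b.support) (l : List P) (h : ¬ b.IsPos (wordProd R l • i)) :
    ∃ l' : List P, wordProd R l' = wordProd R l * srefl R i ∧ l'.length + 1 = l.length := by
  induction l with
  | nil => exact absurd (isPos_simple hi) (by simpa using h)
  | cons j l ih =>
    by_cases h' : b.IsPos (wordProd R l • i)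
    · refine ⟨l, ?_, rfl⟩
      rw [wordProd_cons, mul_smul] at h
      have h1 := eq_of_srefl_smul (hP j.2) h' h
      have h2 := srefl_smul_conj (wordProd R l) i
      rw [wordProd_cons, ← h1, h2]
      simp [mul_assoc]
    · obtain ⟨l', h1, h2⟩ := ih h'
      exact ⟨j :: l', by rw [wordProd_cons, h1, wordProd_cons, mul_assoc], by simp [h2]⟩

lemma exists_reduced {w : R.Aut} (hw : w ∈ parab R P) :
    ∃ l : List P, wordProd R l = w ∧ l.length = len b w := by
  obtain ⟨l, rfl⟩ := exists_word hw
  induction l using List.reverseRecOn with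
  | nil => exact ⟨[], rfl, by simp [len_one]⟩
  | append_singleton l i ih =>
    obtain ⟨l', h1, h2⟩ := ih (wordProd_mem l)
    have hi := hP i.2
    rw [wordProd_append, wordProd_cons, wordProd_nil, mul_one]
    by_cases h : b.IsPos (wordProd R l • (i : ι))
    · refine ⟨l' ++ [i], by simp [h1], ?_⟩
      rw [len_mul_srefl hi h]; simp [h2]
    · obtain ⟨l'', h3, h4⟩ := exchange hP hi l' (by rwa [h1])
      refine ⟨l'', by rw [h3, h1], ?_⟩
      have := len_mul_srefl_of_not hi h
      omega

lemma eq_one_of_len {w : R.Aut} (hw : w ∈ parab R P) (h : len b w = 0) : w = 1 := by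
  obtain ⟨l, rfl, h2⟩ := exists_reduced hP hw
  rw [h] at h2
  rw [List.length_eq_zero_iff.1 h2, wordProd_nil]

/-- An element `w ≠ 1` of `W_P` has a left descent in `P`. -/
lemma exists_left_descent {w : R.Aut} (hw : w ∈ parab R P) (h : w ≠ 1) :
    ∃ i ∈ P, ¬ b.IsPos (w⁻¹ • i) := by
  obtain ⟨l, rfl, h2⟩ := exists_reduced hP hw
  cases l with
  | nil => exact absurd rfl h
  | cons i l =>
    refine ⟨i, i.2, fun h3 => ?_⟩
    have h4 : b.IsPos ((srefl R (i : ι) * wordProd R (i :: l))⁻¹ • (srefl R (i : ι) • (i : ι))) := by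
      simpa [mul_smul, srefl_inv] using h3
    have h5 := len_srefl_mul (hP i.2) h3
    rw [wordProd_cons, ← mul_assoc, srefl_mul_self, one_mul, ← wordProd_cons, ← h2] at h5
    have := len_wordProd_le hP l
    simp at h5; omega

lemma finite_parab : Finite (parab R P) := by
  have hinj : Function.Injective (fun w : parab R P => Equiv.indexHom R (w : R.Aut)) := by
    intro w w' h
    have h1 : ((w' : R.Aut)⁻¹ * w) = 1 := by
      refine eq_one_of_len hP (mul_mem (inv_mem w'.2) w.2) ?_
      rw [len]
      convert Set.ncard_empty ι
      ext j
      have : (w : R.Aut) • j = (w' : R.Aut) • j := DFunLike.congr_fun h j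
      simp [mul_smul, this]
    exact Subtype.ext (inv_mul_eq_one.1 h1).symm
  have : Finite (ι ≃ ι) := inferInstance
  exact Finite.of_injective _ hinj

end Length
end AffineHecke
end

noncomputable section
namespace AffineHecke
open scoped TensorProduct Pointwise

section Matsumoto

open RootPairing BernsteinDatum

section Alternating

variable {M : Type*} [Monoid M]

@[simp] lemma altProd_zero (a b : M) : altProd a b 0 = 1 := rfl

lemma altProd_succ (a b : M) (n : ℕ) : altProd a b (n + 1) = a * altProd b a n := by
  rw [altProd, List.range_succ_eq_map, List.map_cons, List.prod_cons, altProd, List.map_map]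
  congr 3
  funext k
  by_cases h : Even k <;> simp [Nat.even_add_one, h]

lemma altProd_succ_right (a b : M) (n : ℕ) :
    altProd a b (n + 1) = altProd a b n * if Even n then a else b := by
  simp [altProd, List.range_succ]

/-- Two alternating products of `n` involutions agree if and only if the order of their product
divides `n`. -/
lemma altProd_eq_iff {G : Type*} [Group G] {a b : G} (ha : a * a = 1) (hb : b * b = 1) (n : ℕ) :
    altProd a b n = altProd b a n ↔ (a * b) ^ n = 1 := by
  have h2 : ∀ (a b : G) (r : ℕ), altProd a b (2 * r) = (a * b) ^ r := by
    intro a b r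
    induction r with
    | zero => simp
    | succ r ih => rw [mul_add, mul_one, altProd_succ, altProd_succ, ih, pow_succ', mul_assoc]
  have ha' : a⁻¹ = a := inv_eq_of_mul_eq_one_left ha
  have hinv : b * a = (a * b)⁻¹ := by rw [mul_inv_rev, ha', inv_eq_of_mul_eq_one_left hb]
  obtain ⟨r, rfl | rfl⟩ := Nat.even_or_odd' n
  · rw [h2, h2, hinv, inv_pow, two_mul, pow_add, mul_eq_one_iff_eq_inv]
  · have h3 : altProd b a (2 * r + 1) = a * (a * b) ^ (r + 1) := by
      rw [altProd_succ, h2, pow_succ', ← mul_assoc, ← mul_assoc, ha, one_mul]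
    have h4 : altProd a b (2 * r + 1) = a * ((a * b) ^ r)⁻¹ := by
      rw [altProd_succ, h2, hinv, inv_pow]
    rw [h3, h4, mul_right_inj, eq_comm, eq_inv_iff_mul_eq_one, ← pow_add,
      show r + 1 + r = 2 * r + 1 by ring]

end Alternating

variable {ι X Y : Type*} [AddCommGroup X] [AddCommGroup Y] {R : RootDatum ι X Y}
variable {P : Set ι}

/-- The alternating word `i, j, i, …` with `n` letters. -/
def altWord (i j : P) : ℕ → List P
  | 0 => []
  | n + 1 => i :: altWord j i n

lemma length_altWord (i j : P) (n : ℕ) : (altWord i j n).length = n := by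
  induction n generalizing i j with
  | zero => rfl
  | succ n ih => simp [altWord, ih]

lemma map_altWord {M : Type*} [Monoid M] (f : P → M) (i j : P) (n : ℕ) :
    ((altWord i j n).map f).prod = altProd (f i) (f j) n := by
  induction n generalizing i j with
  | zero => rfl
  | succ n ih => simp [altWord, ih, altProd_succ]

variable [Finite ι] [R.IsReduced] {b : R.Base}

/-- The letter after the alternating word `i, j, i, …` with `n` letters. -/
def altLetter (i j : ι) : ℕ → ι
  | 0 => i
  | n + 1 => altLetter j i n

lemma altLetter_eq (i j : ι) (n : ℕ) : altLetter i j n = if Even n then i else j := by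
  induction n generalizing i j with
  | zero => simp [altLetter]
  | succ n ih => by_cases h : Even n <;> simp [altLetter, ih, Nat.even_add_one, h]

lemma isPos_altProd {i j : ι} (hi : i ∈ b.support) (hj : j ∈ b.support) (k : ℕ)
    (hk : ∀ k', 0 < k' → k' ≤ k →
      altProd (srefl R i) (srefl R j) k' ≠ altProd (srefl R j) (srefl R i) k') :
    b.IsPos (altProd (srefl R i) (srefl R j) k • altLetter i j k) := by
  induction k generalizing i j with
  | zero => simpa [altLetter] using isPos_simple hi
  | succ k ih =>
    have h1 := ih hj hi (fun k' h h' => (hk k' h (by omega)).symm)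
    rw [altProd_succ, mul_smul, altLetter]
    by_contra h2
    have h3 := eq_of_srefl_smul hi h1 h2
    have h4 := srefl_smul_conj (altProd (srefl R j) (srefl R i) k) (altLetter j i k)
    rw [h3] at h4
    refine hk (k + 1) (by omega) le_rfl ?_
    have h5 : srefl R i * altProd (srefl R j) (srefl R i) k =
        altProd (srefl R j) (srefl R i) k * srefl R (altLetter j i k) := by
      rw [← eq_mul_inv_iff_mul_eq]; exact h4
    rw [altProd_succ, altProd_succ_right, h5, altLetter_eq]
    split_ifs <;> rfl

lemma root_altProd (i j : ι) (k : ℕ) : ∃ a c : ℤ,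
    R.root (altProd (srefl R i) (srefl R j) k • altLetter i j k) = a • R.root i + c • R.root j := by
  induction k generalizing i j with
  | zero => exact ⟨1, 0, by simp [altLetter]⟩
  | succ k ih =>
    obtain ⟨a, c, h⟩ := ih j i
    rw [altProd_succ, mul_smul, altLetter, root_smul, h, srefl_smul]
    exact ⟨c - R.coroot' i (a • R.root j + c • R.root i), a, by module⟩

/-- An element that makes two simple roots negative makes every positive root in their span
negative. -/
lemma not_isPos_of_pair {w : R.Aut} {i j x : ι} (hi : i ∈ b.support) (hj : j ∈ b.support)
    (hij : i ≠ j) (hwi : ¬ b.IsPos (w • i)) (hwj : ¬ b.IsPos (w • j)) (hx : b.IsPos x) {a c : ℤ}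
    (h : R.root x = a • R.root i + c • R.root j) : ¬ b.IsPos (w • x) := by
  classical
  have hsum : ∑ k ∈ b.support, (Pi.single i a + Pi.single j c : ι → ℤ) k • R.root k =
      a • R.root i + c • R.root j := by
    simp only [Pi.add_apply, add_smul, Finset.sum_add_distrib]
    rw [Finset.sum_eq_single_of_mem i hi fun k _ hk => by simp [hk],
      Finset.sum_eq_single_of_mem j hj fun k _ hk => by simp [hk]]
    simp
  have hsupp : (Pi.single i a + Pi.single j c : ι → ℤ).support ⊆ (b.support : Set ι) := by
    intro k hk
    by_contra hk'
    have h1 : k ≠ i := by rintro rfl; exact hk' hi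
    have h2 : k ≠ j := by rintro rfl; exact hk' hj
    simp [h1, h2] at hk
  have hht : b.height x = a + c := by
    rw [Base.height_eq_sum (h.trans hsum.symm)]
    simp [Finset.sum_add_distrib, hi, hj]
  have hac : 0 ≤ a ∧ 0 ≤ c := by
    rcases b.pos_or_neg_of_sum_smul_root_mem _ ⟨x, h.trans hsum.symm⟩ hsupp with h1 | h1
    · have h2 := h1.le i; have h3 := h1.le j
      simp [hij, hij.symm] at h2 h3
      exact ⟨h2, h3⟩
    · have h2 := h1.le i; have h3 := h1.le j
      simp [hij, hij.symm] at h2 h3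
      have : 0 < b.height x := hx
      omega
  obtain ⟨a, rfl⟩ := Int.eq_ofNat_of_zero_le hac.1
  obtain ⟨c, rfl⟩ := Int.eq_ofNat_of_zero_le hac.2
  rw [not_isPos_iff, isPos_iff_mem, root_neg_index] at *
  rw [root_smul, h, smul_add, neg_add, smul_comm, smul_comm w (c : ℤ), ← root_smul, ← root_smul,
    ← smul_neg, ← smul_neg]
  simp only [natCast_zsmul]
  exact add_mem (nsmul_mem hwi _) (nsmul_mem hwj _)

lemma len_altProd_mul {w : R.Aut} {i j : ι} (hi : i ∈ b.support) (hj : j ∈ b.support)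
    (hij : i ≠ j) (hwi : ¬ b.IsPos (w⁻¹ • i)) (hwj : ¬ b.IsPos (w⁻¹ • j)) (k : ℕ)
    (hk : ∀ k', 0 < k' → k' < k →
      altProd (srefl R i) (srefl R j) k' ≠ altProd (srefl R j) (srefl R i) k') :
    len b ((altProd (srefl R i) (srefl R j) k)⁻¹ * w) + k = len b w := by
  induction k with
  | zero => simp
  | succ k ih =>
    have h1 := ih (fun k' h h' => hk k' h (by omega))
    have hpos := isPos_altProd (b := b) hi hj k (fun k' h h' => hk k' h (by omega))
    obtain ⟨a, c, hac⟩ := root_altProd (R := R) i j k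
    have hneg := not_isPos_of_pair hi hj hij hwi hwj hpos hac
    have hl : altLetter i j k ∈ b.support := by rw [altLetter_eq]; split_ifs <;> assumption
    have h2 : altProd (srefl R i) (srefl R j) (k + 1) =
        altProd (srefl R i) (srefl R j) k * srefl R (altLetter i j k) := by
      rw [altProd_succ_right, altLetter_eq]; split_ifs <;> rfl
    rw [h2, mul_inv_rev, srefl_inv, mul_assoc]
    have h3 := len_srefl_mul_of_not (b := b) (w := (altProd (srefl R i) (srefl R j) k)⁻¹ * w) hl
      (by rwa [mul_inv_rev, inv_inv, mul_smul])
    omega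

lemma orderOf_pos_of_mem_parab (hP : P ⊆ b.support) {w : R.Aut} (hw : w ∈ parab R P) :
    0 < orderOf w := by
  have := finite_parab hP
  have h : orderOf (⟨w, hw⟩ : parab R P) = orderOf w := Subgroup.orderOf_mk w hw
  rw [← h]
  exact orderOf_pos _

variable {M : Type*} [Monoid M] {T : P → M}

/-- Matsumoto's theorem: a product over reduced words of elements that satisfy the braid relations
depends only on the Weyl group element. -/
theorem prod_eq_of_reduced (hP : P ⊆ b.support)
    (hT : ∀ i j : P, altProd (T i) (T j) (orderOf (srefl R (i : ι) * srefl R (j : ι))) =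
      altProd (T j) (T i) (orderOf (srefl R (i : ι) * srefl R (j : ι))))
    {l l' : List P} (h : wordProd R l = wordProd R l') (hl : l.length = len b (wordProd R l))
    (hl' : l'.length = len b (wordProd R l')) : (l.map T).prod = (l'.map T).prod := by
  generalize hn : l.length = n
  induction n generalizing l l' with
  | zero =>
    have h0 : l'.length = 0 := by rw [hl', ← h, ← hl, hn]
    rw [List.length_eq_zero_iff.1 hn, List.length_eq_zero_iff.1 h0]
  | succ n ih =>
    have key : ∀ (i : P) (l l' : List P), wordProd R (i :: l) = wordProd R (i :: l') →
        (i :: l).length = len b (wordProd R (i :: l)) →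
        (i :: l').length = len b (wordProd R (i :: l')) → (i :: l).length = n + 1 →
        ((i :: l).map T).prod = ((i :: l').map T).prod := by
      intro i l l' h hl hl' hn
      have h1 : wordProd R l = wordProd R l' := by simpa using h
      have h2 : ∀ l : List P, (i :: l).length = len b (wordProd R (i :: l)) →
          l.length = len b (wordProd R l) := by
        intro l hl
        refine le_antisymm ?_ (len_wordProd_le hP l)
        rw [wordProd_cons] at hl
        by_cases h3 : b.IsPos ((wordProd R l)⁻¹ • (i : ι))
        · rw [len_srefl_mul (hP i.2) h3] at hl; simp at hl; omega
        · have := len_srefl_mul_of_not (hP i.2) h3; simp at hl; omega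
      rw [List.map_cons, List.map_cons, List.prod_cons, List.prod_cons,
        ih h1 (h2 l hl) (h2 l' hl') (by simpa using hn)]
    have hlen : l'.length = n + 1 := by rw [hl', ← h, ← hl, hn]
    obtain ⟨i, l, rfl⟩ := List.exists_cons_of_length_eq_add_one hn
    obtain ⟨j, l', rfl⟩ := List.exists_cons_of_length_eq_add_one hlen
    by_cases hij : i = j
    · subst hij; exact key i l l' h hl hl' hn
    set w := wordProd R (i :: l) with hw
    have hdesc : ∀ (i : P) (l : List P), wordProd R (i :: l) = w → (i :: l).length = len b w →
        ¬ b.IsPos (w⁻¹ • (i : ι)) := by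
      intro i l h1 h2 h3
      have h4 := len_srefl_mul (hP i.2) h3
      rw [← h1, wordProd_cons, ← mul_assoc, srefl_mul_self, one_mul, ← wordProd_cons, h1,
        ← h2] at h4
      have := len_wordProd_le hP l
      simp at h4; omega
    have hwi := hdesc i l rfl hl
    have hwj := hdesc j l' h.symm (by rw [hl', ← h])
    have hij' : (i : ι) ≠ j := fun h => hij (Subtype.ext h)
    set m := orderOf (srefl R (i : ι) * srefl R (j : ι)) with hm
    have hm0 : 0 < m := orderOf_pos_of_mem_parab hP
      (mul_mem (srefl_mem_parab i.2) (srefl_mem_parab j.2))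
    have hne : ∀ k', 0 < k' → k' < m → altProd (srefl R (i : ι)) (srefl R (j : ι)) k' ≠
        altProd (srefl R (j : ι)) (srefl R (i : ι)) k' := by
      intro k' h0 h1 h2
      have h3 := (altProd_eq_iff (srefl_mul_self _) (srefl_mul_self _) k').1 h2
      exact absurd (Nat.le_of_dvd h0 (orderOf_dvd_of_pow_eq_one h3)) (by omega)
    have hlen2 := len_altProd_mul (hP i.2) (hP j.2) hij' hwi hwj m hne
    have hbr : altProd (srefl R (i : ι)) (srefl R (j : ι)) m =
        altProd (srefl R (j : ι)) (srefl R (i : ι)) m :=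
      (altProd_eq_iff (srefl_mul_self _) (srefl_mul_self _) m).2 (pow_orderOf_eq_one _)
    have hmemw : w ∈ parab R P := wordProd_mem _
    have hmemalt : altProd (srefl R (i : ι)) (srefl R (j : ι)) m ∈ parab R P := by
      rw [← map_altWord (fun i : P => srefl R (i : ι))]
      exact wordProd_mem (altWord i j m)
    obtain ⟨l0, h01, h02⟩ := exists_reduced hP (mul_mem (inv_mem hmemalt) hmemw)
    obtain ⟨r, hr⟩ : ∃ r, m = r + 1 := ⟨m - 1, by omega⟩
    have hA : wordProd R (altWord i j m ++ l0) = w := by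
      rw [wordProd_append, h01, wordProd, map_altWord (fun i : P => srefl R (i : ι)),
        mul_inv_cancel_left]
    have hB : wordProd R (altWord j i m ++ l0) = w := by
      rw [wordProd_append, h01, wordProd, map_altWord (fun i : P => srefl R (i : ι)), ← hbr,
        mul_inv_cancel_left]
    have hAl : (altWord i j m ++ l0).length = len b w := by
      rw [List.length_append, length_altWord, h02]; omega
    have hBl : (altWord j i m ++ l0).length = len b w := by
      rw [List.length_append, length_altWord, h02]; omega
    have e1 : ((i :: l).map T).prod = ((altWord i j m ++ l0).map T).prod := by
      have hc : altWord i j m ++ l0 = i :: (altWord j i r ++ l0) := by rw [hr]; rfl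
      rw [hc] at hA hAl ⊢
      exact key i _ _ hA.symm hl (by rw [hA, hAl]) hn
    have e2 : ((j :: l').map T).prod = ((altWord j i m ++ l0).map T).prod := by
      have hc : altWord j i m ++ l0 = j :: (altWord i j r ++ l0) := by rw [hr]; rfl
      rw [hc] at hB hBl ⊢
      exact key j _ _ (by rw [hB, h]) hl' (by rw [hB, hBl]) hlen
    rw [e1, e2, List.map_append, List.map_append, List.prod_append, List.prod_append, map_altWord,
      map_altWord, hT i j]

open Classical in
/-- The product of the elements `T_i` over a reduced word of `w ∈ W_P`. -/
def wordLift (b : R.Base) (T : P → M) (w : R.Aut) : M :=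
  if h : ∃ l : List P, wordProd R l = w ∧ l.length = len b w then (h.choose.map T).prod else 1

section wordLift

variable (hP : P ⊆ b.support)
    (hT : ∀ i j : P, altProd (T i) (T j) (orderOf (srefl R (i : ι) * srefl R (j : ι))) =
      altProd (T j) (T i) (orderOf (srefl R (i : ι) * srefl R (j : ι))))
include hP hT

lemma wordLift_eq {l : List P} (hl : l.length = len b (wordProd R l)) :
    wordLift b T (wordProd R l) = (l.map T).prod := by
  have h : ∃ l' : List P, wordProd R l' = wordProd R l ∧ l'.length = len b (wordProd R l) :=
    ⟨l, rfl, hl⟩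
  rw [wordLift, dif_pos h]
  exact prod_eq_of_reduced hP hT h.choose_spec.1 (by rw [h.choose_spec.1, h.choose_spec.2]) hl

lemma wordLift_one : wordLift b T (1 : R.Aut) = 1 := by
  have := wordLift_eq hP hT (l := []) (by simp [len_one])
  simpa using this

lemma wordLift_mul_srefl {w : R.Aut} (hw : w ∈ parab R P) (i : P) (h : b.IsPos (w • (i : ι))) :
    wordLift b T (w * srefl R (i : ι)) = wordLift b T w * T i := by
  obtain ⟨l, rfl, h2⟩ := exists_reduced hP hw
  have h3 : wordProd R l * srefl R (i : ι) = wordProd R (l ++ [i]) := by simp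
  rw [wordLift_eq hP hT h2, h3, wordLift_eq hP hT]
  · simp
  · rw [← h3, len_mul_srefl (hP i.2) h]; simp [h2]

lemma wordLift_srefl_mul {w : R.Aut} (hw : w ∈ parab R P) (i : P) (h : b.IsPos (w⁻¹ • (i : ι))) :
    wordLift b T (srefl R (i : ι) * w) = T i * wordLift b T w := by
  obtain ⟨l, rfl, h2⟩ := exists_reduced hP hw
  rw [wordLift_eq hP hT h2, ← wordProd_cons, wordLift_eq hP hT]
  · simp
  · rw [wordProd_cons, len_srefl_mul (hP i.2) h]; simp [h2]

end wordLift

end Matsumoto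
end AffineHecke
end

noncomputable section
namespace AffineHecke
open scoped TensorProduct Pointwise

/-! ### The elements `N_w` and the Bernstein presentation -/

namespace BernsteinDatum

variable {F X : Type*} [AddCommGroup X] (D : BernsteinDatum F X)

variable {D} in
lemma subalgebra_eq_top {B : Subalgebra ℂ D.Hecke} (hθ : ∀ x, D.theta x ∈ B)
    (hN : ∀ i, D.N i ∈ B) (a : D.Hecke) : a ∈ B := by
  obtain ⟨z, rfl⟩ := RingQuot.mkAlgHom_surjective ℂ D.Rel a
  induction z using FreeAlgebra.induction with
  | grade0 r => rw [AlgHom.commutes]; exact B.algebraMap_mem r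
  | grade1 x => rcases x with x | i; exacts [hθ x, hN i]
  | mul a b ha hb => rw [map_mul]; exact B.mul_mem ha hb
  | add a b ha hb => rw [map_add]; exact B.add_mem ha hb

variable {D} in
/-- A subspace that is stable under left multiplication by the generators is a left ideal. -/
lemma mul_mem_of_generators {U : Submodule ℂ D.Hecke} (hθ : ∀ x, ∀ u ∈ U, D.theta x * u ∈ U)
    (hN : ∀ i, ∀ u ∈ U, D.N i * u ∈ U) (a : D.Hecke) : ∀ u ∈ U, a * u ∈ U := by
  let B : Subalgebra ℂ D.Hecke :=
    { carrier := {a | ∀ u ∈ U, a * u ∈ U}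
      mul_mem' := fun {a b} ha hb u hu => by rw [mul_assoc]; exact ha _ (hb u hu)
      add_mem' := fun {a b} ha hb u hu => by rw [add_mul]; exact add_mem (ha u hu) (hb u hu)
      algebraMap_mem' := fun r u hu => by
        rw [← Algebra.smul_def]; exact U.smul_mem r hu }
  exact subalgebra_eq_top (B := B) hθ hN a

variable {D} in
/-- A subspace that is stable under right multiplication by the generators is a right ideal. -/
lemma mul_mem_of_generators_right {U : Submodule ℂ D.Hecke}
    (hθ : ∀ x, ∀ u ∈ U, u * D.theta x ∈ U)
    (hN : ∀ i, ∀ u ∈ U, u * D.N i ∈ U) (a : D.Hecke) : ∀ u ∈ U, u * a ∈ U := by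
  let B : Subalgebra ℂ D.Hecke :=
    { carrier := {a | ∀ u ∈ U, u * a ∈ U}
      mul_mem' := fun {a b} ha hb u hu => by rw [← mul_assoc]; exact hb _ (ha u hu)
      add_mem' := fun {a b} ha hb u hu => by rw [mul_add]; exact add_mem (ha u hu) (hb u hu)
      algebraMap_mem' := fun r u hu => by
        rw [← Algebra.commutes, ← Algebra.smul_def]; exact U.smul_mem r hu }
  exact subalgebra_eq_top (B := B) hθ hN a

lemma mul_self_of_quadratic {A : Type*} [Ring A] [Algebra ℂ A] {N : A} {q q' : ℂ}
    (hq : q * q' = 1) (h : (N - algebraMap ℂ A q) * (N + algebraMap ℂ A q') = 0) :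
    N * N = (q - q') • N + 1 := by
  rw [sub_mul, mul_add, mul_add, ← map_mul, hq, map_one, ← Algebra.commutes, ← Algebra.smul_def,
    ← Algebra.smul_def] at h
  rw [sub_smul]
  rw [← sub_eq_zero, ← h]
  abel

lemma N_sq (i : F) : D.N i * D.N i = ((D.q i : ℂ) - ((D.q i)⁻¹ : ℂˣ)) • D.N i + 1 :=
  mul_self_of_quadratic (by simp) (D.quadratic i)

end BernsteinDatum

open BernsteinDatum RootPairing

namespace ExtendedDatum

variable {ι X Y Γ : Type*} [AddCommGroup X] [AddCommGroup Y] [Group Γ]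
variable (S : ExtendedDatum ι X Y Γ)

instance : S.R.IsReduced := S.reduced

/-- The action of an automorphism of the root datum on `ℂ[X]`. -/
def actA (g : S.R.Aut) : AddMonoidAlgebra ℂ X →ₐ[ℂ] AddMonoidAlgebra ℂ X :=
  AddMonoidAlgebra.mapDomainAlgHom ℂ ℂ (DistribSMul.toAddMonoidHom X g)

@[simp] lemma actA_mono (g : S.R.Aut) (x : X) : S.actA g (mono x) = mono (g • x) := by
  simp [actA, mono]

lemma mono_ext {B : Type*} [Semiring B] [Algebra ℂ B] {f g : AddMonoidAlgebra ℂ X →ₐ[ℂ] B}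
    (h : ∀ x, f (mono x) = g (mono x)) : f = g := by
  refine AddMonoidAlgebra.algHom_ext h ?_
  ext

lemma actA_mul (g h : S.R.Aut) (f : AddMonoidAlgebra ℂ X) :
    S.actA (g * h) f = S.actA g (S.actA h f) := by
  suffices H : S.actA (g * h) = (S.actA g).comp (S.actA h) from DFunLike.congr_fun H f
  exact mono_ext fun x => by simp [mul_smul]

@[simp] lemma actA_one (f : AddMonoidAlgebra ℂ X) : S.actA 1 f = f := by
  suffices H : S.actA 1 = AlgHom.id ℂ _ from DFunLike.congr_fun H f
  exact mono_ext fun x => by simp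

variable {P Q : Set ι}

lemma reflAlg_eq (i : P) (f : AddMonoidAlgebra ℂ X) :
    (S.upper P).reflAlg i f = S.actA (srefl S.R (i : ι)) f := by
  rw [reflAlg, actA]
  change AddMonoidAlgebra.mapDomain _ f = AddMonoidAlgebra.mapDomain _ f
  congr 1

lemma mono_mul (x y : X) : (mono x * mono y : AddMonoidAlgebra ℂ X) = mono (x + y) := by
  simp [mono, AddMonoidAlgebra.single_mul_single]

lemma mono_zero : (mono 0 : AddMonoidAlgebra ℂ X) = 1 := rfl

/-- The right-hand side of the Bernstein relation exists for every `f`. -/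
lemma exists_bernstein (i : P) (f : AddMonoidAlgebra ℂ X) : ∃ g : AddMonoidAlgebra ℂ X,
    g * (mono 0 - mono (-(2 : ℤ) • (S.upper P).root i)) =
      (S.upper P).numer i * (f - (S.upper P).reflAlg i f) := by
  induction f using AddMonoidAlgebra.induction_linear with
  | zero => exact ⟨0, by simp⟩
  | add f f' hf hf' =>
    obtain ⟨g, hg⟩ := hf
    obtain ⟨g', hg'⟩ := hf'
    refine ⟨g + g', ?_⟩
    rw [map_add]
    linear_combination hg + hg'
  | single x c =>
    set α := S.R.root (i : ι) with hα
    have hroot : (S.upper P).root i = α := rfl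
    obtain ⟨n, hn⟩ : ∃ n : ℤ, S.R.coroot' (i : ι) x = n := ⟨_, rfl⟩
    have hsx : srefl S.R (i : ι) • x = x + -(n • α) := by rw [srefl_smul, hn]; abel
    have hc : AddMonoidAlgebra.single x c = c • (mono x : AddMonoidAlgebra ℂ X) := by simp [mono]
    have hs : (S.upper P).reflAlg i (AddMonoidAlgebra.single x c) =
        c • (mono x * mono (-(n • α))) := by
      rw [reflAlg_eq, hc, map_smul, actA_mono, hsx, mono_mul]
    have hgeom : ∀ (y : X) (k : ℤ), ∃ g : AddMonoidAlgebra ℂ X,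
        g * (1 - mono (-y)) = 1 - mono (-(k • y)) := by
      intro y k
      have hnat : ∀ k : ℕ, (mono (-y) : AddMonoidAlgebra ℂ X) ^ k = mono (-((k : ℤ) • y)) := by
        intro k
        induction k with
        | zero => simp [mono_zero]
        | succ k ih => rw [pow_succ, ih, mono_mul]; congr 1; push_cast; module
      rcases k with k | k
      · exact ⟨_, by rw [geom_sum_mul_neg (mono (-y)) k, hnat]; rfl⟩
      · refine ⟨-(∑ j ∈ Finset.range (k + 1), mono (-y) ^ j) * mono ((k + 1 : ℤ) • y), ?_⟩
        have h := geom_sum_mul_neg (mono (-y) : AddMonoidAlgebra ℂ X) (k + 1)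
        rw [hnat] at h
        have h2 : mono (-(((k + 1 : ℕ) : ℤ) • y)) * mono ((k + 1 : ℤ) • y) =
            (1 : AddMonoidAlgebra ℂ X) := by
          rw [mono_mul, ← mono_zero]; congr 1; push_cast; module
        have h3 : (-(Int.negSucc k • y)) = (k + 1 : ℤ) • y := by
          rw [Int.negSucc_eq]; module
        rw [h3]
        linear_combination (-mono ((k + 1 : ℤ) • y)) * h + h2
    rw [hs, hc, hroot, ← smul_sub, mono_zero]
    by_cases h2 : ∃ y : Y, S.R.coroot (i : ι) = (2 : ℤ) • y
    · obtain ⟨y, hy⟩ := h2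
      obtain ⟨k, hk⟩ : ∃ k, n = k * 2 := by
        refine ⟨S.R.toLinearMap x y, ?_⟩
        rw [← hn]
        change S.R.toLinearMap x (S.R.coroot i) = _
        rw [hy, map_smul, smul_eq_mul, mul_comm]
      obtain ⟨g, hg⟩ := hgeom ((2 : ℤ) • α) k
      refine ⟨c • ((S.upper P).numer i * mono x * g), ?_⟩
      rw [hk, mul_smul, neg_smul]
      simp only [Algebra.smul_def]
      linear_combination algebraMap ℂ _ c * (S.upper P).numer i * mono x * hg
    · have hq := S.qStar_eq_q i h2
      obtain ⟨g, hg⟩ := hgeom α n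
      have hnum : (S.upper P).numer i = ((S.q i : ℂ) - ((S.q i)⁻¹ : ℂˣ)) • (1 + mono (-α)) := by
        change ((S.q i : ℂ) - ((S.q i)⁻¹ : ℂˣ)) • mono 0 +
          ((S.qStar i : ℂ) - ((S.qStar i)⁻¹ : ℂˣ)) • mono (-α) = _
        rw [hq, smul_add, mono_zero]
      have hm : (mono (-α) * mono (-α) : AddMonoidAlgebra ℂ X) = mono (-(2 : ℤ) • α) := by
        rw [mono_mul]; congr 1; module
      refine ⟨c • ((S.q i : ℂ) - ((S.q i)⁻¹ : ℂˣ)) • (mono x * g), ?_⟩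
      rw [hnum, ← hm]
      simp only [Algebra.smul_def]
      linear_combination algebraMap ℂ _ c * algebraMap ℂ _ ((S.q i : ℂ) - ((S.q i)⁻¹ : ℂˣ)) *
        mono x * (1 + mono (-α)) * hg

lemma exists_theta_mul_N (i : P) (f : AddMonoidAlgebra ℂ X) : ∃ g : AddMonoidAlgebra ℂ X,
    (S.upper P).thetaHom f * (S.upper P).N i =
      (S.upper P).N i * (S.upper P).thetaHom (S.actA (srefl S.R (i : ι)) f) +
        (S.upper P).thetaHom g := by
  obtain ⟨g, hg⟩ := S.exists_bernstein i f
  refine ⟨g, ?_⟩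
  rw [← (S.upper P).bernstein i f g hg, ← reflAlg_eq]
  abel

lemma exists_N_mul_theta (i : P) (f : AddMonoidAlgebra ℂ X) : ∃ g : AddMonoidAlgebra ℂ X,
    (S.upper P).N i * (S.upper P).thetaHom f =
      (S.upper P).thetaHom (S.actA (srefl S.R (i : ι)) f) * (S.upper P).N i +
        (S.upper P).thetaHom g := by
  obtain ⟨g, hg⟩ := S.exists_theta_mul_N i (S.actA (srefl S.R (i : ι)) f)
  refine ⟨-g, ?_⟩
  rw [hg, ← actA_mul, srefl_mul_self, actA_one, map_neg]
  abel

lemma braid_srefl (P : Set ι) (i j : P) :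
    altProd ((S.upper P).N i) ((S.upper P).N j)
        (orderOf (srefl S.R (i : ι) * srefl S.R (j : ι))) =
      altProd ((S.upper P).N j) ((S.upper P).N i)
        (orderOf (srefl S.R (i : ι) * srefl S.R (j : ι))) := by
  have h := (S.upper P).braid i j
  have hm : (S.upper P).m i j = orderOf (srefl S.R (i : ι) * srefl S.R (j : ι)) := by
    rw [← orderOf_injective (Equiv.weightHom S.R) (Equiv.weightHom_injective S.R), map_mul]
    have h : ∀ j, Equiv.weightHom S.R (srefl S.R j) = S.R.reflection j :=
      Equiv.reflection_weightEquiv S.R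
    rw [h, h]
    rfl
  rwa [hm] at h

/-- The element `N_w` of `ℋ^P`, for `w ∈ W_P`. -/
def Nw (P : Set ι) (w : S.R.Aut) : (S.upper P).Hecke := wordLift S.base (S.upper P).N w

variable [Finite ι] (hP : P ⊆ S.simple)
include hP

lemma Nw_one : S.Nw P 1 = 1 := wordLift_one hP (S.braid_srefl P)

lemma Nw_mul_srefl {w : S.R.Aut} (hw : w ∈ parab S.R P) (i : P)
    (h : S.base.IsPos (w • (i : ι))) :
    S.Nw P (w * srefl S.R (i : ι)) = S.Nw P w * (S.upper P).N i :=
  wordLift_mul_srefl hP (S.braid_srefl P) hw i h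

lemma Nw_srefl_mul {w : S.R.Aut} (hw : w ∈ parab S.R P) (i : P)
    (h : S.base.IsPos (w⁻¹ • (i : ι))) :
    S.Nw P (srefl S.R (i : ι) * w) = (S.upper P).N i * S.Nw P w :=
  wordLift_srefl_mul hP (S.braid_srefl P) hw i h

lemma Nw_mul_N_of_not {w : S.R.Aut} (hw : w ∈ parab S.R P) (i : P)
    (h : ¬ S.base.IsPos (w • (i : ι))) :
    S.Nw P w * (S.upper P).N i =
      ((S.q i : ℂ) - ((S.q i)⁻¹ : ℂˣ)) • S.Nw P w + S.Nw P (w * srefl S.R (i : ι)) := by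
  have h1 : S.base.IsPos ((w * srefl S.R (i : ι)) • (i : ι)) := by
    rw [mul_smul, srefl_smul_index, isPos_smul_neg_index]; exact h
  have h2 := S.Nw_mul_srefl hP (mul_mem hw (srefl_mem_parab i.2)) i h1
  rw [mul_assoc, srefl_mul_self, mul_one] at h2
  rw [h2, mul_assoc, N_sq, mul_add, mul_one, mul_smul_comm]
  rfl

lemma N_mul_Nw_of_not {w : S.R.Aut} (hw : w ∈ parab S.R P) (i : P)
    (h : ¬ S.base.IsPos (w⁻¹ • (i : ι))) :
    (S.upper P).N i * S.Nw P w =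
      ((S.q i : ℂ) - ((S.q i)⁻¹ : ℂˣ)) • S.Nw P w + S.Nw P (srefl S.R (i : ι) * w) := by
  have h1 : S.base.IsPos ((srefl S.R (i : ι) * w)⁻¹ • (i : ι)) := by
    rw [mul_inv_rev, srefl_inv, mul_smul, srefl_smul_index, isPos_smul_neg_index]; exact h
  have h2 := S.Nw_srefl_mul hP (mul_mem (srefl_mem_parab i.2) hw) i h1
  rw [← mul_assoc, srefl_mul_self, one_mul] at h2
  rw [h2, ← mul_assoc, N_sq, add_mul, one_mul, smul_mul_assoc]
  rfl

omit hP

/-- The span of the elements `N_w θ_x` with `w ∈ W_P` of length less than `n`. -/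
def fil (P : Set ι) (n : ℕ) : Submodule ℂ (S.upper P).Hecke :=
  Submodule.span ℂ {z | ∃ w ∈ parab S.R P, len S.base w < n ∧
    ∃ f, z = S.Nw P w * (S.upper P).thetaHom f}

lemma fil_mono {m n : ℕ} (h : m ≤ n) : S.fil P m ≤ S.fil P n :=
  Submodule.span_mono fun _ ⟨w, hw, hl, f, hz⟩ => ⟨w, hw, hl.trans_le h, f, hz⟩

lemma Nw_mul_mem_fil {w : S.R.Aut} (hw : w ∈ parab S.R P) {n : ℕ} (h : len S.base w < n)
    (f : AddMonoidAlgebra ℂ X) : S.Nw P w * (S.upper P).thetaHom f ∈ S.fil P n :=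
  Submodule.subset_span ⟨w, hw, h, f, rfl⟩

include hP

lemma N_mul_fil (i : P) (n : ℕ) : ∀ z ∈ S.fil P n, (S.upper P).N i * z ∈ S.fil P (n + 1) := by
  intro z hz
  induction hz using Submodule.span_induction with
  | mem z hz =>
    obtain ⟨w, hw, hl, f, rfl⟩ := hz
    rw [← mul_assoc]
    by_cases h : S.base.IsPos (w⁻¹ • (i : ι))
    · rw [← S.Nw_srefl_mul hP hw i h]
      refine S.Nw_mul_mem_fil (mul_mem (srefl_mem_parab i.2) hw) ?_ f
      rw [len_srefl_mul (hP i.2) h]; omega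
    · rw [S.N_mul_Nw_of_not hP hw i h, add_mul, smul_mul_assoc]
      refine add_mem (Submodule.smul_mem _ _ (S.Nw_mul_mem_fil hw (by omega) f)) ?_
      refine S.Nw_mul_mem_fil (mul_mem (srefl_mem_parab i.2) hw) ?_ f
      have := len_srefl_mul_of_not (hP i.2) h
      omega
  | zero => simp
  | add x y _ _ hx hy => rw [mul_add]; exact add_mem hx hy
  | smul c x _ hx => rw [mul_smul_comm]; exact Submodule.smul_mem _ _ hx

/-- The commutation of `θ_x` with `N_w`, up to shorter terms. -/
lemma theta_mul_Nw {w : S.R.Aut} (hw : w ∈ parab S.R P) (f : AddMonoidAlgebra ℂ X) :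
    (S.upper P).thetaHom f * S.Nw P w - S.Nw P w * (S.upper P).thetaHom (S.actA w⁻¹ f) ∈
      S.fil P (len S.base w) := by
  generalize hn : len S.base w = n
  induction n generalizing w f with
  | zero =>
    rw [eq_one_of_len hP hw hn, S.Nw_one hP]
    simp
  | succ n ih =>
    have hw1 : w ≠ 1 := by rintro rfl; rw [len_one] at hn; omega
    obtain ⟨i, hi, hd⟩ := exists_left_descent hP hw hw1
    set u := srefl S.R i * w with hu
    have hul : len S.base u + 1 = len S.base w := len_srefl_mul_of_not (hP hi) hd
    have huP : u ∈ parab S.R P := mul_mem (srefl_mem_parab hi) hw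
    have hwu : w = srefl S.R i * u := by rw [hu, ← mul_assoc, srefl_mul_self, one_mul]
    have hpos : S.base.IsPos (u⁻¹ • i) := by
      rw [hu, mul_inv_rev, srefl_inv, mul_smul, srefl_smul_index, isPos_smul_neg_index]; exact hd
    have hN : S.Nw P w = (S.upper P).N ⟨i, hi⟩ * S.Nw P u := by
      rw [hwu]; exact S.Nw_srefl_mul hP huP ⟨i, hi⟩ hpos
    have hun : len S.base u = n := by omega
    obtain ⟨g, hg⟩ := S.exists_theta_mul_N ⟨i, hi⟩ f
    have h1 := ih huP (S.actA (srefl S.R i) f) hun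
    have h2 := ih huP g hun
    have h3 : S.actA w⁻¹ f = S.actA u⁻¹ (S.actA (srefl S.R i) f) := by
      rw [← actA_mul, hwu, mul_inv_rev, srefl_inv]
    rw [hN, ← mul_assoc, hg, h3]
    have h4 := S.N_mul_fil hP ⟨i, hi⟩ n _ h1
    have h5 : (S.upper P).thetaHom g * S.Nw P u ∈ S.fil P (n + 1) := by
      have := add_mem (S.fil_mono (Nat.le_succ n) h2)
        (S.Nw_mul_mem_fil huP (n := n + 1) (by omega) (S.actA u⁻¹ g))
      simpa using this
    convert! add_mem h4 h5 using 1
    simp only [mul_sub, add_mul, mul_assoc]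
    abel

/-- The elements `N_w θ_x` span `ℋ^P`. -/
lemma span_Nw_theta (a : (S.upper P).Hecke) :
    a ∈ Submodule.span ℂ {z | ∃ w ∈ parab S.R P, ∃ f, z = S.Nw P w * (S.upper P).thetaHom f} := by
  set U := Submodule.span ℂ
    {z | ∃ w ∈ parab S.R P, ∃ f, z = S.Nw P w * (S.upper P).thetaHom f} with hU
  have hmem : ∀ w ∈ parab S.R P, ∀ f, S.Nw P w * (S.upper P).thetaHom f ∈ U :=
    fun w hw f => Submodule.subset_span ⟨w, hw, f, rfl⟩
  have h1 : (1 : (S.upper P).Hecke) ∈ U := by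
    have := hmem 1 (one_mem _) 1
    rwa [S.Nw_one hP, map_one, mul_one] at this
  have := mul_mem_of_generators_right (U := U) ?_ ?_ a 1 h1
  · rwa [one_mul] at this
  · intro x u hu
    induction hu using Submodule.span_induction with
    | mem z hz =>
      obtain ⟨w, hw, f, rfl⟩ := hz
      rw [mul_assoc, ← thetaHom_mono, ← map_mul]
      exact hmem w hw _
    | zero => simp
    | add x y _ _ hx hy => rw [add_mul]; exact add_mem hx hy
    | smul c x _ hx => rw [smul_mul_assoc]; exact Submodule.smul_mem _ _ hx
  · intro i u hu
    induction hu using Submodule.span_induction with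
    | mem z hz =>
      obtain ⟨w, hw, f, rfl⟩ := hz
      obtain ⟨g, hg⟩ := S.exists_theta_mul_N i f
      rw [mul_assoc, hg, mul_add, ← mul_assoc]
      refine add_mem ?_ (hmem w hw g)
      have hws := mul_mem hw (srefl_mem_parab (R := S.R) i.2)
      by_cases h : S.base.IsPos (w • (i : ι))
      · rw [← S.Nw_mul_srefl hP hw i h]; exact hmem _ hws _
      · rw [S.Nw_mul_N_of_not hP hw i h, add_mul, smul_mul_assoc]
        exact add_mem (Submodule.smul_mem _ _ (hmem w hw _)) (hmem _ hws _)
    | zero => simp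
    | add x y _ _ hx hy => rw [add_mul]; exact add_mem hx hy
    | smul c x _ hx => rw [smul_mul_assoc]; exact Submodule.smul_mem _ _ hx

/-- The elements `θ_x N_w` span `ℋ^P`. -/
lemma span_theta_Nw (a : (S.upper P).Hecke) :
    a ∈ Submodule.span ℂ {z | ∃ w ∈ parab S.R P, ∃ f, z = (S.upper P).thetaHom f * S.Nw P w} := by
  set U := Submodule.span ℂ
    {z | ∃ w ∈ parab S.R P, ∃ f, z = (S.upper P).thetaHom f * S.Nw P w} with hU
  have hmem : ∀ w ∈ parab S.R P, ∀ f, (S.upper P).thetaHom f * S.Nw P w ∈ U :=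
    fun w hw f => Submodule.subset_span ⟨w, hw, f, rfl⟩
  have h1 : (1 : (S.upper P).Hecke) ∈ U := by
    have := hmem 1 (one_mem _) 1
    rwa [S.Nw_one hP, map_one, mul_one] at this
  have := mul_mem_of_generators (U := U) ?_ ?_ a 1 h1
  · rwa [mul_one] at this
  · intro x u hu
    induction hu using Submodule.span_induction with
    | mem z hz =>
      obtain ⟨w, hw, f, rfl⟩ := hz
      rw [← mul_assoc, ← thetaHom_mono, ← map_mul]
      exact hmem w hw _
    | zero => simp
    | add x y _ _ hx hy => rw [mul_add]; exact add_mem hx hy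
    | smul c x _ hx => rw [mul_smul_comm]; exact Submodule.smul_mem _ _ hx
  · intro i u hu
    induction hu using Submodule.span_induction with
    | mem z hz =>
      obtain ⟨w, hw, f, rfl⟩ := hz
      obtain ⟨g, hg⟩ := S.exists_N_mul_theta i f
      rw [← mul_assoc, hg, add_mul, mul_assoc]
      refine add_mem ?_ (hmem w hw g)
      have hws := mul_mem (srefl_mem_parab (R := S.R) i.2) hw
      by_cases h : S.base.IsPos (w⁻¹ • (i : ι))
      · rw [← S.Nw_srefl_mul hP hw i h]; exact hmem _ hws _
      · rw [S.N_mul_Nw_of_not hP hw i h, mul_add, mul_smul_comm]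
        exact add_mem (Submodule.smul_mem _ _ (hmem w hw _)) (hmem _ hws _)
    | zero => simp
    | add x y _ _ hx hy => rw [mul_add]; exact add_mem hx hy
    | smul c x _ hx => rw [mul_smul_comm]; exact Submodule.smul_mem _ _ hx

lemma len_mul_le (x : S.R.Aut) {y : S.R.Aut} (hy : y ∈ parab S.R P) :
    len S.base (x * y) ≤ len S.base x + len S.base y := by
  obtain ⟨l, rfl, hl⟩ := exists_reduced hP hy
  rw [← hl]
  clear hl hy
  induction l using List.reverseRecOn with
  | nil => simp
  | append_singleton l i ih =>
    rw [wordProd_append, wordProd_cons, wordProd_nil, mul_one, ← mul_assoc, List.length_append]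
    by_cases h : S.base.IsPos ((x * wordProd S.R l) • (i : ι))
    · rw [len_mul_srefl (hP i.2) h]; simp; omega
    · have := len_mul_srefl_of_not (hP i.2) h; simp; omega

omit hP in
/-- Every element of `W_Q` is the product of an element of minimal length in its coset of `W_P`
and an element of `W_P`. -/
lemma exists_coset_decomp (hPQ : P ⊆ Q) (hQ : Q ⊆ S.simple) {w : S.R.Aut}
    (hw : w ∈ parab S.R Q) : ∃ u ∈ parab S.R Q, ∃ v ∈ parab S.R P, w = u * v ∧
      (∀ i ∈ P, S.base.IsPos (u • i)) ∧ len S.base w = len S.base u + len S.base v ∧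
      S.Nw Q w = S.Nw Q u * S.incl hPQ (S.Nw P v) := by
  have hP := hPQ.trans hQ
  generalize hn : len S.base w = n
  induction n using Nat.strong_induction_on generalizing w with
  | _ n ih =>
    by_cases h : ∀ i ∈ P, S.base.IsPos (w • i)
    · exact ⟨w, hw, 1, one_mem _, by simp, h, by simp [len_one, hn], by
        rw [S.Nw_one hP, map_one, mul_one]⟩
    · push Not at h
      obtain ⟨i, hi, hneg⟩ := h
      have hl := len_mul_srefl_of_not (hP hi) hneg
      have hsQ := srefl_mem_parab (R := S.R) (hPQ hi)
      have hsP := srefl_mem_parab (R := S.R) hi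
      obtain ⟨u, hu, v, hv, huv, hmin, hlen, hN⟩ := ih _ (by omega) (mul_mem hw hsQ) rfl
      have hpos : S.base.IsPos ((w * srefl S.R i) • i) := by
        rw [mul_smul, srefl_smul_index, isPos_smul_neg_index]; exact hneg
      have hw' : w = u * (v * srefl S.R i) := by
        rw [← mul_assoc, ← huv, mul_assoc, srefl_mul_self, mul_one]
      have hvpos : S.base.IsPos (v • i) := by
        by_contra hv'
        have h1 := len_mul_srefl_of_not (hP hi) hv'
        have h2 := S.len_mul_le hP u (mul_mem hv hsP)
        rw [← hw'] at h2
        omega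
      refine ⟨u, hu, v * srefl S.R i, mul_mem hv hsP, hw', hmin, ?_, ?_⟩
      · rw [len_mul_srefl (hP hi) hvpos]; omega
      · have h1 := S.Nw_mul_srefl hQ (mul_mem hw hsQ) ⟨i, hPQ hi⟩ hpos
        rw [mul_assoc, srefl_mul_self, mul_one] at h1
        rw [h1, hN, S.Nw_mul_srefl hP hv ⟨i, hi⟩ hvpos, map_mul, incl_N, mul_assoc]

end ExtendedDatum
end AffineHecke
end

noncomputable section
namespace AffineHecke
open scoped TensorProduct Pointwise

/-! ### The braid relations for Demazure–Lusztig operators -/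

section Symmetrizer

/-- The relations between the functions `h_γ` of the six positive roots of `G₂` that account for the
braid relation of length six. -/
def G2Identities {K : Type*} [Field K] (a b h1 h2 h3 h4 h5 h6 : K) : Prop :=
  (1 + b - h2) * h3 + (1 + a - h3) * h4 + h1 * h6 + (1 + b - h6) * h5 + (1 + a - h1) * h2 -
      2 * (a + b) = h4 * h5 ∧
  (1 + b - h4) * h3 + (1 + a - h3) * h2 + h1 * h6 + (1 + b - h6) * h5 + (1 + a - h5) * h4 -
      2 * (a + b) = h1 * h2 ∧
  h1 * h6 * (h4 * h5 - (1 + b - h2) * h3 - (1 + a - h3) * h4) +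
      (1 + b - h6) * h5 * (h1 * h2 - (1 + b - h4) * h3 - (1 + a - h3) * h2) +
      (1 + a - h1) * h2 * (h4 * h5 - (1 + a - h3) * h4) + (a ^ 2 + a * b + b ^ 2) =
    h2 * h3 * h4 * h5 ∧
  h1 * h6 * (h4 * h5 - (1 + b - h2) * h3 - (1 + a - h3) * h4) +
      (1 + b - h6) * h5 * (h1 * h2 - (1 + b - h4) * h3 - (1 + a - h3) * h2) +
      (1 + a - h5) * h4 * (h1 * h2 - (1 + a - h3) * h2) + (a ^ 2 + a * b + b ^ 2) =
    h1 * h2 * h3 * h4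

variable {K : Type*} [Field K]

/-- The identity between the functions `h_γ` of the three positive roots of `A₂` that accounts for
the braid relation of length three. -/
lemma idA2 {x y k : K} (hx : 1 - x ≠ 0) (hy : 1 - y ≠ 0) (hxy : 1 - x * y ≠ 0) {h1 h2 h3 : K}
    (e1 : h1 = (k - x) / (1 - x)) (e2 : h2 = (k - x * y) / (1 - x * y)) (e3 : h3 = (k - y) / (1 - y)) :
    h1 * h3 + (1 + k - h3) * h2 - k = h1 * h2 := by
  rw [e1, e2, e3]; field_simp; ring

/-- The identities between the functions `h_γ` of the four positive roots of `B₂` that account for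
the braid relation of length four. Only the short roots `x` and `x y` can carry two different
parameters, so only these enter with a general `c`. -/
lemma idB2 {x y a b c : K} (hx : 1 - x ^ 2 ≠ 0) (hy : 1 - y ≠ 0) (hxy : 1 - x ^ 2 * y ^ 2 ≠ 0)
    (hxxy : 1 - x ^ 2 * y ≠ 0) {h1 h2 h3 h4 : K}
    (e1 : h1 = 1 + (a - 1 + c * x) / (1 - x ^ 2)) (e2 : h2 = (b - x ^ 2 * y) / (1 - x ^ 2 * y))
    (e3 : h3 = 1 + (a - 1 + c * (x * y)) / (1 - x ^ 2 * y ^ 2)) (e4 : h4 = (b - y) / (1 - y)) :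
    h1 * h4 + (1 + b - h4) * h3 + (1 + a - h1) * h2 - (a + b) = h2 * h3 ∧
    h1 * h4 + (1 + b - h4) * h3 + (1 + a - h3) * h2 - (a + b) = h1 * h2 ∧
    h1 * h4 + (1 + a - h1) * h2 + (1 + b - h2) * h3 - (a + b) = h3 * h4 := by
  rw [e1, e2, e3, e4]
  refine ⟨?_, ?_, ?_⟩ <;> · field_simp; ring

set_option maxRecDepth 4000 in
lemma g2Identities {x y a b : K} (hx : 1 - x ≠ 0) (hy : 1 - y ≠ 0) (hx3y : 1 - x ^ 3 * y ≠ 0)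
    (hx2y : 1 - x ^ 2 * y ≠ 0) (hx3y2 : 1 - x ^ 3 * y ^ 2 ≠ 0) (hxy : 1 - x * y ≠ 0)
    {h1 h2 h3 h4 h5 h6 : K}
    (g1 : h1 = (a - x) / (1 - x)) (g2 : h2 = (b - x ^ 3 * y) / (1 - x ^ 3 * y))
    (g3 : h3 = (a - x ^ 2 * y) / (1 - x ^ 2 * y))
    (g4 : h4 = (b - x ^ 3 * y ^ 2) / (1 - x ^ 3 * y ^ 2))
    (g5 : h5 = (a - x * y) / (1 - x * y)) (g6 : h6 = (b - y) / (1 - y)) :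
    G2Identities a b h1 h2 h3 h4 h5 h6 ∧ G2Identities b a h6 h5 h4 h3 h2 h1 := by
  -- The denominators are replaced by variables, which keeps `field_simp` from factoring them.
  obtain ⟨d1, e1⟩ : ∃ d, d = 1 - x := ⟨_, rfl⟩
  obtain ⟨d2, e2⟩ : ∃ d, d = 1 - x ^ 3 * y := ⟨_, rfl⟩
  obtain ⟨d3, e3⟩ : ∃ d, d = 1 - x ^ 2 * y := ⟨_, rfl⟩
  obtain ⟨d4, e4⟩ : ∃ d, d = 1 - x ^ 3 * y ^ 2 := ⟨_, rfl⟩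
  obtain ⟨d5, e5⟩ : ∃ d, d = 1 - x * y := ⟨_, rfl⟩
  obtain ⟨d6, e6⟩ : ∃ d, d = 1 - y := ⟨_, rfl⟩
  rw [← e1] at hx g1
  rw [← e2] at hx3y g2
  rw [← e3] at hx2y g3
  rw [← e4] at hx3y2 g4
  rw [← e5] at hxy g5
  rw [← e6] at hy g6
  rw [G2Identities, G2Identities, g1, g2, g3, g4, g5, g6]
  refine ⟨⟨?_, ?_, ?_, ?_⟩, ⟨?_, ?_, ?_, ?_⟩⟩ <;> · field_simp; rw [e1, e2, e3, e4, e5, e6]; ring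

variable (s t : K →+* K) (hs : ∀ z, s (s z) = z) (ht : ∀ z, t (t z) = z)
include hs ht

/-- For `τ_s = (1 + s) h_s` and `τ_t = (1 + t) h_t` in type `A₂`, the combination
`τ_t τ_s τ_t - k τ_t` is the sum over the dihedral group `⟨s, t⟩` composed with the multiplication by
the product of all `h_γ`. This is symmetric in `s` and `t`. -/
lemma symmetrizer_A2 {h1 h2 h3 k : K} (s1 : s h1 = 1 + k - h1) (s2 : s h2 = h3) (s3 : s h3 = h2)
    (t1 : t h1 = h2) (t2 : t h2 = h1) (t3 : t h3 = 1 + k - h3) (sk : s k = k) (tk : t k = k)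
    (e : h1 * h3 + (1 + k - h3) * h2 - k = h1 * h2)
    {τs τt : K → K} (hτs : ∀ f, τs f = h1 * f + s (h1 * f)) (hτt : ∀ f, τt f = h3 * f + t (h3 * f)) (f : K) :
    τt (τs (τt f)) - k * τt f =
      let g := h1 * h2 * h3 * f
      g + s g + s (t g) + t (g + s g + s (t g)) := by
  have A2 : τs (τt f) = h1 * h3 * f + t (h2 * h3 * f) + s (h1 * h3 * f + t (h2 * h3 * f)) := by
    rw [hτt, hτs]; simp only [map_add, map_mul, map_sub, map_one, hs, ht, s1, s2, s3, t1, t2, t3, sk, tk]; ring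
  have A3 : τt (τs (τt f)) = (h1 * h3 + (1 + k - h3) * h2) * h3 * f + s (h1 * h2 * h3 * f) + s (t (h1 * h2 * h3 * f))
      + t ((h1 * h3 + (1 + k - h3) * h2) * h3 * f + s (h1 * h2 * h3 * f) + s (t (h1 * h2 * h3 * f))) := by
    rw [A2, hτt]; simp only [map_add, map_mul, map_sub, map_one, hs, ht, s1, s2, s3, t1, t2, t3, sk, tk]; ring
  have e' : h1 * h3 + (1 + k - h3) * h2 = h1 * h2 + k := by linear_combination e
  rw [A3, e', hτt]
  simp only [map_add, map_mul, map_sub, map_one, hs, ht, s1, s2, s3, t1, t2, t3, sk, tk]; ring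

/-- The analogue of `symmetrizer_A2` in type `B₂`. -/
lemma symmetrizer_B2 {h1 h2 h3 h4 a b : K} (s1 : s h1 = 1 + a - h1) (s2 : s h2 = h4) (s3 : s h3 = h3) (s4 : s h4 = h2)
    (t1 : t h1 = h3) (t2 : t h2 = h2) (t3 : t h3 = h1) (t4 : t h4 = 1 + b - h4)
    (sa : s a = a) (ta : t a = a) (sb : s b = b) (tb : t b = b)
    (e1 : h1 * h4 + (1 + b - h4) * h3 + (1 + a - h1) * h2 - (a + b) = h2 * h3)
    (e2 : h1 * h4 + (1 + b - h4) * h3 + (1 + a - h3) * h2 - (a + b) = h1 * h2)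
    {τs τt : K → K} (hτs : ∀ f, τs f = h1 * f + s (h1 * f)) (hτt : ∀ f, τt f = h4 * f + t (h4 * f)) (f : K) :
    τs (τt (τs (τt f))) - (a + b) * τs (τt f) =
      let g := h1 * h2 * h3 * h4 * f
      g + t g + t (s g) + t (s (t g)) + s (g + t g + t (s g) + t (s (t g))) := by
  have A2 : τs (τt f) = h1 * h4 * f + t (h3 * h4 * f) + s (h1 * h4 * f + t (h3 * h4 * f)) := by
    rw [hτt, hτs]; simp only [map_add, map_mul, map_sub, map_one, hs, ht, s1, s2, s3, s4, t1, t2, t3, t4, sa, sb, ta, tb]; ring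
  have A3 : τt (τs (τt f)) = (h1 * h4 + (1 + b - h4) * h3) * h4 * f + s (h1 * h2 * h4 * f) + s (t (h2 * h3 * h4 * f))
      + t ((h1 * h4 + (1 + b - h4) * h3) * h4 * f + s (h1 * h2 * h4 * f) + s (t (h2 * h3 * h4 * f))) := by
    rw [A2, hτt]; simp only [map_add, map_mul, map_sub, map_one, hs, ht, s1, s2, s3, s4, t1, t2, t3, t4, sa, sb, ta, tb]; ring
  have A4 : τs (τt (τs (τt f))) = h1 * h4 * (h1 * h4 + (1 + b - h4) * h3 + (1 + a - h1) * h2) * f +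
      t (h3 * h4 * (h1 * h4 + (1 + b - h4) * h3 + (1 + a - h3) * h2) * f) +
      t (s (h1 * h2 * h3 * h4 * f)) + t (s (t (h1 * h2 * h3 * h4 * f))) +
      s (h1 * h4 * (h1 * h4 + (1 + b - h4) * h3 + (1 + a - h1) * h2) * f +
      t (h3 * h4 * (h1 * h4 + (1 + b - h4) * h3 + (1 + a - h3) * h2) * f) +
      t (s (h1 * h2 * h3 * h4 * f)) + t (s (t (h1 * h2 * h3 * h4 * f)))) := by
    rw [A3, hτs]; simp only [map_add, map_mul, map_sub, map_one, hs, ht, s1, s2, s3, s4, t1, t2, t3, t4, sa, sb, ta, tb]; ring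
  rw [sub_eq_iff_eq_add] at e1 e2
  rw [A4, e1, e2, A2]
  simp only [map_add, map_mul, map_sub, map_one, hs, ht, s1, s2, s3, s4, t1, t2, t3, t4, sa, sb, ta, tb]; ring

/-- The analogue of `symmetrizer_A2` in type `G₂`. -/
lemma symmetrizer_G2 {h1 h2 h3 h4 h5 h6 a b : K} (s1 : s h1 = 1 + a - h1) (s2 : s h2 = h6) (s3 : s h3 = h5) (s4 : s h4 = h4)
    (s5 : s h5 = h3) (s6 : s h6 = h2)
    (t1 : t h1 = h5) (t2 : t h2 = h4) (t3 : t h3 = h3) (t4 : t h4 = h2) (t5 : t h5 = h1) (t6 : t h6 = 1 + b - h6)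
    (sa : s a = a) (ta : t a = a) (sb : s b = b) (tb : t b = b)
    (e : G2Identities a b h1 h2 h3 h4 h5 h6)
    {τs τt : K → K} (hτs : ∀ f, τs f = h1 * f + s (h1 * f)) (hτt : ∀ f, τt f = h6 * f + t (h6 * f)) (f : K) :
    τs (τt (τs (τt (τs (τt f))))) - 2 * (a + b) * τs (τt (τs (τt f))) + (a ^ 2 + a * b + b ^ 2) * τs (τt f) =
      let g := h1 * h2 * h3 * h4 * h5 * h6 * f
      g + t g + t (s g) + t (s (t g)) + t (s (t (s g))) + t (s (t (s (t g)))) +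
        s (g + t g + t (s g) + t (s (t g)) + t (s (t (s g))) + t (s (t (s (t g))))) := by
  obtain ⟨e1, e2, e3, e4⟩ := e
  have A2 : τs (τt f) = h1 * h6 * f + t (h5 * h6 * f) + s (h1 * h6 * f + t (h5 * h6 * f)) := by
    rw [hτt, hτs]; simp only [map_add, map_mul, map_sub, map_one, hs, ht, s1, s2, s3, s4, s5, s6, t1, t2, t3, t4, t5, t6, sa, sb, ta, tb]; ring
  have A3 : τt (τs (τt f)) = (h1 * h6 + (1 + b - h6) * h5) * h6 * f + s (h1 * h2 * h6 * f) + s (t (h4 * h5 * h6 * f))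
      + t ((h1 * h6 + (1 + b - h6) * h5) * h6 * f + s (h1 * h2 * h6 * f) + s (t (h4 * h5 * h6 * f))) := by
    rw [A2, hτt]; simp only [map_add, map_mul, map_sub, map_one, hs, ht, s1, s2, s3, s4, s5, s6, t1, t2, t3, t4, t5, t6, sa, sb, ta, tb]; ring
  obtain ⟨B1, hB1⟩ : ∃ B, B = h1 * h6 + (1 + b - h6) * h5 + (1 + a - h1) * h2 := ⟨_, rfl⟩
  obtain ⟨B5, hB5⟩ : ∃ B, B = h1 * h6 + (1 + b - h6) * h5 + (1 + a - h5) * h4 := ⟨_, rfl⟩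
  have A4 : τs (τt (τs (τt f))) = h1 * h6 * B1 * f + t (h5 * h6 * B5 * f) + t (s (h1 * h2 * h3 * h6 * f)) +
      t (s (t (h3 * h4 * h5 * h6 * f))) +
      s (h1 * h6 * B1 * f + t (h5 * h6 * B5 * f) + t (s (h1 * h2 * h3 * h6 * f)) +
      t (s (t (h3 * h4 * h5 * h6 * f)))) := by
    rw [A3, hτs, hB1, hB5]; simp only [map_add, map_mul, map_sub, map_one, hs, ht, s1, s2, s3, s4, s5, s6, t1, t2, t3, t4, t5, t6, sa, sb, ta, tb]; ring
  obtain ⟨C, hC⟩ : ∃ C, C = h1 * h6 * B1 + (1 + b - h6) * h5 * B5 := ⟨_, rfl⟩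
  have A5 : τt (τs (τt (τs (τt f)))) = h6 * C * f + s (h1 * h2 * h6 * ((1 + b - h2) * h3 + B1) * f) +
      s (t (h4 * h5 * h6 * ((1 + b - h4) * h3 + B5) * f)) + s (t (s (h1 * h2 * h3 * h4 * h6 * f))) +
      s (t (s (t (h2 * h3 * h4 * h5 * h6 * f)))) +
      t (h6 * C * f + s (h1 * h2 * h6 * ((1 + b - h2) * h3 + B1) * f) +
      s (t (h4 * h5 * h6 * ((1 + b - h4) * h3 + B5) * f)) + s (t (s (h1 * h2 * h3 * h4 * h6 * f))) +
      s (t (s (t (h2 * h3 * h4 * h5 * h6 * f))))) := by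
    rw [A4, hτt, hC]; simp only [map_add, map_mul, map_sub, map_one, hs, ht, s1, s2, s3, s4, s5, s6, t1, t2, t3, t4, t5, t6, sa, sb, ta, tb]; ring
  have hF : ∀ F1 F2, F1 = (1 + b - h2) * h3 + B1 → F2 = (1 + b - h4) * h3 + B5 →
    τs (τt (τs (τt (τs (τt f))))) = h1 * h6 * (C + (1 + a - h1) * h2 * F1) * f +
      t (h5 * h6 * (C + (1 + a - h5) * h4 * F2) * f) +
      t (s (h1 * h2 * h3 * h6 * (F1 + (1 + a - h3) * h4) * f)) +
      t (s (t (h3 * h4 * h5 * h6 * (F2 + (1 + a - h3) * h2) * f))) +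
      t (s (t (s (h1 * h2 * h3 * h4 * h5 * h6 * f)))) + t (s (t (s (t (h1 * h2 * h3 * h4 * h5 * h6 * f))))) +
      s (h1 * h6 * (C + (1 + a - h1) * h2 * F1) * f +
      t (h5 * h6 * (C + (1 + a - h5) * h4 * F2) * f) +
      t (s (h1 * h2 * h3 * h6 * (F1 + (1 + a - h3) * h4) * f)) +
      t (s (t (h3 * h4 * h5 * h6 * (F2 + (1 + a - h3) * h2) * f))) +
      t (s (t (s (h1 * h2 * h3 * h4 * h5 * h6 * f)))) + t (s (t (s (t (h1 * h2 * h3 * h4 * h5 * h6 * f)))))) := by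
    intro F1 F2 hF1 hF2
    rw [A5, ← hF1, ← hF2, hτs]; simp only [map_add, map_mul, map_sub, map_one, hs, ht, s1, s2, s3, s4, s5, s6, t1, t2, t3, t4, t5, t6, sa, sb, ta, tb]; ring
  have d1 : B1 = h4 * h5 - (1 + b - h2) * h3 - (1 + a - h3) * h4 + 2 * (a + b) := by
    rw [hB1]; linear_combination e1
  have d5 : B5 = h1 * h2 - (1 + b - h4) * h3 - (1 + a - h3) * h2 + 2 * (a + b) := by
    rw [hB5]; linear_combination e2
  have c1 : C + (1 + a - h1) * h2 * ((1 + b - h2) * h3 + B1) = h2 * h3 * h4 * h5 + 2 * (a + b) * B1 - (a ^ 2 + a * b + b ^ 2) := by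
    rw [hC]
    linear_combination (h1 * h6 + (1 + a - h1) * h2) * d1 + (1 + b - h6) * h5 * d5 + e3 - 2 * (a + b) * hB1
  have c2 : C + (1 + a - h5) * h4 * ((1 + b - h4) * h3 + B5) = h1 * h2 * h3 * h4 + 2 * (a + b) * B5 - (a ^ 2 + a * b + b ^ 2) := by
    rw [hC]
    linear_combination h1 * h6 * d1 + ((1 + b - h6) * h5 + (1 + a - h5) * h4) * d5 + e4 - 2 * (a + b) * hB5
  have c3 : (1 + b - h2) * h3 + B1 + (1 + a - h3) * h4 = h4 * h5 + 2 * (a + b) := by linear_combination d1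
  have c4 : (1 + b - h4) * h3 + B5 + (1 + a - h3) * h2 = h1 * h2 + 2 * (a + b) := by linear_combination d5
  rw [hF _ _ rfl rfl, c1, c2, c3, c4, A4, A2]
  have s22 : s 2 = 2 := map_ofNat s 2
  have t22 : t 2 = 2 := map_ofNat t 2
  simp only [map_add, map_mul, map_sub, map_pow, map_one, s22, t22, hs, ht, sa, sb, ta, tb]; ring

end Symmetrizer

/-- The function `h_γ = 1 + q N_γ / (1 - θ_{-2γ})`, where `q = q(s_γ)^{1/2}` and `N_γ` is the factor in
the Bernstein relation. It is written in terms of `z = θ_{-γ}`, `a = q(s_γ)` and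
`c = q(s_γ)^{1/2} (q_{γ^∨}^{1/2} - q_{γ^∨}^{-1/2})`, so that `q N_γ = a - 1 + c z`. -/
def hfun {K : Type*} [Field K] (a c z : K) : K := 1 + (a - 1 + c * z) / (1 - z ^ 2)

section
variable {K : Type*} [Field K] {s t : K →+* K} {a b c x y : K}

lemma hfun_inv (hx : x ≠ 0) (hx' : 1 - x ^ 2 ≠ 0) : hfun a c x⁻¹ = 1 + a - hfun a c x := by
  have h2 : 1 - x⁻¹ ^ 2 = -(1 - x ^ 2) / x ^ 2 := by field_simp; ring
  rw [hfun, hfun, h2]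
  obtain ⟨d, hd⟩ : ∃ d, d = 1 - x ^ 2 := ⟨_, rfl⟩
  rw [← hd] at hx' ⊢
  field_simp
  rw [hd]; ring

lemma map_hfun (sa : s a = a) (sc : s c = c) : s (hfun a c x) = hfun a c (s x) := by
  simp [hfun, sa, sc]

/-- With equal parameters one factor `1 + θ_{-γ}` cancels. -/
lemma hfun_eq (hx : 1 - x ^ 2 ≠ 0) : hfun a (a - 1) x = (a - x) / (1 - x) := by
  have h : 1 - x ^ 2 = (1 - x) * (1 + x) := by ring
  have h1 : 1 - x ≠ 0 := fun h1 => hx (by rw [h, h1, zero_mul])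
  have h2 : 1 + x ≠ 0 := fun h2 => hx (by rw [h, h2, mul_zero])
  rw [hfun, h]; field_simp; ring

lemma one_sub_ne (hx : 1 - x ^ 2 ≠ 0) : 1 - x ≠ 0 := fun h => hx (by linear_combination (1 + x) * h)

variable {τs τt : K → K}

/-- The relation between `τ_s = (1 + s) h_s` and `τ_t = (1 + t) h_t` for orthogonal simple roots. The
lemmas for the other types of rank two give the deformed braid relations: those of `τ_s` and `τ_t`
have lower order terms, which disappear for `τ_s - 1` and `τ_t - 1`. -/
lemma demazure_A1 (hst : ∀ z, s (t z) = t (s z)) {h h' : K} (th : t h = h) (sh : s h' = h')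
    (hτs : ∀ f, τs f = h * f + s (h * f)) (hτt : ∀ f, τt f = h' * f + t (h' * f)) (f : K) :
    τs (τt f) = τt (τs f) := by
  have h1 : t (s h) = s h := by rw [← hst, th]
  simp only [hτs, hτt, map_add, map_mul, th, sh, hst, h1]; ring

variable (hs : ∀ z, s (s z) = z) (ht : ∀ z, t (t z) = z)
include hs ht

lemma demazure_A2 (hst : ∀ z, s (t (s z)) = t (s (t z))) (sa : s a = a) (ta : t a = a)
    (hx : x ≠ 0) (hy : y ≠ 0) (hx2 : 1 - x ^ 2 ≠ 0) (hy2 : 1 - y ^ 2 ≠ 0)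
    (hxy : 1 - (x * y) ^ 2 ≠ 0)
    (sx : s x = x⁻¹) (sy : s y = x * y) (tx : t x = x * y) (ty : t y = y⁻¹)
    (hτs : ∀ f, τs f = hfun a (a - 1) x * f + s (hfun a (a - 1) x * f))
    (hτt : ∀ f, τt f = hfun a (a - 1) y * f + t (hfun a (a - 1) y * f)) (f : K) :
    τs (τt (τs f)) - a * τs f = τt (τs (τt f)) - a * τt f := by
  have sc : s (a - 1) = a - 1 := by rw [map_sub, sa, map_one]
  have tc : t (a - 1) = a - 1 := by rw [map_sub, ta, map_one]
  have s1 := (map_hfun (x := x) sa sc).trans (by rw [sx, hfun_inv hx hx2])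
  have s2 := (map_hfun (x := x * y) sa sc).trans
    (by rw [map_mul, sx, sy, inv_mul_cancel_left₀ hx])
  have s3 := (map_hfun (x := y) sa sc).trans (by rw [sy])
  have t1 := (map_hfun (x := x) ta tc).trans (by rw [tx])
  have t2 := (map_hfun (x := x * y) ta tc).trans
    (by rw [map_mul, tx, ty, mul_inv_cancel_right₀ hy])
  have t3 := (map_hfun (x := y) ta tc).trans (by rw [ty, hfun_inv hy hy2])
  have e := idA2 (one_sub_ne hx2) (one_sub_ne hy2) (one_sub_ne hxy) (hfun_eq (a := a) hx2)
    (hfun_eq hxy) (hfun_eq hy2)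
  have e' := idA2 (h2 := hfun a (a - 1) (x * y)) (one_sub_ne hy2) (one_sub_ne hx2) (by rw [mul_comm]; exact one_sub_ne hxy)
    (hfun_eq (a := a) hy2) (by rw [mul_comm y x]; exact hfun_eq hxy) (hfun_eq hx2)
  rw [symmetrizer_A2 s t hs ht s1 s2 s3 t1 t2 t3 sa ta e hτs hτt,
    symmetrizer_A2 t s ht hs t3 t2 t1 s3 s2 s1 ta sa e' hτt hτs]
  simp only [map_add, map_mul, hst]; ring

lemma demazure_B2 (hst : ∀ z, s (t (s (t z))) = t (s (t (s z)))) (sa : s a = a) (ta : t a = a)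
    (sb : s b = b) (tb : t b = b) (sc : s c = c) (tc : t c = c)
    (hx : x ≠ 0) (hy : y ≠ 0) (hx2 : 1 - x ^ 2 ≠ 0) (hy2 : 1 - y ^ 2 ≠ 0)
    (hxy : 1 - (x * y) ^ 2 ≠ 0) (hxxy : 1 - (x ^ 2 * y) ^ 2 ≠ 0)
    (sx : s x = x⁻¹) (sy : s y = x ^ 2 * y) (tx : t x = x * y) (ty : t y = y⁻¹)
    (hτs : ∀ f, τs f = hfun a c x * f + s (hfun a c x * f))
    (hτt : ∀ f, τt f = hfun b (b - 1) y * f + t (hfun b (b - 1) y * f)) (f : K) :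
    τs (τt (τs (τt f))) - (a + b) * τs (τt f) = τt (τs (τt (τs f))) - (a + b) * τt (τs f) := by
  have sd : s (b - 1) = b - 1 := by rw [map_sub, sb, map_one]
  have td : t (b - 1) = b - 1 := by rw [map_sub, tb, map_one]
  have s1 := (map_hfun (x := x) sa sc).trans (by rw [sx, hfun_inv hx hx2])
  have s2 := (map_hfun (x := x ^ 2 * y) sb sd).trans
    (by rw [map_mul, map_pow, sx, sy, inv_pow, inv_mul_cancel_left₀ (pow_ne_zero 2 hx)])
  have s3 := (map_hfun (x := x * y) sa sc).trans
    (by rw [map_mul, sx, sy, pow_two, mul_assoc, inv_mul_cancel_left₀ hx])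
  have s4 := (map_hfun (x := y) sb sd).trans (by rw [sy])
  have t1 := (map_hfun (x := x) ta tc).trans (by rw [tx])
  have t2 := (map_hfun (x := x ^ 2 * y) tb td).trans (by
    rw [map_mul, map_pow, tx, ty, mul_pow, pow_two y, ← mul_assoc, mul_inv_cancel_right₀ hy])
  have t3 := (map_hfun (x := x * y) ta tc).trans
    (by rw [map_mul, tx, ty, mul_inv_cancel_right₀ hy])
  have t4 := (map_hfun (x := y) tb td).trans (by rw [ty, hfun_inv hy hy2])
  obtain ⟨e1, e2, e3⟩ := idB2 (h1 := hfun a c x) (h3 := hfun a c (x * y)) (a := a) (b := b) (c := c) hx2 (one_sub_ne hy2)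
    (by rw [← mul_pow]; exact hxy) (one_sub_ne hxxy) rfl (hfun_eq hxxy)
    (by rw [hfun, mul_pow]) (hfun_eq hy2)
  rw [symmetrizer_B2 s t hs ht s1 s2 s3 s4 t1 t2 t3 t4 sa ta sb tb e1 e2 hτs hτt, add_comm a b,
    symmetrizer_B2 t s ht hs t4 t3 t2 t1 s4 s3 s2 s1 tb sb ta sa (by linear_combination e1)
      (by linear_combination e3) hτt hτs]
  simp only [map_add, map_mul, hst]; ring

lemma demazure_G2 (hst : ∀ z, s (t (s (t (s (t z))))) = t (s (t (s (t (s z)))))) (sa : s a = a)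
    (ta : t a = a) (sb : s b = b) (tb : t b = b)
    (hx : x ≠ 0) (hy : y ≠ 0) (hx2 : 1 - x ^ 2 ≠ 0) (hy2 : 1 - y ^ 2 ≠ 0)
    (hxy : 1 - (x * y) ^ 2 ≠ 0) (hx2y : 1 - (x ^ 2 * y) ^ 2 ≠ 0)
    (hx3y : 1 - (x ^ 3 * y) ^ 2 ≠ 0) (hx3y2 : 1 - (x ^ 3 * y ^ 2) ^ 2 ≠ 0)
    (sx : s x = x⁻¹) (sy : s y = x ^ 3 * y) (tx : t x = x * y) (ty : t y = y⁻¹)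
    (hτs : ∀ f, τs f = hfun a (a - 1) x * f + s (hfun a (a - 1) x * f))
    (hτt : ∀ f, τt f = hfun b (b - 1) y * f + t (hfun b (b - 1) y * f)) (f : K) :
    τs (τt (τs (τt (τs (τt f))))) - 2 * (a + b) * τs (τt (τs (τt f))) +
        (a ^ 2 + a * b + b ^ 2) * τs (τt f) =
      τt (τs (τt (τs (τt (τs f))))) - 2 * (a + b) * τt (τs (τt (τs f))) +
        (a ^ 2 + a * b + b ^ 2) * τt (τs f) := by
  have sc : s (a - 1) = a - 1 := by rw [map_sub, sa, map_one]
  have tc : t (a - 1) = a - 1 := by rw [map_sub, ta, map_one]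
  have sd : s (b - 1) = b - 1 := by rw [map_sub, sb, map_one]
  have td : t (b - 1) = b - 1 := by rw [map_sub, tb, map_one]
  have s1 := (map_hfun (x := x) sa sc).trans (by rw [sx, hfun_inv hx hx2])
  have s2 := (map_hfun (x := x ^ 3 * y) sb sd).trans (congrArg (hfun b (b - 1)) (a₂ := y)
    (by simp only [map_mul, map_pow, sx, sy, tx, ty]; field_simp))
  have s3 := (map_hfun (x := x ^ 2 * y) sa sc).trans (congrArg (hfun a (a - 1)) (a₂ := x * y)
    (by simp only [map_mul, map_pow, sx, sy, tx, ty]; field_simp))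
  have s4 := (map_hfun (x := x ^ 3 * y ^ 2) sb sd).trans
    (congrArg (hfun b (b - 1)) (a₂ := x ^ 3 * y ^ 2)
      (by simp only [map_mul, map_pow, sx, sy, tx, ty]; field_simp))
  have s5 := (map_hfun (x := x * y) sa sc).trans (congrArg (hfun a (a - 1)) (a₂ := x ^ 2 * y)
    (by simp only [map_mul, map_pow, sx, sy, tx, ty]; field_simp))
  have s6 := (map_hfun (x := y) sb sd).trans (by rw [sy])
  have t1 := (map_hfun (x := x) ta tc).trans (by rw [tx])
  have t2 := (map_hfun (x := x ^ 3 * y) tb td).trans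
    (congrArg (hfun b (b - 1)) (a₂ := x ^ 3 * y ^ 2)
      (by simp only [map_mul, map_pow, sx, sy, tx, ty]; field_simp))
  have t3 := (map_hfun (x := x ^ 2 * y) ta tc).trans (congrArg (hfun a (a - 1)) (a₂ := x ^ 2 * y)
    (by simp only [map_mul, map_pow, sx, sy, tx, ty]; field_simp))
  have t4 := (map_hfun (x := x ^ 3 * y ^ 2) tb td).trans
    (congrArg (hfun b (b - 1)) (a₂ := x ^ 3 * y)
      (by simp only [map_mul, map_pow, sx, sy, tx, ty]; field_simp))
  have t5 := (map_hfun (x := x * y) ta tc).trans (congrArg (hfun a (a - 1)) (a₂ := x)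
    (by simp only [map_mul, map_pow, sx, sy, tx, ty]; field_simp))
  have t6 := (map_hfun (x := y) tb td).trans (by rw [ty, hfun_inv hy hy2])
  obtain ⟨e, e'⟩ := g2Identities (a := a) (b := b) (one_sub_ne hx2) (one_sub_ne hy2)
    (one_sub_ne hx3y) (one_sub_ne hx2y) (one_sub_ne hx3y2) (one_sub_ne hxy) (hfun_eq hx2)
    (hfun_eq hx3y) (hfun_eq hx2y) (hfun_eq hx3y2) (hfun_eq hxy) (hfun_eq hy2)
  have h1 := symmetrizer_G2 s t hs ht s1 s2 s3 s4 s5 s6 t1 t2 t3 t4 t5 t6 sa ta sb tb e hτs hτt f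
  have h2 := symmetrizer_G2 t s ht hs t6 t5 t4 t3 t2 t1 s6 s5 s4 s3 s2 s1 tb sb ta sa e' hτt hτs f
  simp only [map_add, map_mul, hst] at h1 h2
  linear_combination h1 - h2

end

section Deform

open BernsteinDatum

variable {A : Type*} [Ring A] [Algebra ℂ A] {σ τ : A} {a b : ℂ}

lemma sub_one_comm (h : σ * τ = τ * σ) : (σ - 1) * (τ - 1) = (τ - 1) * (σ - 1) := by
  simp only [sub_mul, mul_sub, one_mul, mul_one, h]; abel

/-- The deformed braid relation of `σ` and `τ` amounts to the braid relation of `σ - 1` and `τ - 1`.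
The lemmas `sub_one_braid4` and `sub_one_braid6` are the analogues for braids of these lengths. -/
lemma sub_one_braid3 (hσ : σ * σ = (1 + a) • σ) (hτ : τ * τ = (1 + a) • τ)
    (h : σ * (τ * σ) - a • σ = τ * (σ * τ) - a • τ) :
    (σ - 1) * ((τ - 1) * (σ - 1)) = (τ - 1) * ((σ - 1) * (τ - 1)) := by
  simp only [sub_mul, mul_sub, one_mul, mul_one, hσ, hτ]
  linear_combination (norm := module) h

lemma sub_one_braid4 (hσ : σ * σ = (1 + a) • σ) (hτ : τ * τ = (1 + b) • τ)
    (h : σ * (τ * (σ * τ)) - (a + b) • (σ * τ) = τ * (σ * (τ * σ)) - (a + b) • (τ * σ)) :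
    (σ - 1) * ((τ - 1) * ((σ - 1) * (τ - 1))) = (τ - 1) * ((σ - 1) * ((τ - 1) * (σ - 1))) := by
  have hσ' : ∀ z, σ * (σ * z) = (1 + a) • (σ * z) := fun z => by
    rw [← mul_assoc, hσ, smul_mul_assoc]
  have hτ' : ∀ z, τ * (τ * z) = (1 + b) • (τ * z) := fun z => by
    rw [← mul_assoc, hτ, smul_mul_assoc]
  simp only [sub_mul, mul_sub, one_mul, mul_one, mul_smul_comm, hσ, hτ, hσ', hτ']
  linear_combination (norm := module) h

lemma sub_one_braid6 (hσ : σ * σ = (1 + a) • σ) (hτ : τ * τ = (1 + b) • τ)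
    (h : σ * (τ * (σ * (τ * (σ * τ)))) - (2 * (a + b)) • (σ * (τ * (σ * τ))) +
        (a ^ 2 + a * b + b ^ 2) • (σ * τ) =
      τ * (σ * (τ * (σ * (τ * σ)))) - (2 * (a + b)) • (τ * (σ * (τ * σ))) +
        (a ^ 2 + a * b + b ^ 2) • (τ * σ)) :
    (σ - 1) * ((τ - 1) * ((σ - 1) * ((τ - 1) * ((σ - 1) * (τ - 1))))) =
      (τ - 1) * ((σ - 1) * ((τ - 1) * ((σ - 1) * ((τ - 1) * (σ - 1))))) := by
  have hσ' : ∀ z, σ * (σ * z) = (1 + a) • (σ * z) := fun z => by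
    rw [← mul_assoc, hσ, smul_mul_assoc]
  have hτ' : ∀ z, τ * (τ * z) = (1 + b) • (τ * z) := fun z => by
    rw [← mul_assoc, hτ, smul_mul_assoc]
  simp only [sub_mul, mul_sub, one_mul, mul_one, mul_smul_comm, smul_sub, smul_smul, hσ, hτ,
    hσ', hτ']
  linear_combination (norm := module) h

lemma altProd_smul (c d : ℂ) (x y : A) (n : ℕ) :
    altProd (c • x) (d • y) n = altProd c d n • altProd x y n := by
  induction n generalizing c d x y with
  | zero => simp
  | succ n ih => rw [altProd_succ, ih, altProd_succ, altProd_succ, smul_mul_smul_comm]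

end Deform

end AffineHecke
end

noncomputable section
namespace AffineHecke
open scoped TensorProduct Pointwise

/-! ### The action on rational functions -/

open BernsteinDatum RootPairing
namespace ExtendedDatum
variable {ι X Y Γ : Type*} [AddCommGroup X] [AddCommGroup Y] [Group Γ]
variable (S : ExtendedDatum ι X Y Γ)

include S in
lemma isAddTorsionFree : IsAddTorsionFree X := by
  have : Module.IsReflexive ℤ X := .of_isPerfPair S.R.toLinearMap
  have : Module.IsTorsionFree ℤ X := inferInstance
  exact Module.isTorsionFree_int_iff_isAddTorsionFree.1 this

include S in
lemma isDomain [Module.Finite ℤ X] : IsDomain (AddMonoidAlgebra ℂ X) := by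
  have := S.isAddTorsionFree
  have : AddMonoid.FG X :=
    AddGroup.fg_iff_addMonoid_fg.1 (Module.Finite.iff_addGroup_fg.1 inferInstance)
  exact NoZeroDivisors.to_isDomain _

/-- The field `ℂ(X)` of rational functions on the torus `T`, as the field of fractions of `ℂ[X]`. -/
abbrev KX (X : Type*) [AddCommGroup X] : Type _ := FractionRing (AddMonoidAlgebra ℂ X)

variable [IsDomain (AddMonoidAlgebra ℂ X)]

lemma actA_injective (g : S.R.Aut) : Function.Injective (S.actA g) := fun f f' h => by
  have := congrArg (S.actA g⁻¹) h
  rwa [← actA_mul, ← actA_mul, inv_mul_cancel, actA_one, actA_one] at this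

/-- The action of the automorphisms of the root datum on `ℂ(X)`. -/
def actK (g : S.R.Aut) : KX X →+* KX X :=
  IsFractionRing.lift (A := AddMonoidAlgebra ℂ X) (K := KX X)
    (g := (algebraMap (AddMonoidAlgebra ℂ X) (KX X)).comp (S.actA g : _ →+* _))
    ((IsFractionRing.injective (AddMonoidAlgebra ℂ X) (KX X)).comp (S.actA_injective g))

/-- The inclusion of `ℂ[X]` in `ℂ(X)`. -/
abbrev toK (f : AddMonoidAlgebra ℂ X) : KX X := algebraMap (AddMonoidAlgebra ℂ X) (KX X) f

lemma toK_injective : Function.Injective (toK : AddMonoidAlgebra ℂ X → KX X) :=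
  IsFractionRing.injective (AddMonoidAlgebra ℂ X) (KX X)

@[simp] lemma actK_toK (g : S.R.Aut) (f : AddMonoidAlgebra ℂ X) :
    S.actK g (toK f) = toK (S.actA g f) := IsFractionRing.lift_algebraMap _ f

lemma hom_toK_ext {f g : KX X →+* KX X} (h : ∀ a, f (toK a) = g (toK a)) : f = g :=
  IsLocalization.ringHom_ext (nonZeroDivisors (AddMonoidAlgebra ℂ X)) (RingHom.ext h)

lemma actK_mul (g h : S.R.Aut) (z : KX X) : S.actK (g * h) z = S.actK g (S.actK h z) := by
  suffices H : S.actK (g * h) = (S.actK g).comp (S.actK h) from DFunLike.congr_fun H z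
  exact hom_toK_ext fun a => by simp only [RingHom.comp_apply, actK_toK, actA_mul]

@[simp] lemma actK_one (z : KX X) : S.actK 1 z = z := by
  suffices H : S.actK 1 = RingHom.id _ from DFunLike.congr_fun H z
  exact hom_toK_ext fun a => by simp

lemma actK_algebraMap (g : S.R.Aut) (c : ℂ) : S.actK g (algebraMap ℂ _ c) = algebraMap ℂ _ c := by
  rw [IsScalarTower.algebraMap_apply ℂ (AddMonoidAlgebra ℂ X) (KX X)]
  exact (S.actK_toK g _).trans (by rw [AlgHom.commutes])

lemma actK_smul (g : S.R.Aut) (c : ℂ) (z : KX X) : S.actK g (c • z) = c • S.actK g z := by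
  rw [Algebra.smul_def, Algebra.smul_def, map_mul, actK_algebraMap]

lemma mono_injective : Function.Injective (mono : X → AddMonoidAlgebra ℂ X) := fun _ _ h =>
  AddMonoidAlgebra.of_injective h

lemma actK_injective : Function.Injective S.actK := fun g h H => by
  apply Equiv.weightHom_injective S.R
  ext x
  have := DFunLike.congr_fun H (toK (mono x))
  rw [actK_toK, actK_toK, actA_mono, actA_mono] at this
  exact mono_injective (toK_injective this)

/-- The function `h_α ∈ ℂ(X)` for the root `α = root i`; see `hfun`. -/
def hK (i : ι) : KX X :=
  hfun (algebraMap ℂ _ ((S.q i : ℂ) ^ 2))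
    (algebraMap ℂ _ ((S.q i : ℂ) * ((S.qStar i : ℂ) - ((S.qStar i)⁻¹ : ℂˣ))))
    (toK (mono (-S.R.root i)))

lemma toK_mono_mul (x y : X) : toK (mono x) * toK (mono y) = toK (mono (x + y)) := by
  rw [toK, toK, ← map_mul, mono_mul]

lemma toK_mono_zero : toK (mono (0 : X)) = 1 := map_one _

lemma toK_mono_pow (x : X) (n : ℕ) : toK (mono x) ^ n = toK (mono (n • x)) := by
  induction n with
  | zero => rw [pow_zero, zero_smul, toK_mono_zero]
  | succ n ih => rw [pow_succ, ih, toK_mono_mul, succ_nsmul]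

lemma toK_mono_ne (x : X) : toK (mono x) ≠ 0 := fun h => by
  have := toK_mono_mul x (-x)
  rw [h, zero_mul, add_neg_cancel, toK_mono_zero] at this
  exact zero_ne_one this

lemma toK_mono_neg (x : X) : toK (mono (-x)) = (toK (mono x))⁻¹ := by
  refine eq_inv_of_mul_eq_one_left ?_
  rw [toK_mono_mul, neg_add_cancel, toK_mono_zero]

include S in
lemma one_sub_toK_sq {x : X} (hx : x ≠ 0) : 1 - toK (mono x) ^ 2 ≠ 0 := by
  rw [toK_mono_pow, ← toK_mono_zero, sub_ne_zero]
  intro h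
  have := S.isAddTorsionFree
  have h2 := mono_injective (toK_injective h)
  exact hx ((nsmul_eq_zero_iff_right two_ne_zero).1 h2.symm)

lemma actK_mono (g : S.R.Aut) (x : X) : S.actK g (toK (mono x)) = toK (mono (g • x)) := by
  rw [actK_toK, actA_mono]

lemma actK_srefl_root (i : ι) : S.actK (srefl S.R i) (toK (mono (-S.R.root i))) =
    (toK (mono (-S.R.root i)))⁻¹ := by
  rw [actK_mono, ← toK_mono_neg, neg_neg, smul_neg, ← root_smul, srefl_smul_index, root_neg_index,
    neg_neg]

variable [Finite ι]

lemma actK_hK (i : ι) : S.actK (srefl S.R i) (S.hK i) =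
    1 + algebraMap ℂ _ ((S.q i : ℂ) ^ 2) - S.hK i := by
  rw [hK, map_hfun (S.actK_algebraMap _ _) (S.actK_algebraMap _ _), actK_srefl_root,
    hfun_inv (toK_mono_ne _) (S.one_sub_toK_sq (neg_ne_zero.2 (S.R.ne_zero i)))]

/-- The operator `τ_α = (1 + s_α) h_α` on `ℂ(X)`. -/
def tauK (i : ι) : Module.End ℂ (KX X) where
  toFun f := S.hK i * f + S.actK (srefl S.R i) (S.hK i * f)
  map_add' f g := by rw [mul_add, map_add]; ring
  map_smul' c f := by
    rw [mul_smul_comm, actK_smul, RingHom.id_apply, smul_add]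

lemma tauK_apply (i : ι) (f : KX X) :
    S.tauK i f = S.hK i * f + S.actK (srefl S.R i) (S.hK i * f) := rfl

lemma actK_actK_srefl (i : ι) (f : KX X) :
    S.actK (srefl S.R i) (S.actK (srefl S.R i) f) = f := by
  rw [← actK_mul, srefl_mul_self, actK_one]

lemma tauK_sq (i : ι) : S.tauK i * S.tauK i = (1 + (S.q i : ℂ) ^ 2) • S.tauK i := by
  ext f
  rw [Module.End.mul_apply, LinearMap.smul_apply, Algebra.smul_def, map_add, map_one,
    tauK_apply, tauK_apply]
  simp only [map_add, map_sub, map_mul, map_one, actK_actK_srefl, actK_hK, actK_algebraMap]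
  ring

/-- The Demazure–Lusztig operator `q(s_α)^{-1/2} (τ_α - 1)`, by which `N_{s_α}` acts on `ℂ(X)`. -/
def demK (i : ι) : Module.End ℂ (KX X) := ((S.q i)⁻¹ : ℂˣ) • (S.tauK i - 1)

lemma demK_quadratic (i : ι) : (S.demK i - algebraMap ℂ _ (S.q i : ℂ)) *
    (S.demK i + algebraMap ℂ _ (((S.q i)⁻¹ : ℂˣ) : ℂ)) = 0 := by
  have h1 : S.demK i - algebraMap ℂ _ (S.q i : ℂ) =
      (((S.q i)⁻¹ : ℂˣ) : ℂ) • (S.tauK i - (1 + (S.q i : ℂ) ^ 2) • 1) := by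
    rw [demK, Algebra.algebraMap_eq_smul_one, Units.smul_def]
    have : (((S.q i)⁻¹ : ℂˣ) : ℂ) * (1 + (S.q i : ℂ) ^ 2) = ((S.q i)⁻¹ : ℂˣ) + S.q i := by
      field_simp
      rw [mul_add, mul_one, pow_two, ← mul_assoc, Units.inv_mul, one_mul]
    rw [smul_sub, smul_sub, smul_smul, this, add_smul]
    abel
  have h2 : S.demK i + algebraMap ℂ _ (((S.q i)⁻¹ : ℂˣ) : ℂ) =
      (((S.q i)⁻¹ : ℂˣ) : ℂ) • S.tauK i := by
    rw [demK, Algebra.algebraMap_eq_smul_one, Units.smul_def, smul_sub]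
    abel
  rw [h1, h2, smul_mul_smul_comm, sub_mul, tauK_sq, smul_one_mul, sub_self, smul_zero]

variable {S} in
lemma srefl_eq_iff {g h : S.R.Aut} : g = h ↔ ∀ x : X, g • x = h • x :=
  ⟨fun H x => by rw [H], fun H => Equiv.weightHom_injective S.R (LinearEquiv.ext H)⟩

lemma smul_root (i j : ι) : srefl S.R i • S.R.root j =
    S.R.root j - S.R.pairing j i • S.R.root i := by
  rw [srefl_smul, root_coroot'_eq_pairing]

lemma altProd_smul_comm {A : Type*} [Ring A] [Algebra ℂ A] {c d : ℂ} {x y : A} {n : ℕ}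
    (h : altProd c d n = altProd d c n) (h' : altProd x y n = altProd y x n) :
    altProd (c • x) (d • y) n = altProd (d • y) (c • x) n := by
  rw [altProd_smul, altProd_smul, h, h']

section Rank2

variable {S} {i j : ι}

lemma mul_pow_eq_one_iff (n : ℕ) : (srefl S.R i * srefl S.R j) ^ n = 1 ↔
    altProd (srefl S.R i) (srefl S.R j) n = altProd (srefl S.R j) (srefl S.R i) n :=
  (altProd_eq_iff (srefl_mul_self i) (srefl_mul_self j) n).symm

lemma not_srefl_eq (h1 : S.R.pairing i j * S.R.pairing j i < 4) :
    srefl S.R i * srefl S.R j ≠ 1 := by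
  intro h
  rw [← pow_one (srefl S.R i * srefl S.R j), mul_pow_eq_one_iff, srefl_eq_iff] at h
  have := congrArg (S.R.coroot' i) (h (S.R.root i))
  simp only [altProd_succ, altProd_zero, mul_one, smul_root, map_sub, map_smul, smul_eq_mul,
    root_coroot'_eq_pairing, pairing_same] at this
  omega

lemma orderOf_A1 (h1 : S.R.pairing i j = 0) (h2 : S.R.pairing j i = 0) :
    orderOf (srefl S.R i * srefl S.R j) = 2 := by
  refine orderOf_eq_prime ?_ (not_srefl_eq (by rw [h1, h2]; norm_num))
  rw [mul_pow_eq_one_iff, srefl_eq_iff]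
  intro x
  simp only [altProd_succ, altProd_zero, mul_one, mul_smul, srefl_smul, map_sub, map_smul,
    smul_eq_mul, root_coroot'_eq_pairing, pairing_same, h1, h2]
  module

lemma orderOf_A2 (h1 : S.R.pairing i j = -1) (h2 : S.R.pairing j i = -1) :
    orderOf (srefl S.R i * srefl S.R j) = 3 := by
  refine orderOf_eq_prime ?_ (not_srefl_eq (by rw [h1, h2]; norm_num))
  rw [mul_pow_eq_one_iff, srefl_eq_iff]
  intro x
  simp only [altProd_succ, altProd_zero, mul_one, mul_smul, srefl_smul, map_sub, map_smul,
    smul_eq_mul, root_coroot'_eq_pairing, pairing_same, h1, h2]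
  module

lemma orderOf_B2 (h1 : S.R.pairing i j = -1) (h2 : S.R.pairing j i = -2) :
    orderOf (srefl S.R i * srefl S.R j) = 4 := by
  refine orderOf_eq_prime_pow (p := 2) (n := 1) ?_ ?_
  · rw [mul_pow_eq_one_iff, srefl_eq_iff]
    intro h
    have := congrArg (S.R.coroot' j) (h (S.R.root i))
    simp only [altProd_succ, altProd_zero, mul_one, mul_smul, srefl_smul, map_sub, map_smul,
      smul_eq_mul, root_coroot'_eq_pairing, pairing_same, h1, h2, pow_one] at this
    omega
  · rw [mul_pow_eq_one_iff, srefl_eq_iff]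
    intro x
    norm_num only
    simp only [altProd_succ, altProd_zero, mul_one, mul_smul, srefl_smul, map_sub, map_smul,
      smul_eq_mul, root_coroot'_eq_pairing, pairing_same, h1, h2]
    module

lemma orderOf_G2 (h1 : S.R.pairing i j = -1) (h2 : S.R.pairing j i = -3) :
    orderOf (srefl S.R i * srefl S.R j) = 6 := by
  refine orderOf_eq_of_pow_and_pow_div_prime (by norm_num) ?_ ?_
  · rw [mul_pow_eq_one_iff, srefl_eq_iff]
    intro x
    simp only [altProd_succ, altProd_zero, mul_one, mul_smul, srefl_smul, map_sub, map_smul,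
      smul_eq_mul, root_coroot'_eq_pairing, pairing_same, h1, h2]
    module
  · have key : ∀ n ∈ ({2, 3} : Finset ℕ), (srefl S.R i * srefl S.R j) ^ n ≠ 1 := by
      intro n hn
      rw [Ne, mul_pow_eq_one_iff, srefl_eq_iff]
      intro h
      have hi := congrArg (S.R.coroot' i) (h (S.R.root i))
      have hj := congrArg (S.R.coroot' j) (h (S.R.root i))
      simp only [Finset.mem_insert, Finset.mem_singleton] at hn
      rcases hn with rfl | rfl <;>
      simp only [altProd_succ, altProd_zero, mul_one, mul_smul, srefl_smul, map_sub, map_smul,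
        smul_eq_mul, root_coroot'_eq_pairing, pairing_same, h1, h2] at hi hj <;> omega
    intro p hp hd
    have h2 : p ∣ 2 * 3 := hd
    rw [hp.dvd_mul, Nat.prime_dvd_prime_iff_eq hp Nat.prime_two,
      Nat.prime_dvd_prime_iff_eq hp Nat.prime_three] at h2
    rcases h2 with rfl | rfl
    · exact key 3 (by simp)
    · exact key 2 (by simp)

lemma actK_altProd (n : ℕ)
    (h : orderOf (srefl S.R i * srefl S.R j) = n) (z : KX X) :
    S.actK (altProd (srefl S.R i) (srefl S.R j) n) z =
      S.actK (altProd (srefl S.R j) (srefl S.R i) n) z := by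
  rw [(mul_pow_eq_one_iff n).1 (h ▸ pow_orderOf_eq_one _)]

/-- A coroot that takes an odd value is not in `2Y`, so the two parameters are equal. -/
lemma qStar_eq_of_odd {x : X} (h : Odd (S.R.coroot' i x)) : S.qStar i = S.q i := by
  refine S.qStar_eq_q i ?_
  rintro ⟨y, hy⟩
  have : S.R.coroot' i x = 2 * S.R.toLinearMap x y := by
    change S.R.toLinearMap x (S.R.coroot i) = _
    rw [hy, map_smul, smul_eq_mul]
  rw [this] at h
  exact (Int.not_odd_iff_even.2 (even_two_mul _)) h

lemma hK_eq (h : S.qStar i = S.q i) :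
    S.hK i = hfun (algebraMap ℂ _ ((S.q i : ℂ) ^ 2)) (algebraMap ℂ _ ((S.q i : ℂ) ^ 2) - 1)
      (toK (mono (-S.R.root i))) := by
  rw [hK, h]
  congr 1
  rw [← map_one (algebraMap ℂ (KX X)), ← map_sub, mul_sub, Units.mul_inv, pow_two]

lemma actK_srefl_mono_neg_root (n : ℕ) (h : S.R.pairing j i = -n) :
    S.actK (srefl S.R i) (toK (mono (-S.R.root j))) =
      toK (mono (-S.R.root i)) ^ n * toK (mono (-S.R.root j)) := by
  rw [actK_mono, toK_mono_pow, toK_mono_mul, smul_neg, smul_root, h]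
  congr 2
  module

lemma mono_combination_ne [S.R.IsReduced] (hli : LinearIndependent ℤ ![S.R.root i, S.R.root j])
    (a b : ℕ) (hab : a ≠ 0 ∨ b ≠ 0) :
    1 - (toK (mono (-S.R.root i)) ^ a * toK (mono (-S.R.root j)) ^ b) ^ 2 ≠ 0 := by
  rw [toK_mono_pow, toK_mono_pow, toK_mono_mul]
  refine S.one_sub_toK_sq fun h => ?_
  have := LinearIndependent.pair_iff.1 hli a b (by
    rw [← neg_eq_zero, ← h]; module)
  omega

lemma actK_altProd_apply (n : ℕ) (z : KX X) :
    S.actK (altProd (srefl S.R i) (srefl S.R j) (n + 1)) z =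
      S.actK (srefl S.R i) (S.actK (altProd (srefl S.R j) (srefl S.R i) n) z) := by
  rw [altProd_succ, actK_mul]

/-- The braid relations for the Demazure–Lusztig operators of two simple roots, with the first root
not longer than the second one. -/
lemma braid_demK_of_le (hi : i ∈ S.simple) (hj : j ∈ S.simple) (hij : i ≠ j)
    (h : (S.R.pairing i j, S.R.pairing j i) ∈
      ({(0, 0), (-1, -1), (-1, -2), (-1, -3)} : Set (ℤ × ℤ))) :
    altProd (S.demK i) (S.demK j) (orderOf (srefl S.R i * srefl S.R j)) =
      altProd (S.demK j) (S.demK i) (orderOf (srefl S.R i * srefl S.R j)) := by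
  have hli : LinearIndependent ℤ ![S.R.root i, S.R.root j] :=
    S.base.linearIndependent_pair_of_ne (i := ⟨i, hi⟩) (j := ⟨j, hj⟩)
      (fun h => hij (congrArg Subtype.val h))
  have hne := mono_combination_ne hli
  have hx0 := toK_mono_ne (-S.R.root i)
  have hy0 := toK_mono_ne (-S.R.root j)
  have hxx := S.one_sub_toK_sq (neg_ne_zero.2 (S.R.ne_zero i))
  have hyy := S.one_sub_toK_sq (neg_ne_zero.2 (S.R.ne_zero j))
  have hsi := S.actK_algebraMap (srefl S.R i)
  have hsj := S.actK_algebraMap (srefl S.R j)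
  have hσ := S.tauK_sq i
  have hτ := S.tauK_sq j
  simp only [Set.mem_insert_iff, Set.mem_singleton_iff, Prod.mk.injEq] at h
  rcases h with ⟨h1, h2⟩ | ⟨h1, h2⟩ | ⟨h1, h2⟩ | ⟨h1, h2⟩
  · have ho := orderOf_A1 h1 h2
    have hst : ∀ z, S.actK (srefl S.R i) (S.actK (srefl S.R j) z) =
        S.actK (srefl S.R j) (S.actK (srefl S.R i) z) := fun z => by
      have := actK_altProd 2 ho z
      simpa only [actK_altProd_apply, altProd_zero, actK_one] using this
    have h3 : S.actK (srefl S.R j) (S.hK i) = S.hK i := by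
      rw [hK, map_hfun (hsj _) (hsj _), actK_srefl_mono_neg_root 0 (by simpa using h1)]
      rw [pow_zero, one_mul]
    have h4 : S.actK (srefl S.R i) (S.hK j) = S.hK j := by
      rw [hK, map_hfun (hsi _) (hsi _), actK_srefl_mono_neg_root 0 (by simpa using h2)]
      rw [pow_zero, one_mul]
    have hD : S.tauK i * S.tauK j = S.tauK j * S.tauK i := LinearMap.ext fun f =>
      demazure_A1 hst h3 h4 (S.tauK_apply i) (S.tauK_apply j) f
    rw [ho]
    refine altProd_smul_comm (by simp only [altProd_succ, altProd_zero]; ring) ?_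
    simp only [altProd_succ, altProd_zero, mul_one]
    exact sub_one_comm hD
  · have ho := orderOf_A2 h1 h2
    have hst : ∀ z, S.actK (srefl S.R i) (S.actK (srefl S.R j) (S.actK (srefl S.R i) z)) =
        S.actK (srefl S.R j) (S.actK (srefl S.R i) (S.actK (srefl S.R j) z)) := fun z => by
      have := actK_altProd 3 ho z
      simpa only [actK_altProd_apply, altProd_zero, actK_one] using this
    -- In type `A₂` the roots `α_i` and `α_j` are conjugate: `s_i α_j = s_j α_i`.
    have hqq : S.q i = S.q j := by
      rw [← S.q_invariant i j, ← S.q_invariant j i]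
      congr 1
      apply S.R.root.injective
      rw [root_reflectionPerm, root_reflectionPerm, reflection_apply_root, reflection_apply_root,
        h1, h2]
      module
    have hKi := hK_eq (qStar_eq_of_odd (S := S) (i := i) (x := S.R.root j)
      (by rw [root_coroot'_eq_pairing, h2]; decide))
    have hKj := hK_eq (qStar_eq_of_odd (S := S) (i := j) (x := S.R.root i)
      (by rw [root_coroot'_eq_pairing, h1]; decide))
    rw [← hqq] at hKj hτ
    have hD : S.tauK i * (S.tauK j * S.tauK i) - ((S.q i : ℂ) ^ 2) • S.tauK i =
        S.tauK j * (S.tauK i * S.tauK j) - ((S.q i : ℂ) ^ 2) • S.tauK j := by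
      ext f
      have := demazure_A2 (τs := S.tauK i) (τt := S.tauK j) (S.actK_actK_srefl i) (S.actK_actK_srefl j) hst (hsi _) (hsj _) hx0 hy0
        hxx hyy (by simpa using hne 1 1) (S.actK_srefl_root i)
        (by simpa using actK_srefl_mono_neg_root 1 h2)
        (by rw [mul_comm]; simpa using actK_srefl_mono_neg_root 1 h1) (S.actK_srefl_root j)
        (fun f => by rw [← hKi, tauK_apply])
        (fun f => by rw [← hKj, tauK_apply]) f
      simp only [LinearMap.sub_apply, Module.End.mul_apply, LinearMap.smul_apply]
      simpa only [Algebra.smul_def] using this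
    rw [ho]
    refine altProd_smul_comm (by rw [hqq]) ?_
    simp only [altProd_succ, altProd_zero, mul_one]
    exact sub_one_braid3 hσ hτ hD
  · have ho := orderOf_B2 h1 h2
    have hst : ∀ z, S.actK (srefl S.R i) (S.actK (srefl S.R j) (S.actK (srefl S.R i)
        (S.actK (srefl S.R j) z))) = S.actK (srefl S.R j) (S.actK (srefl S.R i)
        (S.actK (srefl S.R j) (S.actK (srefl S.R i) z))) := fun z => by
      have := actK_altProd 4 ho z
      simpa only [actK_altProd_apply, altProd_zero, actK_one] using this
    have hKj := hK_eq (qStar_eq_of_odd (S := S) (i := j) (x := S.R.root i)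
      (by rw [root_coroot'_eq_pairing, h1]; decide))
    have hD : S.tauK i * (S.tauK j * (S.tauK i * S.tauK j)) -
          ((S.q i : ℂ) ^ 2 + (S.q j : ℂ) ^ 2) • (S.tauK i * S.tauK j) =
        S.tauK j * (S.tauK i * (S.tauK j * S.tauK i)) -
          ((S.q i : ℂ) ^ 2 + (S.q j : ℂ) ^ 2) • (S.tauK j * S.tauK i) := by
      ext f
      have := demazure_B2 (τs := S.tauK i) (τt := S.tauK j) (S.actK_actK_srefl i) (S.actK_actK_srefl j) hst (hsi _) (hsj _)
        (hsi _) (hsj _) (hsi _) (hsj _) hx0 hy0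
        hxx hyy (by simpa using hne 1 1) (by simpa using hne 2 1) (S.actK_srefl_root i)
        (actK_srefl_mono_neg_root 2 h2)
        (by rw [mul_comm]; simpa using actK_srefl_mono_neg_root 1 h1) (S.actK_srefl_root j)
        (S.tauK_apply i)
        (fun f => by rw [← hKj, tauK_apply]) f
      simp only [LinearMap.sub_apply, Module.End.mul_apply, LinearMap.smul_apply]
      simpa only [Algebra.smul_def, map_add] using this
    rw [ho]
    refine altProd_smul_comm (by simp only [altProd_succ, altProd_zero]; ring) ?_
    simp only [altProd_succ, altProd_zero, mul_one]
    exact sub_one_braid4 hσ hτ hD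
  · have ho := orderOf_G2 h1 h2
    have hst : ∀ z, S.actK (srefl S.R i) (S.actK (srefl S.R j) (S.actK (srefl S.R i)
        (S.actK (srefl S.R j) (S.actK (srefl S.R i) (S.actK (srefl S.R j) z))))) =
        S.actK (srefl S.R j) (S.actK (srefl S.R i) (S.actK (srefl S.R j) (S.actK (srefl S.R i)
        (S.actK (srefl S.R j) (S.actK (srefl S.R i) z))))) := fun z => by
      have := actK_altProd 6 ho z
      simpa only [actK_altProd_apply, altProd_zero, actK_one] using this
    have hKi := hK_eq (qStar_eq_of_odd (S := S) (i := i) (x := S.R.root j)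
      (by rw [root_coroot'_eq_pairing, h2]; decide))
    have hKj := hK_eq (qStar_eq_of_odd (S := S) (i := j) (x := S.R.root i)
      (by rw [root_coroot'_eq_pairing, h1]; decide))
    obtain ⟨a, ha⟩ : ∃ a, a = (S.q i : ℂ) ^ 2 := ⟨_, rfl⟩
    obtain ⟨b, hb⟩ : ∃ b, b = (S.q j : ℂ) ^ 2 := ⟨_, rfl⟩
    rw [← ha] at hKi hσ
    rw [← hb] at hKj hτ
    have hD : S.tauK i * (S.tauK j * (S.tauK i * (S.tauK j * (S.tauK i * S.tauK j)))) -
          (2 * (a + b)) • (S.tauK i * (S.tauK j * (S.tauK i * S.tauK j))) +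
          (a ^ 2 + a * b + b ^ 2) • (S.tauK i * S.tauK j) =
        S.tauK j * (S.tauK i * (S.tauK j * (S.tauK i * (S.tauK j * S.tauK i)))) -
          (2 * (a + b)) • (S.tauK j * (S.tauK i * (S.tauK j * S.tauK i))) +
          (a ^ 2 + a * b + b ^ 2) • (S.tauK j * S.tauK i) := by
      ext f
      have := demazure_G2 (τs := S.tauK i) (τt := S.tauK j) (S.actK_actK_srefl i) (S.actK_actK_srefl j) hst (hsi _) (hsj _)
        (hsi _) (hsj _) hx0 hy0
        hxx hyy (by simpa using hne 1 1) (by simpa using hne 2 1) (by simpa using hne 3 1)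
        (by simpa using hne 3 2) (S.actK_srefl_root i)
        (actK_srefl_mono_neg_root 3 h2)
        (by rw [mul_comm]; simpa using actK_srefl_mono_neg_root 1 h1) (S.actK_srefl_root j)
        (fun f => by rw [← hKi, tauK_apply])
        (fun f => by rw [← hKj, tauK_apply]) f
      simp only [LinearMap.sub_apply, LinearMap.add_apply, Module.End.mul_apply,
        LinearMap.smul_apply]
      simpa only [Algebra.smul_def, map_add, map_mul, map_pow, map_ofNat] using this
    rw [ho]
    refine altProd_smul_comm (by simp only [altProd_succ, altProd_zero]; ring) ?_
    simp only [altProd_succ, altProd_zero, mul_one]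
    exact sub_one_braid6 hσ hτ hD

lemma braid_demK (hi : i ∈ S.simple) (hj : j ∈ S.simple) :
    altProd (S.demK i) (S.demK j) (orderOf (srefl S.R i * srefl S.R j)) =
      altProd (S.demK j) (S.demK i) (orderOf (srefl S.R i * srefl S.R j)) := by
  rcases eq_or_ne i j with rfl | hij
  · rfl
  have h1 : ∀ i j, S.R.pairingIn ℤ i j = S.R.pairing i j := fun i j =>
    S.R.algebraMap_pairingIn ℤ i j
  -- Two distinct simple roots of a reduced root system span `A₁ × A₁`, `A₂`, `B₂` or `G₂`.
  have h2 := S.R.pairingIn_pairingIn_mem_set_of_isCrystal_of_isRed i j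
  have h3 := S.base.pairingIn_le_zero_of_ne hij hi hj
  have h4 := S.base.pairingIn_le_zero_of_ne hij.symm hj hi
  rw [h1] at h3 h4
  have h5 : S.R.pairing i j ≠ -2 ∨ S.R.pairing j i ≠ -2 := by
    by_contra! h
    have := Module.isTorsionFree_int_iff_isAddTorsionFree.2 S.isAddTorsionFree
    exact S.base.root_ne_neg_of_ne hi hj hij ((S.R.pairing_neg_two_neg_two_iff i j).1 h)
  simp only [h1, Set.mem_insert_iff, Set.mem_singleton_iff, Prod.mk.injEq] at h2
  by_cases h : (S.R.pairing i j, S.R.pairing j i) ∈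
      ({(0, 0), (-1, -1), (-1, -2), (-1, -3)} : Set (ℤ × ℤ))
  · exact braid_demK_of_le hi hj hij h
  · have h' : (S.R.pairing j i, S.R.pairing i j) ∈
        ({(0, 0), (-1, -1), (-1, -2), (-1, -3)} : Set (ℤ × ℤ)) := by
      simp only [Set.mem_insert_iff, Set.mem_singleton_iff, Prod.mk.injEq] at h ⊢
      omega
    have := braid_demK_of_le hj hi hij.symm h'
    have ho : orderOf (srefl S.R i * srefl S.R j) = orderOf (srefl S.R j * srefl S.R i) := by
      rw [← orderOf_inv, mul_inv_rev, srefl_inv, srefl_inv]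
    rw [ho, this]

end Rank2

end ExtendedDatum
end AffineHecke
end

noncomputable section
namespace AffineHecke
open scoped TensorProduct Pointwise

/-! ### The faithful representation and the Bernstein basis -/

open BernsteinDatum RootPairing
namespace ExtendedDatum
variable {ι X Y Γ : Type*} [AddCommGroup X] [AddCommGroup Y] [Group Γ]
variable (S : ExtendedDatum ι X Y Γ)

lemma incl_thetaHom {P Q : Set ι} (h : P ⊆ Q) (f : AddMonoidAlgebra ℂ X) :
    S.incl h ((S.upper P).thetaHom f) = (S.upper Q).thetaHom f := by
  suffices H : (S.incl h).comp (S.upper P).thetaHom = (S.upper Q).thetaHom from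
    DFunLike.congr_fun H f
  exact mono_ext fun x => by rw [AlgHom.comp_apply, thetaHom_mono, thetaHom_mono, incl_theta]

section Domain

variable [IsDomain (AddMonoidAlgebra ℂ X)] [Finite ι] {P Q : Set ι}

lemma orderOf_reflection (i j : ι) : orderOf (S.R.reflection i * S.R.reflection j) =
    orderOf (srefl S.R i * srefl S.R j) := by
  rw [← orderOf_injective (Equiv.weightHom S.R) (Equiv.weightHom_injective S.R), map_mul]
  have h : ∀ j, Equiv.weightHom S.R (srefl S.R j) = S.R.reflection j :=
    Equiv.reflection_weightEquiv S.R
  rw [h, h]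

lemma demK_apply (i : ι) (k : KX X) : S.demK i k =
    ((S.q i)⁻¹ : ℂˣ) • (S.hK i * k + S.actK (srefl S.R i) (S.hK i * k) - k) := rfl

lemma demK_apply' (i : ι) (k : KX X) : S.demK i k =
    algebraMap ℂ _ (((S.q i)⁻¹ : ℂˣ) : ℂ) *
      (S.hK i * k + S.actK (srefl S.R i) (S.hK i) * S.actK (srefl S.R i) k - k) := by
  rw [demK_apply, Units.smul_def, Algebra.smul_def, map_mul]

/-- The images of the generators of `ℋ^P` in the representation on `ℂ(X)`. -/
def genK (P : Set ι) : FreeAlgebra ℂ (X ⊕ P) →ₐ[ℂ] Module.End ℂ (KX X) :=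
  FreeAlgebra.lift ℂ (Sum.elim (fun x => LinearMap.mulLeft ℂ (toK (mono x)))
    (fun i : P => S.demK (i : ι)))

lemma genK_theta (x : X) :
    S.genK P (genTheta P x) = LinearMap.mulLeft ℂ (toK (mono x)) := by
  simp [genK, genTheta]

lemma genK_N (i : P) : S.genK P (genN X i) = S.demK (i : ι) := by
  simp [genK, genN]

lemma genK_thetaLin (f : AddMonoidAlgebra ℂ X) (k : KX X) :
    S.genK P (genThetaLin P f) k = toK f * k := by
  have h : (genThetaLin P f : FreeAlgebra ℂ (X ⊕ P)) =
      f.coeff.sum fun x c => c • genTheta P x := by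
    rw [genThetaLin, Finsupp.linearCombination_apply]
  have h2 : f = f.coeff.sum fun x c => c • mono x := by
    simp [mono, AddMonoidAlgebra.sum_coeff_single]
  rw [h, Finsupp.sum, map_sum, LinearMap.sum_apply]
  conv_rhs => rw [h2, Finsupp.sum, toK, map_sum, Finset.sum_mul]
  refine Finset.sum_congr rfl fun x _ => ?_
  rw [map_smul, LinearMap.smul_apply, genK_theta, LinearMap.mulLeft_apply]
  rw [Algebra.smul_def (f.coeff x) (mono x), map_mul, ← IsScalarTower.algebraMap_apply,
    Algebra.smul_def, mul_assoc]

variable (hP : P ⊆ S.simple)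

include hP in
lemma genK_rel ⦃a b : FreeAlgebra ℂ (X ⊕ P)⦄ (h : (S.upper P).Rel a b) :
    S.genK P a = S.genK P b := by
  induction h with
  | theta_zero =>
    rw [genK_theta, map_one, toK_mono_zero]; ext; simp
  | theta_add x y =>
    rw [map_mul, genK_theta, genK_theta, genK_theta, ← toK_mono_mul]; ext; simp [mul_assoc]
  | quadratic i =>
    rw [map_mul, map_sub, map_add, AlgHom.commutes, AlgHom.commutes, genK_N, map_zero]
    exact S.demK_quadratic i
  | braid i j =>
    rw [map_altProd, map_altProd, genK_N, genK_N]
    change altProd _ _ (orderOf (S.R.reflection _ * S.R.reflection _)) =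
      altProd _ _ (orderOf (S.R.reflection _ * S.R.reflection _))
    rw [orderOf_reflection]
    exact braid_demK (hP i.2) (hP j.2)
  | bernstein i f g h =>
    rw [map_sub, map_mul, map_mul, genK_N]
    ext k
    rw [LinearMap.sub_apply, Module.End.mul_apply, Module.End.mul_apply, genK_thetaLin,
      genK_thetaLin, genK_thetaLin, reflAlg_eq, demK_apply', demK_apply', map_mul, actK_toK,
      ← actA_mul, srefl_mul_self, actA_one]
    rw [reflAlg_eq] at h
    have hne := S.one_sub_toK_sq (neg_ne_zero.2 (S.R.ne_zero (i : ι)))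
    have hnum : toK ((S.upper P).numer i) =
        algebraMap ℂ _ ((S.q i : ℂ) - ((S.q i)⁻¹ : ℂˣ)) +
          algebraMap ℂ _ ((S.qStar i : ℂ) - ((S.qStar i)⁻¹ : ℂˣ)) *
            toK (mono (-S.R.root (i : ι))) := by
      rw [numer, Algebra.smul_def, Algebra.smul_def, mono_zero, mul_one, toK, map_add, map_mul,
        ← IsScalarTower.algebraMap_apply, ← IsScalarTower.algebraMap_apply]
      rfl
    have hz : toK (mono (-(2 : ℤ) • (S.upper P).root i)) =
        toK (mono (-S.R.root (i : ι))) ^ 2 := by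
      rw [toK_mono_pow]
      congr 2
      change -(2 : ℤ) • S.R.root (i : ι) = _
      module
    have h1 : toK g * (toK (mono 0) - toK (mono (-(2 : ℤ) • (S.upper P).root i))) =
        toK ((S.upper P).numer i) * (toK f - toK (S.actA (srefl S.R (i : ι)) f)) := by
      simpa only [map_mul, map_sub] using congrArg (algebraMap _ (KX X)) h
    rw [hnum, hz, toK_mono_zero] at h1
    have hK : S.hK (i : ι) * (1 - toK (mono (-S.R.root (i : ι))) ^ 2) =
        (1 - toK (mono (-S.R.root (i : ι))) ^ 2) + algebraMap ℂ _ (S.q i : ℂ) *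
          (algebraMap ℂ _ ((S.q i : ℂ) - ((S.q i)⁻¹ : ℂˣ)) +
          algebraMap ℂ _ ((S.qStar i : ℂ) - ((S.qStar i)⁻¹ : ℂˣ)) *
            toK (mono (-S.R.root (i : ι)))) := by
      have h3 : algebraMap ℂ (KX X) ((S.q i : ℂ) ^ 2) - 1 = algebraMap ℂ _ (S.q i : ℂ) *
          algebraMap ℂ _ ((S.q i : ℂ) - ((S.q i)⁻¹ : ℂˣ)) := by
        rw [← map_mul, mul_sub, Units.mul_inv, map_sub, map_one, pow_two]
      rw [hK, hfun, add_mul, one_mul, div_mul_cancel₀ _ hne, h3, map_mul]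
      ring
    have hq : algebraMap ℂ (KX X) (((S.q i)⁻¹ : ℂˣ) : ℂ) * algebraMap ℂ _ (S.q i : ℂ) = 1 := by
      rw [← map_mul, Units.inv_mul, map_one]
    apply mul_right_cancel₀ hne
    linear_combination (algebraMap ℂ (KX X) (((S.q i)⁻¹ : ℂˣ) : ℂ) *
      (toK f - toK (S.actA (srefl S.R (i : ι)) f)) * k) * hK - k * h1 +
      ((algebraMap ℂ _ ((S.q i : ℂ) - ((S.q i)⁻¹ : ℂˣ)) +
          algebraMap ℂ _ ((S.qStar i : ℂ) - ((S.qStar i)⁻¹ : ℂˣ)) *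
            toK (mono (-S.R.root (i : ι)))) *
        (toK f - toK (S.actA (srefl S.R (i : ι)) f)) * k) * hq

/-- The representation of `ℋ^P` on `ℂ(X)` by Demazure–Lusztig operators. -/
def repK (hP : P ⊆ S.simple) : (S.upper P).Hecke →ₐ[ℂ] Module.End ℂ (KX X) :=
  RingQuot.liftAlgHom ℂ ⟨S.genK P, S.genK_rel hP⟩

lemma repK_theta (f : AddMonoidAlgebra ℂ X) (k : KX X) :
    S.repK hP ((S.upper P).thetaHom f) k = toK f * k := by
  rw [← mk_genThetaLin, repK, RingQuot.liftAlgHom_mkAlgHom_apply, genK_thetaLin]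

lemma repK_N (i : P) : S.repK hP ((S.upper P).N i) = S.demK (i : ι) := by
  rw [N, repK, RingQuot.liftAlgHom_mkAlgHom_apply, genK_N]

lemma hK_ne_zero (i : ι) : S.hK i ≠ 0 := by
  intro h
  have hne := S.one_sub_toK_sq (neg_ne_zero.2 (S.R.ne_zero i))
  have h1 : S.hK i * (1 - toK (mono (-S.R.root i)) ^ 2) =
      algebraMap ℂ _ ((S.q i : ℂ) ^ 2) +
        algebraMap ℂ _ ((S.q i : ℂ) * ((S.qStar i : ℂ) - ((S.qStar i)⁻¹ : ℂˣ))) *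
          toK (mono (-S.R.root i)) - toK (mono (-S.R.root i)) ^ 2 := by
    rw [hK, hfun, add_mul, one_mul, div_mul_cancel₀ _ hne]
    ring
  obtain ⟨a, ha⟩ : ∃ a, a = (S.q i : ℂ) ^ 2 := ⟨_, rfl⟩
  obtain ⟨c, hc⟩ : ∃ c, c = (S.q i : ℂ) * ((S.qStar i : ℂ) - ((S.qStar i)⁻¹ : ℂˣ)) := ⟨_, rfl⟩
  rw [h, zero_mul, toK_mono_pow, ← ha, ← hc,
    IsScalarTower.algebraMap_apply ℂ (AddMonoidAlgebra ℂ X) (KX X),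
    IsScalarTower.algebraMap_apply ℂ (AddMonoidAlgebra ℂ X) (KX X)] at h1
  have h2 : algebraMap ℂ (AddMonoidAlgebra ℂ X) a + algebraMap ℂ _ c * mono (-S.R.root i) -
      mono (2 • -S.R.root i) = 0 := by
    apply toK_injective
    simpa only [map_add, map_sub, map_mul, map_zero] using h1.symm
  have := S.isAddTorsionFree
  have h3 := S.R.ne_zero i
  have h4 : ¬ (0 = 2 • -S.R.root i) := fun h =>
    neg_ne_zero.2 h3 ((nsmul_eq_zero_iff_right two_ne_zero).1 h.symm)
  have h5 : ¬ (-S.R.root i = 2 • -S.R.root i) := fun h => neg_ne_zero.2 h3 (by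
    rwa [two_nsmul, left_eq_add] at h)
  rw [Algebra.algebraMap_eq_smul_one, Algebra.algebraMap_eq_smul_one, smul_one_mul, ← mono_zero] at h2
  generalize -S.R.root i = y at h2 h4 h5
  have h6 := congrArg (fun f => AddMonoidAlgebra.coeff f (2 • y)) h2
  simp [mono, Finsupp.single_apply, h4, h5] at h6

/-- `N_w` acts on `ℂ(X)` by a combination of elements of the Weyl group in which `w` occurs, and
otherwise only shorter elements. -/
lemma exists_expansion {w : S.R.Aut} (hw : w ∈ parab S.R P) : ∃ c : S.R.Aut →₀ KX X,
    (∀ k, S.repK hP (S.Nw P w) k = c.sum fun u a => a * S.actK u k) ∧ c w ≠ 0 ∧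
      ∀ u, c u ≠ 0 → u ≠ w → len S.base u < len S.base w := by
  classical
  generalize hn : len S.base w = n
  induction n generalizing w with
  | zero =>
    rw [eq_one_of_len hP hw hn, S.Nw_one hP]
    refine ⟨Finsupp.single 1 1, fun k => ?_, by simp, fun u hu hu1 => ?_⟩
    · rw [Finsupp.sum_single_index (by simp)]; simp
    · rw [Finsupp.single_apply_ne_zero] at hu
      exact absurd hu.1 hu1
  | succ n ih =>
    have hw1 : w ≠ 1 := by rintro rfl; rw [len_one] at hn; omega
    obtain ⟨i, hi, hd⟩ := exists_left_descent hP hw hw1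
    -- `N_w = N_i N_u` with `w = s_i u`, and `N_i` acts by `q⁻¹ (h_i - 1) + q⁻¹ s_i(h_i) s_i`.
    set u := srefl S.R i * w with hu
    have hul : len S.base u + 1 = len S.base w := len_srefl_mul_of_not (hP hi) hd
    have huP : u ∈ parab S.R P := mul_mem (srefl_mem_parab hi) hw
    have hwu : w = srefl S.R i * u := by rw [hu, ← mul_assoc, srefl_mul_self, one_mul]
    have hpos : S.base.IsPos (u⁻¹ • i) := by
      rw [hu, mul_inv_rev, srefl_inv, mul_smul, srefl_smul_index, isPos_smul_neg_index]; exact hd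
    have hN : S.Nw P w = (S.upper P).N ⟨i, hi⟩ * S.Nw P u := by
      rw [hwu]; exact S.Nw_srefl_mul hP huP ⟨i, hi⟩ hpos
    obtain ⟨c, hc, hcu, hcl⟩ := ih huP (by omega)
    set q' : KX X := algebraMap ℂ _ (((S.q i)⁻¹ : ℂˣ) : ℂ) with hq'
    have hq0 : q' ≠ 0 := by
      rw [hq', Ne, FaithfulSMul.algebraMap_eq_zero_iff]; exact Units.ne_zero _
    have hl : ∀ v, len S.base (srefl S.R i * v) ≤ len S.base v + 1 := fun v => by
      by_cases h : S.base.IsPos (v⁻¹ • i)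
      · exact (len_srefl_mul (hP hi) h).le
      · have := len_srefl_mul_of_not (hP hi) h; omega
    let e : S.R.Aut ≃ S.R.Aut := Equiv.mulLeft (srefl S.R i)
    let c1 : S.R.Aut →₀ KX X := c.mapRange (fun a => q' * (S.hK i - 1) * a) (by simp)
    let c2 : S.R.Aut →₀ KX X := (c.mapRange
      (fun a => q' * S.actK (srefl S.R i) (S.hK i) * S.actK (srefl S.R i) a) (by simp)).equivMapDomain e
    have he : ∀ v, e.symm v = srefl S.R i * v := fun v => by
      change (srefl S.R i)⁻¹ * v = _
      rw [srefl_inv]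
    have h2 : ∀ v, c2 v = q' * S.actK (srefl S.R i) (S.hK i) *
        S.actK (srefl S.R i) (c (srefl S.R i * v)) := fun v => by
      rw [Finsupp.equivMapDomain_apply, he, Finsupp.mapRange_apply]
    have h1 : ∀ v, c1 v = q' * (S.hK i - 1) * c v := fun v => Finsupp.mapRange_apply
    refine ⟨c1 + c2, fun k => ?_, ?_, fun v hv hvw => ?_⟩
    · rw [hN, map_mul, Module.End.mul_apply, repK_N, hc, demK_apply', Finsupp.sum_add_index'
        (by simp) (by intros; ring)]
      have e1 : (c1.sum fun u a => a * S.actK u k) =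
          q' * (S.hK i - 1) * c.sum fun u a => a * S.actK u k := by
        rw [Finsupp.sum_mapRange_index (by simp), Finsupp.mul_sum]
        exact Finsupp.sum_congr fun u _ => by ring
      have e2 : (c2.sum fun u a => a * S.actK u k) =
          q' * S.actK (srefl S.R i) (S.hK i) *
            S.actK (srefl S.R i) (c.sum fun u a => a * S.actK u k) := by
        rw [Finsupp.sum_equivMapDomain, Finsupp.sum_mapRange_index (by simp), Finsupp.sum,
          Finsupp.sum, map_sum, Finset.mul_sum]
        refine Finset.sum_congr rfl fun u _ => ?_
        rw [map_mul, ← actK_mul]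
        change _ * S.actK (srefl S.R i * u) k = _
        ring
      rw [e1, e2]
      ring
    · have h3 : c w = 0 := by
        by_contra h
        have h5 : w ≠ u := fun h => by rw [← h] at hul; omega
        have := hcl w h h5
        omega
      rw [Finsupp.add_apply, h1, h2, h3, mul_zero, zero_add]
      refine mul_ne_zero (mul_ne_zero hq0 ?_) ?_
      · rw [Ne, map_eq_zero]; exact S.hK_ne_zero i
      · rw [Ne, map_eq_zero]; exact hcu
    · by_contra hlen
      apply hv
      have h3 : c v = 0 := by
        by_contra h
        rcases eq_or_ne v u with rfl | h4
        · omega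
        · have := hcl v h h4; omega
      have h4 : c (srefl S.R i * v) = 0 := by
        by_contra h
        rcases eq_or_ne (srefl S.R i * v) u with h5 | h5
        · exact hvw (mul_left_cancel h5)
        · have h6 := hcl _ h h5
          have h7 := hl (srefl S.R i * v)
          rw [← mul_assoc, srefl_mul_self, one_mul] at h7
          omega
      rw [Finsupp.add_apply, h1, h2, h3, h4, map_zero, mul_zero, mul_zero, add_zero]

include hP in
/-- The elements `N_w` are independent over `ℂ[X]`. In a relation, the coefficient in `ℂ(X)` of a
longest `w` is nonzero by `exists_expansion`, and automorphisms of a field are independent. -/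
lemma eq_zero_of_sum_Nw (f : S.R.Aut →₀ AddMonoidAlgebra ℂ X) (hf : ∀ w ∈ f.support, w ∈ parab S.R P)
    (h : (f.sum fun w a => S.Nw P w * (S.upper P).thetaHom a) = 0) : f = 0 := by
  classical
  by_contra hne
  obtain ⟨w, hw, hmax⟩ := Finset.exists_max_image f.support (len S.base)
    (Finsupp.support_nonempty_iff.2 hne)
  choose c hc hcw hcl using fun w : f.support => S.exists_expansion hP (hf w w.2)
  have h1 : ∀ k, ∑ u ∈ f.support.attach, ((c u).sum fun v a => a * S.actK v (toK (f u)) * S.actK v k) = 0 := by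
    intro k
    have := congrArg (fun z => S.repK hP z k) h
    simp only [Finsupp.sum, map_sum, map_mul, LinearMap.sum_apply, Module.End.mul_apply, map_zero,
      LinearMap.zero_apply, repK_theta] at this
    rw [← this, ← Finset.sum_attach f.support]
    refine Finset.sum_congr rfl fun u _ => ?_
    rw [hc u]
    exact Finset.sum_congr rfl fun v _ => by
      change _ * _ * _ = _ * S.actK v (_ * _)
      rw [map_mul, mul_assoc]
  let d : S.R.Aut →₀ KX X := ∑ u ∈ f.support.attach,
    (c u).sum fun v a => Finsupp.single v (a * S.actK v (toK (f u)))
  have hd : (d.sum fun v a => a * S.actK v ·) = fun _ => 0 := by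
    funext k
    rw [← h1 k]
    have hz : ∀ v : S.R.Aut, (0 : KX X) * S.actK v k = 0 := fun v => zero_mul _
    have ha : ∀ (v : S.R.Aut) (a b : KX X), (a + b) * S.actK v k = a * S.actK v k + b * S.actK v k :=
      fun v a b => add_mul _ _ _
    refine (Finsupp.sum_finsetSum_index hz ha).symm.trans ?_
    refine Finset.sum_congr rfl fun u _ => ?_
    refine (Finsupp.sum_sum_index hz ha).trans ?_
    exact Finset.sum_congr rfl fun v _ => Finsupp.sum_single_index (hz v)
  have hli : LinearIndependent (KX X) fun g : S.R.Aut => (fun k : KX X => S.actK g k) := by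
    have := (linearIndependent_monoidHom (KX X) (KX X)).comp
      (fun g : S.R.Aut => (S.actK g : KX X →* KX X)) (fun g h H => S.actK_injective (RingHom.ext
        fun k => DFunLike.congr_fun H k))
    exact this
  have hd0 : d = 0 := by
    rw [linearIndependent_iff] at hli
    apply hli
    rw [Finsupp.linearCombination_apply]
    funext k
    have := congrFun hd k
    simp only [Finsupp.sum, Finset.sum_apply, Pi.smul_apply, smul_eq_mul, Pi.zero_apply] at this ⊢
    exact this
  have hdw : d w = c ⟨w, hw⟩ w * S.actK w (toK (f w)) := by
    have hs : ∀ u : f.support, ((c u).sum fun v a => Finsupp.single v (a * S.actK v (toK (f u)))) w =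
        c u w * S.actK w (toK (f u)) := by
      intro u
      rw [Finsupp.sum_apply, Finsupp.sum, Finset.sum_eq_single w]
      · simp
      · intro v _ hv; simp [hv]
      · intro h; simp at h; simp [h]
    rw [Finsupp.finsetSum_apply, Finset.sum_eq_single ⟨w, hw⟩]
    · exact hs _
    · intro u _ hu
      rw [hs]
      have : c u w = 0 := by
        by_contra h
        have := hcl u w h (fun h => hu (Subtype.ext h.symm))
        have := hmax u u.2
        omega
      rw [this, zero_mul]
    · intro h; exact absurd (Finset.mem_attach _ _) h
  rw [hd0, Finsupp.zero_apply, eq_comm, mul_eq_zero, map_eq_zero (S.actK w)] at hdw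
  rcases hdw with h | h
  · exact hcw _ h
  · exact Finsupp.mem_support_iff.1 hw (toK_injective (h.trans (map_zero _).symm))

/-- There is an `ℋ^P`-linear retraction from `ℋ^Q` to `ℋ^P`. -/
lemma exists_retraction (hPQ : P ⊆ Q) (hQ : Q ⊆ S.simple) :
    ∃ r : (S.upper Q).Hecke →ₗ[ℂ] (S.upper P).Hecke, r 1 = 1 ∧
      ∀ a b, r (a * S.incl hPQ b) = r a * b := by
  classical
  have hP := hPQ.trans hQ
  -- the expansion of an element of `ℋ^Q` in the elements `N_w`
  let Ψ : (parab S.R Q →₀ AddMonoidAlgebra ℂ X) →ₗ[ℂ] (S.upper Q).Hecke :=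
    Finsupp.lsum ℂ fun w => (LinearMap.mulLeft ℂ (S.Nw Q w)).comp (S.upper Q).thetaHom.toLinearMap
  let Φ : (parab S.R Q →₀ AddMonoidAlgebra ℂ X) →ₗ[ℂ] (S.upper P).Hecke :=
    Finsupp.lsum ℂ fun w => if (w : S.R.Aut) ∈ parab S.R P then
      (LinearMap.mulLeft ℂ (S.Nw P w)).comp (S.upper P).thetaHom.toLinearMap else 0
  have hΨs : ∀ w a, Ψ (Finsupp.single w a) = S.Nw Q w * (S.upper Q).thetaHom a := fun w a => by
    simp [Ψ]
  have hΨ : Function.Bijective Ψ := by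
    constructor
    · rw [← LinearMap.ker_eq_bot, LinearMap.ker_eq_bot']
      intro f hf
      have h2 := S.eq_zero_of_sum_Nw hQ (f.embDomain (Function.Embedding.subtype _)) (fun w hw => by
        rw [Finsupp.support_embDomain, Finset.mem_map] at hw
        obtain ⟨v, -, rfl⟩ := hw
        exact v.2) (by rw [Finsupp.sum_embDomain]; exact hf)
      rwa [Finsupp.embDomain_eq_zero] at h2
    · rw [← LinearMap.range_eq_top, eq_top_iff]
      intro a _
      refine Submodule.span_le.2 ?_ (S.span_Nw_theta hQ a)
      rintro _ ⟨w, hw, f, rfl⟩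
      exact ⟨Finsupp.single ⟨w, hw⟩ f, hΨs _ _⟩
  let e := LinearEquiv.ofBijective Ψ hΨ
  let r : (S.upper Q).Hecke →ₗ[ℂ] (S.upper P).Hecke := Φ.comp e.symm.toLinearMap
  have hr : ∀ w ∈ parab S.R Q, ∀ a, r (S.Nw Q w * (S.upper Q).thetaHom a) =
      if w ∈ parab S.R P then S.Nw P w * (S.upper P).thetaHom a else 0 := by
    intro w hw a
    have : e.symm (S.Nw Q w * (S.upper Q).thetaHom a) = Finsupp.single ⟨w, hw⟩ a := by
      rw [LinearEquiv.symm_apply_eq]; exact (hΨs ⟨w, hw⟩ a).symm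
    change Φ (e.symm _) = _
    rw [this]
    simp only [Φ, Finsupp.lsum_single]
    split_ifs <;> rfl
  have hparab : parab S.R P ≤ parab S.R Q := Subgroup.closure_mono (Set.image_mono hPQ)
  have hθ := S.incl_thetaHom hPQ
  refine ⟨r, ?_, fun a b => ?_⟩
  · have := hr 1 (one_mem _) 1
    rwa [S.Nw_one hQ, map_one (S.upper Q).thetaHom, mul_one, if_pos (one_mem _), S.Nw_one hP,
      map_one (S.upper P).thetaHom, mul_one] at this
  -- a set of `b` on which linearity holds for all `a` is a subalgebra
  let B : Subalgebra ℂ (S.upper P).Hecke :=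
    { carrier := {b | ∀ a, r (a * S.incl hPQ b) = r a * b}
      mul_mem' := fun {b c} hb hc a => by
        rw [map_mul (S.incl hPQ), ← mul_assoc, hc, hb, mul_assoc]
      add_mem' := fun {b c} hb hc a => by
        rw [map_add (S.incl hPQ), mul_add, map_add, hb, hc, mul_add]
      algebraMap_mem' := fun c a => by
        rw [AlgHom.commutes, ← Algebra.commutes, ← Algebra.smul_def, map_smul, Algebra.smul_def,
          Algebra.commutes] }
  have hspan : ∀ b, (∀ w ∈ parab S.R Q, ∀ f, r (S.Nw Q w * (S.upper Q).thetaHom f * S.incl hPQ b) =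
      r (S.Nw Q w * (S.upper Q).thetaHom f) * b) → b ∈ B := by
    intro b hb a
    have ha := S.span_Nw_theta hQ a
    induction ha using Submodule.span_induction with
    | mem z hz => obtain ⟨w, hw, f, rfl⟩ := hz; exact hb w hw f
    | zero => simp
    | add x y _ _ hx hy => rw [add_mul, map_add, map_add, hx, hy, add_mul]
    | smul c x _ hx => rw [smul_mul_assoc, map_smul, map_smul, hx, smul_mul_assoc]
  refine subalgebra_eq_top (B := B) (fun x => hspan _ fun w hw f => ?_)
    (fun i => hspan _ fun w hw f => ?_) b a
  · rw [← thetaHom_mono, hθ, mul_assoc, ← map_mul, hr w hw, hr w hw]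
    split_ifs
    · rw [map_mul, mul_assoc]
    · rw [zero_mul]
  · obtain ⟨g, hg⟩ := S.exists_theta_mul_N i f
    have hg' := congrArg (S.incl hPQ) hg
    rw [map_mul, map_add, map_mul, hθ, hθ, hθ, incl_N] at hg'
    have hi : srefl S.R (i : ι) ∈ parab S.R P := srefl_mem_parab i.2
    have hiff : w * srefl S.R (i : ι) ∈ parab S.R P ↔ w ∈ parab S.R P :=
      Subgroup.mul_mem_cancel_right _ hi
    have hwi := mul_mem hw (hparab hi)
    rw [incl_N, mul_assoc, hg', mul_add, ← mul_assoc, map_add, hr w hw, hr w hw]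
    by_cases h : S.base.IsPos (w • (i : ι))
    · have h1 := S.Nw_mul_srefl hQ hw (Set.inclusion hPQ i) h
      rw [← h1]
      change r (S.Nw Q (w * srefl S.R (i : ι)) * _) + _ = _
      rw [hr _ hwi]
      by_cases hwP : w ∈ parab S.R P
      · rw [if_pos (hiff.2 hwP), if_pos hwP, if_pos hwP, S.Nw_mul_srefl hP hwP i h, mul_assoc,
          mul_assoc, ← mul_add, ← hg]
      · rw [if_neg (mt hiff.1 hwP), if_neg hwP, if_neg hwP, zero_mul, add_zero]
    · have h1 := S.Nw_mul_N_of_not hQ hw (Set.inclusion hPQ i) h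
      rw [h1]
      change r ((_ • _ + S.Nw Q (w * srefl S.R (i : ι))) * _) + _ = _
      rw [add_mul, smul_mul_assoc, map_add, map_smul, hr _ hwi, hr _ hw]
      by_cases hwP : w ∈ parab S.R P
      · rw [if_pos (hiff.2 hwP), if_pos hwP, if_pos hwP, if_pos hwP, mul_assoc _ _ ((S.upper P).N i),
          hg, mul_add, ← mul_assoc, S.Nw_mul_N_of_not hP hwP i h, add_mul, smul_mul_assoc]
      · rw [if_neg (mt hiff.1 hwP), if_neg hwP, if_neg hwP, if_neg hwP, zero_mul, smul_zero,
          add_zero, add_zero]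

end Domain

end ExtendedDatum

section Induced

variable {A : Type*} [Ring A] [Algebra ℂ A] {B : Type*} [Ring B] [Algebra ℂ B]
variable {V : Type*} [AddCommGroup V] [Module ℂ V] {W : Type*} [AddCommGroup W] [Module ℂ W]
variable (f : B →ₐ[ℂ] A) (π : B →ₐ[ℂ] Module.End ℂ V)

/-- The quotient map `A ⊗_ℂ V → A ⊗_B V`. -/
def indMk : A ⊗[ℂ] V →ₗ[ℂ] IndSpace f π := (indRel f π).mkQ

lemma indMk_surjective : Function.Surjective (indMk f π) := (indRel f π).mkQ_surjective

lemma indRep_indMk (a : A) (z : A ⊗[ℂ] V) :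
    indRep f π a (indMk f π z) = indMk f π (leftMul V A a z) := rfl

lemma indMk_balanced (a : A) (b : B) (v : V) :
    indMk f π ((a * f b) ⊗ₜ[ℂ] v) = indMk f π (a ⊗ₜ[ℂ] π b v) := by
  rw [← sub_eq_zero, ← map_sub]
  exact (Submodule.Quotient.mk_eq_zero _).2 (Submodule.subset_span ⟨a, b, v, rfl⟩)

variable {f π} in
lemma exists_indMk_lift (g : A →ₗ[ℂ] V →ₗ[ℂ] W) (hg : ∀ a b v, g (a * f b) v = g a (π b v)) :
    ∃ F : IndSpace f π →ₗ[ℂ] W, ∀ a v, F (indMk f π (a ⊗ₜ[ℂ] v)) = g a v := by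
  have hle : indRel f π ≤ LinearMap.ker (TensorProduct.lift g) := by
    refine Submodule.span_le.2 ?_
    rintro _ ⟨a, b, v, rfl⟩
    rw [SetLike.mem_coe, LinearMap.mem_ker, map_sub, TensorProduct.lift.tmul,
      TensorProduct.lift.tmul, hg, sub_self]
  exact ⟨(indRel f π).liftQ _ hle, fun a v => (Submodule.liftQ_apply _ _ _).trans
    (TensorProduct.lift.tmul _ _)⟩

/-- The canonical map `v ↦ 1 ⊗ v` from a representation to the induced one. -/
def indUnit : V →ₗ[ℂ] IndSpace f π := (indMk f π).comp (TensorProduct.mk ℂ A V 1)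

lemma indUnit_eq (v : V) : indUnit f π v = indMk f π (1 ⊗ₜ[ℂ] v) := rfl

lemma indRep_indUnit (a : A) (v : V) :
    indRep f π a (indUnit f π v) = indMk f π (a ⊗ₜ[ℂ] v) := by
  rw [indUnit_eq, indRep_indMk, leftMul_tmul, mul_one]

lemma indUnit_apply (b : B) (v : V) :
    indUnit f π (π b v) = indRep f π (f b) (indUnit f π v) := by
  rw [indRep_indUnit, indUnit_eq, ← indMk_balanced, one_mul]

/-- The induced representation is generated by the image of `indUnit`. -/
lemma ind_span (x : IndSpace f π) :
    x ∈ Submodule.span ℂ {z | ∃ a v, z = indRep f π a (indUnit f π v)} := by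
  obtain ⟨z, rfl⟩ := indMk_surjective f π x
  induction z using TensorProduct.induction_on with
  | zero => rw [map_zero]; exact zero_mem _
  | tmul a v => exact Submodule.subset_span ⟨a, v, (indRep_indUnit f π a v).symm⟩
  | add x y hx hy => rw [map_add]; exact add_mem hx hy

variable {f π} in
/-- Frobenius reciprocity. -/
lemma exists_ind_lift {τ : A →ₐ[ℂ] Module.End ℂ W} (j : V →ₗ[ℂ] W)
    (hj : ∀ b v, j (π b v) = τ (f b) (j v)) : ∃ F : IndSpace f π →ₗ[ℂ] W,
      (∀ v, F (indUnit f π v) = j v) ∧ ∀ a x, F (indRep f π a x) = τ a (F x) := by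
  obtain ⟨F, hF⟩ := exists_indMk_lift (f := f) (π := π)
    ((LinearMap.lcomp ℂ W j).comp (τ.toLinearMap : A →ₗ[ℂ] W →ₗ[ℂ] W))
    (fun a b v => by
      change τ (a * f b) (j v) = τ a (j (π b v))
      rw [hj, map_mul, Module.End.mul_apply])
  have hF' : ∀ a v, F (indMk f π (a ⊗ₜ[ℂ] v)) = τ a (j v) := hF
  refine ⟨F, fun v => ?_, fun a x => ?_⟩
  · rw [indUnit_eq, hF', map_one]; rfl
  · obtain ⟨z, rfl⟩ := indMk_surjective f π x
    rw [indRep_indMk]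
    induction z using TensorProduct.induction_on with
    | zero => simp
    | tmul b v => rw [leftMul_tmul, hF', hF', map_mul]; rfl
    | add x y hx hy => rw [map_add, map_add, map_add, hx, hy, map_add (indMk f π), map_add F, map_add]

lemma indUnit_injective (r : A →ₗ[ℂ] B) (h1 : r 1 = 1) (hr : ∀ a b, r (a * f b) = r a * b) :
    Function.Injective (indUnit f π) := by
  obtain ⟨F, hF⟩ := exists_indMk_lift (f := f) (π := π)
    ((π.toLinearMap : B →ₗ[ℂ] V →ₗ[ℂ] V).comp r)
    (fun a b v => by
      change π (r (a * f b)) v = π (r a) (π b v)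
      rw [hr, map_mul, Module.End.mul_apply])
  have hF' : ∀ v, F (indUnit f π v) = v := fun v => by
    rw [indUnit_eq, hF]
    change π (r 1) v = v
    rw [h1, map_one]; rfl
  exact fun v w h => by rw [← hF' v, h, hF']

end Induced

namespace ExtendedDatum

variable {ι X Y Γ : Type*} [AddCommGroup X] [AddCommGroup Y] [Group Γ]
variable (S : ExtendedDatum ι X Y Γ)

/-- A representation of `ℋ^P` embeds in the `ℋ^Q`-representation that it induces. -/
lemma indUnit_incl_injective [Finite ι] [Module.Finite ℤ X] {P Q : Set ι} (hPQ : P ⊆ Q)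
    (hQ : Q ⊆ S.simple) {V : Type*} [AddCommGroup V] [Module ℂ V]
    (π : (S.upper P).Hecke →ₐ[ℂ] Module.End ℂ V) :
    Function.Injective (indUnit (S.incl hPQ) π) := by
  have := S.isDomain
  obtain ⟨r, h1, hr⟩ := S.exists_retraction hPQ hQ
  exact indUnit_injective _ _ r h1 hr

end ExtendedDatum
end AffineHecke
end

noncomputable section
namespace AffineHecke
open scoped TensorProduct Pointwise

/-! ### The space `𝔞 = Hom(X, ℝ)` with an invariant inner product -/

open BernsteinDatum RootPairing
namespace ExtendedDatum
variable {ι X Y Γ : Type*} [AddCommGroup X] [AddCommGroup Y] [Group Γ]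
variable (S : ExtendedDatum ι X Y Γ) {P Q : Set ι}

/-- The coroot `α_i^∨` as an element of `𝔞`. -/
def cor (i : ι) : X →+ ℝ := (Int.castAddHom ℝ).comp (S.R.coroot' i).toAddMonoidHom

lemma cor_apply (i : ι) (x : X) : S.cor i x = (S.R.coroot' i x : ℝ) := rfl

/-- The action of the automorphisms of the root datum on `𝔞`. -/
def aact (g : S.R.Aut) : (X →+ ℝ) →ₗ[ℝ] (X →+ ℝ) where
  toFun μ := μ.comp (DistribSMul.toAddMonoidHom X g⁻¹)
  map_add' _ _ := rfl
  map_smul' _ _ := rfl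

lemma aact_apply (g : S.R.Aut) (μ : X →+ ℝ) (x : X) : S.aact g μ x = μ (g⁻¹ • x) := rfl

@[simp] lemma aact_one (μ : X →+ ℝ) : S.aact 1 μ = μ := by
  ext x; rw [aact_apply, inv_one, one_smul]

lemma aact_mul (g h : S.R.Aut) (μ : X →+ ℝ) : S.aact (g * h) μ = S.aact g (S.aact h μ) := by
  ext x; rw [aact_apply, aact_apply, aact_apply, mul_inv_rev, mul_smul]

lemma aact_cor (g : S.R.Aut) (i : ι) : S.aact g (S.cor i) = S.cor (g • i) := by
  ext x
  rw [aact_apply, cor_apply, cor_apply, ← coroot'_smul S.R g i, smul_inv_smul]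

lemma aact_root (g : S.R.Aut) (μ : X →+ ℝ) (i : ι) :
    S.aact g μ (S.R.root (g • i)) = μ (S.R.root i) := by
  rw [aact_apply, root_smul, inv_smul_smul]

lemma aact_srefl (i : ι) (μ : X →+ ℝ) :
    S.aact (srefl S.R i) μ = μ - μ (S.R.root i) • S.cor i := by
  ext x
  rw [aact_apply, srefl_inv, srefl_smul, map_sub, map_zsmul, AddMonoidHom.sub_apply,
    AddMonoidHom.smul_apply, cor_apply, smul_eq_mul, zsmul_eq_mul, mul_comm]

lemma cor_neg_index (i : ι) : S.cor (S.R.reflectionPerm i i) = -S.cor i := by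
  rw [← srefl_smul_index, ← aact_cor, aact_srefl, cor_apply, root_coroot'_eq_pairing, pairing_same]
  push_cast
  module

variable [Finite ι]

variable {S} in
/-- An automorphism that maps `P` to `Q` conjugates `W_P` to `W_Q`. -/
lemma conj_mem_parab {g : S.R.Aut} (h : g • P = Q) {w : S.R.Aut} (hw : w ∈ parab S.R P) :
    g * w * g⁻¹ ∈ parab S.R Q := by
  induction hw using Subgroup.closure_induction with
  | mem x hx =>
    obtain ⟨i, hi, rfl⟩ := hx
    rw [← srefl_smul_conj]
    exact srefl_mem_parab (h ▸ Set.smul_mem_smul_set hi)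
  | one => simp
  | mul x y _ _ hx hy =>
    have : g * (x * y) * g⁻¹ = (g * x * g⁻¹) * (g * y * g⁻¹) := by group
    rw [this]; exact mul_mem hx hy
  | inv x _ hx =>
    have : g * x⁻¹ * g⁻¹ = (g * x * g⁻¹)⁻¹ := by group
    rw [this]; exact inv_mem hx

/-- The group generated by the Weyl group and the diagram automorphisms. -/
def sym : Subgroup S.R.Aut where
  carrier := {g | ∃ γ, ∃ w ∈ parab S.R S.simple, g = S.act γ * w}
  one_mem' := ⟨1, 1, one_mem _, by simp⟩
  mul_mem' := by
    rintro _ _ ⟨γ, w, hw, rfl⟩ ⟨γ', w', hw', rfl⟩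
    refine ⟨γ * γ', S.act γ'⁻¹ * w * (S.act γ'⁻¹)⁻¹ * w',
      mul_mem (conj_mem_parab (S.act_simple _) hw) hw', ?_⟩
    rw [map_mul, map_inv]; group
  inv_mem' := by
    rintro _ ⟨γ, w, hw, rfl⟩
    refine ⟨γ⁻¹, S.act γ * w⁻¹ * (S.act γ)⁻¹, conj_mem_parab (S.act_simple _) (inv_mem hw), ?_⟩
    rw [map_inv]; group

lemma parab_le_sym : parab S.R S.simple ≤ S.sym := fun w hw => ⟨1, w, hw, by simp⟩

lemma act_mem_sym (γ : Γ) : S.act γ ∈ S.sym := ⟨γ, 1, one_mem _, by simp⟩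

lemma srefl_mem_sym {i : ι} (hi : i ∈ S.simple) : srefl S.R i ∈ S.sym :=
  S.parab_le_sym (srefl_mem_parab hi)

variable [Finite Γ] [Module.Finite ℤ X]

instance : Finite S.sym := by
  have := finite_parab (R := S.R) (b := S.base) (P := S.simple) subset_rfl
  refine Finite.of_surjective (fun p : Γ × parab S.R S.simple =>
    (⟨S.act p.1 * p.2, p.1, p.2, p.2.2, rfl⟩ : S.sym)) ?_
  rintro ⟨_, γ, w, hw, rfl⟩
  exact ⟨(γ, ⟨w, hw⟩), rfl⟩

instance : Fintype S.sym := Fintype.ofFinite _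

/-- A finite set of generators of `X`. -/
def gens (X : Type*) [AddCommGroup X] [Module.Finite ℤ X] : Finset X :=
  (Module.Finite.fg_top (R := ℤ) (M := X)).choose

lemma span_gens : Submodule.span ℤ (gens X : Set X) = ⊤ :=
  (Module.Finite.fg_top (R := ℤ) (M := X)).choose_spec

/-- An embedding of `𝔞` in a Euclidean space. It defines an inner product on `𝔞` that is invariant
under the Weyl group and `Γ`. -/
def emb : (X →+ ℝ) →ₗ[ℝ] EuclideanSpace ℝ (S.sym × gens X) where
  toFun μ := WithLp.toLp 2 fun p => μ ((p.1 : S.R.Aut) • (p.2 : X))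
  map_add' _ _ := rfl
  map_smul' _ _ := rfl

lemma emb_apply (μ : X →+ ℝ) (p : S.sym × gens X) :
    S.emb μ p = μ ((p.1 : S.R.Aut) • (p.2 : X)) := rfl

lemma emb_injective : Function.Injective S.emb := by
  rw [← LinearMap.ker_eq_bot, LinearMap.ker_eq_bot']
  intro μ h
  have h1 : ∀ x ∈ gens X, μ x = 0 := fun x hx => by
    have := congrArg (fun v => v (⟨1, ⟨x, hx⟩⟩ : S.sym × gens X)) h
    simpa [emb_apply] using this
  have h2 : Submodule.span ℤ (gens X : Set X) ≤ LinearMap.ker μ.toIntLinearMap :=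
    Submodule.span_le.2 h1
  rw [span_gens] at h2
  ext x
  exact h2 (Submodule.mem_top (x := x))

/-- The invariant inner product on `𝔞`. -/
def ip (μ ν : X →+ ℝ) : ℝ := inner ℝ (S.emb μ) (S.emb ν)

/-- The norm of the invariant inner product on `𝔞`. -/
def nrm (μ : X →+ ℝ) : ℝ := ‖S.emb μ‖

lemma ip_eq_sum (μ ν : X →+ ℝ) : S.ip μ ν = ∑ g : S.sym, ∑ x : gens X,
    ν ((g : S.R.Aut) • (x : X)) * μ ((g : S.R.Aut) • (x : X)) := by
  rw [ip, PiLp.inner_apply, Fintype.sum_prod_type]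
  rfl

lemma ip_add_left (μ μ' ν : X →+ ℝ) : S.ip (μ + μ') ν = S.ip μ ν + S.ip μ' ν := by
  rw [ip, map_add, inner_add_left]; rfl
lemma ip_add_right (μ ν ν' : X →+ ℝ) : S.ip μ (ν + ν') = S.ip μ ν + S.ip μ ν' := by
  rw [ip, map_add, inner_add_right]; rfl
lemma ip_sub_left (μ μ' ν : X →+ ℝ) : S.ip (μ - μ') ν = S.ip μ ν - S.ip μ' ν := by
  rw [ip, map_sub, inner_sub_left]; rfl
lemma ip_sub_right (μ ν ν' : X →+ ℝ) : S.ip μ (ν - ν') = S.ip μ ν - S.ip μ ν' := by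
  rw [ip, map_sub, inner_sub_right]; rfl
lemma ip_smul_left (c : ℝ) (μ ν : X →+ ℝ) : S.ip (c • μ) ν = c * S.ip μ ν := by
  rw [ip, map_smul, real_inner_smul_left]; rfl
lemma ip_smul_right (c : ℝ) (μ ν : X →+ ℝ) : S.ip μ (c • ν) = c * S.ip μ ν := by
  rw [ip, map_smul, real_inner_smul_right]; rfl
lemma ip_comm (μ ν : X →+ ℝ) : S.ip μ ν = S.ip ν μ := real_inner_comm _ _

lemma ip_self (μ : X →+ ℝ) : S.ip μ μ = S.nrm μ ^ 2 := real_inner_self_eq_norm_sq _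

lemma nrm_nonneg (μ : X →+ ℝ) : 0 ≤ S.nrm μ := norm_nonneg _

lemma nrm_eq_zero {μ : X →+ ℝ} : S.nrm μ = 0 ↔ μ = 0 := by
  rw [nrm, norm_eq_zero, ← map_zero S.emb, S.emb_injective.eq_iff]

lemma ip_le (μ ν : X →+ ℝ) : S.ip μ ν ≤ S.nrm μ * S.nrm ν := real_inner_le_norm _ _

lemma ip_aact {g : S.R.Aut} (hg : g ∈ S.sym) (μ ν : X →+ ℝ) :
    S.ip (S.aact g μ) (S.aact g ν) = S.ip μ ν := by
  rw [ip_eq_sum, ip_eq_sum]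
  refine Fintype.sum_equiv (Equiv.mulLeft (⟨g, hg⟩ : S.sym)⁻¹) _ _ fun h => ?_
  refine Finset.sum_congr rfl fun x _ => ?_
  rw [aact_apply, aact_apply, smul_smul]
  rfl

lemma nrm_aact {g : S.R.Aut} (hg : g ∈ S.sym) (μ : X →+ ℝ) : S.nrm (S.aact g μ) = S.nrm μ := by
  have := S.ip_aact hg μ μ
  rw [ip_self, ip_self] at this
  exact (pow_left_inj₀ (S.nrm_nonneg _) (S.nrm_nonneg _) two_ne_zero).1 this

lemma cor_ne_zero (i : ι) : S.cor i ≠ 0 := fun h => by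
  have := DFunLike.congr_fun h (S.R.root i)
  rw [cor_apply, root_coroot'_eq_pairing, pairing_same] at this
  norm_num at this

lemma ip_cor {i : ι} (hi : i ∈ S.simple) (μ : X →+ ℝ) :
    S.ip μ (S.cor i) = μ (S.R.root i) * (S.nrm (S.cor i) ^ 2 / 2) := by
  have h := S.ip_aact (S.srefl_mem_sym hi) μ (S.cor i)
  rw [aact_cor, srefl_smul_index, cor_neg_index, aact_srefl, ip_sub_left, ip_smul_left] at h
  have hn : ∀ ν, S.ip ν (-S.cor i) = -S.ip ν (S.cor i) := fun ν => by
    rw [← neg_one_smul ℝ, ip_smul_right]; ring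
  rw [hn, hn, ip_self] at h
  linarith

lemma nrm_cor_pos (i : ι) : 0 < S.nrm (S.cor i) ^ 2 / 2 := by
  have := (S.nrm_nonneg (S.cor i)).lt_of_ne' (mt S.nrm_eq_zero.1 (S.cor_ne_zero i))
  positivity

lemma ip_cor_nonneg {i : ι} (hi : i ∈ S.simple) {μ : X →+ ℝ} :
    0 ≤ S.ip μ (S.cor i) ↔ 0 ≤ μ (S.R.root i) := by
  rw [S.ip_cor hi, mul_nonneg_iff_of_pos_right (S.nrm_cor_pos i)]

end ExtendedDatum
end AffineHecke
end

noncomputable section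
namespace AffineHecke
open scoped TensorProduct Pointwise

/-! ### The decomposition of `𝔞` in the Langlands classification -/

open BernsteinDatum RootPairing
open scoped NNReal
namespace ExtendedDatum
variable {ι X Y Γ : Type*} [AddCommGroup X] [AddCommGroup Y] [Group Γ]
variable (S : ExtendedDatum ι X Y Γ) {P Q : Set ι}

/-- The cone of nonpositive combinations of the coroots in `P`, as a subset of `𝔞`. -/
def negC (P : Set ι) : Submodule ℝ≥0 (X →+ ℝ) := Submodule.span ℝ≥0 (Set.range fun i : P => -S.cor i)

/-- The real span of the coroots in `P`. -/
def corSpan (P : Set ι) : Submodule ℝ (X →+ ℝ) := Submodule.span ℝ (Set.range fun i : P => S.cor i)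

lemma cor_mem_corSpan {i : ι} (hi : i ∈ P) : S.cor i ∈ S.corSpan P :=
  Submodule.subset_span ⟨⟨i, hi⟩, rfl⟩

lemma neg_cor_mem_negC {i : ι} (hi : i ∈ P) : -S.cor i ∈ S.negC P :=
  Submodule.subset_span ⟨⟨i, hi⟩, rfl⟩

lemma mem_corSpan_of_mem_negC {ν : X →+ ℝ} (h : ν ∈ S.negC P) : ν ∈ S.corSpan P := by
  induction h using Submodule.span_induction with
  | mem x hx => obtain ⟨i, rfl⟩ := hx; exact neg_mem (S.cor_mem_corSpan i.2)
  | zero => exact zero_mem _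
  | add x y _ _ hx hy => exact add_mem hx hy
  | smul c x _ hx => exact Submodule.smul_mem _ (c : ℝ) hx

lemma negC_mono (h : P ⊆ Q) : S.negC P ≤ S.negC Q :=
  Submodule.span_mono (by rintro _ ⟨i, rfl⟩; exact ⟨⟨i, h i.2⟩, rfl⟩)

lemma aact_mem_negC {g : S.R.Aut} (h : g • P = Q) {ν : X →+ ℝ} (hν : ν ∈ S.negC P) :
    S.aact g ν ∈ S.negC Q := by
  induction hν using Submodule.span_induction with
  | mem x hx =>
    obtain ⟨i, rfl⟩ := hx
    rw [map_neg, aact_cor]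
    exact S.neg_cor_mem_negC (h ▸ Set.smul_mem_smul_set i.2)
  | zero => rw [map_zero]; exact zero_mem _
  | add x y _ _ hx hy => rw [map_add]; exact add_mem hx hy
  | smul c x _ hx =>
    have : S.aact g (c • x) = c • S.aact g x := rfl
    rw [this]; exact Submodule.smul_mem _ c hx

variable [Finite ι]

/-- The negative cone of the Bernstein datum of `ℋ^P`, up to a map of lattices. -/
lemma mem_negC_iff {ν : X →+ ℝ} : ν ∈ S.negC P ↔
    ∃ c : P → ℝ, (∀ i, c i ≤ 0) ∧ ∀ x, ν x = ∑ᶠ i, c i * (S.R.coroot' i x : ℝ) := by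
  have := Fintype.ofFinite P
  rw [negC, Submodule.mem_span_range_iff_exists_fun]
  constructor
  · rintro ⟨c, rfl⟩
    refine ⟨fun i => -c i, fun i => by simp, fun x => ?_⟩
    rw [finsum_eq_sum_of_fintype, AddMonoidHom.finsetSum_apply]
    refine Finset.sum_congr rfl fun i _ => ?_
    change (c i : ℝ) * -(S.cor i x) = _
    rw [cor_apply]; ring
  · rintro ⟨c, hc, h⟩
    refine ⟨fun i => ⟨-c i, by linarith [hc i]⟩, ?_⟩
    ext x
    rw [h, finsum_eq_sum_of_fintype, AddMonoidHom.finsetSum_apply]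
    refine Finset.sum_congr rfl fun i _ => ?_
    change (-c i : ℝ) * -(S.cor i x) = _
    rw [cor_apply]; ring

lemma mem_negCone_upper {ν : X →+ ℝ} : ν ∈ (S.upper P).negCone ↔ ν ∈ S.negC P :=
  (S.mem_negC_iff).symm

lemma mem_negCone_lower {ν : (X ⧸ S.perp P) →+ ℝ} :
    ν ∈ (S.lower P).negCone ↔ ν.comp (QuotientAddGroup.mk' (S.perp P)) ∈ S.negC P := by
  rw [mem_negC_iff]
  refine exists_congr fun c => and_congr_right fun _ => ?_
  constructor
  · exact fun h x => h _
  · intro h x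
    obtain ⟨x, rfl⟩ := QuotientAddGroup.mk'_surjective _ x
    exact h x

/-- The sum of the positive roots takes the value `2` at every simple coroot. -/
lemma exists_rho : ∃ x : X, ∀ i ∈ S.simple, S.R.coroot' i x = 2 := by
  classical
  have := Fintype.ofFinite ι
  have := S.reduced
  refine ⟨∑ j with S.base.IsPos j, S.R.root j, fun i hi => ?_⟩
  have hi' : i ∈ S.base.support := hi
  set Φ : Finset ι := {j | S.base.IsPos j} with hΦ
  have hiΦ : i ∈ Φ := by simp [hΦ, isPos_simple hi']
  have hmaps : ∀ j ∈ Φ.erase i, srefl S.R i • j ∈ Φ.erase i := fun j hj => by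
    simp only [hΦ, Finset.mem_erase, Finset.mem_filter, Finset.mem_univ, true_and] at hj ⊢
    refine ⟨fun h => ?_, isPos_srefl_smul S.base hi' hj.2 hj.1⟩
    have h2 : j = srefl S.R i • i := by
      nth_rewrite 2 [← h]; rw [srefl_smul_smul]
    exact not_isPos_srefl_self hi' (h2 ▸ hj.2)
  have h1 : srefl S.R i • ∑ j ∈ Φ.erase i, S.R.root j = ∑ j ∈ Φ.erase i, S.R.root j := by
    rw [Finset.smul_sum]
    refine Finset.sum_nbij' (fun j => srefl S.R i • j) (fun j => srefl S.R i • j) ?_ ?_ ?_ ?_ ?_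
    · exact hmaps
    · exact hmaps
    · exact fun j _ => srefl_smul_smul i j
    · exact fun j _ => srefl_smul_smul i j
    · exact fun j _ => (root_smul S.R _ j).symm
  rw [srefl_smul, sub_eq_self] at h1
  have h2 : S.R.coroot' i (∑ j ∈ Φ.erase i, S.R.root j) = 0 := by
    have h3 := congrArg (S.R.coroot' i) h1
    rw [map_smul, root_coroot'_eq_pairing, pairing_same, map_zero, smul_eq_mul] at h3
    omega
  rw [← Finset.add_sum_erase _ _ hiΦ, map_add, h2, root_coroot'_eq_pairing, pairing_same, add_zero]

variable [Finite Γ] [Module.Finite ℤ X]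

lemma ip_nonpos (hP : P ⊆ S.simple) {η ν : X →+ ℝ} (hη : ∀ i ∈ P, 0 ≤ η (S.R.root i))
    (hν : ν ∈ S.negC P) : S.ip η ν ≤ 0 := by
  induction hν using Submodule.span_induction with
  | mem x hx =>
    obtain ⟨i, rfl⟩ := hx
    have := (S.ip_cor_nonneg (hP i.2)).2 (hη i i.2)
    change S.ip η (-S.cor i) ≤ 0
    rw [← neg_one_smul ℝ, ip_smul_right]; linarith
  | zero => rw [← zero_smul ℝ (0 : X →+ ℝ), ip_smul_right, zero_mul]
  | add x y _ _ hx hy => rw [ip_add_right]; linarith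
  | smul c x _ hx =>
    change S.ip η ((c : ℝ) • x) ≤ 0
    rw [ip_smul_right]; exact mul_nonpos_of_nonneg_of_nonpos c.2 hx

lemma ip_eq_zero (hP : P ⊆ S.simple) {μ κ : X →+ ℝ} (hμ : ∀ i ∈ P, μ (S.R.root i) = 0)
    (hκ : κ ∈ S.corSpan P) : S.ip μ κ = 0 := by
  induction hκ using Submodule.span_induction with
  | mem x hx =>
    obtain ⟨i, rfl⟩ := hx
    rw [S.ip_cor (hP i.2), hμ i i.2, zero_mul]
  | zero => rw [← zero_smul ℝ (0 : X →+ ℝ), ip_smul_right, zero_mul]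
  | add x y _ _ hx hy => rw [ip_add_right, hx, hy, add_zero]
  | smul c x _ hx => rw [ip_smul_right, hx, mul_zero]

lemma nrm_add_smul (η x : X →+ ℝ) (ε : ℝ) :
    S.nrm (η + ε • x) ^ 2 = S.nrm η ^ 2 + 2 * ε * S.ip η x + ε ^ 2 * S.nrm x ^ 2 := by
  simp only [← ip_self, ip_add_left, ip_add_right, ip_smul_left, ip_smul_right, S.ip_comm x η]
  ring

/-- The first-order condition for a minimum of the norm. -/
lemma ip_nonneg_of_min {η x : X →+ ℝ}
    (h : ∀ ε : ℝ, 0 ≤ ε → ε ≤ 1 → S.nrm η ^ 2 ≤ S.nrm (η + ε • x) ^ 2) : 0 ≤ S.ip η x := by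
  by_contra! hlt
  have h1 : ∀ ε : ℝ, 0 < ε → ε ≤ 1 → 0 ≤ 2 * S.ip η x + ε * S.nrm x ^ 2 := fun ε h0 h1 => by
    have := h ε h0.le h1
    rw [nrm_add_smul] at this
    by_contra! h2
    nlinarith
  have hx : 0 ≤ S.nrm x ^ 2 := sq_nonneg _
  set a := -S.ip η x with ha
  have hapos : 0 < a := by linarith
  have h2 := h1 (a / (a + S.nrm x ^ 2)) (by positivity) (by rw [div_le_one (by positivity)]; linarith)
  have h3 : a / (a + S.nrm x ^ 2) * S.nrm x ^ 2 ≤ a := by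
    rw [div_mul_eq_mul_div, div_le_iff₀ (by positivity)]; nlinarith
  linarith

/-- `λ = η + ν` is the decomposition in which `η` is the projection of `λ` to the cone of
`P`-dominant elements and `ν` is the one to its polar cone. -/
structure IsDec (P : Set ι) (l η ν : X →+ ℝ) : Prop where
  mem : ν ∈ S.negC P
  dominant : ∀ i ∈ P, 0 ≤ η (S.R.root i)
  orth : S.ip η ν = 0
  eq : l = η + ν

lemma continuous_nrm_sub (l : X →+ ℝ) [Fintype P] :
    Continuous fun c : P → ℝ => S.nrm (l - ∑ i, c i • -S.cor i) := by
  simp only [nrm, map_sub, map_sum, map_smul]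
  fun_prop

/-- Every element has a decomposition into a `P`-dominant part and a nonpositive combination of the
coroots in `P`. The distance to the cone `negC P` attains its minimum, because the coefficients of
an element of the cone are bounded by its value at the sum of the positive roots. -/
lemma exists_isDec (hP : P ⊆ S.simple) (l : X →+ ℝ) : ∃ η ν, S.IsDec P l η ν := by
  have := Fintype.ofFinite P
  obtain ⟨ρ, hρ⟩ := S.exists_rho
  let f : (P → ℝ) → X →+ ℝ := fun c => ∑ i, c i • -S.cor i
  have hfρ : ∀ c, f c ρ = -2 * ∑ i, c i := fun c => by
    rw [AddMonoidHom.finsetSum_apply, Finset.mul_sum]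
    refine Finset.sum_congr rfl fun i _ => ?_
    change c i * -(S.cor i ρ) = _
    rw [cor_apply, hρ i (hP i.2)]; push_cast; ring
  -- Evaluation at `ρ` is a bounded functional.
  obtain ⟨C, hC0, hC⟩ : ∃ C : ℝ, 0 ≤ C ∧ ∀ ν : X →+ ℝ, |ν ρ| ≤ C * S.nrm ν := by
    have hfd : FiniteDimensional ℝ (X →+ ℝ) := Module.Finite.of_injective S.emb S.emb_injective
    let g : LinearMap.range S.emb →ₗ[ℝ] ℝ :=
      (show (X →+ ℝ) →ₗ[ℝ] ℝ from ⟨⟨fun ν => ν ρ, fun _ _ => rfl⟩, fun _ _ => rfl⟩) ∘ₗ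
        (LinearEquiv.ofInjective S.emb S.emb_injective).symm.toLinearMap
    refine ⟨‖LinearMap.toContinuousLinearMap g‖, ContinuousLinearMap.opNorm_nonneg _, fun ν => ?_⟩
    have h := (LinearMap.toContinuousLinearMap g).le_opNorm
      (LinearEquiv.ofInjective S.emb S.emb_injective ν)
    have h2 : LinearMap.toContinuousLinearMap g (LinearEquiv.ofInjective S.emb S.emb_injective ν)
        = ν ρ := by
      change (fun ν : X →+ ℝ => ν ρ) ((LinearEquiv.ofInjective S.emb S.emb_injective).symm
        (LinearEquiv.ofInjective S.emb S.emb_injective ν)) = ν ρ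
      rw [LinearEquiv.symm_apply_apply]
    rw [h2] at h
    exact h
  let s : Set (P → ℝ) := {c | ∀ i, 0 ≤ c i}
  have hs : IsClosed s := by
    have : s = ⋂ i, {c : P → ℝ | 0 ≤ c i} := by ext; simp [s]
    rw [this]
    exact isClosed_iInter fun i => isClosed_le continuous_const (continuous_apply i)
  have hbd : ∀ c ∈ s, S.nrm (l - f c) ≤ S.nrm l → c ∈ Metric.closedBall 0 (C * S.nrm l) := by
    intro c hc h
    have h0 : 0 ≤ C * S.nrm l := mul_nonneg hC0 (S.nrm_nonneg _)
    have h1 : S.nrm (f c) ≤ 2 * S.nrm l := by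
      have : S.nrm (f c) ≤ S.nrm l + S.nrm (l - f c) := by
        have := norm_sub_le (S.emb l) (S.emb (l - f c))
        rwa [← map_sub, sub_sub_cancel] at this
      linarith
    have h2 : 2 * ∑ i, c i ≤ C * (2 * S.nrm l) := by
      have h3 := hC (f c)
      rw [hfρ, abs_mul, abs_of_nonneg (Finset.sum_nonneg fun i _ => hc i)] at h3
      norm_num at h3
      have := mul_le_mul_of_nonneg_left h1 hC0
      linarith
    rw [mem_closedBall_zero_iff, pi_norm_le_iff_of_nonneg h0]
    intro i
    rw [Real.norm_of_nonneg (hc i)]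
    have := Finset.single_le_sum (fun i _ => hc i) (Finset.mem_univ i)
    linarith
  obtain ⟨c, hc, hmin⟩ : ∃ c ∈ s, ∀ c' ∈ s, S.nrm (l - f c) ≤ S.nrm (l - f c') := by
    have hK : IsCompact (s ∩ Metric.closedBall 0 (C * S.nrm l)) :=
      (isCompact_closedBall _ _).inter_left hs
    have h0 : f 0 = 0 := by simp [f]
    have h0s : (0 : P → ℝ) ∈ s := fun i => le_rfl
    have h0K : (0 : P → ℝ) ∈ s ∩ Metric.closedBall 0 (C * S.nrm l) :=
      ⟨h0s, hbd 0 h0s (by rw [h0, sub_zero])⟩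
    obtain ⟨c, hc, hm⟩ := hK.exists_isMinOn ⟨0, h0K⟩ (S.continuous_nrm_sub l).continuousOn
    refine ⟨c, hc.1, fun c' hc' => ?_⟩
    by_cases h : S.nrm (l - f c') ≤ S.nrm l
    · exact hm ⟨hc', hbd c' hc' h⟩
    · have h1 := hm h0K
      have h2 : S.nrm (l - f c) ≤ S.nrm (l - f 0) := h1
      rw [h0, sub_zero] at h2
      linarith
  have hlin : ∀ a b (ε : ℝ), f (a + ε • b) = f a + ε • f b := fun a b ε => by
    simp only [f, Finset.smul_sum, ← Finset.sum_add_distrib]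
    refine Finset.sum_congr rfl fun i _ => ?_
    rw [Pi.add_apply, Pi.smul_apply, add_smul, smul_assoc]
  -- First variation at the minimum, in the direction `b`.
  have key : ∀ b : P → ℝ, (∀ ε : ℝ, 0 ≤ ε → ε ≤ 1 → c + ε • b ∈ s) → S.ip (l - f c) (f b) ≤ 0 := by
    intro b hb
    have := S.ip_nonneg_of_min (η := l - f c) (x := -f b) fun ε h0 h1 => by
      have h2 := hmin _ (hb ε h0 h1)
      rw [hlin] at h2
      have h3 : l - (f c + ε • f b) = l - f c + ε • -f b := by module
      rw [h3] at h2
      exact pow_le_pow_left₀ (S.nrm_nonneg _) h2 2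
    rw [← neg_one_smul ℝ, ip_smul_right] at this
    linarith
  refine ⟨l - f c, f c, ?_, ?_, ?_, (sub_add_cancel _ _).symm⟩
  · exact sum_mem fun i _ => Submodule.smul_mem _ (⟨c i, hc i⟩ : ℝ≥0) (S.neg_cor_mem_negC i.2)
  · intro i hi
    classical
    rw [← S.ip_cor_nonneg (hP hi)]
    have h := key (Pi.single ⟨i, hi⟩ 1) fun ε h0 _ j =>
      add_nonneg (hc j) (mul_nonneg h0 (by rw [Pi.single_apply]; split_ifs <;> norm_num))
    have h2 : f (Pi.single ⟨i, hi⟩ 1) = (-1 : ℝ) • S.cor i := by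
      simp only [f]
      rw [Finset.sum_eq_single_of_mem _ (Finset.mem_univ ⟨i, hi⟩)
        fun j _ hj => by rw [Pi.single_eq_of_ne hj, zero_smul], Pi.single_eq_same]
      module
    rw [h2, ip_smul_right] at h
    linarith
  · have h1 := key c fun ε h0 _ j => add_nonneg (hc j) (mul_nonneg h0 (hc j))
    have h2 := key (-c) fun ε h0 h1 j => by
      change 0 ≤ c j + ε * -c j
      nlinarith [hc j]
    have h3 : f (-c) = (-1 : ℝ) • f c := by
      simp only [f, Finset.smul_sum]
      exact Finset.sum_congr rfl fun i _ => by rw [Pi.neg_apply]; module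
    rw [h3, ip_smul_right] at h2
    linarith

lemma IsDec.unique {S : ExtendedDatum ι X Y Γ} (hP : P ⊆ S.simple) {l η ν η' ν' : X →+ ℝ}
    (h : S.IsDec P l η ν) (h' : S.IsDec P l η' ν') : η = η' := by
  have h1 : η - η' = ν' - ν := by
    have := h.eq.symm.trans h'.eq
    rw [sub_eq_sub_iff_add_eq_add, this, add_comm]
  have h2 : S.ip (η - η') (η - η') ≤ 0 := by
    nth_rewrite 2 [h1]
    rw [ip_sub_left, ip_sub_right, ip_sub_right, h.orth, h'.orth]
    have := S.ip_nonpos hP h.dominant h'.mem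
    have := S.ip_nonpos hP h'.dominant h.mem
    linarith
  rw [ip_self] at h2
  exact sub_eq_zero.1 (S.nrm_eq_zero.1 (pow_eq_zero_iff two_ne_zero |>.1
    (le_antisymm h2 (sq_nonneg _))))

/-- The dominant part of an element of `𝔞`. -/
def dom (l : X →+ ℝ) : X →+ ℝ := (S.exists_isDec subset_rfl l).choose

lemma exists_isDec_dom (l : X →+ ℝ) : ∃ ν, S.IsDec S.simple l (S.dom l) ν :=
  (S.exists_isDec subset_rfl l).choose_spec

lemma IsDec.dom_eq {S : ExtendedDatum ι X Y Γ} {l η ν : X →+ ℝ} (h : S.IsDec S.simple l η ν) :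
    S.dom l = η :=
  (S.exists_isDec_dom l).choose_spec.unique subset_rfl h

lemma posCone_nonneg {μ : X →+ ℝ} (hμ : μ ∈ S.posCone P) {i : ι} (hi : i ∈ S.simple) :
    0 ≤ μ (S.R.root i) := by
  by_cases h : i ∈ P
  · exact (hμ.1 i h).ge
  · exact (hμ.2 i ⟨hi, h⟩).le

lemma isDec_add (hP : P ⊆ S.simple) {μ ν : X →+ ℝ} (hμ : μ ∈ S.posCone P) (hν : ν ∈ S.negC P) :
    S.IsDec S.simple (μ + ν) μ ν :=
  ⟨S.negC_mono hP hν, fun _ => S.posCone_nonneg hμ,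
    S.ip_eq_zero hP hμ.1 (S.mem_corSpan_of_mem_negC hν), rfl⟩

/-- The dominant part of `μ + ν` with `μ ∈ 𝔞^{P++}` and `ν` in the cone of `P` is `μ`. -/
lemma dom_add (hP : P ⊆ S.simple) {μ ν : X →+ ℝ} (hμ : μ ∈ S.posCone P) (hν : ν ∈ S.negC P) :
    S.dom (μ + ν) = μ :=
  (S.isDec_add hP hμ hν).dom_eq

lemma dom_act (γ : Γ) (l : X →+ ℝ) : S.dom (S.aact (S.act γ) l) = S.aact (S.act γ) (S.dom l) := by
  obtain ⟨ν, h⟩ := S.exists_isDec_dom l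
  refine IsDec.dom_eq (ν := S.aact (S.act γ) ν) ⟨S.aact_mem_negC (S.act_simple γ) h.mem, ?_, ?_, ?_⟩
  · intro i hi
    have hi' : (S.act γ)⁻¹ • i ∈ S.simple := by
      rw [← map_inv, ← S.act_simple γ⁻¹]; exact Set.smul_mem_smul_set hi
    have := h.dominant _ hi'
    rwa [← S.aact_root (S.act γ), smul_inv_smul] at this
  · rw [S.ip_aact (S.act_mem_sym γ), h.orth]
  · nth_rewrite 1 [h.eq]; rw [map_add]

/-- The norm of the dominant part. -/
def size (l : X →+ ℝ) : ℝ := S.nrm (S.dom l)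

lemma size_nonneg (l : X →+ ℝ) : 0 ≤ S.size l := S.nrm_nonneg _

/-- The elements of size zero are the exponents that are allowed in tempered representations. -/
lemma size_eq_zero {l : X →+ ℝ} : S.size l = 0 ↔ l ∈ S.negC S.simple := by
  rw [size, nrm_eq_zero]
  constructor
  · intro h
    obtain ⟨ν, h1⟩ := S.exists_isDec_dom l
    rw [h1.eq, h, zero_add]; exact h1.mem
  · intro h
    refine IsDec.dom_eq (ν := l) ⟨h, fun i _ => le_rfl, ?_, (zero_add _).symm⟩
    rw [← zero_smul ℝ (0 : X →+ ℝ), ip_smul_left, zero_mul]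

/-- Against dominant test vectors, `λ` is bounded by its dominant part. -/
lemma ip_le_ip_dom (l : X →+ ℝ) {δ : X →+ ℝ} (hδ : ∀ i ∈ S.simple, 0 ≤ δ (S.R.root i)) :
    S.ip l δ ≤ S.ip (S.dom l) δ := by
  obtain ⟨ν, h⟩ := S.exists_isDec_dom l
  nth_rewrite 1 [h.eq]
  rw [ip_add_left, S.ip_comm ν]
  have := S.ip_nonpos subset_rfl hδ h.mem
  linarith

end ExtendedDatum
end AffineHecke
end

noncomputable section
namespace AffineHecke
open scoped TensorProduct Pointwise

/-! ### The weights of standard modules: estimates -/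

open BernsteinDatum RootPairing
open scoped NNReal
namespace ExtendedDatum
variable {ι X Y Γ : Type*} [AddCommGroup X] [AddCommGroup Y] [Group Γ]
variable (S : ExtendedDatum ι X Y Γ) {P Q : Set ι}
variable [Finite ι]

lemma nonneg_of_isPos {δ : X →+ ℝ} (hδ : ∀ i ∈ S.simple, 0 ≤ δ (S.R.root i)) {j : ι}
    (hj : S.base.IsPos j) : 0 ≤ δ (S.R.root j) := by
  rw [isPos_iff_mem] at hj
  generalize S.R.root j = x at hj ⊢
  induction hj using AddSubmonoid.closure_induction with
  | mem x hx => obtain ⟨i, hi, rfl⟩ := hx; exact hδ i hi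
  | zero => rw [map_zero]
  | add x y _ _ hx hy => rw [map_add]; exact add_nonneg hx hy

/-- A positive root at which `μ ∈ 𝔞^{P++}` vanishes is a nonnegative combination of `P`. -/
lemma mem_closure_of_posCone {μ : X →+ ℝ} (hμ : μ ∈ S.posCone P) {j : ι} (hj : S.base.IsPos j)
    (h : μ (S.R.root j) = 0) : S.R.root j ∈ AddSubmonoid.closure (S.R.root '' P) := by
  rw [isPos_iff_mem] at hj
  suffices H : 0 ≤ μ (S.R.root j) ∧
      (μ (S.R.root j) = 0 → S.R.root j ∈ AddSubmonoid.closure (S.R.root '' P)) from H.2 h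
  clear h
  generalize S.R.root j = x at hj ⊢
  induction hj using AddSubmonoid.closure_induction with
  | mem x hx =>
    obtain ⟨i, hi, rfl⟩ := hx
    by_cases hiP : i ∈ P
    · exact ⟨(hμ.1 i hiP).ge, fun _ => AddSubmonoid.subset_closure ⟨i, hiP, rfl⟩⟩
    · have := hμ.2 i ⟨hi, hiP⟩
      exact ⟨this.le, fun h => absurd h this.ne'⟩
  | zero => exact ⟨(map_zero μ).ge, fun _ => zero_mem _⟩
  | add x y _ _ hx hy =>
    rw [map_add]
    exact ⟨add_nonneg hx.1 hy.1, fun h => add_mem (hx.2 (by linarith [hx.1, hy.1]))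
      (hy.2 (by linarith [hx.1, hy.1]))⟩

variable [Finite Γ] [Module.Finite ℤ X]

lemma ip_aact_left {g : S.R.Aut} (hg : g ∈ S.sym) (μ ν : X →+ ℝ) :
    S.ip (S.aact g μ) ν = S.ip μ (S.aact g⁻¹ ν) := by
  rw [← S.ip_aact (inv_mem hg), ← aact_mul, inv_mul_cancel, aact_one]

/-- The weights `u t`, with `u ≠ 1` a minimal representative of a coset of `W_P` and `t` a weight of
the inducing representation, have a strictly smaller dominant part. -/
lemma size_aact_lt (hP : P ⊆ S.simple) {u : S.R.Aut} (hu : u ∈ parab S.R S.simple)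
    (hpos : ∀ i ∈ P, S.base.IsPos (u • i)) (hu1 : u ≠ 1) {μ ν : X →+ ℝ}
    (hμ : μ ∈ S.posCone P) (hν : ν ∈ S.negC P) : S.size (S.aact u (μ + ν)) < S.nrm μ := by
  have := S.reduced
  obtain ⟨ν', h⟩ := S.exists_isDec_dom (S.aact u (μ + ν))
  set δ := S.dom (S.aact u (μ + ν)) with hδ
  have hus := S.parab_le_sym hu
  have h1 : S.ip (S.aact u (μ + ν)) δ = S.nrm δ ^ 2 := by
    rw [h.eq, ip_add_left, S.ip_comm ν', h.orth, ip_self, add_zero]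
  have h2 : S.ip (S.aact u ν) δ ≤ 0 := by
    rw [S.ip_aact_left hus, S.ip_comm]
    refine S.ip_nonpos hP (fun i hi => ?_) hν
    rw [← S.aact_root u, ← aact_mul, mul_inv_cancel, aact_one]
    exact S.nonneg_of_isPos h.dominant (hpos i hi)
  rw [map_add, ip_add_left] at h1
  have h3 := S.ip_le (S.aact u μ) δ
  have h4 := S.nrm_aact hus μ
  rw [h4] at h3
  have hδ0 := S.nrm_nonneg δ
  have hμ0 := S.nrm_nonneg μ
  change S.nrm δ < S.nrm μ
  by_contra! hle
  -- Equality in the Cauchy–Schwarz estimate makes `u μ` dominant, and then `u` fixes `μ`.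
  have h5 : S.nrm (S.aact u μ - δ) ^ 2 ≤ 0 := by
    rw [← ip_self, ip_sub_left, ip_sub_right, ip_sub_right, ip_self, ip_self, h4,
      S.ip_comm δ]
    nlinarith
  have h6 : S.aact u μ = δ := sub_eq_zero.1 (S.nrm_eq_zero.1 (pow_eq_zero_iff two_ne_zero |>.1
    (le_antisymm h5 (sq_nonneg _))))
  -- A left descent of `u` gives a positive root in the span of `P` that `u` makes negative.
  obtain ⟨i, hi, hneg⟩ := exists_left_descent (b := S.base) subset_rfl hu hu1
  set j := u⁻¹ • i with hj
  have hβ : S.base.IsPos (S.R.reflectionPerm j j) := (not_isPos_iff S.base).1 hneg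
  have h7 : μ (S.R.root j) = δ (S.R.root i) := by
    rw [← h6, ← S.aact_root u, hj, smul_inv_smul]
  have h8 : μ (S.R.root (S.R.reflectionPerm j j)) = 0 := by
    have h9 := S.nonneg_of_isPos (fun i => S.posCone_nonneg hμ) hβ
    have h10 := h.dominant i hi
    rw [root_neg_index, map_neg] at h9 ⊢
    linarith
  have h9 := S.mem_closure_of_posCone hμ hβ h8
  have h10 : S.base.IsPos (u • S.R.reflectionPerm j j) := by
    rw [isPos_iff_mem, root_smul]
    clear h8
    generalize S.R.root (S.R.reflectionPerm j j) = x at h9 ⊢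
    induction h9 using AddSubmonoid.closure_induction with
    | mem x hx =>
      obtain ⟨k, hk, rfl⟩ := hx
      rw [← root_smul, ← isPos_iff_mem]; exact hpos k hk
    | zero => rw [smul_zero]; exact zero_mem _
    | add x y _ _ hx hy => rw [smul_add]; exact add_mem hx hy
  rw [isPos_smul_neg_index, hj, smul_inv_smul] at h10
  exact h10 (isPos_simple hi)

/-- An element that is maximal in the sense of its dominant part, and that differs from
`μ ∈ 𝔞^{P++}` by a combination of coroots in `P`, differs from it by a nonpositive combination. -/
lemma mem_negC_of_size_le (hP : P ⊆ S.simple) {μ l : X →+ ℝ} (hμ : μ ∈ S.posCone P)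
    (hl : l - μ ∈ S.corSpan P) (hsize : S.size l ≤ S.nrm μ) : l - μ ∈ S.negC P := by
  obtain ⟨η, ν, h⟩ := S.exists_isDec hP (l - μ)
  have hη : η ∈ S.corSpan P := by
    rw [← sub_eq_iff_eq_add.2 h.eq]
    exact sub_mem hl (S.mem_corSpan_of_mem_negC h.mem)
  have hμη := S.ip_eq_zero hP hμ.1 hη
  have hμν := S.ip_eq_zero hP hμ.1 (S.mem_corSpan_of_mem_negC h.mem)
  -- The test vector `μ + ε η` is dominant for small `ε`.
  obtain ⟨ε, hε0, hε1, hε⟩ : ∃ ε : ℝ, 0 < ε ∧ ε ≤ 1 ∧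
      ∀ i ∈ S.simple, 0 ≤ (μ + ε • η) (S.R.root i) := by
    have h1 : ∀ i ∈ S.simple, ∀ᶠ ε : ℝ in nhdsWithin 0 (Set.Ioi 0),
        0 ≤ (μ + ε • η) (S.R.root i) := by
      intro i hi
      by_cases hiP : i ∈ P
      · filter_upwards [self_mem_nhdsWithin] with ε hε
        change 0 ≤ μ (S.R.root i) + ε * η (S.R.root i)
        rw [hμ.1 i hiP, zero_add]
        exact mul_nonneg (le_of_lt hε) (h.dominant i hiP)
      · have h2 : Filter.Tendsto (fun ε : ℝ => μ (S.R.root i) + ε * η (S.R.root i))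
            (nhds 0) (nhds (μ (S.R.root i) + 0 * η (S.R.root i))) :=
          (by fun_prop : Continuous fun ε : ℝ => μ (S.R.root i) + ε * η (S.R.root i)).tendsto 0
        rw [zero_mul, add_zero] at h2
        have h3 : ∀ᶠ ε : ℝ in nhdsWithin 0 (Set.Ioi 0), 0 < μ (S.R.root i) + ε * η (S.R.root i) :=
          (h2.mono_left nhdsWithin_le_nhds).eventually_const_lt (hμ.2 i ⟨hi, hiP⟩)
        filter_upwards [h3] with ε hε using hε.le
    have h4 : ∀ᶠ ε : ℝ in nhdsWithin 0 (Set.Ioi 0), ∀ i ∈ S.simple,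
        0 ≤ (μ + ε • η) (S.R.root i) :=
      (Filter.eventually_all_finite (Set.toFinite S.simple)).2 h1
    have h5 : ∀ᶠ ε : ℝ in nhdsWithin 0 (Set.Ioi 0), ε ≤ 1 :=
      nhdsWithin_le_nhds (Iic_mem_nhds one_pos)
    obtain ⟨ε, h6, h7, h8⟩ := (h4.and (h5.and self_mem_nhdsWithin)).exists
    exact ⟨ε, h8, h7, h6⟩
  have h1 := S.ip_le_ip_dom l hε
  have h2 := S.ip_le (S.dom l) (μ + ε • η)
  have h3 : S.ip l (μ + ε • η) = S.nrm μ ^ 2 + ε * S.nrm η ^ 2 := by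
    have h4 : l = μ + (η + ν) := by rw [← h.eq]; abel
    rw [h4]
    simp only [ip_add_left, ip_add_right, ip_smul_right, ip_self, S.ip_comm η μ, S.ip_comm ν,
      hμη, hμν, h.orth]
    ring
  have h4 := S.nrm_add_smul μ η ε
  rw [hμη] at h4
  set a := S.nrm μ
  set b := S.nrm η with hb
  set d := S.nrm (μ + ε • η)
  have ha : 0 ≤ a := S.nrm_nonneg _
  have hd : 0 ≤ d := S.nrm_nonneg _
  have h5 : a ^ 2 + ε * b ^ 2 ≤ a * d := by
    have : S.nrm (S.dom l) * d ≤ a * d := mul_le_mul_of_nonneg_right hsize hd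
    linarith
  have h6 : (a ^ 2 + ε * b ^ 2) ^ 2 ≤ a ^ 2 * (a ^ 2 + ε ^ 2 * b ^ 2) := by
    have := pow_le_pow_left₀ (by positivity) h5 2
    rw [mul_pow, h4] at this
    linarith
  have h7 : b = 0 := by
    by_contra hb0
    have hb2 : 0 < b ^ 2 := by positivity
    have h8 : 0 < (ε * b ^ 2) ^ 2 := by positivity
    have h9 : a ^ 2 * (ε ^ 2 * b ^ 2) ≤ a ^ 2 * (ε * b ^ 2) := by
      refine mul_le_mul_of_nonneg_left (mul_le_mul_of_nonneg_right ?_ hb2.le) (sq_nonneg a)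
      nlinarith
    have h10 : 0 ≤ a ^ 2 * (ε * b ^ 2) := by positivity
    nlinarith
  rw [h.eq, S.nrm_eq_zero.1 h7, zero_add]
  exact h.mem

/-! ### Averaging over a parabolic subgroup -/

omit [Finite Γ] [Module.Finite ℤ X]

lemma mem_perp_of_fixed {x : X} (h : ∀ w ∈ parab S.R P, w • x = x) :
    x ∈ S.perp P := by
  intro i hi
  have h1 := h _ (srefl_mem_parab hi)
  rw [srefl_smul, sub_eq_self] at h1
  have h3 := congrArg (S.R.coroot' i) h1
  rw [map_smul, root_coroot'_eq_pairing, pairing_same, map_zero, smul_eq_mul] at h3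
  omega

lemma fixed_of_mem_perp {x : X} (h : x ∈ S.perp P) {w : S.R.Aut} (hw : w ∈ parab S.R P) :
    w • x = x := by
  induction hw using Subgroup.closure_induction with
  | mem g hg => obtain ⟨i, hi, rfl⟩ := hg; rw [srefl_smul, h i hi, zero_smul, sub_zero]
  | one => exact one_smul _ x
  | mul g g' _ _ h1 h2 => rw [mul_smul, h2, h1]
  | inv g _ h1 => nth_rewrite 1 [← h1]; rw [inv_smul_smul]

lemma sub_aact_mem_corSpan (κ : X →+ ℝ) {w : S.R.Aut} (hw : w ∈ parab S.R P) :
    κ - S.aact w κ ∈ S.corSpan P := by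
  induction hw using Subgroup.closure_induction generalizing κ with
  | mem g hg =>
    obtain ⟨i, hi, rfl⟩ := hg
    rw [aact_srefl, sub_sub_cancel]
    exact Submodule.smul_mem _ _ (S.cor_mem_corSpan hi)
  | one => rw [aact_one, sub_self]; exact zero_mem _
  | mul g g' _ _ h1 h2 =>
    rw [aact_mul, ← sub_add_sub_cancel _ (S.aact g' κ)]
    exact add_mem (h2 κ) (h1 _)
  | inv g _ h1 =>
    have := h1 (S.aact g⁻¹ κ)
    rw [← aact_mul, mul_inv_cancel, aact_one] at this
    rw [← neg_sub]; exact neg_mem this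

lemma aact_eq_self {κ : X →+ ℝ} (h : ∀ i ∈ P, κ (S.R.root i) = 0) {w : S.R.Aut}
    (hw : w ∈ parab S.R P) : S.aact w κ = κ := by
  induction hw using Subgroup.closure_induction with
  | mem g hg => obtain ⟨i, hi, rfl⟩ := hg; rw [aact_srefl, h i hi, zero_smul, sub_zero]
  | one => exact S.aact_one κ
  | mul g g' _ _ h1 h2 => rw [aact_mul, h2, h1]
  | inv g _ h1 => nth_rewrite 1 [← h1]; rw [← aact_mul, inv_mul_cancel, aact_one]

/-- The sum over the orbit of `x` under `W_P`. -/
def orbitSum (P : Set ι) (x : X) : X := ∑ᶠ w : parab S.R P, (w : S.R.Aut) • x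

lemma smul_orbitSum (hP : P ⊆ S.simple) {w : S.R.Aut} (hw : w ∈ parab S.R P) (x : X) :
    w • S.orbitSum P x = S.orbitSum P x ∧ S.orbitSum P (w • x) = S.orbitSum P x := by
  have := S.reduced
  have := finite_parab (R := S.R) hP
  have := Fintype.ofFinite (parab S.R P)
  simp only [orbitSum, finsum_eq_sum_of_fintype, Finset.smul_sum, smul_smul]
  exact ⟨Equiv.sum_comp (Equiv.mulLeft (⟨w, hw⟩ : parab S.R P)) fun g => (g : S.R.Aut) • x,
    Equiv.sum_comp (Equiv.mulRight (⟨w, hw⟩ : parab S.R P)) fun g => (g : S.R.Aut) • x⟩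

lemma map_orbitSum (hP : P ⊆ S.simple) {A : Type*} [AddCommGroup A] (f : X →+ A) (x : X) {a : A}
    (h : ∀ w ∈ parab S.R P, f (w • x) = a) :
    f (S.orbitSum P x) = Nat.card (parab S.R P) • a := by
  have := S.reduced
  have := finite_parab (R := S.R) hP
  have := Fintype.ofFinite (parab S.R P)
  rw [orbitSum, finsum_eq_sum_of_fintype, map_sum,
    Finset.sum_congr rfl fun w _ => h _ (Subtype.prop w), Finset.sum_const, Finset.card_univ, Nat.card_eq_fintype_card]

lemma card_parab_ne_zero (hP : P ⊆ S.simple) : Nat.card (parab S.R P) ≠ 0 := by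
  have := S.reduced
  have := finite_parab (R := S.R) hP
  exact Nat.card_pos.ne'

lemma orbitSum_mem_perp (hP : P ⊆ S.simple) (x : X) : S.orbitSum P x ∈ S.perp P :=
  S.mem_perp_of_fixed fun _ hw => (S.smul_orbitSum hP hw x).1

lemma mem_corSpan_of_perp (hP : P ⊆ S.simple) {κ : X →+ ℝ} (h : ∀ x ∈ S.perp P, κ x = 0) :
    κ ∈ S.corSpan P := by
  have := S.reduced
  have := finite_parab (R := S.R) hP
  have := Fintype.ofFinite (parab S.R P)
  have h1 : ∑ w : parab S.R P, S.aact w κ = 0 := by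
    ext x
    rw [AddMonoidHom.finsetSum_apply]
    simp only [aact_apply]
    rw [AddMonoidHom.zero_apply, ← h _ (S.orbitSum_mem_perp hP x), orbitSum,
      finsum_eq_sum_of_fintype, map_sum]
    exact Equiv.sum_comp (Equiv.inv (parab S.R P)) fun g => κ ((g : S.R.Aut) • x)
  have h2 : ∑ w : parab S.R P, (κ - S.aact w κ) ∈ S.corSpan P :=
    sum_mem fun w _ => S.sub_aact_mem_corSpan κ w.2
  rw [Finset.sum_sub_distrib, h1, sub_zero, Finset.sum_const, Finset.card_univ,
    ← Nat.cast_smul_eq_nsmul ℝ] at h2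
  exact (Submodule.smul_mem_iff _ (by simp)).1 h2

lemma eq_zero_of_perp (hP : P ⊆ S.simple) {κ : X →+ ℝ} (h : ∀ x ∈ S.perp P, κ x = 0)
    (h' : ∀ i ∈ P, κ (S.R.root i) = 0) : κ = 0 := by
  ext x
  have h1 := S.map_orbitSum hP κ x (a := κ x) fun w hw => by
    rw [← inv_inv w, ← aact_apply, S.aact_eq_self h' (inv_mem hw)]
  rw [h _ (S.orbitSum_mem_perp hP x), eq_comm, smul_eq_zero] at h1
  exact h1.resolve_left (S.card_parab_ne_zero hP)

/-- `(X ∩ (P^∨)^⊥) ∩ ℚ P = 0`. -/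
lemma eq_zero_of_mem_perp (hP : P ⊆ S.simple) {x : X} (h : x ∈ S.perp P) {n : ℤ} (hn : n ≠ 0)
    (hx : n • x ∈ AddSubgroup.closure (S.R.root '' P)) : x = 0 := by
  have := S.isAddTorsionFree
  have h1 : ∀ y ∈ AddSubgroup.closure (S.R.root '' P), S.orbitSum P y = 0 := by
    have := S.reduced
    have := finite_parab (R := S.R) hP
    have := Fintype.ofFinite (parab S.R P)
    intro y hy
    have hadd : ∀ y z, S.orbitSum P (y + z) = S.orbitSum P y + S.orbitSum P z := fun y z => by
      simp only [orbitSum, finsum_eq_sum_of_fintype, smul_add, Finset.sum_add_distrib]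
    have hz : S.orbitSum P 0 = 0 := by
      have := hadd 0 0; rwa [add_zero, left_eq_add] at this
    induction hy using AddSubgroup.closure_induction with
    | mem y hy =>
      obtain ⟨i, hi, rfl⟩ := hy
      have h2 := (S.smul_orbitSum hP (srefl_mem_parab hi) (S.R.root i)).2
      have h3 : srefl S.R i • S.R.root i = -S.R.root i := by
        rw [← root_smul, srefl_smul_index, root_neg_index]
      have h4 := hadd (S.R.root i) (-S.R.root i)
      rw [← h3, h2, h3, add_neg_cancel, hz, ← two_nsmul] at h4
      exact (smul_eq_zero.1 h4.symm).resolve_left two_ne_zero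
    | zero => exact hz
    | add y z _ _ h2 h3 => rw [hadd, h2, h3, add_zero]
    | neg y _ h2 =>
      have := hadd y (-y)
      rwa [add_neg_cancel, hz, h2, zero_add, eq_comm] at this
  have h2 := S.map_orbitSum hP (AddMonoidHom.id X) (n • x) (a := n • x) fun w hw => by
    rw [smul_comm, S.fixed_of_mem_perp h hw]; rfl
  rw [AddMonoidHom.id_apply, h1 _ hx, eq_comm, smul_eq_zero] at h2
  have := h2.resolve_left (S.card_parab_ne_zero hP)
  exact (smul_eq_zero.1 this).resolve_left hn

end ExtendedDatum
end AffineHecke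
end

noncomputable section
namespace AffineHecke
open scoped TensorProduct Pointwise

/-! ### Generalities on representations -/

section RepTheory

variable {A : Type*} [CommRing A] [Algebra ℂ A] {B : Type*} [Ring B] [Algebra ℂ B]
variable {V : Type*} [AddCommGroup V] [Module ℂ V] {W : Type*} [AddCommGroup W] [Module ℂ W]
variable {Z : Type*} [AddCommGroup Z] [Module ℂ Z]

/-- Homomorphisms of representations. -/
def Equivariant (π : B →ₐ[ℂ] Module.End ℂ V) (σ : B →ₐ[ℂ] Module.End ℂ W) (F : V →ₗ[ℂ] W) : Prop :=
  ∀ b v, F (π b v) = σ b (F v)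

variable {π : B →ₐ[ℂ] Module.End ℂ V} {σ : B →ₐ[ℂ] Module.End ℂ W} {τ : B →ₐ[ℂ] Module.End ℂ Z}

lemma RepEquiv.symm (h : RepEquiv π σ) : RepEquiv σ π := by
  obtain ⟨e, he⟩ := h
  exact ⟨e.symm, fun b v => by rw [LinearEquiv.symm_apply_eq, he, e.apply_symm_apply]⟩

lemma RepEquiv.trans (h : RepEquiv π σ) (h' : RepEquiv σ τ) : RepEquiv π τ := by
  obtain ⟨e, he⟩ := h
  obtain ⟨f, hf⟩ := h'
  exact ⟨e.trans f, fun b v => by rw [LinearEquiv.trans_apply, he, hf, LinearEquiv.trans_apply]⟩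

lemma Equivariant.comap {F : V →ₗ[ℂ] W} (hF : Equivariant π σ F) {U : Submodule ℂ W}
    (hU : IsInvariant σ U) : IsInvariant π (U.comap F) := fun b v hv => by
  rw [Submodule.mem_comap, hF]; exact hU b _ hv

lemma Equivariant.map {F : V →ₗ[ℂ] W} (hF : Equivariant π σ F) {U : Submodule ℂ V}
    (hU : IsInvariant π U) : IsInvariant σ (U.map F) := by
  rintro b _ ⟨v, hv, rfl⟩
  exact ⟨π b v, hU b v hv, hF b v⟩

lemma isInvariant_bot : IsInvariant π ⊥ := fun b v hv => by
  rw [Submodule.mem_bot] at hv ⊢; rw [hv, map_zero]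

lemma isInvariant_top : IsInvariant π ⊤ := fun _ _ _ => Submodule.mem_top

lemma IsInvariant.inf {U U' : Submodule ℂ V} (h : IsInvariant π U) (h' : IsInvariant π U') :
    IsInvariant π (U ⊓ U') := fun b v hv => ⟨h b v hv.1, h' b v hv.2⟩

lemma IsInvariant.iSup {κ : Sort*} {U : κ → Submodule ℂ V} (h : ∀ k, IsInvariant π (U k)) :
    IsInvariant π (⨆ k, U k) := fun b => by
  change (⨆ k, U k) ≤ (⨆ k, U k).comap (π b)
  exact iSup_le fun k v hv => Submodule.mem_iSup_of_mem k (h k b v hv)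

lemma IsInvariant.sup {U U' : Submodule ℂ V} (h : IsInvariant π U) (h' : IsInvariant π U') :
    IsInvariant π (U ⊔ U') := fun b => by
  change U ⊔ U' ≤ (U ⊔ U').comap (π b)
  exact sup_le (fun v hv => Submodule.mem_sup_left (h b v hv))
    fun v hv => Submodule.mem_sup_right (h' b v hv)

lemma Equivariant.ker {F : V →ₗ[ℂ] W} (hF : Equivariant π σ F) : IsInvariant π (LinearMap.ker F) :=
  hF.comap isInvariant_bot

lemma Equivariant.range {F : V →ₗ[ℂ] W} (hF : Equivariant π σ F) :
    IsInvariant σ (LinearMap.range F) := by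
  rw [LinearMap.range_eq_map]; exact hF.map isInvariant_top

lemma IsIrred.injective {F : V →ₗ[ℂ] W} (hF : Equivariant π σ F) (h : IsIrred π) (h0 : F ≠ 0) :
    Function.Injective F := by
  rw [← LinearMap.ker_eq_bot]
  exact (h.2 _ hF.ker).resolve_right fun h' => h0 (LinearMap.ker_eq_top.1 h')

lemma IsIrred.surjective {F : V →ₗ[ℂ] W} (hF : Equivariant π σ F) (h : IsIrred σ) (h0 : F ≠ 0) :
    Function.Surjective F := by
  rw [← LinearMap.range_eq_top]
  exact (h.2 _ hF.range).resolve_left fun h' => h0 (LinearMap.range_eq_bot.1 h')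

lemma IsIrred.of_repEquiv (h : IsIrred π) (h' : RepEquiv π σ) : IsIrred σ := by
  obtain ⟨e, he⟩ := h'
  have := h.1
  refine ⟨e.symm.toEquiv.nontrivial, fun U hU => ?_⟩
  have he' : Equivariant π σ e.toLinearMap := he
  rcases h.2 _ (he'.comap hU) with h1 | h1
  · left
    rw [eq_bot_iff]
    intro w hw
    have : e.symm w ∈ U.comap e.toLinearMap := by
      change e (e.symm w) ∈ U; rwa [e.apply_symm_apply]
    rw [h1, Submodule.mem_bot] at this
    rw [Submodule.mem_bot, ← e.apply_symm_apply w, this, map_zero]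
  · right
    rw [eq_top_iff]
    intro w _
    have : e.symm w ∈ U.comap e.toLinearMap := h1 ▸ Submodule.mem_top
    change e (e.symm w) ∈ U at this
    rwa [e.apply_symm_apply] at this

/-- Pulling back along a surjective homomorphism of algebras preserves irreducibility. -/
lemma IsIrred.comp {C : Type*} [Ring C] [Algebra ℂ C] (h : IsIrred π) {f : C →ₐ[ℂ] B}
    (hf : Function.Surjective f) : IsIrred (π.comp f) :=
  ⟨h.1, fun U hU => h.2 U fun b v hv => by obtain ⟨c, rfl⟩ := hf b; exact hU c v hv⟩

/-- The restriction of a representation to an invariant subspace. -/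
def subRep (π : B →ₐ[ℂ] Module.End ℂ V) (U : Submodule ℂ V) (hU : IsInvariant π U) :
    B →ₐ[ℂ] Module.End ℂ U :=
  AlgHom.ofLinearMap
    { toFun := fun b => (π b).restrict (hU b)
      map_add' := fun a b => by ext v; simp
      map_smul' := fun c a => by ext v; simp }
    (by ext v; simp)
    (fun a b => by ext v; simp)

@[simp] lemma coe_subRep {U : Submodule ℂ V} (hU : IsInvariant π U) (b : B) (u : U) :
    (subRep π U hU b u : V) = π b u := rfl

lemma equivariant_subtype {U : Submodule ℂ V} (hU : IsInvariant π U) :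
    Equivariant (subRep π U hU) π U.subtype := fun _ _ => rfl

lemma equivariant_mkQ {U : Submodule ℂ V} (hU : IsInvariant π U) :
    Equivariant π (quotRep π U hU) U.mkQ := fun _ _ => rfl

/-- A nonzero invariant subspace of finite dimension contains an irreducible one. -/
lemma exists_irred_sub [FiniteDimensional ℂ V] {E : Submodule ℂ V} (hE : IsInvariant π E)
    (h0 : E ≠ ⊥) : ∃ U ≤ E, ∃ hU : IsInvariant π U, IsIrred (subRep π U hU) := by
  let s : Set (Submodule ℂ V) := {U | U ≤ E ∧ U ≠ ⊥ ∧ IsInvariant π U}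
  obtain ⟨U, ⟨h1, h2, h3⟩, hmin⟩ := wellFounded_lt.has_min s ⟨E, le_rfl, h0, hE⟩
  refine ⟨U, h1, h3, Submodule.nontrivial_iff_ne_bot.2 h2, fun U' hU' => ?_⟩
  have h4 : IsInvariant π (U'.map U.subtype) := (equivariant_subtype h3).map hU'
  have h5 : U'.map U.subtype ≤ U := Submodule.map_subtype_le _ _
  by_cases h6 : U' = ⊥
  · exact Or.inl h6
  · right
    have h7 : U'.map U.subtype ≠ ⊥ := fun h => h6
      (Submodule.map_injective_of_injective U.injective_subtype (h.trans (Submodule.map_bot _).symm))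
    have h8 : U'.map U.subtype = U := by
      by_contra hne
      exact hmin _ ⟨h5.trans h1, h7, h4⟩ (lt_of_le_of_ne h5 hne)
    rw [eq_top_iff]
    intro u _
    have : (u : V) ∈ U'.map U.subtype := h8.symm ▸ u.2
    obtain ⟨u', hu', h9⟩ := this
    rwa [← Subtype.ext h9]

/-- Schur's lemma. -/
lemma IsIrred.exists_scalar [FiniteDimensional ℂ V] (h : IsIrred π) (T : Module.End ℂ V)
    (hT : Equivariant π π T) : ∃ c : ℂ, ∀ v, T v = c • v := by
  have := h.1
  obtain ⟨c, hc⟩ := Module.End.exists_eigenvalue T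
  refine ⟨c, fun v => ?_⟩
  have h1 : IsInvariant π (Module.End.eigenspace T c) := fun b v hv => by
    rw [Module.End.mem_eigenspace_iff] at hv ⊢
    rw [hT, hv, map_smul]
  have h2 := (h.2 _ h1).resolve_left hc
  exact Module.End.mem_eigenspace_iff.1 (h2 ▸ Submodule.mem_top)

/-! ### Weights of representations of commutative algebras -/

/-- `v` is a nonzero eigenvector with eigencharacter `χ`. -/
def IsEigen (ρ : A →ₐ[ℂ] Module.End ℂ V) (χ : A →ₐ[ℂ] ℂ) (v : V) : Prop :=
  v ≠ 0 ∧ ∀ a, ρ a v = χ a • v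

lemma exists_isEigen [FiniteDimensional ℂ V] [Nontrivial V] (ρ : A →ₐ[ℂ] Module.End ℂ V) :
    ∃ χ v, IsEigen ρ χ v := by
  obtain ⟨U, -, hU, hirr⟩ := exists_irred_sub (π := ρ) isInvariant_top top_ne_bot
  have h1 : ∀ a, ∃ c : ℂ, ∀ u : U, subRep ρ U hU a u = c • u := fun a =>
    hirr.exists_scalar _ fun b v => by
      rw [← Module.End.mul_apply, ← Module.End.mul_apply, ← map_mul, ← map_mul, mul_comm]
  choose c hc using h1
  have := hirr.1
  obtain ⟨u, hu⟩ := exists_ne (0 : U)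
  have key : ∀ {a b : ℂ}, a • u = b • u → a = b := fun h => smul_left_injective ℂ hu h
  refine ⟨AlgHom.ofLinearMap
    { toFun := c
      map_add' := fun a b => key (by rw [← hc, map_add, add_smul, ← hc, ← hc]; rfl)
      map_smul' := fun z a => key (by
        rw [← hc, map_smul, RingHom.id_apply, smul_assoc, ← hc]; rfl) }
    (key (by change c 1 • u = _; rw [← hc, map_one, one_smul]; rfl))
    (fun a b => key (by
      change c (a * b) • u = (c a * c b) • u
      rw [← hc, map_mul, Module.End.mul_apply, hc, hc, smul_comm, smul_smul, mul_comm])),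
    u, by simpa using hu, fun a => congrArg Subtype.val (hc a u)⟩

/-- An eigenvector modulo a proper subspace yields an eigenvector. Some `r ≡ 1` modulo
the kernel `m` of the character kills the intersection of all `m^k V`, so that the product of `r`
and the given vector generates a module that is killed by a power of `m`. -/
lemma exists_isEigen_of_quotient [FiniteDimensional ℂ V] (ρ : A →ₐ[ℂ] Module.End ℂ V)
    (χ : A →ₐ[ℂ] ℂ) {N : Submodule ℂ V} {v : V} (hv : v ∉ N)
    (h : ∀ a, ρ a v - χ a • v ∈ N) : ∃ w, IsEigen ρ χ w := by
  let _ : Module A V := Module.compHom V (ρ : A →+* Module.End ℂ V)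
  have hsm : ∀ (a : A) (v : V), a • v = ρ a v := fun _ _ => rfl
  have : IsScalarTower ℂ A V := ⟨fun c a v => by rw [hsm, hsm, map_smul]; rfl⟩
  have : IsArtinian A V := isArtinian_of_tower ℂ inferInstance
  have : IsNoetherian A V := isNoetherian_of_tower ℂ inferInstance
  let m : Ideal A := RingHom.ker χ
  have hmono : ∀ i j : ℕ, i ≤ j → m ^ j • (⊤ : Submodule A V) ≤ m ^ i • (⊤ : Submodule A V) :=
    fun i j hij => Submodule.smul_mono_left (Ideal.pow_le_pow_right hij)
  obtain ⟨k, hk⟩ := IsArtinian.monotone_stabilizes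
    (⟨fun k => OrderDual.toDual (m ^ k • (⊤ : Submodule A V)), fun i j hij => hmono i j hij⟩ :
      ℕ →o (Submodule A V)ᵒᵈ)
  have hk1 : m ^ k • (⊤ : Submodule A V) ≤ m • (m ^ k • (⊤ : Submodule A V)) := by
    have h1 : m ^ k • (⊤ : Submodule A V) = m ^ (k + 1) • (⊤ : Submodule A V) :=
      hk (k + 1) (Nat.le_succ k)
    rw [← mul_smul, ← pow_succ', ← h1]
  obtain ⟨r, hr1, hr2⟩ := Submodule.exists_sub_one_mem_and_smul_eq_zero_of_fg_of_le_smul m _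
    (IsNoetherian.noetherian _) hk1
  have hχr : χ r = 1 := by
    have : χ (r - 1) = 0 := hr1
    rwa [map_sub, map_one, sub_eq_zero] at this
  set u := r • v with hu
  have hu0 : u ≠ 0 := fun h0 => hv (by
    have h1 := h r
    rw [hχr, one_smul, ← hsm, ← hu, h0, zero_sub] at h1
    simpa using N.neg_mem h1)
  have hex : ∃ k, ∀ b ∈ m ^ k, b • u = 0 := ⟨k, fun b hb => by
    rw [hu, smul_comm]
    exact hr2 _ (Submodule.smul_mem_smul hb Submodule.mem_top)⟩
  classical
  obtain ⟨j, hj⟩ : ∃ j, Nat.find hex = j + 1 := Nat.exists_eq_succ_of_ne_zero fun h0 => by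
    have := Nat.find_spec hex 1 (by rw [h0, pow_zero, Ideal.one_eq_top]; trivial)
    rw [one_smul] at this
    exact hu0 this
  have h1 := Nat.find_min hex (m := j) (by omega)
  push Not at h1
  obtain ⟨b, hb, hb0⟩ := h1
  refine ⟨b • u, hb0, fun a => ?_⟩
  have h2 : a - algebraMap ℂ A (χ a) ∈ m := by
    change χ (a - algebraMap ℂ A (χ a)) = 0
    rw [map_sub, AlgHom.commutes]; simp
  have h3 := Nat.find_spec hex ((a - algebraMap ℂ A (χ a)) * b)
    (by rw [hj, pow_succ']; exact Ideal.mul_mem_mul h2 hb)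
  rw [mul_smul, sub_smul, algebraMap_smul, sub_eq_zero] at h3
  exact h3

/-- An eigenvector, modulo a subspace `N`, in the image of a map that is equivariant
modulo `N` yields an eigenvector in the source of the map. -/
lemma exists_isEigen_of_map [FiniteDimensional ℂ V] {ρ : A →ₐ[ℂ] Module.End ℂ V}
    {ρ' : A →ₐ[ℂ] Module.End ℂ W} {χ : A →ₐ[ℂ] ℂ} {N : Submodule ℂ W}
    (G : V →ₗ[ℂ] W) (hG : ∀ a v, G (ρ a v) - ρ' a (G v) ∈ N) {v : V} (hv : G v ∉ N)
    (h : ∀ a, ρ' a (G v) - χ a • G v ∈ N) : ∃ w, IsEigen ρ χ w := by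
  refine exists_isEigen_of_quotient ρ χ (N := N.comap G) hv fun a => ?_
  have := add_mem (hG a v) (h a)
  rw [sub_add_sub_cancel] at this
  rwa [Submodule.mem_comap, map_sub, map_smul]

/-! ### Finite dimension of irreducible representations -/

/-- An irreducible representation of an algebra that is finitely generated as a module over a
commutative algebra of finite type has finite dimension. -/
lemma IsIrred.finiteDimensional [Algebra.FiniteType ℂ A] (i : A →ₐ[ℂ] B) {κ : Type*} [Finite κ]
    (b : κ → B) (hb : ∀ x, x ∈ Submodule.span ℂ {z | ∃ a k, z = i a * b k})
    (h : IsIrred π) : FiniteDimensional ℂ V := by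
  have := h.1
  obtain ⟨v₀, hv₀⟩ := exists_ne (0 : V)
  let _ : Module A V := Module.compHom V (π.comp i : A →+* Module.End ℂ V)
  have hsm : ∀ (a : A) (v : V), a • v = π (i a) v := fun _ _ => rfl
  have : IsScalarTower ℂ A V := ⟨fun c a v => by rw [hsm, hsm, map_smul, map_smul]; rfl⟩
  have hspan : ∀ v (U : Submodule A V), (∀ k, π (b k) v ∈ U) → ∀ x, π x v ∈ U := by
    intro v U hU x
    have := hb x
    induction this using Submodule.span_induction with
    | mem x hx =>
      obtain ⟨a, k, rfl⟩ := hx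
      rw [map_mul]; exact U.smul_mem a (hU k)
    | zero => rw [map_zero]; exact U.zero_mem
    | add x y _ _ hx hy => rw [map_add]; exact U.add_mem hx hy
    | smul c x _ hx => rw [map_smul]; exact (U.restrictScalars ℂ).smul_mem c hx
  have hfin : Module.Finite A V := by
    refine ⟨Submodule.fg_def.2 ⟨Set.range fun k => π (b k) v₀, Set.finite_range _, ?_⟩⟩
    rw [eq_top_iff]
    intro v _
    let U : Submodule ℂ V :=
      { carrier := {v | ∃ x, π x v₀ = v}
        add_mem' := by rintro _ _ ⟨x, rfl⟩ ⟨y, rfl⟩; exact ⟨x + y, by simp⟩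
        zero_mem' := ⟨0, by simp⟩
        smul_mem' := by rintro c _ ⟨x, rfl⟩; exact ⟨c • x, by simp⟩ }
    have hU : IsInvariant π U := by
      rintro y _ ⟨x, rfl⟩; exact ⟨y * x, by simp⟩
    have hU1 : U = ⊤ := (h.2 U hU).resolve_left fun h1 => hv₀ (by
      have : v₀ ∈ U := ⟨1, by simp⟩
      rwa [h1] at this)
    obtain ⟨x, rfl⟩ : v ∈ U := hU1 ▸ Submodule.mem_top
    exact hspan v₀ (Submodule.span A (Set.range fun k => π (b k) v₀))
      (fun k => Submodule.subset_span (Set.mem_range_self k)) x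
  obtain ⟨M, hM, -⟩ := IsCoatomic.eq_top_or_exists_le_coatom (⊥ : Submodule A V) |>.resolve_left bot_ne_top
  have hsimp : IsSimpleModule A (V ⧸ M) := isSimpleModule_iff_isCoatom.2 hM
  have hQ : FiniteDimensional ℂ (V ⧸ M) := by
    obtain ⟨I, hI, ⟨e⟩⟩ := isSimpleModule_iff_quot_maximal.1 hsimp
    let _ : Field (A ⧸ I) := Ideal.Quotient.field I
    have : Algebra.FiniteType ℂ (A ⧸ I) := inferInstance
    have : Module.Finite ℂ (A ⧸ I) := finite_of_finite_type_of_isJacobsonRing ℂ (A ⧸ I)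
    exact Module.Finite.equiv (e.restrictScalars ℂ).symm
  have := Fintype.ofFinite κ
  let F : V →ₗ[ℂ] (κ → V ⧸ M) := LinearMap.pi fun k => (M.mkQ.restrictScalars ℂ) ∘ₗ π (b k)
  have hF : ∀ v, F v = 0 → ∀ x, π x v ∈ M := fun v hv => hspan v M fun k => by
    have := congrFun hv k
    exact (Submodule.Quotient.mk_eq_zero M).1 this
  refine Module.Finite.of_injective F (LinearMap.ker_eq_bot.1 ?_)
  refine (h.2 _ fun y v hv => ?_).resolve_right fun h1 => hM.1 ?_
  · rw [LinearMap.mem_ker] at hv ⊢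
    ext k
    change M.mkQ (π (b k) (π y v)) = 0
    rw [Submodule.mkQ_apply, Submodule.Quotient.mk_eq_zero, ← Module.End.mul_apply, ← map_mul]
    exact hF v hv _
  · rw [eq_top_iff]
    intro v _
    have := hF v (LinearMap.mem_ker.1 (h1 ▸ Submodule.mem_top)) 1
    simpa using this

/-! ### Unique irreducible quotients -/

lemma le_radical {U : Submodule ℂ V} (hU : IsInvariant π U) (h : U ≠ ⊤) : U ≤ radical π :=
  le_sSup ⟨hU, h⟩

/-- When the sum of the proper invariant subspaces is proper, its quotient is the unique irreducible
quotient. -/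
lemma hasUniqueIrredQuotient_of_radical_ne_top (h : radical π ≠ ⊤) : HasUniqueIrredQuotient π := by
  constructor
  · refine ⟨Submodule.Quotient.nontrivial_iff.2 h, fun U hU => ?_⟩
    by_cases h1 : U.comap (radical π).mkQ = ⊤
    · right
      rw [← Submodule.map_comap_eq_of_surjective (radical π).mkQ_surjective U, h1,
        Submodule.map_top, Submodule.range_mkQ]
    · left
      have h2 := le_radical ((equivariant_mkQ (isInvariant_radical π)).comap hU) h1
      rw [eq_bot_iff]
      intro x hx
      obtain ⟨v, rfl⟩ := (radical π).mkQ_surjective x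
      rw [Submodule.mem_bot, Submodule.mkQ_apply, Submodule.Quotient.mk_eq_zero]
      exact h2 hx
  · intro U hU hirr
    have hne : U ≠ ⊤ := Submodule.Quotient.nontrivial_iff.1 hirr.1
    refine le_antisymm (le_radical hU hne) ?_
    rcases hirr.2 _ ((equivariant_mkQ hU).map (isInvariant_radical π)) with h1 | h1
    · rwa [← LinearMap.le_ker_iff_map, Submodule.ker_mkQ] at h1
    · exact absurd (by
        rw [eq_top_iff, ← Submodule.comap_top U.mkQ, ← h1, Submodule.comap_map_mkQ]
        exact sup_le (le_radical hU hne) le_rfl) h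

/-- If the proper invariant subspaces have a property that is stable under sums and that the whole
space does not have, then their sum is proper. -/
lemma hasUniqueIrredQuotient_of_small [FiniteDimensional ℂ V] [Nontrivial V]
    (p : Submodule ℂ V → Prop) (hp : ∀ U U', IsInvariant π U → IsInvariant π U' → p U → p U' →
      p (U ⊔ U')) (h : ∀ U, IsInvariant π U → U ≠ ⊤ → p U) (htop : ¬ p ⊤) :
    HasUniqueIrredQuotient π := by
  refine hasUniqueIrredQuotient_of_radical_ne_top fun htop' => ?_
  let s : Set (Submodule ℂ V) := {U | IsInvariant π U ∧ p U}
  obtain ⟨U, ⟨h1, h2⟩, hmax⟩ := wellFounded_gt.has_min s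
    ⟨⊥, isInvariant_bot, h _ isInvariant_bot bot_ne_top⟩
  have h3 : radical π ≤ U := sSup_le fun U' hU' => by
    by_contra hle
    exact hmax (U ⊔ U') ⟨h1.sup hU'.1, hp _ _ h1 hU'.1 h2 (h _ hU'.1 hU'.2)⟩
      (left_lt_sup.2 hle)
  rw [htop', top_le_iff] at h3
  exact htop (h3 ▸ h2)

/-- A representation with a unique irreducible quotient maps onto that quotient only. -/
lemma HasUniqueIrredQuotient.repEquiv (h : HasUniqueIrredQuotient π) (hσ : IsIrred σ)
    {F : V →ₗ[ℂ] W} (hF : Equivariant π σ F) (h0 : F ≠ 0) : RepEquiv σ (headRep π) := by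
  have hs := hσ.surjective hF h0
  have h1 : RepEquiv (quotRep π _ hF.ker) σ :=
    ⟨F.quotKerEquivOfSurjective hs, fun b x => by
      obtain ⟨v, rfl⟩ := (LinearMap.ker F).mkQ_surjective x
      exact hF b v⟩
  have h2 := h.2 _ hF.ker (hσ.of_repEquiv h1.symm)
  refine h1.symm.trans ⟨Submodule.quotEquivOfEq _ _ h2, fun b x => ?_⟩
  obtain ⟨v, rfl⟩ := (LinearMap.ker F).mkQ_surjective x
  rfl

/-! ### Maps from irreducible representations into sums of irreducible representations -/

lemma repEquiv_of_range_le (hπ : IsIrred π) (hσ : IsIrred σ) {F : V →ₗ[ℂ] Z} {G : W →ₗ[ℂ] Z}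
    (hF : Equivariant π τ F) (hG : Equivariant σ τ G) (h0 : F ≠ 0)
    (h : LinearMap.range F ≤ LinearMap.range G) : RepEquiv π σ := by
  have hG0 : G ≠ 0 := fun h1 => h0 (by
    rw [← LinearMap.range_eq_bot, eq_bot_iff]
    exact h.trans (LinearMap.range_eq_bot.2 h1).le)
  have hGi := hσ.injective hG hG0
  have hFi := hπ.injective hF h0
  let e : V →ₗ[ℂ] W := (LinearEquiv.ofInjective G hGi).symm.toLinearMap ∘ₗ
    F.codRestrict (LinearMap.range G) fun v => h ⟨v, rfl⟩
  have he : ∀ v, G (e v) = F v := fun v => by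
    have := congrArg Subtype.val ((LinearEquiv.ofInjective G hGi).apply_symm_apply
      (F.codRestrict (LinearMap.range G) (fun v => h ⟨v, rfl⟩) v))
    exact this
  have hequi : Equivariant π σ e := fun b v => hGi (by rw [he, hF, hG, he])
  have he0 : e ≠ 0 := fun h1 => h0 (by ext v; rw [← he, h1]; simp)
  exact ⟨LinearEquiv.ofBijective e ⟨hπ.injective hequi he0, hσ.surjective hequi he0⟩, hequi⟩

/-- An irreducible representation that maps to a sum of images of irreducible representations, and
not to the invariant subspace `N`, is isomorphic to one of these. -/
lemma exists_repEquiv_of_mem_iSup {κ : Type*} {E : κ → Type*} [∀ k, AddCommGroup (E k)]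
    [∀ k, Module ℂ (E k)] {ε : ∀ k, B →ₐ[ℂ] Module.End ℂ (E k)} (hε : ∀ k, IsIrred (ε k))
    {g : ∀ k, E k →ₗ[ℂ] Z} (hg : ∀ k, Equivariant (ε k) τ (g k)) (hπ : IsIrred π)
    {F : V →ₗ[ℂ] Z} (hF : Equivariant π τ F) {N : Submodule ℂ Z} (hN : IsInvariant τ N) {v : V}
    (hv : F v ∉ N) (hv' : F v ∈ N ⊔ ⨆ k, LinearMap.range (g k)) : ∃ k, RepEquiv π (ε k) := by
  obtain ⟨s, hs⟩ : ∃ s : Finset κ, F v ∈ N ⊔ ⨆ k ∈ s, LinearMap.range (g k) := by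
    obtain ⟨y, hy, z, hz, h⟩ := Submodule.mem_sup.1 hv'
    obtain ⟨s, hs⟩ := (Submodule.mem_iSup_iff_exists_finset).1 hz
    exact ⟨s, h ▸ Submodule.add_mem_sup hy hs⟩
  clear hv'
  classical
  induction s using Finset.induction_on generalizing N with
  | empty => exact absurd (by simpa using hs) hv
  | insert k s hk ih =>
    rw [Finset.iSup_insert, ← sup_assoc] at hs
    by_cases h : F v ∈ N ⊔ LinearMap.range (g k)
    · refine ⟨k, repEquiv_of_range_le (τ := quotRep τ N hN) hπ (hε k) (F := N.mkQ ∘ₗ F)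
        (G := N.mkQ ∘ₗ g k) (fun b v => ?_) (fun b v => ?_) (fun h0 => hv ?_) ?_⟩
      · rw [LinearMap.comp_apply, hF, equivariant_mkQ hN]; rfl
      · rw [LinearMap.comp_apply, hg, equivariant_mkQ hN]; rfl
      · have := LinearMap.congr_fun h0 v
        rwa [LinearMap.comp_apply, LinearMap.zero_apply, Submodule.mkQ_apply,
          Submodule.Quotient.mk_eq_zero] at this
      · have hI := hF.comap (hN.sup (hg k).range)
        have htop := (hπ.2 _ hI).resolve_left fun h1 => hv (by
          have h2 : v ∈ (N ⊔ LinearMap.range (g k)).comap F := h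
          rw [h1, Submodule.mem_bot] at h2
          rw [h2, map_zero]; exact N.zero_mem)
        rintro _ ⟨x, rfl⟩
        have h2 : x ∈ (N ⊔ LinearMap.range (g k)).comap F := htop ▸ Submodule.mem_top
        obtain ⟨y, hy, _, ⟨z, rfl⟩, h3⟩ := Submodule.mem_sup.1 (Submodule.mem_comap.1 h2)
        refine ⟨z, ?_⟩
        rw [LinearMap.comp_apply, LinearMap.comp_apply, ← h3, map_add,
          (Submodule.Quotient.mk_eq_zero N).2 hy |> fun h : N.mkQ y = 0 => h, zero_add]
    · exact ih (hN.sup (hg k).range) h hs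

end RepTheory
end AffineHecke
end

noncomputable section
namespace AffineHecke
open scoped TensorProduct Pointwise

/-! ### Weights of representations generated by parabolic subrepresentations -/

section Chars

variable {A : Type*} [CommRing A] [Algebra ℂ A]
variable {V : Type*} [AddCommGroup V] [Module ℂ V] {W : Type*} [AddCommGroup W] [Module ℂ W]

lemma exists_isEigen_of_sup [FiniteDimensional ℂ V] {ρ : A →ₐ[ℂ] Module.End ℂ V}
    {ρ' : A →ₐ[ℂ] Module.End ℂ W} {χ : A →ₐ[ℂ] ℂ} {N : Submodule ℂ W} (hN : IsInvariant ρ' N)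
    (G : V →ₗ[ℂ] W) (hG : ∀ a v, G (ρ a v) - ρ' a (G v) ∈ N) {z : W} (hz : IsEigen ρ' χ z)
    (hz1 : z ∉ N) (hz2 : z ∈ N ⊔ LinearMap.range G) : ∃ w, IsEigen ρ χ w := by
  obtain ⟨n, hn, _, ⟨v, rfl⟩, rfl⟩ := Submodule.mem_sup.1 hz2
  refine exists_isEigen_of_map G hG (v := v) (fun h => hz1 (N.add_mem hn h)) fun a => ?_
  have h1 := hz.2 a
  have h2 : ρ' a (G v) - χ a • G v = χ a • n - ρ' a n := by
    rw [map_add, smul_add] at h1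
    rw [sub_eq_sub_iff_add_eq_add, add_comm, h1]
  rw [h2]
  exact sub_mem (N.smul_mem _ hn) (hN a n hn)

lemma exists_isEigen_of_mem_sup [FiniteDimensional ℂ W] {ρ : A →ₐ[ℂ] Module.End ℂ W}
    {χ : A →ₐ[ℂ] ℂ} {N E : Submodule ℂ W} (hN : IsInvariant ρ N) (hE : IsInvariant ρ E) {z : W}
    (hz : IsEigen ρ χ z) (hz1 : z ∉ N) (hz2 : z ∈ N ⊔ E) : ∃ w ∈ E, IsEigen ρ χ w := by
  obtain ⟨w, h1, h2⟩ := exists_isEigen_of_sup (ρ := subRep ρ E hE) hN E.subtype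
    (fun a v => by rw [Submodule.subtype_apply, coe_subRep]; simp) hz hz1
    (by rwa [Submodule.range_subtype])
  exact ⟨w, w.2, by simpa using h1, fun a => congrArg Subtype.val (h2 a)⟩

variable {X : Type*} [AddCommGroup X]

/-- The character of `ℂ[X]` given by a character of `X`. -/
def wtHom (t : AddChar X ℂ) : AddMonoidAlgebra ℂ X →ₐ[ℂ] ℂ :=
  AddMonoidAlgebra.lift ℂ ℂ X t.toMonoidHom

@[simp] lemma wtHom_mono (t : AddChar X ℂ) (x : X) : wtHom t (BernsteinDatum.mono x) = t x := by
  simp [wtHom, BernsteinDatum.mono]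

lemma exists_wtHom (χ : AddMonoidAlgebra ℂ X →ₐ[ℂ] ℂ) : ∃ t, χ = wtHom t := by
  refine ⟨⟨fun x => χ (BernsteinDatum.mono x), ?_, fun x y => ?_⟩, ExtendedDatum.mono_ext fun x => ?_⟩
  · exact map_one χ
  · rw [← map_mul, ExtendedDatum.mono_mul]
  · rw [wtHom_mono]; rfl

end Chars

open BernsteinDatum RootPairing

section

variable {F X : Type*} [AddCommGroup X] (D : BernsteinDatum F X)
variable {V : Type*} [AddCommGroup V] [Module ℂ V]

/-- The restriction of a representation of an affine Hecke algebra to `ℂ[X]`. -/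
abbrev thetaRep (π : D.Hecke →ₐ[ℂ] Module.End ℂ V) :
    AddMonoidAlgebra ℂ X →ₐ[ℂ] Module.End ℂ V := π.comp D.thetaHom

variable {D} {π : D.Hecke →ₐ[ℂ] Module.End ℂ V}

lemma isEigen_iff {t : AddChar X ℂ} {v : V} :
    IsEigen (thetaRep D π) (wtHom t) v ↔ v ≠ 0 ∧ ∀ x, π (D.theta x) v = t x • v := by
  refine and_congr_right fun _ => ⟨fun h x => ?_, fun h f => ?_⟩
  · have := h (mono x)
    rwa [AlgHom.comp_apply, thetaHom_mono, wtHom_mono] at this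
  · induction f using AddMonoidAlgebra.induction_linear with
    | zero => simp
    | add f g hf hg => rw [map_add, map_add, LinearMap.add_apply, hf, hg, add_smul]
    | single x c =>
      have : AddMonoidAlgebra.single x c = c • mono x := by simp [mono]
      rw [this, map_smul, map_smul, LinearMap.smul_apply, AlgHom.comp_apply, thetaHom_mono,
        wtHom_mono, h, smul_assoc]

lemma isWeight_iff {t : AddChar X ℂ} :
    D.IsWeight π t ↔ ∃ v, IsEigen (thetaRep D π) (wtHom t) v :=
  exists_congr fun _ => isEigen_iff.symm

lemma exists_isWeight [FiniteDimensional ℂ V] [Nontrivial V] : ∃ t, D.IsWeight π t := by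
  obtain ⟨χ, v, h⟩ := exists_isEigen (thetaRep D π)
  obtain ⟨t, rfl⟩ := exists_wtHom χ
  exact ⟨t, isWeight_iff.2 ⟨v, h⟩⟩

end

namespace ExtendedDatum
variable {ι X Y Γ : Type*} [AddCommGroup X] [AddCommGroup Y] [Group Γ]
variable (S : ExtendedDatum ι X Y Γ) {P : Set ι}

/-- The character `x ↦ t(g x)`. -/
def charAct (g : S.R.Aut) (t : AddChar X ℂ) : AddChar X ℂ where
  toFun x := t (g • x)
  map_zero_eq_one' := by rw [smul_zero]; exact t.map_zero_eq_one
  map_add_eq_mul' x y := by rw [smul_add]; exact t.map_add_eq_mul _ _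

lemma charAct_apply (g : S.R.Aut) (t : AddChar X ℂ) (x : X) : S.charAct g t x = t (g • x) := rfl

lemma logAbs_charAct (g : S.R.Aut) (t : AddChar X ℂ) :
    logAbs (S.charAct g t) = S.aact g⁻¹ (logAbs t) := by
  ext x; rw [aact_apply, inv_inv]; rfl

variable [Finite ι] [Finite Γ] [Module.Finite ℤ X]
variable {Q : Type*} [AddCommGroup Q] [Module ℂ Q] {κ : Type*}

/-- A representation `π` of `ℋ` that is generated by subspaces `E k`, such that `E k` is stable under
the parabolic subalgebra `ℋ^{P k}` and the weights `t` of `E k` satisfy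
`log |t| ∈ μ k + negC (P k)`, where `μ k ∈ 𝔞^{P k ++}` has norm `r`. -/
structure LanglandsGenerated (π : S.H →ₐ[ℂ] Module.End ℂ Q) (P : κ → Set ι)
    (E : κ → Submodule ℂ Q) (μ : κ → X →+ ℝ) (r : ℝ) : Prop where
  subset : ∀ k, P k ⊆ S.simple
  mem_posCone : ∀ k, μ k ∈ S.posCone (P k)
  nrm_eq : ∀ k, S.nrm (μ k) = r
  invariant : ∀ k, IsInvariant (π.comp (S.incl (subset k))) (E k)
  weight : ∀ k, ∀ e ∈ E k, ∀ t, IsEigen (thetaRep _ π) (wtHom t) e → logAbs t - μ k ∈ S.negC (P k)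
  span_eq : ∀ U : Submodule ℂ Q, (∀ k, ∀ e ∈ E k, ∀ a, π a e ∈ U) → U = ⊤

namespace LanglandsGenerated

variable {S} {π : S.H →ₐ[ℂ] Module.End ℂ Q} {P : κ → Set ι} {E : κ → Submodule ℂ Q}
  {μ : κ → X →+ ℝ} {r : ℝ} (G : S.LanglandsGenerated π P E μ r)
include G

lemma theta_mem (k : κ) {e : Q} (he : e ∈ E k) (f : AddMonoidAlgebra ℂ X) :
    thetaRep _ π f e ∈ E k := by
  have := G.invariant k ((S.upper (P k)).thetaHom f) e he
  rwa [AlgHom.comp_apply, S.incl_thetaHom] at this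

omit G in
variable (π E) in
/-- The span of the subspaces `N_w E_k` with `w` of length less than `n`. -/
def filtration (n : ℕ) : Submodule ℂ Q := Submodule.span ℂ {z | ∃ w ∈ parab S.R S.simple,
  len S.base w < n ∧ ∃ k, ∃ e ∈ E k, z = π (S.Nw S.simple w) e}

omit G in
lemma Nw_mem_filtration {n : ℕ} {w : S.R.Aut} (hw : w ∈ parab S.R S.simple)
    (h : len S.base w < n) {k : κ} {e : Q} (he : e ∈ E k) :
    π (S.Nw S.simple w) e ∈ filtration π E n :=
  Submodule.subset_span ⟨w, hw, h, k, e, he, rfl⟩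

omit G in
lemma filtration_mono {m n : ℕ} (h : m ≤ n) : filtration π E m ≤ filtration π E n :=
  Submodule.span_mono fun _ ⟨w, hw, hl, rest⟩ => ⟨w, hw, hl.trans_le h, rest⟩

lemma fil_apply_mem {n : ℕ} {b : S.H} (hb : b ∈ S.fil S.simple n) {k : κ} {e : Q} (he : e ∈ E k) :
    π b e ∈ filtration π E n := by
  induction hb using Submodule.span_induction with
  | mem b hb =>
    obtain ⟨w, hw, hl, f, rfl⟩ := hb
    rw [map_mul]
    exact Nw_mem_filtration hw hl (G.theta_mem k he f)
  | zero => rw [map_zero]; exact zero_mem _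
  | add x y _ _ hx hy => rw [map_add]; exact add_mem hx hy
  | smul c x _ hx => rw [map_smul]; exact Submodule.smul_mem _ c hx

lemma theta_Nw_sub_mem {w : S.R.Aut} (hw : w ∈ parab S.R S.simple) (f : AddMonoidAlgebra ℂ X)
    {k : κ} {e : Q} (he : e ∈ E k) :
    thetaRep _ π f (π (S.Nw S.simple w) e) - π (S.Nw S.simple w) (thetaRep _ π (S.actA w⁻¹ f) e) ∈
      filtration π E (len S.base w) := by
  have h1 := G.fil_apply_mem (S.theta_mul_Nw subset_rfl hw f) he
  rw [map_sub, map_mul, map_mul] at h1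
  exact h1

lemma invariant_filtration (n : ℕ) : IsInvariant (thetaRep _ π) (filtration π E n) := by
  intro f z hz
  induction hz using Submodule.span_induction with
  | mem b hb =>
    obtain ⟨w, hw, hl, k, e, he, rfl⟩ := hb
    have h1 := filtration_mono hl.le (G.theta_Nw_sub_mem hw f he)
    have h2 := Nw_mem_filtration (π := π) hw hl (G.theta_mem k he (S.actA w⁻¹ f))
    have := add_mem h1 h2
    rwa [sub_add_cancel] at this
  | zero => rw [map_zero]; exact zero_mem _
  | add x y _ _ hx hy => rw [map_add]; exact add_mem hx hy
  | smul c x _ hx => rw [map_smul]; exact Submodule.smul_mem _ c hx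

lemma exists_filtration_eq_top : ∃ n, filtration π E n = ⊤ := by
  have := S.reduced
  have := finite_parab (R := S.R) (b := S.base) (P := S.simple) subset_rfl
  obtain ⟨n, hn⟩ := (Set.finite_range fun w : parab S.R S.simple => len S.base w).bddAbove
  refine ⟨n + 1, G.span_eq _ fun k e he a => G.fil_apply_mem ?_ he⟩
  refine Submodule.span_mono ?_ (S.span_Nw_theta subset_rfl a)
  rintro _ ⟨w, hw, f, rfl⟩
  exact ⟨w, hw, Nat.lt_succ_of_le (hn ⟨⟨w, hw⟩, rfl⟩), f, rfl⟩

lemma filtration_one_le : filtration π E 1 ≤ ⨆ k, E k := by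
  refine Submodule.span_le.2 ?_
  rintro _ ⟨w, hw, hl, k, e, he, rfl⟩
  have := S.reduced
  rw [eq_one_of_len (b := S.base) subset_rfl hw (Nat.lt_one_iff.1 hl), S.Nw_one subset_rfl, map_one]
  exact Submodule.mem_iSup_of_mem k he

variable [FiniteDimensional ℂ Q]

/-- In one step of the filtration, only weights `w t` occur with `w` a nontrivial minimal coset
representative and `t` a weight of some `E k`. -/
lemma mem_filtration_or {n : ℕ} (hn : n ≠ 0) {t : AddChar X ℂ} {v : Q}
    (hv : IsEigen (thetaRep _ π) (wtHom t) v) (h : v ∈ filtration π E (n + 1)) :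
    v ∈ filtration π E n ∨ S.size (logAbs t) < r := by
  have := S.reduced
  let T := {w : S.R.Aut // w ∈ parab S.R S.simple ∧ len S.base w = n} × κ
  let M : T → Submodule ℂ Q := fun p => (E p.2).map (π (S.Nw S.simple p.1))
  have h1 : v ∈ filtration π E n ⊔ ⨆ p, M p := by
    refine (Submodule.span_le.2 ?_ : filtration π E (n + 1) ≤ _) h
    rintro _ ⟨w, hw, hl, k, e, he, rfl⟩
    rcases Nat.lt_succ_iff_lt_or_eq.1 hl with hl | hl
    · exact Submodule.mem_sup_left (Nw_mem_filtration hw hl he)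
    · exact Submodule.mem_sup_right (Submodule.mem_iSup_of_mem (⟨⟨w, hw, hl⟩, k⟩ : T) ⟨e, he, rfl⟩)
  obtain ⟨s, hs⟩ : ∃ s : Finset T, v ∈ filtration π E n ⊔ ⨆ p ∈ s, M p := by
    obtain ⟨y, hy, z, hz, h⟩ := Submodule.mem_sup.1 h1
    obtain ⟨s, hs⟩ := (Submodule.mem_iSup_iff_exists_finset).1 hz
    exact ⟨s, h ▸ Submodule.add_mem_sup hy hs⟩
  clear h1 h
  by_contra! hcon
  obtain ⟨hvn, hsize⟩ := hcon
  have hM : ∀ (p : T) (f), ∀ z ∈ M p, thetaRep _ π f z ∈ filtration π E n ⊔ M p := by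
    rintro p f _ ⟨e, he, rfl⟩
    have h2 := G.theta_Nw_sub_mem p.1.2.1 f he
    rw [p.1.2.2] at h2
    rw [← sub_add_cancel (thetaRep _ π f (π (S.Nw S.simple p.1) e))]
    exact Submodule.add_mem_sup h2 ⟨_, G.theta_mem p.2 he _, rfl⟩
  classical
  induction s using Finset.induction_on with
  | empty => exact hvn (by simpa using hs)
  | insert p s hp ih =>
    rw [Finset.iSup_insert, sup_comm (M p), ← sup_assoc] at hs
    set N := filtration π E n ⊔ ⨆ p ∈ s, M p with hNdef
    have hN : IsInvariant (thetaRep _ π) N := by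
      intro f
      change N ≤ N.comap (thetaRep _ π f)
      refine sup_le (fun z hz => Submodule.mem_sup_left (G.invariant_filtration n f z hz)) ?_
      refine iSup₂_le fun p hp z hz => ?_
      exact sup_le_sup_left (le_iSup₂ (f := fun p (_ : p ∈ s) => M p) p hp) _ (hM p f z hz)
    refine ih ?_
    by_contra hvN
    obtain ⟨⟨w, hw, hl⟩, k⟩ := p
    change v ∈ N ⊔ (E k).map (π (S.Nw S.simple w)) at hs
    obtain ⟨u, hu, x, hx, rfl, hpos, hlen, hNw⟩ := S.exists_coset_decomp (G.subset k) subset_rfl hw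
    by_cases hx1 : x = 1
    · subst hx1
      rw [mul_one] at hw hl hNw
      have hu1 : u ≠ 1 := by rintro rfl; exact hn (hl.symm.trans (len_one S.base))
      obtain ⟨e, he1, he2⟩ := exists_isEigen_of_sup
        (ρ := (subRep (thetaRep _ π) (E k) fun f e he => G.theta_mem k he f).comp (S.actA u⁻¹)) hN
        (π (S.Nw S.simple u) ∘ₗ (E k).subtype) (fun f e => by
          rw [← neg_mem_iff, neg_sub]
          refine Submodule.mem_sup_left ?_
          rw [← hl]
          exact G.theta_Nw_sub_mem hu f e.2) hv hvN (by
          rw [LinearMap.range_comp, Submodule.range_subtype]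
          rw [mul_one] at hs
          exact hs)
      have h3 : IsEigen (thetaRep _ π) (wtHom (S.charAct u t)) (e : Q) := by
        refine isEigen_iff.2 ⟨by simpa using he1, fun y => ?_⟩
        have h4 := congrArg Subtype.val (he2 (mono (u • y)))
        rw [AlgHom.comp_apply, S.actA_mono, inv_smul_smul] at h4
        change π ((S.upper S.simple).thetaHom (mono y)) e = wtHom t (mono (u • y)) • (e : Q) at h4
        rwa [thetaHom_mono, wtHom_mono] at h4
      have h4 := G.weight k e e.2 _ h3
      have h5 := S.size_aact_lt (G.subset k) hu hpos hu1 (G.mem_posCone k) h4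
      rw [add_sub_cancel, logAbs_charAct, ← aact_mul, mul_inv_cancel, aact_one, G.nrm_eq] at h5
      exact absurd h5 (not_lt.2 hsize)
    · have hlu : len S.base u < n := by
        have : len S.base x ≠ 0 := fun h0 => hx1 (eq_one_of_len ((G.subset k)) hx h0)
        omega
      refine hvN (sup_le le_rfl (?_ : Submodule.map _ _ ≤ N) hs)
      rintro _ ⟨e, he, rfl⟩
      rw [hNw, map_mul]
      exact Submodule.mem_sup_left (Nw_mem_filtration hu hlu (G.invariant k _ e he))

/-- The weights of the representation outside the span of the `E k` are small. -/
lemma mem_iSup_or {t : AddChar X ℂ} {v : Q} (hv : IsEigen (thetaRep _ π) (wtHom t) v) :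
    v ∈ ⨆ k, E k ∨ S.size (logAbs t) < r := by
  obtain ⟨n, hn⟩ := G.exists_filtration_eq_top
  have h : v ∈ filtration π E n := hn ▸ Submodule.mem_top
  clear hn
  induction n with
  | zero =>
    exact Or.inl (G.filtration_one_le (filtration_mono zero_le_one h))
  | succ n ih =>
    by_cases h0 : n = 0
    · subst h0; exact Or.inl (G.filtration_one_le h)
    · rcases G.mem_filtration_or h0 hv h with h1 | h1
      · exact ih h1
      · exact Or.inr h1

lemma dom_eq (k : κ) {e : Q} (he : e ∈ E k) {t : AddChar X ℂ}
    (ht : IsEigen (thetaRep _ π) (wtHom t) e) : S.dom (logAbs t) = μ k := by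
  have := S.dom_add (G.subset k) (G.mem_posCone k) (G.weight k e he t ht)
  rwa [add_sub_cancel] at this

/-- A weight vector in the span of the `E k` lies in the span of those for which `μ k` is the dominant
part of the weight. -/
lemma mem_iSup_dom {t : AddChar X ℂ} {v : Q} (hv : IsEigen (thetaRep _ π) (wtHom t) v)
    (h : v ∈ ⨆ k, E k) : v ∈ ⨆ k : {k // μ k = S.dom (logAbs t)}, E k := by
  set N := ⨆ k : {k // μ k = S.dom (logAbs t)}, E k with hN
  obtain ⟨s, hs⟩ : ∃ s : Finset κ, v ∈ N ⊔ ⨆ k ∈ s, E k := by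
    obtain ⟨s, hs⟩ := (Submodule.mem_iSup_iff_exists_finset).1 h
    exact ⟨s, Submodule.mem_sup_right hs⟩
  have hE : ∀ k, IsInvariant (thetaRep _ π) (E k) := fun k f e he => G.theta_mem k he f
  classical
  induction s using Finset.induction_on with
  | empty => simpa using hs
  | insert k s hk ih =>
    rw [Finset.iSup_insert, sup_comm (E k), ← sup_assoc] at hs
    refine ih ?_
    by_contra hvN
    have hN1 : IsInvariant (thetaRep _ π) N := IsInvariant.iSup fun k => hE k
    have hN2 : IsInvariant (thetaRep _ π) (⨆ k ∈ s, E k) :=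
      IsInvariant.iSup fun k => IsInvariant.iSup fun _ => hE k
    have hN' := hN1.sup hN2
    obtain ⟨e, he, h1⟩ := exists_isEigen_of_mem_sup hN' (hE k) hv hvN hs
    have h2 := G.dom_eq k he h1
    rw [sup_eq_left.2] at hs
    · exact hvN hs
    exact le_trans (le_iSup (fun k : {k // μ k = S.dom (logAbs t)} => E k) ⟨k, h2.symm⟩) le_sup_left

/-- A weight is either small, or it is a weight of the span of the `E k`. -/
lemma weight_cases {t : AddChar X ℂ} {v : Q} (hv : IsEigen (thetaRep _ π) (wtHom t) v) :
    S.size (logAbs t) < r ∨ ((∃ k, μ k = S.dom (logAbs t)) ∧ S.size (logAbs t) = r ∧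
      v ∈ ⨆ k : {k // μ k = S.dom (logAbs t)}, E k) := by
  rcases G.mem_iSup_or hv with h | h
  · right
    have h1 := G.mem_iSup_dom hv h
    obtain ⟨k, hk⟩ : ∃ k, μ k = S.dom (logAbs t) := by
      by_contra hne
      have : IsEmpty {k // μ k = S.dom (logAbs t)} := ⟨fun k => hne ⟨k, k.2⟩⟩
      rw [iSup_of_empty, Submodule.mem_bot] at h1
      exact hv.1 h1
    exact ⟨⟨k, hk⟩, by rw [size, ← hk, G.nrm_eq], h1⟩
  · exact Or.inl h

lemma size_le {t : AddChar X ℂ} {v : Q} (hv : IsEigen (thetaRep _ π) (wtHom t) v) :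
    S.size (logAbs t) ≤ r := by
  rcases G.weight_cases hv with h | h
  · exact h.le
  · exact h.2.1.le

end LanglandsGenerated

/-- All weights in the subspace `U` have a dominant part of norm less than `r`. -/
def SmallWeights (π : S.H →ₐ[ℂ] Module.End ℂ Q) (r : ℝ) (U : Submodule ℂ Q) : Prop :=
  ∀ v ∈ U, ∀ t, IsEigen (thetaRep _ π) (wtHom t) v → S.size (logAbs t) < r

variable {S}

lemma SmallWeights.sup [FiniteDimensional ℂ Q] {π : S.H →ₐ[ℂ] Module.End ℂ Q} {r : ℝ}
    {U U' : Submodule ℂ Q} (hU : IsInvariant (thetaRep _ π) U)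
    (hU' : IsInvariant (thetaRep _ π) U') (h : S.SmallWeights π r U) (h' : S.SmallWeights π r U') :
    S.SmallWeights π r (U ⊔ U') := by
  intro v hv t ht
  by_cases h1 : v ∈ U
  · exact h v h1 t ht
  · obtain ⟨w, hw, h2⟩ := exists_isEigen_of_mem_sup hU hU' ht h1 hv
    exact h' w hw t h2

end ExtendedDatum
end AffineHecke
end

noncomputable section
namespace AffineHecke
open scoped TensorProduct Pointwise

/-! ### Parabolic algebras and their representations -/

open BernsteinDatum RootPairing
namespace ExtendedDatum
variable {ι X Y Γ : Type*} [AddCommGroup X] [AddCommGroup Y] [Group Γ]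
variable (S : ExtendedDatum ι X Y Γ) {P : Set ι}

lemma algebra_finiteType (X : Type*) [AddCommGroup X] [Module.Finite ℤ X] :
    Algebra.FiniteType ℂ (AddMonoidAlgebra ℂ X) := by
  have : AddMonoid.FG X :=
    AddGroup.fg_iff_addMonoid_fg.1 (Module.Finite.iff_addGroup_fg.1 inferInstance)
  infer_instance

/-- Irreducible representations of `ℋ^P` have finite dimension. -/
lemma finiteDimensional_of_isIrred [Finite ι] [Module.Finite ℤ X] (hP : P ⊆ S.simple)
    {V : Type*} [AddCommGroup V] [Module ℂ V] {π : (S.upper P).Hecke →ₐ[ℂ] Module.End ℂ V}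
    (h : IsIrred π) : FiniteDimensional ℂ V := by
  have := S.reduced
  have := finite_parab (R := S.R) hP
  have := algebra_finiteType X
  refine h.finiteDimensional (S.upper P).thetaHom (fun w : parab S.R P => S.Nw P w) fun x => ?_
  refine Submodule.span_mono ?_ (S.span_theta_Nw hP x)
  rintro _ ⟨w, hw, f, rfl⟩
  exact ⟨f, ⟨w, hw⟩, rfl⟩

lemma twist_theta {t : AddChar X ℂ} (ht : t ∈ S.torusUpper P) (x : X) :
    S.twist ht ((S.upper P).theta x) = t x • (S.upper P).theta x := by
  rw [twist, Hom.map_theta]; rfl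

lemma twist_N {t : AddChar X ℂ} (ht : t ∈ S.torusUpper P) (i : P) :
    S.twist ht ((S.upper P).N i) = (S.upper P).N i := by
  rw [twist, Hom.map_N]; rfl

lemma quot_theta (x : X) :
    S.quot P ((S.upper P).theta x) = (S.lower P).theta (QuotientAddGroup.mk' (S.perp P) x) := by
  rw [quot, Hom.map_theta]; exact one_smul ℂ _

lemma quot_N (i : P) : S.quot P ((S.upper P).N i) = (S.lower P).N i := by
  rw [quot, Hom.map_N]; rfl

lemma inv_mem_torusUpper {t : AddChar X ℂ} (ht : t ∈ S.torusUpper P) : t⁻¹ ∈ S.torusUpper P := by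
  intro x hx
  rw [AddChar.inv_apply]
  refine ht _ ?_
  obtain ⟨n, hn, h⟩ := hx
  exact ⟨n, hn, by rw [smul_neg]; exact neg_mem h⟩

lemma addChar_mul_neg {X : Type*} [AddCommGroup X] (t : AddChar X ℂ) (x : X) : t x * t (-x) = 1 := by
  rw [← AddChar.map_add_eq_mul, add_neg_cancel, AddChar.map_zero_eq_one]

lemma addChar_ne_zero {X : Type*} [AddCommGroup X] (t : AddChar X ℂ) (x : X) : t x ≠ 0 :=
  left_ne_zero_of_mul_eq_one (addChar_mul_neg t x)

lemma twist_twist {t : AddChar X ℂ} (ht : t ∈ S.torusUpper P) (a : (S.upper P).Hecke) :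
    S.twist (S.inv_mem_torusUpper ht) (S.twist ht a) = a := by
  suffices h : (S.twist (S.inv_mem_torusUpper ht)).comp (S.twist ht) = AlgHom.id ℂ _ from
    DFunLike.congr_fun h a
  refine hecke_ext (fun x => ?_) fun i => ?_
  · rw [AlgHom.comp_apply, twist_theta, map_smul, twist_theta, smul_smul, AddChar.inv_apply,
      addChar_mul_neg, one_smul]; rfl
  · rw [AlgHom.comp_apply, twist_N, twist_N]; rfl

lemma twist_surjective {t : AddChar X ℂ} (ht : t ∈ S.torusUpper P) :
    Function.Surjective (S.twist ht) := fun a => by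
  refine subalgebra_eq_top (B := (S.twist ht).range) (fun x => ?_) (fun i => ?_) a
  · refine ⟨(t x)⁻¹ • (S.upper P).theta x, ?_⟩
    change S.twist ht _ = _
    rw [map_smul, twist_theta, smul_smul, inv_mul_cancel₀ (addChar_ne_zero t x), one_smul]
  · exact ⟨_, S.twist_N ht i⟩

lemma quot_surjective : Function.Surjective (S.quot P) := fun a => by
  refine subalgebra_eq_top (B := (S.quot P).range) (fun x => ?_) (fun i => ?_) a
  · obtain ⟨x, rfl⟩ := QuotientAddGroup.mk'_surjective _ x
    exact ⟨_, S.quot_theta x⟩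
  · exact ⟨_, S.quot_N i⟩

/-- `θ_x` is central in `ℋ^P` when `x` is perpendicular to the coroots in `P`. -/
lemma commute_theta {x : X} (hx : x ∈ S.perp P) (a : (S.upper P).Hecke) :
    (S.upper P).theta x * a = a * (S.upper P).theta x := by
  let B : Subalgebra ℂ (S.upper P).Hecke := Subalgebra.centralizer ℂ {(S.upper P).theta x}
  have key : a ∈ B := by
    refine subalgebra_eq_top (fun y => ?_) (fun i => ?_) a
    · rw [Subalgebra.mem_centralizer_iff]
      rintro _ rfl
      rw [← theta_add, ← theta_add, add_comm]
    · rw [Subalgebra.mem_centralizer_iff]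
      rintro _ rfl
      have h1 : (S.upper P).reflAlg i (mono x) = mono x := by
        rw [reflAlg_eq, actA_mono, srefl_smul, hx i i.2, zero_smul, sub_zero]
      have h2 := (S.upper P).bernstein i (mono x) 0 (by rw [h1]; simp)
      rw [h1, map_zero, sub_eq_zero, thetaHom_mono] at h2
      exact h2
  exact (Subalgebra.mem_centralizer_iff ℂ).1 key _ rfl

/-- A homomorphism from `ℋ^P` that is trivial on `θ_x` for `x` perpendicular to the coroots in `P`
factors through `ℋ_P`. -/
lemma exists_lower_hom [Module.Finite ℤ X] {B : Type*} [Ring B] [Algebra ℂ B]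
    (τ : (S.upper P).Hecke →ₐ[ℂ] B) (hτ : ∀ x ∈ S.perp P, τ ((S.upper P).theta x) = 1) :
    ∃ σ : (S.lower P).Hecke →ₐ[ℂ] B, ∀ a, σ (S.quot P a) = τ a := by
  let q := QuotientAddGroup.mk' (S.perp P)
  have hq : Function.Surjective q := QuotientAddGroup.mk'_surjective _
  let φ : BernsteinDatum.Hom (S.upper P) (S.lower P) :=
    { onX := q
      onF := id
      char := 1
      char_root := fun _ => rfl
      map_root := fun _ => rfl
      map_coroot := fun _ _ => rfl
      map_m := fun _ _ => rfl
      map_q := fun _ => rfl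
      map_qStar := fun _ => rfl }
  have hφ1 : ∀ x, φ.onAlg (mono x) = mono (q x) := fun x => φ.onAlg_mono x rfl
  have hwell : ∀ x y, q x = q y → τ ((S.upper P).theta x) = τ ((S.upper P).theta y) := by
    intro x y h
    have h1 : x - y ∈ S.perp P := by
      rw [← QuotientAddGroup.eq_zero_iff, QuotientAddGroup.mk_sub]
      exact sub_eq_zero.2 h
    rw [← sub_add_cancel x y, theta_add, map_mul, hτ _ h1, one_mul]
  choose s hs using hq
  have hs' : ∀ x, τ ((S.upper P).theta (s (q x))) = τ ((S.upper P).theta x) := fun x =>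
    hwell _ _ (hs _)
  let g : FreeAlgebra ℂ ((X ⧸ S.perp P) ⊕ P) →ₐ[ℂ] B := FreeAlgebra.lift ℂ
    (Sum.elim (fun y => τ ((S.upper P).theta (s y))) fun i => τ ((S.upper P).N i))
  have hgθ : ∀ x, g (genTheta P (q x)) = τ ((S.upper P).theta x) := fun x => by
    simp only [g, genTheta, FreeAlgebra.lift_ι_apply, Sum.elim_inl, hs']
  have hgN : ∀ i : P, g (genN _ i) = τ ((S.upper P).N i) := fun i => by
    simp only [g, genN, FreeAlgebra.lift_ι_apply, Sum.elim_inr]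
  have hgL : ∀ f : AddMonoidAlgebra ℂ X,
      g (genThetaLin P (φ.onAlg f)) = τ ((S.upper P).thetaHom f) := by
    have hadd : ∀ a b : AddMonoidAlgebra ℂ (X ⧸ S.perp P),
        genThetaLin P (a + b) = genThetaLin P a + genThetaLin P b := fun a b => by
      simp [genThetaLin]
    have hsm : ∀ (c : ℂ) (a : AddMonoidAlgebra ℂ (X ⧸ S.perp P)),
        genThetaLin P (c • a) = c • genThetaLin P a := fun c a => by
      simp [genThetaLin]
    intro f
    induction f using AddMonoidAlgebra.induction_linear with
    | zero => simp [genThetaLin]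
    | add a b ha hb => rw [map_add, hadd, map_add, ha, hb, map_add, map_add]
    | single x c =>
      have : AddMonoidAlgebra.single x c = c • mono x := by simp [mono]
      rw [this, map_smul, hφ1, hsm, map_smul, map_smul, map_smul, thetaHom_mono, ← hgθ]
      congr 2
      simp [genThetaLin, mono]
  have htf : IsAddTorsionFree (X ⧸ S.perp P) := by
    refine Module.isTorsionFree_int_iff_isAddTorsionFree.1 ?_
    rw [Module.isTorsionFree_iff_smul_eq_zero]
    intro n y h
    obtain ⟨x, rfl⟩ := QuotientAddGroup.mk'_surjective _ y
    rw [← map_zsmul, QuotientAddGroup.mk'_apply, QuotientAddGroup.eq_zero_iff] at h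
    by_cases hn : n = 0
    · exact Or.inl hn
    · right
      rw [QuotientAddGroup.mk'_apply, QuotientAddGroup.eq_zero_iff]
      intro i hi
      have := h i hi
      rw [map_smul, smul_eq_mul, mul_eq_zero] at this
      exact this.resolve_left hn
  have hdom : NoZeroDivisors (AddMonoidAlgebra ℂ (X ⧸ S.perp P)) := by
    have : AddGroup.FG X := Module.Finite.iff_addGroup_fg.1 inferInstance
    have : AddMonoid.FG (X ⧸ S.perp P) := AddGroup.fg_iff_addMonoid_fg.1 inferInstance
    infer_instance
  have hdom' : IsDomain (AddMonoidAlgebra ℂ (X ⧸ S.perp P)) := NoZeroDivisors.to_isDomain _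
  have hrel : ∀ ⦃a b⦄, (S.lower P).Rel a b → g a = g b := by
    intro a b h
    induction h with
    | theta_zero => rw [← map_zero q, hgθ, theta_zero, map_one, map_one]
    | theta_add x y =>
      rw [← hs x, ← hs y]
      rw [← map_add, map_mul, hgθ, hgθ, hgθ, theta_add, map_mul]
    | quadratic i =>
      have := congrArg τ ((S.upper P).quadratic i)
      simp only [map_mul, map_sub, map_add, AlgHom.commutes, map_zero, hgN] at this ⊢
      exact this
    | braid i j =>
      have := congrArg τ ((S.upper P).braid i j)
      simp only [map_altProd, hgN] at this ⊢
      exact this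
    | bernstein i f f' h =>
      have hsurj : ∀ f, ∃ f', φ.onAlg f' = f := fun f => by
        induction f using AddMonoidAlgebra.induction_linear with
        | zero => exact ⟨0, map_zero _⟩
        | add a b ha hb =>
          obtain ⟨a', rfl⟩ := ha
          obtain ⟨b', rfl⟩ := hb
          exact ⟨a' + b', map_add _ _ _⟩
        | single y c =>
          refine ⟨c • mono (s y), ?_⟩
          rw [map_smul, hφ1, show q (s y) = y from hs y]
          simp [mono]
      obtain ⟨F, rfl⟩ := hsurj f
      obtain ⟨F', hF⟩ := S.exists_bernstein i F
      have hF' := congrArg φ.onAlg hF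
      rw [map_mul, map_mul, map_sub, map_sub, φ.onAlg_numer, φ.onAlg_reflAlg, hφ1, hφ1,
        map_zero] at hF'
      have hα : q (-(2 : ℤ) • (S.upper P).root i) = -(2 : ℤ) • (S.lower P).root i :=
        map_zsmul q _ _
      rw [hα] at hF'
      have hne : (mono 0 - mono (-(2 : ℤ) • (S.lower P).root i) :
          AddMonoidAlgebra ℂ (X ⧸ S.perp P)) ≠ 0 := by
        rw [sub_ne_zero, ← hα, ← map_zero q]
        intro h0
        have h1 := mono_injective h0
        have h2 : -(2 : ℤ) • S.R.root i ∈ S.perp P :=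
          (QuotientAddGroup.eq_zero_iff _).1 (h1.symm.trans (map_zero q))
        have h3 := h2 i i.2
        rw [map_smul, root_coroot'_eq_pairing, pairing_same] at h3
        norm_num at h3
      have hg' : φ.onAlg F' = f' := mul_right_cancel₀ hne (hF'.trans h.symm)
      rw [← hg', map_sub, map_mul, map_mul, hgN, hgL, hgL]
      have hr : (S.lower P).reflAlg i (φ.onAlg F) = φ.onAlg ((S.upper P).reflAlg i F) :=
        (φ.onAlg_reflAlg i F).symm
      rw [hr, hgL, ← (S.upper P).bernstein i F F' hF, map_sub, map_mul, map_mul]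
  refine ⟨RingQuot.liftAlgHom ℂ ⟨g, hrel⟩, fun a => ?_⟩
  suffices h : (RingQuot.liftAlgHom ℂ ⟨g, hrel⟩ : (S.lower P).Hecke →ₐ[ℂ] B).comp (S.quot P) = τ from
    DFunLike.congr_fun h a
  refine hecke_ext (fun x => ?_) fun i => ?_
  · rw [AlgHom.comp_apply, quot_theta, theta, RingQuot.liftAlgHom_mkAlgHom_apply]
    exact hgθ x
  · rw [AlgHom.comp_apply, quot_N, N, RingQuot.liftAlgHom_mkAlgHom_apply]
    exact hgN i

/-! ### Extension of characters -/

/-- A character of a subgroup extends to the whole group. -/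
lemma exists_extend_char {A C : Type*} [AddCommGroup A] [AddCommGroup C] (f : A →+ C)
    (hf : Function.Injective f) (χ : AddChar A ℂ) : ∃ t : AddChar C ℂ, ∀ a, t (f a) = χ a := by
  have hdiv : ∀ n : ℕ, n ≠ 0 → Function.Surjective fun u : Additive ℂˣ => n • u := by
    intro n hn u
    obtain ⟨z, hz⟩ := IsAlgClosed.exists_pow_nat_eq ((Additive.toMul u : ℂˣ) : ℂ) (Nat.pos_of_ne_zero hn)
    have hz0 : z ≠ 0 := by
      rintro rfl
      rw [zero_pow hn] at hz
      exact (Additive.toMul u : ℂˣ).ne_zero hz.symm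
    exact ⟨Additive.ofMul (Units.mk0 z hz0), Additive.toMul.injective (Units.ext hz)⟩
  let _ : DivisibleBy (Additive ℂˣ) ℕ := divisibleByOfSMulRightSurj _ _ fun {n} hn => hdiv n hn
  let _ : DivisibleBy (Additive ℂˣ) ℤ := AddGroup.divisibleByIntOfDivisibleByNat _
  let g : A →+ Additive ℂˣ :=
    { toFun := fun a => Additive.ofMul (Units.mk0 (χ a) (addChar_ne_zero χ a))
      map_zero' := Additive.toMul.injective (Units.ext χ.map_zero_eq_one)
      map_add' := fun a b => Additive.toMul.injective (Units.ext (χ.map_add_eq_mul a b)) }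
  obtain ⟨h, hh⟩ := (Module.Baer.of_divisible (Additive ℂˣ)).extension_property_addMonoidHom f hf g
  refine ⟨⟨fun c => ((Additive.toMul (h c) : ℂˣ) : ℂ), by simp, fun a b => by simp⟩, fun a => ?_⟩
  have := DFunLike.congr_fun hh a
  change h (f a) = g a at this
  change ((Additive.toMul (h (f a)) : ℂˣ) : ℂ) = _
  rw [this]; rfl

/-- The subgroup `X ∩ ℚ P`. -/
def ratSpan (P : Set ι) : AddSubgroup X where
  carrier := {x | ∃ n : ℤ, n ≠ 0 ∧ n • x ∈ AddSubgroup.closure (S.R.root '' P)}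
  zero_mem' := ⟨1, one_ne_zero, by rw [smul_zero]; exact zero_mem _⟩
  add_mem' := by
    rintro x y ⟨n, hn, hx⟩ ⟨m, hm, hy⟩
    refine ⟨n * m, mul_ne_zero hn hm, ?_⟩
    rw [smul_add, mul_comm n m, mul_smul, mul_comm m n, mul_smul]
    exact add_mem (zsmul_mem hx _) (zsmul_mem hy _)
  neg_mem' := by
    rintro x ⟨n, hn, hx⟩
    exact ⟨n, hn, by rw [smul_neg]; exact neg_mem hx⟩

/-- Every character of `X ∩ (P^∨)^⊥` is the restriction of an element of `T^P`. -/
lemma exists_torusUpper [Finite ι] (hP : P ⊆ S.simple) (t : AddChar X ℂ) :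
    ∃ t' ∈ S.torusUpper P, ∀ x ∈ S.perp P, t' x = t x := by
  let f : S.perp P →+ X ⧸ S.ratSpan P := (QuotientAddGroup.mk' (S.ratSpan P)).comp (S.perp P).subtype
  have hf : Function.Injective f := (injective_iff_map_eq_zero f).2 fun x hx => by
    obtain ⟨n, hn, h⟩ := (QuotientAddGroup.eq_zero_iff (x : X)).1 hx
    exact Subtype.ext (S.eq_zero_of_mem_perp hP x.2 hn h)
  obtain ⟨t', ht'⟩ := exists_extend_char f hf (t.compAddMonoidHom (S.perp P).subtype)
  refine ⟨t'.compAddMonoidHom (QuotientAddGroup.mk' (S.ratSpan P)), fun x hx => ?_, fun x hx =>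
    ht' ⟨x, hx⟩⟩
  rw [AddChar.compAddMonoidHom_apply, QuotientAddGroup.mk'_apply,
    (QuotientAddGroup.eq_zero_iff x).2 hx, AddChar.map_zero_eq_one]

end ExtendedDatum
end AffineHecke
end

noncomputable section
namespace AffineHecke
open scoped TensorProduct Pointwise

/-! ### Langlands data in representations of `ℋ` -/

open BernsteinDatum RootPairing
namespace ExtendedDatum
variable {ι X Y Γ : Type*} [AddCommGroup X] [AddCommGroup Y] [Group Γ]
variable (S : ExtendedDatum ι X Y Γ) {P : Set ι}

/-- The weights of `σ ∘ φ_{t'}` are the products of `t'` with the weights of `σ`, so for tempered `σ`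
their exponents differ from `log |t'|` by elements of the cone. -/
lemma mem_negCone_of_weight {V : Type*} [AddCommGroup V] [Module ℂ V]
    {σ : (S.lower P).Hecke →ₐ[ℂ] Module.End ℂ V} {t t' : AddChar X ℂ} (ht' : t' ∈ S.torusUpper P)
    (hσ : (S.lower P).IsTempered σ) [Finite ι] {v : V}
    (hv : IsEigen (thetaRep _ ((σ.comp (S.quot P)).comp (S.twist ht'))) (wtHom t) v) :
    logAbs t - logAbs t' ∈ S.negC P := by
  obtain ⟨hv0, hv⟩ := isEigen_iff.1 hv
  have h1 : ∀ x : X, σ ((S.lower P).theta (QuotientAddGroup.mk' (S.perp P) x)) v =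
      (t x * t' (-x)) • v := fun x => by
    have h2 := hv x
    rw [AlgHom.comp_apply, AlgHom.comp_apply, twist_theta, map_smul, map_smul, quot_theta,
      LinearMap.smul_apply] at h2
    rw [mul_comm, mul_smul, ← h2, smul_smul, mul_comm, addChar_mul_neg, one_smul]
  have key : ∀ {a b : ℂ}, a • v = b • v → a = b := fun h => smul_left_injective ℂ hv0 h
  have hs : Function.Surjective (QuotientAddGroup.mk' (S.perp P)) :=
    QuotientAddGroup.mk'_surjective _
  choose s hs using hs
  have h2 : ∀ y, σ ((S.lower P).theta y) v = (t (s y) * t' (-s y)) • v := fun y => by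
    rw [← h1, hs]
  let u : AddChar (X ⧸ S.perp P) ℂ :=
    { toFun := fun y => t (s y) * t' (-s y)
      map_zero_eq_one' := key (by rw [← h2, theta_zero, map_one, one_smul]; rfl)
      map_add_eq_mul' := fun y z => key (by
        rw [← h2, theta_add, map_mul, Module.End.mul_apply, h2, map_smul, h2, smul_smul, mul_comm]) }
  have h3 : ∀ x, u (QuotientAddGroup.mk' (S.perp P) x) = t x * t' (-x) := fun x =>
    key (by rw [← h1, h2]; rfl)
  have h4 := S.mem_negCone_lower.1 (hσ u ⟨v, hv0, h2⟩)
  convert h4 using 1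
  ext x
  change Real.log ‖t x‖ - Real.log ‖t' x‖ = Real.log ‖u (QuotientAddGroup.mk' (S.perp P) x)‖
  rw [h3, norm_mul, Real.log_mul (norm_ne_zero_iff.2 (addChar_ne_zero t x))
    (norm_ne_zero_iff.2 (addChar_ne_zero t' _))]
  have h5 := map_neg (logAbs t') x
  change Real.log ‖t' (-x)‖ = - Real.log ‖t' x‖ at h5
  rw [h5]; ring

namespace LanglandsDatum

variable {S} (L : LanglandsDatum.{v} S)

lemma isIrred_rep : IsIrred L.rep :=
  (L.irred.comp S.quot_surjective).comp (S.twist_surjective L.t_mem)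

variable [Finite ι]

lemma weight_rep {t : AddChar X ℂ} {v : L.V} (hv : IsEigen (thetaRep _ L.rep) (wtHom t) v) :
    logAbs t - logAbs L.t ∈ S.negC L.P :=
  S.mem_negCone_of_weight L.t_mem L.tempered hv

variable [Module.Finite ℤ X]

lemma finiteDimensional : FiniteDimensional ℂ L.V :=
  S.finiteDimensional_of_isIrred L.P_subset L.isIrred_rep

end LanglandsDatum

variable [Finite ι] [Module.Finite ℤ X]
variable {S}
variable {Q : Type*} [AddCommGroup Q] [Module ℂ Q] {π : S.H →ₐ[ℂ] Module.End ℂ Q}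

/-- A representation of finite dimension has finitely many weights. -/
lemma finite_weights [FiniteDimensional ℂ Q] :
    {t : AddChar X ℂ | ∃ v, IsEigen (thetaRep _ π) (wtHom t) v}.Finite := by
  let f : X → Module.End ℂ Q := fun x => π ((S.upper S.simple).theta x)
  have hcomm : ∀ x y, Commute (f x) (f y) := fun x y => by
    change f x * f y = f y * f x
    simp only [f]
    rw [← map_mul, ← map_mul, ← theta_add, ← theta_add, add_comm]
  have h1 := Module.End.independent_iInf_maxGenEigenspace_of_forall_mapsTo f
    fun x y φ => Module.End.mapsTo_maxGenEigenspace_of_comm (hcomm y x) φ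
  have h2 := WellFoundedGT.finite_ne_bot_of_iSupIndep h1
  refine Set.Finite.of_finite_image (f := fun t : AddChar X ℂ => (t : X → ℂ))
    (h2.subset ?_) DFunLike.coe_injective.injOn
  rintro _ ⟨t, ⟨v, hv⟩, rfl⟩
  obtain ⟨hv0, hv⟩ := isEigen_iff.1 hv
  refine (Submodule.ne_bot_iff _).2 ⟨v, ?_, hv0⟩
  rw [Submodule.mem_iInf]
  intro x
  rw [Module.End.mem_maxGenEigenspace]
  exact ⟨1, by rw [pow_one, LinearMap.sub_apply, hv]; simp⟩

variable [Finite Γ]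

/-- A nonpositive combination of simple coroots that is orthogonal to a dominant `μ` involves only
the coroots at which `μ` vanishes. -/
lemma mem_negC_of_ip_eq_zero {μ ν : X →+ ℝ} (hμ : ∀ i ∈ S.simple, 0 ≤ μ (S.R.root i))
    (hν : ν ∈ S.negC S.simple) (h : S.ip μ ν = 0) :
    ν ∈ S.negC {i | i ∈ S.simple ∧ μ (S.R.root i) = 0} := by
  suffices H : S.ip μ ν ≤ 0 ∧ (S.ip μ ν = 0 → ν ∈ S.negC {i | i ∈ S.simple ∧ μ (S.R.root i) = 0})
    from H.2 h
  clear h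
  induction hν using Submodule.span_induction with
  | mem x hx =>
    obtain ⟨i, rfl⟩ := hx
    refine ⟨S.ip_nonpos subset_rfl hμ (S.neg_cor_mem_negC i.2), fun h => S.neg_cor_mem_negC ⟨i.2, ?_⟩⟩
    change S.ip μ (-S.cor i) = 0 at h
    rw [← neg_one_smul ℝ, ip_smul_right, S.ip_cor i.2] at h
    have := (S.nrm_cor_pos i).ne'
    simpa [this] using h
  | zero => exact ⟨S.ip_nonpos subset_rfl hμ (zero_mem _), fun _ => zero_mem _⟩
  | add x y _ _ hx hy =>
    rw [ip_add_right]
    exact ⟨add_nonpos hx.1 hy.1, fun h => add_mem (hx.2 (by linarith [hx.1, hy.1]))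
      (hy.2 (by linarith [hx.1, hy.1]))⟩
  | smul c x _ hx =>
    have h1 : S.ip μ (c • x) = c * S.ip μ x := S.ip_smul_right _ _ _
    rw [h1]
    refine ⟨mul_nonpos_of_nonneg_of_nonpos c.2 hx.1, fun h => ?_⟩
    rcases mul_eq_zero.1 h with h2 | h2
    · rw [NNReal.coe_eq_zero.1 h2, zero_smul]; exact zero_mem _
    · exact Submodule.smul_mem _ _ (hx.2 h2)

/-- The representation `τ` of `ℋ^P` and the character `t ∈ T^P` that give its central character on
`X ∩ (P^∨)^⊥` constitute a Langlands datum, provided that `τ` satisfies the estimate on weights. -/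
lemma exists_langlandsDatum_of_rep (hP : P ⊆ S.simple) {V : Type v} [AddCommGroup V] [Module ℂ V]
    {τ : (S.upper P).Hecke →ₐ[ℂ] Module.End ℂ V} (hτ : IsIrred τ) {t : AddChar X ℂ}
    (ht : t ∈ S.torusUpper P) (hpos : logAbs t ∈ S.posCone P)
    (hcentral : ∀ x ∈ S.perp P, ∀ v, τ ((S.upper P).theta x) v = t x • v)
    (hw : ∀ t' v, IsEigen (thetaRep _ τ) (wtHom t') v → logAbs t' - logAbs t ∈ S.negC P) :
    ∃ (L : LanglandsDatum.{v} S) (h : L.P = P) (e : L.V ≃ₗ[ℂ] V),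
      ∀ a v, e (L.rep a v) = τ (S.incl h.subset a) (e v) := by
  obtain ⟨σ, hσ⟩ := S.exists_lower_hom (P := P) (τ.comp (S.twist (S.inv_mem_torusUpper ht))) fun x hx => by
    rw [AlgHom.comp_apply, twist_theta, map_smul]
    ext v
    rw [LinearMap.smul_apply, hcentral x hx, smul_smul, AddChar.inv_apply, mul_comm,
      addChar_mul_neg, one_smul]; rfl
  have hrep : ∀ a, σ (S.quot P (S.twist ht a)) = τ a := fun a => by
    rw [hσ, AlgHom.comp_apply, twist_twist]
  have hirr : IsIrred σ := ⟨hτ.1, fun U hU => hτ.2 U fun a v hv => by rw [← hrep]; exact hU _ v hv⟩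
  refine ⟨⟨P, hP, V, σ, hirr, ?_, t, ht, hpos⟩, rfl, LinearEquiv.refl ℂ V, fun a v => ?_⟩
  · rintro s ⟨v, hv0, hv⟩
    rw [mem_negCone_lower]
    let t' : AddChar X ℂ := t * s.compAddMonoidHom (QuotientAddGroup.mk' (S.perp P))
    have h1 : IsEigen (thetaRep _ τ) (wtHom t') v := isEigen_iff.2 ⟨hv0, fun x => by
      rw [← hrep, twist_theta, map_smul, map_smul, quot_theta, LinearMap.smul_apply, hv, smul_smul]
      rfl⟩
    have h2 := hw t' v h1
    convert h2 using 1
    ext x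
    change Real.log ‖s (QuotientAddGroup.mk' (S.perp P) x)‖ =
      Real.log ‖t x * s (QuotientAddGroup.mk' (S.perp P) x)‖ - Real.log ‖t x‖
    rw [norm_mul, Real.log_mul (norm_ne_zero_iff.2 (addChar_ne_zero t x))
      (norm_ne_zero_iff.2 (addChar_ne_zero s _))]
    ring
  · have h1 : S.incl (subset_refl P) a = a := by
      suffices h : S.incl (subset_refl P) = AlgHom.id ℂ _ from DFunLike.congr_fun h a
      exact hecke_ext (fun x => S.incl_theta _ x) fun i => S.incl_N _ i
    change σ (S.quot P (S.twist ht a)) v = τ (S.incl (subset_refl P) a) v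
    rw [h1, hrep]

/-- Transport of a representation to a space in a given universe. -/
lemma exists_transport {B : Type*} [Ring B] [Algebra ℂ B] {V : Type*} [AddCommGroup V] [Module ℂ V]
    [FiniteDimensional ℂ V] (π : B →ₐ[ℂ] Module.End ℂ V) :
    ∃ (V' : Type v) (_ : AddCommGroup V') (_ : Module ℂ V') (σ : B →ₐ[ℂ] Module.End ℂ V')
      (e : V' ≃ₗ[ℂ] V), ∀ b v, e (σ b v) = π b (e v) := by
  let e : ULift.{v} (Fin (Module.finrank ℂ V) → ℂ) ≃ₗ[ℂ] V :=
    ULift.moduleEquiv.trans (Module.finBasis ℂ V).equivFun.symm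
  refine ⟨_, inferInstance, inferInstance, (e.symm.conjAlgEquiv ℂ).toAlgHom.comp π, e, fun b v => ?_⟩
  change e (e.symm (π b (e.symm.symm v))) = _
  rw [e.apply_symm_apply]; rfl

/-- Every nonzero representation of `ℋ` of finite dimension contains the representation of some
parabolic subalgebra that is given by a Langlands datum. It comes from a weight whose dominant part has
maximal norm. -/
lemma exists_langlandsDatum [FiniteDimensional ℂ Q] [Nontrivial Q] (π : S.H →ₐ[ℂ] Module.End ℂ Q) :
    ∃ (L : LanglandsDatum.{v} S) (φ : L.V →ₗ[ℂ] Q), φ ≠ 0 ∧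
      Equivariant L.rep (π.comp (S.incl L.P_subset)) φ := by
  obtain ⟨t₀, ⟨v₀, hv₀⟩, hmax⟩ := (finite_weights (π := π)).exists_maximalFor
    (fun t => S.size (logAbs t)) _ (by
      obtain ⟨t, ht⟩ := exists_isWeight (π := π)
      exact ⟨t, isWeight_iff.1 ht⟩)
  have hmax' : ∀ t v, IsEigen (thetaRep _ π) (wtHom t) v →
      S.size (logAbs t) ≤ S.size (logAbs t₀) := fun t v h => by
    by_contra! hlt
    exact absurd (hmax ⟨v, h⟩ hlt.le) (not_le.2 hlt)
  set μ := S.dom (logAbs t₀) with hμ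
  obtain ⟨ν, hdec⟩ := S.exists_isDec_dom (logAbs t₀)
  set P : Set ι := {i | i ∈ S.simple ∧ μ (S.R.root i) = 0} with hPdef
  have hP : P ⊆ S.simple := fun i hi => hi.1
  have hν : ν ∈ S.negC P := mem_negC_of_ip_eq_zero hdec.dominant hdec.mem hdec.orth
  have hμP : μ ∈ S.posCone P := ⟨fun i hi => hi.2, fun i hi =>
    lt_of_le_of_ne (hdec.dominant i hi.1) fun h => hi.2 ⟨hi.1, h.symm⟩⟩
  have hperp : ∀ κ ∈ S.corSpan P, ∀ x ∈ S.perp P, κ x = 0 := by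
    intro κ hκ x hx
    induction hκ using Submodule.span_induction with
    | mem κ h =>
      obtain ⟨i, rfl⟩ := h
      change S.cor i x = 0
      rw [cor_apply, hx i i.2, Int.cast_zero]
    | zero => rfl
    | add a b _ _ ha hb => rw [AddMonoidHom.add_apply, ha, hb, add_zero]
    | smul c a _ ha => change c * a x = 0; rw [ha, mul_zero]
  obtain ⟨t, ht, htt⟩ := S.exists_torusUpper hP t₀
  have hlog : logAbs t = μ := by
    refine sub_eq_zero.1 (S.eq_zero_of_perp hP (fun x hx => ?_) fun i hi => ?_)
    · have h1 : logAbs t x = logAbs t₀ x := by change Real.log _ = Real.log _; rw [htt x hx]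
      rw [AddMonoidHom.sub_apply, h1, hdec.eq, AddMonoidHom.add_apply,
        hperp ν (S.mem_corSpan_of_mem_negC hν) x hx, add_zero, sub_self]
    · have h1 : logAbs t (S.R.root i) = 0 := by
        change Real.log ‖t _‖ = 0
        rw [S.torusUpper_root ht ⟨i, hi⟩, norm_one, Real.log_one]
      rw [AddMonoidHom.sub_apply, h1, hi.2, sub_zero]
  -- The common eigenspace of the central elements `θ_x` of `ℋ^P`.
  let πP := π.comp (S.incl hP)
  let E : Submodule ℂ Q := ⨅ x : S.perp P,
    LinearMap.ker (πP ((S.upper P).theta x) - t (x : X) • (1 : Module.End ℂ Q))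
  have hEmem : ∀ v, v ∈ E ↔ ∀ x ∈ S.perp P, πP ((S.upper P).theta x) v = t x • v := fun v => by
    rw [Submodule.mem_iInf]
    refine ⟨fun h x hx => ?_, fun h x => ?_⟩
    · exact sub_eq_zero.1 (h ⟨x, hx⟩)
    · exact sub_eq_zero.2 (h x x.2)
  have hEinv : IsInvariant πP E := fun a v hv => by
    rw [hEmem] at hv ⊢
    intro x hx
    rw [← Module.End.mul_apply, ← map_mul, S.commute_theta hx, map_mul, Module.End.mul_apply,
      hv x hx, map_smul]
  have hE0 : E ≠ ⊥ := by
    obtain ⟨h0, h1⟩ := isEigen_iff.1 hv₀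
    refine (Submodule.ne_bot_iff _).2 ⟨v₀, (hEmem _).2 fun x hx => ?_, h0⟩
    change π (S.incl hP _) v₀ = _
    rw [incl_theta, h1, htt x hx]
  obtain ⟨U, hUE, hU, hirr⟩ := exists_irred_sub hEinv hE0
  obtain ⟨V, _, _, τ, e, he⟩ := exists_transport.{v} (subRep πP U hU)
  have hτ : IsIrred τ := hirr.of_repEquiv (RepEquiv.symm ⟨e, he⟩)
  have hval : ∀ a v, (e (τ a v) : Q) = π (S.incl hP a) (e v : Q) := fun a v => by
    rw [he]; rfl
  obtain ⟨L, hLP, e', he'⟩ := exists_langlandsDatum_of_rep hP hτ ht (hlog ▸ hμP)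
    (fun x hx v => e.injective (Subtype.ext (by
      rw [map_smul]
      exact (hval _ v).trans ((hEmem _).1 (hUE (e v).2) x hx))))
    (fun t' v h => by
      obtain ⟨h0, h1⟩ := isEigen_iff.1 h
      have h2 : IsEigen (thetaRep _ π) (wtHom t') (e v : Q) := isEigen_iff.2 ⟨fun h3 => h0
        (e.map_eq_zero_iff.1 (Subtype.ext h3)), fun x => by
          have := hval ((S.upper _).theta x) v
          rw [incl_theta, h1, map_smul] at this
          exact this.symm⟩
      rw [hlog]
      refine S.mem_negC_of_size_le hP hμP (S.mem_corSpan_of_perp hP fun x hx => ?_) (hmax' t' _ h2)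
      have h4 := (hEmem _).1 (hUE (e v).2) x hx
      change π (S.incl hP _) _ = _ at h4
      rw [incl_theta, (isEigen_iff.1 h2).2 x] at h4
      have h5 : t' x = t x := smul_left_injective ℂ h2.1 h4
      rw [AddMonoidHom.sub_apply, ← hlog]
      change Real.log ‖t' x‖ - Real.log ‖t x‖ = 0
      rw [h5, sub_self])
  refine ⟨L, U.subtype ∘ₗ e.toLinearMap ∘ₗ e'.toLinearMap, fun h0 => ?_, fun a v => ?_⟩
  · have := L.isIrred_rep.1
    obtain ⟨v, hv⟩ := exists_ne (0 : L.V)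
    exact hv (e'.map_eq_zero_iff.1 (e.map_eq_zero_iff.1 (Subtype.ext (LinearMap.congr_fun h0 v))))
  · change (e (e' (L.rep a v)) : Q) = π (S.incl _ a) (e (e' v) : Q)
    rw [he', hval]
    congr 2
    suffices h : (S.incl hP).comp (S.incl hLP.subset) = S.incl L.P_subset from DFunLike.congr_fun h a
    refine hecke_ext (fun x => ?_) fun i => ?_
    · rw [AlgHom.comp_apply, incl_theta, incl_theta, incl_theta]
    · rw [AlgHom.comp_apply, incl_N, incl_N, incl_N]

end ExtendedDatum
end AffineHecke
end

noncomputable section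
namespace AffineHecke
open scoped TensorProduct Pointwise

/-! ### The Langlands classification for `ℋ` -/

open BernsteinDatum RootPairing
namespace ExtendedDatum
variable {ι X Y Γ : Type*} [AddCommGroup X] [AddCommGroup Y] [Group Γ]
variable {S : ExtendedDatum ι X Y Γ}
variable [Finite ι] [Finite Γ] [Module.Finite ℤ X]
variable {Q : Type*} [AddCommGroup Q] [Module ℂ Q] {π : S.H →ₐ[ℂ] Module.End ℂ Q}

lemma LanglandsGenerated.finiteDimensional {κ : Type*} [Finite κ] {P : κ → Set ι}
    {E : κ → Submodule ℂ Q} {μ : κ → X →+ ℝ} {r : ℝ} (G : S.LanglandsGenerated π P E μ r)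
    (hE : ∀ k, FiniteDimensional ℂ (E k)) : FiniteDimensional ℂ Q := by
  have := S.reduced
  have := finite_parab (R := S.R) (b := S.base) (P := S.simple) subset_rfl
  obtain ⟨n, hn⟩ := G.exists_filtration_eq_top
  let M : (parab S.R S.simple) × κ → Submodule ℂ Q := fun p => (E p.2).map (π (S.Nw S.simple p.1))
  have h1 : (⨆ p, M p) = ⊤ := by
    rw [eq_top_iff, ← hn]
    refine Submodule.span_le.2 ?_
    rintro _ ⟨w, hw, -, k, e, he, rfl⟩
    exact Submodule.mem_iSup_of_mem (⟨⟨w, hw⟩, k⟩ : (parab S.R S.simple) × κ) ⟨e, he, rfl⟩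
  have h2 : ∀ p, FiniteDimensional ℂ (M p) := fun p => inferInstance
  have h3 : FiniteDimensional ℂ (⨆ p, M p : Submodule ℂ Q) := Submodule.finite_iSup M
  rw [h1] at h3
  exact Module.Finite.equiv Submodule.topEquiv

/-- The weights in the image of a representation of `ℋ^P` are weights of that representation. -/
lemma exists_isEigen_of_mem_range {P : Set ι} (hP : P ⊆ S.simple) {M : Type*} [AddCommGroup M]
    [Module ℂ M] [FiniteDimensional ℂ M] {τ : (S.upper P).Hecke →ₐ[ℂ] Module.End ℂ M}
    {j : M →ₗ[ℂ] Q} (hj : Equivariant τ (π.comp (S.incl hP)) j) {m : M} {t : AddChar X ℂ}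
    (h : IsEigen (thetaRep _ π) (wtHom t) (j m)) : ∃ m', IsEigen (thetaRep _ τ) (wtHom t) m' := by
  refine exists_isEigen_of_map (ρ' := thetaRep _ π) (N := ⊥) j (fun f x => ?_) (v := m)
    (by simpa using h.1) fun f => ?_
  · rw [Submodule.mem_bot, AlgHom.comp_apply, hj, AlgHom.comp_apply, S.incl_thetaHom, sub_eq_zero]
    rfl
  · rw [h.2, sub_self]; exact zero_mem _

lemma isEigen_map {P : Set ι} (hP : P ⊆ S.simple) {M : Type*} [AddCommGroup M]
    [Module ℂ M] {τ : (S.upper P).Hecke →ₐ[ℂ] Module.End ℂ M}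
    {j : M →ₗ[ℂ] Q} (hj : Equivariant τ (π.comp (S.incl hP)) j) {m : M} {t : AddChar X ℂ}
    (h : IsEigen (thetaRep _ τ) (wtHom t) m) (h0 : j m ≠ 0) :
    IsEigen (thetaRep _ π) (wtHom t) (j m) := by
  refine ⟨h0, fun f => ?_⟩
  rw [← map_smul, ← h.2, AlgHom.comp_apply, AlgHom.comp_apply, hj, AlgHom.comp_apply,
    S.incl_thetaHom]

/-- The cones `𝔞^{P++}` are disjoint. -/
lemma eq_of_mem_posCone {P P' : Set ι} (hP : P ⊆ S.simple) (hP' : P' ⊆ S.simple) {μ : X →+ ℝ}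
    (h : μ ∈ S.posCone P) (h' : μ ∈ S.posCone P') : P = P' := by
  have key : ∀ {P P' : Set ι}, P ⊆ S.simple → μ ∈ S.posCone P → μ ∈ S.posCone P' → P ⊆ P' := by
    intro P P' hP h h' i hi
    by_contra hi'
    exact (h'.2 i ⟨hP hi, hi'⟩).ne' (h.1 i hi)
  exact (key hP h h').antisymm (key hP' h' h)

/-- If the set `E` generates the representation, then its translates span the whole space. -/
lemma eq_top_of_generates {B : Type*} [Ring B] [Algebra ℂ B] {V : Type*} [AddCommGroup V]
    [Module ℂ V] {π : B →ₐ[ℂ] Module.End ℂ V} {E : Set V}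
    (hE : ∀ U, IsInvariant π U → E ⊆ U → U = ⊤) {U : Submodule ℂ V}
    (h : ∀ e ∈ E, ∀ b, π b e ∈ U) : U = ⊤ := by
  let U' : Submodule ℂ V :=
    { carrier := {v | ∀ b, π b v ∈ U}
      add_mem' := fun ha hb b => by rw [map_add]; exact U.add_mem (ha b) (hb b)
      zero_mem' := fun b => by rw [map_zero]; exact U.zero_mem
      smul_mem' := fun c v hv b => by rw [map_smul]; exact U.smul_mem c (hv b) }
  have h1 : U' = ⊤ := hE U' (fun a v hv b => by
    rw [← Module.End.mul_apply, ← map_mul]; exact hv _) h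
  rw [eq_top_iff]
  intro v _
  have h2 : v ∈ U' := h1 ▸ Submodule.mem_top
  simpa using h2 1

namespace LanglandsDatum

variable (L : LanglandsDatum.{v} S)

/-- The central exponent `log |t|` of a Langlands datum. -/
abbrev exponent : X →+ ℝ := logAbs L.t

variable {L}

lemma generated {j : L.V →ₗ[ℂ] Q} (hj : Equivariant L.rep (π.comp (S.incl L.P_subset)) j)
    (hgen : ∀ U, IsInvariant π U → (Set.range j) ⊆ U → U = ⊤) :
    S.LanglandsGenerated π (fun _ : Unit => L.P) (fun _ => LinearMap.range j)
      (fun _ => L.exponent) (S.nrm L.exponent) where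
  subset _ := L.P_subset
  mem_posCone _ := L.t_pos
  nrm_eq _ := rfl
  invariant _ := hj.range
  weight := by
    rintro - _ ⟨m, rfl⟩ t ht
    have := L.finiteDimensional
    obtain ⟨m', hm'⟩ := exists_isEigen_of_mem_range L.P_subset hj ht
    exact L.weight_rep hm'
  span_eq U hU := eq_top_of_generates hgen (by
    rintro _ ⟨m, rfl⟩ b
    exact hU () _ ⟨m, rfl⟩ b)

/-- A representation of finite dimension that is generated by the image of a Langlands datum has a
unique irreducible quotient: its proper invariant subspaces are those that do not meet the image of the
datum, and they have small weights only. -/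
lemma hasUniqueIrredQuotient [FiniteDimensional ℂ Q] {j : L.V →ₗ[ℂ] Q}
    (hj : Equivariant L.rep (π.comp (S.incl L.P_subset)) j) (h0 : j ≠ 0)
    (hgen : ∀ U, IsInvariant π U → (Set.range j) ⊆ U → U = ⊤) : HasUniqueIrredQuotient π := by
  have G := generated hj hgen
  have := L.finiteDimensional
  have := L.isIrred_rep.1
  have hinj := L.isIrred_rep.injective hj h0
  have : Nontrivial Q := hinj.nontrivial
  obtain ⟨t, ht⟩ := exists_isWeight (π := L.rep)
  obtain ⟨v, hv⟩ := isWeight_iff.1 ht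
  have hv' := isEigen_map L.P_subset hj hv fun h => hv.1 (hinj (h.trans (map_zero j).symm))
  have hθ : ∀ {U : Submodule ℂ Q}, IsInvariant π U → IsInvariant (thetaRep _ π) U :=
    fun hU f v hv => hU _ v hv
  refine hasUniqueIrredQuotient_of_small (S.SmallWeights π (S.nrm L.exponent))
    (fun U U' hU hU' => SmallWeights.sup (hθ hU) (hθ hU')) (fun U hU hne v hv t ht => ?_) fun htop => ?_
  · refine (G.weight_cases ht).resolve_right fun ⟨_, _, h1⟩ => hne ?_
    obtain ⟨m, rfl⟩ : v ∈ LinearMap.range j := (iSup_le fun _ => le_rfl : _ ≤ LinearMap.range j) h1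
    have h2 : IsInvariant L.rep (U.comap j) := hj.comap fun a v hv => hU _ v hv
    rcases L.isIrred_rep.2 _ h2 with h3 | h3
    · have h4 : m ∈ U.comap j := hv
      rw [h3, Submodule.mem_bot] at h4
      exact absurd (by rw [h4, map_zero]) ht.1
    · exact hgen U hU (by
        rintro _ ⟨m, rfl⟩
        exact (h3 ▸ Submodule.mem_top : m ∈ U.comap j))
  · have h1 := htop _ Submodule.mem_top t hv'
    rw [size, G.dom_eq () ⟨v, rfl⟩ hv'] at h1
    exact lt_irrefl _ h1

lemma equivariant_indUnit : Equivariant L.rep (L.standard.comp (S.incl L.P_subset))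
    (indUnit (S.incl L.P_subset) L.rep) := fun a v => indUnit_apply _ _ a v

variable (L) in
lemma indUnit_injective : Function.Injective (indUnit (S.incl L.P_subset) L.rep) :=
  S.indUnit_incl_injective L.P_subset subset_rfl L.rep

variable (L) in
lemma indUnit_ne_zero : indUnit (S.incl L.P_subset) L.rep ≠ 0 := fun h => by
  have := L.isIrred_rep.1
  obtain ⟨v, hv⟩ := exists_ne (0 : L.V)
  exact hv (L.indUnit_injective (by rw [h]; rfl))

lemma standard_generates (U) (hU : IsInvariant L.standard U)
    (h : Set.range (indUnit (S.incl L.P_subset) L.rep) ⊆ U) : U = ⊤ := by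
  rw [eq_top_iff]
  intro x _
  refine (Submodule.span_le.2 ?_ : _ ≤ U) (ind_span (S.incl L.P_subset) L.rep x)
  rintro _ ⟨a, v, rfl⟩
  exact hU a _ (h ⟨v, rfl⟩)

variable (L) in
lemma finiteDimensional_standard : FiniteDimensional ℂ (IndSpace (S.incl L.P_subset) L.rep) := by
  have := L.finiteDimensional
  exact (generated equivariant_indUnit standard_generates).finiteDimensional fun _ => inferInstance

variable (L) in
lemma hasUniqueIrredQuotient_standard : HasUniqueIrredQuotient L.standard := by
  have := L.finiteDimensional_standard
  exact hasUniqueIrredQuotient equivariant_indUnit L.indUnit_ne_zero standard_generates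

/-- Frobenius reciprocity for the Langlands quotient. -/
lemma repEquiv_head (hπ : IsIrred π) {j : L.V →ₗ[ℂ] Q}
    (hj : Equivariant L.rep (π.comp (S.incl L.P_subset)) j) (h0 : j ≠ 0) :
    RepEquiv π (headRep L.standard) := by
  obtain ⟨F, hF1, hF2⟩ := exists_ind_lift (f := S.incl L.P_subset) (π := L.rep) (τ := π) j hj
  refine L.hasUniqueIrredQuotient_standard.repEquiv hπ (F := F) hF2 fun h => h0 ?_
  ext v
  rw [← hF1, h]; rfl

variable (L) in
/-- The map of a Langlands datum to its Langlands quotient. -/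
def toHead : L.V →ₗ[ℂ] _ ⧸ radical L.standard :=
  (radical L.standard).mkQ ∘ₗ indUnit (S.incl L.P_subset) L.rep

lemma equivariant_toHead :
    Equivariant L.rep ((headRep L.standard).comp (S.incl L.P_subset)) L.toHead := fun a v => by
  change (radical L.standard).mkQ _ = _
  rw [equivariant_indUnit]; rfl

lemma toHead_ne_zero : L.toHead ≠ 0 := fun h => by
  refine Submodule.Quotient.nontrivial_iff.1 L.hasUniqueIrredQuotient_standard.1.1
    (standard_generates _ (isInvariant_radical _) ?_)
  rintro _ ⟨v, rfl⟩
  exact (Submodule.Quotient.mk_eq_zero _).1 (LinearMap.congr_fun h v)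

lemma generates_of_isIrred (hπ : IsIrred π) {V : Type*} [AddCommGroup V] [Module ℂ V]
    {j : V →ₗ[ℂ] Q} (h0 : j ≠ 0) (U) (hU : IsInvariant π U) (h : Set.range j ⊆ U) : U = ⊤ := by
  refine (hπ.2 U hU).resolve_left fun h1 => h0 ?_
  ext v
  have : j v ∈ U := h ⟨v, rfl⟩
  rwa [h1, Submodule.mem_bot] at this

/-- Two Langlands data that map to the same irreducible representation are equivalent. -/
lemma equivalent_of_maps {L L' : LanglandsDatum.{v} S} [FiniteDimensional ℂ Q] (hπ : IsIrred π)
    {j : L.V →ₗ[ℂ] Q} (hj : Equivariant L.rep (π.comp (S.incl L.P_subset)) j) (h0 : j ≠ 0)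
    {j' : L'.V →ₗ[ℂ] Q} (hj' : Equivariant L'.rep (π.comp (S.incl L'.P_subset)) j') (h0' : j' ≠ 0) :
    L.Equivalent L' := by
  have G := generated hj (generates_of_isIrred hπ h0)
  have G' := generated hj' (generates_of_isIrred hπ h0')
  have hinj := L.isIrred_rep.injective hj h0
  have hinj' := L'.isIrred_rep.injective hj' h0'
  have := L.finiteDimensional
  have := L'.finiteDimensional
  have := L.isIrred_rep.1
  have := L'.isIrred_rep.1
  obtain ⟨t, ht⟩ := exists_isWeight (π := L.rep)
  obtain ⟨v, hv⟩ := isWeight_iff.1 ht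
  have hv' := isEigen_map L.P_subset hj hv fun h => hv.1 (hinj (h.trans (map_zero j).symm))
  obtain ⟨s, hs⟩ := exists_isWeight (π := L'.rep)
  obtain ⟨u, hu⟩ := isWeight_iff.1 hs
  have hu' := isEigen_map L'.P_subset hj' hu fun h => hu.1 (hinj' (h.trans (map_zero j').symm))
  have h1 : S.size (logAbs t) = S.nrm L.exponent := by rw [size, G.dom_eq () ⟨v, rfl⟩ hv']
  have h2 : S.size (logAbs s) = S.nrm L'.exponent := by rw [size, G'.dom_eq () ⟨u, rfl⟩ hu']
  have h3 := G'.size_le hv'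
  have h4 := G.size_le hu'
  obtain ⟨⟨-, h5⟩, -, h6⟩ := (G'.weight_cases hv').resolve_left (by linarith)
  have h7 : L'.exponent = L.exponent := h5.trans (G.dom_eq () ⟨v, rfl⟩ hv')
  have h8 : j v ∈ LinearMap.range j' := (iSup_le fun _ => le_rfl : _ ≤ LinearMap.range j') h6
  have hP : L.P = L'.P := eq_of_mem_posCone L.P_subset L'.P_subset L.t_pos (by
    have := L'.t_pos; rwa [show logAbs L'.t = logAbs L.t from h7] at this)
  have hsurj : ∀ {P P' : Set ι} (h : P = P'), Function.Surjective (S.incl h.subset) := by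
    rintro P _ rfl a
    refine subalgebra_eq_top (B := (S.incl (subset_refl P)).range) (fun x => ?_) (fun i => ?_) a
    · exact ⟨_, S.incl_theta _ x⟩
    · exact ⟨_, S.incl_N _ i⟩
  have hcomp : ∀ a, S.incl L'.P_subset (S.incl hP.subset a) = S.incl L.P_subset a := fun a => by
    suffices h : (S.incl L'.P_subset).comp (S.incl hP.subset) = S.incl L.P_subset from
      DFunLike.congr_fun h a
    refine hecke_ext (fun x => ?_) fun i => ?_
    · rw [AlgHom.comp_apply, incl_theta, incl_theta, incl_theta]
    · rw [AlgHom.comp_apply, incl_N, incl_N, incl_N]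
  have hG : Equivariant (L'.rep.comp (S.incl hP.subset)) (π.comp (S.incl L.P_subset)) j' :=
    fun a v => by rw [AlgHom.comp_apply, hj', AlgHom.comp_apply, hcomp]; rfl
  have h9 : (LinearMap.range j').comap j = ⊤ := (L.isIrred_rep.2 _ (hj.comap hG.range)).resolve_left
    fun h => hv.1 (by
      have : v ∈ (LinearMap.range j').comap j := h8
      rwa [h, Submodule.mem_bot] at this)
  obtain ⟨e, he⟩ := repEquiv_of_range_le L.isIrred_rep (L'.isIrred_rep.comp (hsurj hP)) hj hG h0 (by
    rintro _ ⟨x, rfl⟩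
    exact (h9 ▸ Submodule.mem_top : x ∈ (LinearMap.range j').comap j))
  exact ⟨hP, e, he⟩

/-- Langlands quotients are isomorphic if and only if the data are equivalent. -/
lemma repEquiv_head_iff {L L' : LanglandsDatum.{v} S} :
    RepEquiv (headRep L.standard) (headRep L'.standard) ↔ L.Equivalent L' := by
  constructor
  · rintro ⟨e, he⟩
    have := L'.finiteDimensional_standard
    refine equivalent_of_maps L'.hasUniqueIrredQuotient_standard.1 (j := e.toLinearMap ∘ₗ L.toHead)
      (fun a v => ?_) (fun h => L.toHead_ne_zero ?_) equivariant_toHead toHead_ne_zero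
    · change e (L.toHead _) = _
      rw [equivariant_toHead]; exact he _ _
    · ext v
      exact e.map_eq_zero_iff.1 (LinearMap.congr_fun h v)
  · rintro ⟨hP, e, he⟩
    refine (repEquiv_head (L := L) L'.hasUniqueIrredQuotient_standard.1
      (j := L'.toHead ∘ₗ e.toLinearMap) (fun a v => ?_) fun h => L'.toHead_ne_zero ?_).symm
    · change L'.toHead (e _) = _
      rw [he, equivariant_toHead, AlgHom.comp_apply, AlgHom.comp_apply]
      congr 2
      suffices h : (S.incl L'.P_subset).comp (S.incl hP.subset) = S.incl L.P_subset from
        DFunLike.congr_fun h a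
      refine hecke_ext (fun x => ?_) fun i => ?_
      · rw [AlgHom.comp_apply, incl_theta, incl_theta, incl_theta]
      · rw [AlgHom.comp_apply, incl_N, incl_N, incl_N]
    · ext v
      obtain ⟨v, rfl⟩ := e.surjective v
      exact LinearMap.congr_fun h v

end LanglandsDatum

lemma exists_repEquiv_head (hπ : IsIrred π) :
    ∃ L : LanglandsDatum.{v} S, RepEquiv π (headRep L.standard) := by
  have := S.finiteDimensional_of_isIrred subset_rfl hπ
  have := hπ.1
  obtain ⟨L, j, h0, hj⟩ := exists_langlandsDatum.{v} π
  exact ⟨L, LanglandsDatum.repEquiv_head hπ hj h0⟩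

end ExtendedDatum
end AffineHecke
end

noncomputable section
namespace AffineHecke
open scoped TensorProduct Pointwise

/-! ### Crossed products and intertwining cocycles -/

namespace Crossed

variable {A : Type*} [Ring A] [Algebra ℂ A] {G : Type*} [Group G] (ρ : G →* (A →ₐ[ℂ] A))

lemma single_eq (g : G) (a : A) :
    (SkewMonoidAlgebra.single g a : Crossed ρ) = of ρ a * gp ρ g := by
  let _ := actionOf ρ
  change SkewMonoidAlgebra.single g a =
    SkewMonoidAlgebra.single (1 : G) a * SkewMonoidAlgebra.single g (1 : A)
  rw [SkewMonoidAlgebra.single_mul_single, one_mul, one_smul, mul_one]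

variable {ρ} in
lemma induction {p : Crossed ρ → Prop} (x : Crossed ρ) (h0 : p 0)
    (hadd : ∀ x y, p x → p y → p (x + y)) (h : ∀ a g, p (of ρ a * gp ρ g)) : p x :=
  SkewMonoidAlgebra.induction_on (p := p) x h0
    (fun g a => by rw [single_eq]; exact h a g) hadd

lemma lift_of {B : Type*} [Ring B] [Algebra ℂ B] (f : A →ₐ[ℂ] B) (φ : G →* B) (h) (a : A) :
    lift ρ f φ h (of ρ a) = f a := by
  let _ := actionOf ρ
  refine (SkewMonoidAlgebra.liftNC_single (f : A →+ B) φ 1 a).trans ?_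
  rw [map_one, mul_one]; rfl

lemma lift_gp {B : Type*} [Ring B] [Algebra ℂ B] (f : A →ₐ[ℂ] B) (φ : G →* B) (h) (g : G) :
    lift ρ f φ h (gp ρ g) = φ g := by
  let _ := actionOf ρ
  refine (SkewMonoidAlgebra.liftNC_single (f : A →+ B) φ g 1).trans ?_
  rw [AddMonoidHom.coe_coe, map_one, one_mul]

lemma equivariant {V W : Type*} [AddCommGroup V] [Module ℂ V] [AddCommGroup W] [Module ℂ W]
    {π : Crossed ρ →ₐ[ℂ] Module.End ℂ V} {σ : Crossed ρ →ₐ[ℂ] Module.End ℂ W} {F : V →ₗ[ℂ] W}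
    (h : Equivariant (π.comp (of ρ)) (σ.comp (of ρ)) F)
    (h' : ∀ g v, F (π (gp ρ g) v) = σ (gp ρ g) (F v)) : Equivariant π σ F := fun x v => by
  induction x using induction with
  | h0 => simp
  | hadd x y hx hy => rw [map_add, map_add, LinearMap.add_apply, map_add, hx, hy]; rfl
  | h a g =>
    rw [map_mul, map_mul, Module.End.mul_apply, Module.End.mul_apply, ← h']
    exact h a _

/-- The linear map `∑ a_g g ↦ ∑ φ_g(a_g)`. -/
lemma exists_linearMap {M : Type*} [AddCommMonoid M] [Module ℂ M] (φ : G → A →ₗ[ℂ] M) :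
    ∃ r : Crossed ρ →ₗ[ℂ] M, ∀ a g, r (of ρ a * gp ρ g) = φ g a := by
  let _ := actionOf ρ
  have := smulComm_actionOf ρ
  let r : SkewMonoidAlgebra A G →ₗ[ℂ] M :=
    (Finsupp.lsum ℂ φ).comp (SkewMonoidAlgebra.coeffLinearEquiv (S := ℂ)).toLinearMap
  refine ⟨(show Crossed ρ →ₗ[ℂ] M from r), fun a g => ?_⟩
  rw [← single_eq]
  change Finsupp.lsum ℂ φ (Finsupp.single g a) = _
  simp

/-- A retraction `r : A → A'` extends to crossed products with a group and a subgroup. -/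
lemma exists_retraction {A' : Type*} [Ring A'] [Algebra ℂ A'] {K : Type*} [Group K] (i : K →* G)
    (hi : Function.Injective i)
    (ρ' : K →* (A' →ₐ[ℂ] A')) (f : A' →ₐ[ℂ] A) (hf : ∀ k a, f (ρ' k a) = ρ (i k) (f a))
    (F : Crossed ρ' →ₐ[ℂ] Crossed ρ) (hF : ∀ a, F (of ρ' a) = of ρ (f a))
    (hF' : ∀ k, F (gp ρ' k) = gp ρ (i k))
    (r : A →ₗ[ℂ] A') (h1 : r 1 = 1) (hr : ∀ a b, r (a * f b) = r a * b) :
    ∃ R : Crossed ρ →ₗ[ℂ] Crossed ρ', R 1 = 1 ∧ ∀ a b, R (a * F b) = R a * b := by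
  classical
  let φ : G → A →ₗ[ℂ] Crossed ρ' := fun g => if hg : ∃ k, i k = g then
    { toFun := fun a => of ρ' (r a) * gp ρ' hg.choose
      map_add' := fun a b => by rw [map_add, map_add, add_mul]
      map_smul' := fun c a => by rw [map_smul, map_smul, smul_mul_assoc]; rfl } else 0
  obtain ⟨R, hR⟩ := exists_linearMap ρ φ
  have hR1 : ∀ a k, R (of ρ a * gp ρ (i k)) = of ρ' (r a) * gp ρ' k := fun a k => by
    have hk : ∃ k', i k' = i k := ⟨k, rfl⟩
    rw [hR, show φ (i k) = _ from dif_pos hk]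
    change of ρ' (r a) * gp ρ' hk.choose = _
    rw [hi hk.choose_spec]
  refine ⟨R, ?_, fun x y => ?_⟩
  · have := hR1 1 1
    rw [h1, map_one i, map_one (of ρ), map_one (gp ρ), one_mul, map_one (of ρ'), map_one (gp ρ'),
      one_mul] at this
    exact this
  induction x using induction with
  | h0 => simp
  | hadd x x' hx hx' => rw [add_mul, map_add, map_add, hx, hx', add_mul]
  | h a g =>
    induction y using induction with
    | h0 => simp
    | hadd y y' hy hy' => rw [map_add, mul_add, map_add, hy, hy', mul_add]
    | h b k =>
      have h2 : of ρ a * gp ρ g * F (of ρ' b * gp ρ' k) =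
          of ρ (a * ρ g (f b)) * gp ρ (g * i k) := by
        rw [map_mul, hF, hF', map_mul, map_mul, mul_assoc, ← mul_assoc (gp ρ g), gp_mul_of]
        simp only [mul_assoc]
      rw [h2]
      by_cases hg : ∃ k, i k = g
      · obtain ⟨g, rfl⟩ := hg
        rw [← map_mul i, hR1, hR1, ← hf, hr, map_mul, map_mul,
          mul_assoc (of ρ' (r a)) (gp ρ' g), ← mul_assoc (gp ρ' g) (of ρ' b), gp_mul_of]
        simp only [mul_assoc]
      · rw [hR, hR, show φ g = 0 from dif_neg hg, show φ (g * i k) = 0 from dif_neg ?_]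
        · simp
        · rintro ⟨k', hk'⟩
          exact hg ⟨k' * k⁻¹, by rw [map_mul, hk', map_inv, mul_inv_cancel_right]⟩

end Crossed

open BernsteinDatum RootPairing
namespace ExtendedDatum
variable {ι X Y Γ : Type*} [AddCommGroup X] [AddCommGroup Y] [Group Γ]
variable {S : ExtendedDatum ι X Y Γ}

variable (S) in
lemma psi_of_eq_one {γ : Γ} {P : Set ι} (h : S.act γ • P = P) (hγ : γ = 1) (a : (S.upper P).Hecke) :
    S.psi γ h a = a := by
  subst hγ
  exact S.psi_one h a

variable (S) in
lemma psi_psi_inv {γ : Γ} {P Q : Set ι} (h : S.act γ • P = Q) (a : (S.upper Q).Hecke) :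
    S.psi γ h (S.psi γ⁻¹ (S.smul_inv_eq h) a) = a := by
  rw [← S.psi_mul γ γ⁻¹ (S.smul_inv_eq h) h (by rw [mul_inv_cancel, map_one, one_smul])]
  exact S.psi_of_eq_one _ (mul_inv_cancel γ) a

variable (S) in
lemma psi_surjective {γ : Γ} {P Q : Set ι} (h : S.act γ • P = Q) :
    Function.Surjective (S.psi γ h) := fun a => ⟨_, S.psi_psi_inv h a⟩

variable (S) in
lemma incl_psi_apply {γ : Γ} {P Q : Set ι} (h : S.act γ • P = Q) (hP : P ⊆ S.simple)
    (hQ : Q ⊆ S.simple) (a : (S.upper P).Hecke) :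
    S.incl hQ (S.psi γ h a) = S.psi γ (S.act_simple γ) (S.incl hP a) := by
  suffices H : (S.incl hQ).comp (S.psi γ h) = (S.psi γ (S.act_simple γ)).comp (S.incl hP) from
    DFunLike.congr_fun H a
  refine hecke_ext (fun x => ?_) (fun i => ?_)
  · rw [AlgHom.comp_apply, AlgHom.comp_apply, psi_theta, incl_theta, incl_theta]
    exact (S.psi_theta γ (S.act_simple γ) x).symm
  · rw [AlgHom.comp_apply, AlgHom.comp_apply, psi_N, incl_N, incl_N]
    exact (S.psi_N γ (S.act_simple γ) (Set.inclusion hP i)).symm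

/-- The restriction to `ℋ` of a representation of `ℋ ⋊ Γ`. -/
abbrev resH {Q : Type*} [AddCommGroup Q] [Module ℂ Q] (Ψ : S.HΓ →ₐ[ℂ] Module.End ℂ Q) :
    S.H →ₐ[ℂ] Module.End ℂ Q := Ψ.comp (Crossed.of _)

/-- The action of `γ ∈ Γ` in a representation of `ℋ ⋊ Γ`. -/
abbrev op {Q : Type*} [AddCommGroup Q] [Module ℂ Q] (Ψ : S.HΓ →ₐ[ℂ] Module.End ℂ Q) (γ : Γ) :
    Module.End ℂ Q := Ψ (Crossed.gp _ γ)

section Res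

variable {Q : Type*} [AddCommGroup Q] [Module ℂ Q] {Ψ : S.HΓ →ₐ[ℂ] Module.End ℂ Q}

lemma op_one (q : Q) : op Ψ 1 q = q := by rw [op, map_one, map_one]; rfl

lemma op_mul (γ δ : Γ) (q : Q) : op Ψ (γ * δ) q = op Ψ γ (op Ψ δ q) := by
  rw [op, map_mul, map_mul]; rfl

lemma op_inv_op (γ : Γ) (q : Q) : op Ψ γ⁻¹ (op Ψ γ q) = q := by
  rw [← op_mul, inv_mul_cancel, op_one]

lemma op_injective (γ : Γ) : Function.Injective (op Ψ γ) := fun a b h => by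
  rw [← op_inv_op (Ψ := Ψ) γ a, h, op_inv_op]

lemma op_resH (γ : Γ) (a : S.H) (q : Q) :
    op Ψ γ (resH Ψ a q) = resH Ψ (S.psi γ (S.act_simple γ) a) (op Ψ γ q) := by
  have h := congrArg (fun z => Ψ z q)
    (Crossed.gp_mul_of (S.psiHom S.simple (MonoidHom.id Γ) S.act_simple) γ a)
  simp only [map_mul] at h
  exact h

/-- The action of `γ` moves a weight vector of weight `t` to one of weight `t ∘ γ⁻¹`. -/
lemma isEigen_op {t : AddChar X ℂ} {q : Q} (h : IsEigen (thetaRep _ (resH Ψ)) (wtHom t) q) (γ : Γ) :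
    IsEigen (thetaRep _ (resH Ψ)) (wtHom (S.charAct (S.act γ⁻¹) t)) (op Ψ γ q) := by
  obtain ⟨h0, h1⟩ := isEigen_iff.1 h
  refine isEigen_iff.2 ⟨fun h => h0 (op_injective (Ψ := Ψ) γ (h.trans (map_zero _).symm)), fun x => ?_⟩
  have h2 := op_resH (Ψ := Ψ) γ ((S.upper S.simple).theta (S.act γ⁻¹ • x)) q
  rw [h1, map_smul, psi_theta, map_inv, smul_inv_smul] at h2
  rw [← h2, charAct_apply, map_inv]

variable [Finite ι] [Finite Γ] [Module.Finite ℤ X]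

lemma finiteDimensional_of_isIrred_crossed (h : IsIrred Ψ) : FiniteDimensional ℂ Q := by
  have := S.reduced
  have := finite_parab (R := S.R) (b := S.base) (P := S.simple) subset_rfl
  have := algebra_finiteType X
  refine h.finiteDimensional ((Crossed.of _).comp (S.upper S.simple).thetaHom)
    (κ := parab S.R S.simple × Γ)
    (fun k => Crossed.of _ (S.Nw S.simple k.1) * Crossed.gp _ k.2) fun x => ?_
  induction x using Crossed.induction with
  | h0 => exact zero_mem _
  | hadd x y hx hy => exact add_mem hx hy
  | h a γ =>
    have h1 := S.span_theta_Nw subset_rfl a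
    induction h1 using Submodule.span_induction with
    | mem a ha =>
      obtain ⟨w, hw, f, rfl⟩ := ha
      refine Submodule.subset_span ⟨f, (⟨w, hw⟩, γ), ?_⟩
      rw [map_mul, mul_assoc]; rfl
    | zero => rw [map_zero, zero_mul]; exact zero_mem _
    | add a b _ _ ha hb => rw [map_add, add_mul]; exact add_mem ha hb
    | smul c a _ ha => rw [map_smul, smul_mul_assoc]; exact Submodule.smul_mem _ c ha

end Res

namespace LanglandsDatum

variable {L L' L'' : LanglandsDatum.{v} S}

lemma Intertwines.trans {γ δ η : Γ} {h1 : S.act δ • L.P = L'.P} {h2 : S.act γ • L'.P = L''.P}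
    {e : L.V ≃ₗ[ℂ] L'.V} {e' : L'.V ≃ₗ[ℂ] L''.V} (H : L.Intertwines L' δ h1 e)
    (H' : L'.Intertwines L'' γ h2 e') (hη : η = γ * δ) (h : S.act η • L.P = L''.P) :
    L.Intertwines L'' η h (e.trans e') := fun a v => by
  subst hη
  rw [S.psi_mul γ δ h1 h2, LinearEquiv.trans_apply, H, H', LinearEquiv.trans_apply]

variable [Finite ι] [Module.Finite ℤ X]

/-- Two intertwining operators along the same `γ` are proportional, by Schur's lemma. -/
lemma Intertwines.exists_unit {γ : Γ} {h : S.act γ • L.P = L'.P}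
    {e e' : L.V ≃ₗ[ℂ] L'.V} (he : L.Intertwines L' γ h e) (he' : L.Intertwines L' γ h e') :
    ∃ c : ℂˣ, ∀ v, e v = (c : ℂ) • e' v := by
  have := L.finiteDimensional
  obtain ⟨c, hc⟩ := L.isIrred_rep.exists_scalar (e.trans e'.symm).toLinearMap fun a v => by
    change e'.symm (e _) = L.rep a (e'.symm (e v))
    rw [LinearEquiv.symm_apply_eq, he, he', LinearEquiv.apply_symm_apply]
  have hc' : ∀ v, e v = c • e' v := fun v => by
    have := hc v
    change e'.symm (e v) = _ at this
    rw [LinearEquiv.symm_apply_eq] at this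
    rw [this, map_smul]
  have := L.isIrred_rep.1
  obtain ⟨v, hv⟩ := exists_ne (0 : L.V)
  have h0 : c ≠ 0 := by
    rintro rfl
    have := hc' v
    rw [zero_smul] at this
    exact hv (e.map_eq_zero_iff.1 this)
  exact ⟨Units.mk0 c h0, hc'⟩

lemma nonempty_cocycle (L : LanglandsDatum.{v} S) : Nonempty L.Cocycle := by
  have h1 : ∀ δ : L.isotropy, ∃ e, L.Intertwines L δ (L.isotropy_smul δ) e :=
    fun δ => δ.2.choose_spec
  choose I hI using h1
  have h2 : ∀ δ ε : L.isotropy, ∃ c : ℂˣ, ∀ v, I (δ * ε) v = (c : ℂ) • I δ (I ε v) := fun δ ε =>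
    (hI (δ * ε)).exists_unit ((hI ε).trans (hI δ) rfl _)
  choose κ hκ using h2
  exact ⟨⟨I, hI, κ, hκ⟩⟩

lemma inclHP_of (a : (S.upper L.P).Hecke) :
    L.inclHP (Crossed.of _ a) = Crossed.of _ (S.incl L.P_subset a) := by
  rw [inclHP, Crossed.lift_of]; rfl

lemma inclHP_gp (δ : L.isotropy) : L.inclHP (Crossed.gp _ δ) = Crossed.gp _ (δ : Γ) := by
  rw [inclHP, Crossed.lift_gp]; rfl

lemma indUnit_inclHP_injective {V : Type*} [AddCommGroup V] [Module ℂ V]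
    (π : L.HP →ₐ[ℂ] Module.End ℂ V) : Function.Injective (indUnit L.inclHP π) := by
  have := S.isDomain
  obtain ⟨r, h1, hr⟩ := S.exists_retraction L.P_subset subset_rfl
  obtain ⟨R, h2, hR⟩ := Crossed.exists_retraction
    (S.psiHom S.simple (MonoidHom.id Γ) S.act_simple) L.isotropy.subtype Subtype.val_injective
    (S.psiHom L.P L.isotropy.subtype L.isotropy_smul) (S.incl L.P_subset)
    (fun δ a => L.incl_psi δ a) L.inclHP inclHP_of inclHP_gp r h1 hr
  exact AffineHecke.indUnit_injective _ _ R h2 hR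

variable {K : L.Cocycle}

lemma ProjRep.tensorRep_of (ρ : ProjRep K) (a : (S.upper L.P).Hecke) (v : L.V) (x : ρ.W) :
    ρ.tensorRep (Crossed.of _ a) (v ⊗ₜ x) = L.rep a v ⊗ₜ x := by
  rw [ProjRep.tensorRep, Crossed.lift_of]; rfl

lemma ProjRep.tensorRep_gp (ρ : ProjRep K) (δ : L.isotropy) (v : L.V) (x : ρ.W) :
    ρ.tensorRep (Crossed.gp _ δ) (v ⊗ₜ x) = K.I δ v ⊗ₜ ρ.ρ δ x := by
  rw [ProjRep.tensorRep, Crossed.lift_gp]; rfl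

end LanglandsDatum
end ExtendedDatum
end AffineHecke
end

noncomputable section
namespace AffineHecke
open scoped TensorProduct Pointwise

/-! ### The representations `(σ ∘ φ_t) ⊗ ρ` -/

section Coord

variable {V W : Type*} [AddCommGroup V] [Module ℂ V] [AddCommGroup W] [Module ℂ W]

/-- The map `V ⊗ W → V` given by a functional on `W`. -/
def coordMap (V : Type*) [AddCommGroup V] [Module ℂ V] (φ : W →ₗ[ℂ] ℂ) : V ⊗[ℂ] W →ₗ[ℂ] V :=
  (TensorProduct.rid ℂ V).toLinearMap ∘ₗ LinearMap.lTensor V φ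

@[simp] lemma coordMap_tmul (φ : W →ₗ[ℂ] ℂ) (v : V) (x : W) :
    coordMap V φ (v ⊗ₜ x) = φ x • v := by
  simp [coordMap]

lemma coordMap_ext {κ : Type*} (b : Module.Basis κ ℂ W) {x y : V ⊗[ℂ] W}
    (h : ∀ k, coordMap V (b.coord k) x = coordMap V (b.coord k) y) : x = y := by
  classical
  have key : ∀ (k : κ) (z : V ⊗[ℂ] W), TensorProduct.equivFinsuppOfBasisRight b z k =
      coordMap V (b.coord k) z := fun k z => by
    induction z using TensorProduct.induction_on with
    | zero => simp
    | tmul v x => simp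
    | add z z' hz hz' => rw [map_add, Finsupp.add_apply, hz, hz', map_add]
  apply (TensorProduct.equivFinsuppOfBasisRight (M := V) b).injective
  ext k
  rw [key, key, h]

lemma exists_coordMap_ne_zero {x : V ⊗[ℂ] W} (hx : x ≠ 0) : ∃ φ, coordMap V φ x ≠ 0 := by
  by_contra! h
  exact hx (coordMap_ext (Module.Free.chooseBasis ℂ W) fun k => by rw [h, map_zero])

end Coord

open BernsteinDatum RootPairing
namespace ExtendedDatum
variable {ι X Y Γ : Type*} [AddCommGroup X] [AddCommGroup Y] [Group Γ]
variable {S : ExtendedDatum ι X Y Γ} [Finite ι] [Finite Γ] [Module.Finite ℤ X]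
namespace LanglandsDatum
variable {L : LanglandsDatum.{v} S} {K : L.Cocycle}
namespace ProjRep
variable (ρ : ProjRep K)

/-- The restriction of `(σ ∘ φ_t) ⊗ ρ` to `ℋ^P`. -/
abbrev resRep : (S.upper L.P).Hecke →ₐ[ℂ] Module.End ℂ (L.V ⊗[ℂ] ρ.W) :=
  ρ.tensorRep.comp (Crossed.of _)

lemma equivariant_coordMap (φ : ρ.W →ₗ[ℂ] ℂ) : Equivariant ρ.resRep L.rep (coordMap L.V φ) :=
  fun a z => by
    induction z using TensorProduct.induction_on with
    | zero => simp
    | tmul v x => rw [AlgHom.comp_apply, tensorRep_of, coordMap_tmul, coordMap_tmul, map_smul]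
    | add z z' hz hz' => rw [map_add, map_add, hz, hz', map_add, map_add]

lemma equivariant_tmul (x : ρ.W) :
    Equivariant L.rep ρ.resRep ((TensorProduct.mk ℂ L.V ρ.W).flip x) := fun a v => by
  change L.rep a v ⊗ₜ x = ρ.resRep a (v ⊗ₜ x)
  rw [AlgHom.comp_apply, tensorRep_of]

/-- A nonzero vector generates `ρ`. -/
lemma span_orbit {x : ρ.W} (hx : x ≠ 0) : Submodule.span ℂ (Set.range fun δ => ρ.ρ δ x) = ⊤ := by
  refine (ρ.irred _ fun δ y hy => ?_).resolve_left fun h => ?_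
  · induction hy using Submodule.span_induction with
    | mem y hy =>
      obtain ⟨ε, rfl⟩ := hy
      change ρ.ρ δ (ρ.ρ ε x) ∈ _
      rw [ρ.ρ_mul]
      exact Submodule.smul_mem _ _ (Submodule.subset_span ⟨_, rfl⟩)
    | zero => rw [map_zero]; exact zero_mem _
    | add y z _ _ hy hz => rw [map_add]; exact add_mem hy hz
    | smul c y _ hy => rw [map_smul]; exact Submodule.smul_mem _ c hy
  · have h1 : ρ.ρ 1 x ∈ Submodule.span ℂ (Set.range fun δ => ρ.ρ δ x) :=
      Submodule.subset_span ⟨1, rfl⟩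
    rw [h, Submodule.mem_bot] at h1
    exact hx ((ρ.ρ 1).map_eq_zero_iff.1 h1)

lemma finiteDimensional : FiniteDimensional ℂ ρ.W := by
  have := ρ.nontrivial
  obtain ⟨x, hx⟩ := exists_ne (0 : ρ.W)
  have h1 := FiniteDimensional.span_of_finite ℂ (Set.finite_range fun δ => ρ.ρ δ x)
  rw [ρ.span_orbit hx] at h1
  exact Module.Finite.equiv Submodule.topEquiv

/-- By Schur's lemma the multiplicity space of `σ ∘ φ_t` in `(σ ∘ φ_t) ⊗ ρ` is `ρ`. -/
lemma exists_eq_tmul {f : L.V →ₗ[ℂ] L.V ⊗[ℂ] ρ.W} (hf : Equivariant L.rep ρ.resRep f) :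
    ∃ x : ρ.W, ∀ v, f v = v ⊗ₜ x := by
  have := ρ.finiteDimensional
  have := L.finiteDimensional
  let b := Module.finBasis ℂ ρ.W
  have h1 : ∀ k, ∃ c : ℂ, ∀ v, coordMap L.V (b.coord k) (f v) = c • v := fun k =>
    L.isIrred_rep.exists_scalar (coordMap L.V (b.coord k) ∘ₗ f) fun a v => by
      change coordMap _ _ (f _) = _
      rw [hf, ρ.equivariant_coordMap]; rfl
  choose c hc using h1
  refine ⟨b.equivFun.symm c, fun v => coordMap_ext b fun k => ?_⟩
  rw [hc, coordMap_tmul, Module.Basis.coord_apply, Module.Basis.equivFun_symm_apply, Module.Basis.repr_sum_self]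

lemma nontrivial_tensor : Nontrivial (L.V ⊗[ℂ] ρ.W) := by
  have := ρ.nontrivial
  have := L.isIrred_rep.1
  exact inferInstance

lemma finiteDimensional_tensor : FiniteDimensional ℂ (L.V ⊗[ℂ] ρ.W) := by
  have := ρ.finiteDimensional
  have := L.finiteDimensional
  exact inferInstance

lemma isIrred_tensorRep : IsIrred ρ.tensorRep := by
  refine ⟨ρ.nontrivial_tensor, fun U hU => or_iff_not_imp_left.2 fun h0 => ?_⟩
  have := ρ.finiteDimensional_tensor
  obtain ⟨M, hMU, hM, hirr⟩ := exists_irred_sub (π := ρ.resRep) (E := U) (fun a u hu => hU _ u hu) h0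
  have := hirr.1
  obtain ⟨m, hm⟩ := exists_ne (0 : M)
  obtain ⟨φ, hφ⟩ := exists_coordMap_ne_zero (x := (m : L.V ⊗[ℂ] ρ.W)) (by simpa using hm)
  have hF : Equivariant (subRep ρ.resRep M hM) L.rep (coordMap L.V φ ∘ₗ M.subtype) :=
    fun a x => ρ.equivariant_coordMap φ a x
  have hF0 : coordMap L.V φ ∘ₗ M.subtype ≠ 0 := fun h => hφ (LinearMap.congr_fun h m)
  let e := LinearEquiv.ofBijective _ ⟨hirr.injective hF hF0, L.isIrred_rep.surjective hF hF0⟩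
  obtain ⟨x, hx⟩ := ρ.exists_eq_tmul (f := M.subtype ∘ₗ e.symm.toLinearMap) fun a v => by
    change ((e.symm (L.rep a v) : M) : L.V ⊗[ℂ] ρ.W) = ρ.resRep a (e.symm v : M)
    rw [← coe_subRep hM]
    congr 1
    rw [LinearEquiv.symm_apply_eq]
    refine Eq.trans ?_ (hF a _).symm
    exact congrArg _ (e.apply_symm_apply v).symm
  have hxU : ∀ v, v ⊗ₜ x ∈ U := fun v => by
    rw [← hx]; exact hMU (e.symm v).2
  have hx0 : x ≠ 0 := by
    rintro rfl
    have h1 := hx (e m)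
    rw [TensorProduct.tmul_zero] at h1
    change ((e.symm (e m) : M) : L.V ⊗[ℂ] ρ.W) = 0 at h1
    rw [e.symm_apply_apply] at h1
    exact hm (by simpa using h1)
  let W' : Submodule ℂ ρ.W :=
    { carrier := {x | ∀ v : L.V, v ⊗ₜ[ℂ] x ∈ U}
      add_mem' := fun hx hy v => by rw [TensorProduct.tmul_add]; exact add_mem (hx v) (hy v)
      zero_mem' := fun v => by rw [TensorProduct.tmul_zero]; exact zero_mem _
      smul_mem' := fun c x hx v => by rw [TensorProduct.tmul_smul]; exact U.smul_mem c (hx v) }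
  have hW : W' = ⊤ := (ρ.irred W' fun δ y hy v => by
    have := hU (Crossed.gp _ δ) _ (hy ((K.I δ).symm v))
    rwa [tensorRep_gp, LinearEquiv.apply_symm_apply] at this).resolve_left fun h => hx0 (by
      have : x ∈ W' := hxU
      rwa [h, Submodule.mem_bot] at this)
  rw [eq_top_iff]
  intro z _
  induction z using TensorProduct.induction_on with
  | zero => exact zero_mem _
  | tmul v y => exact (hW ▸ Submodule.mem_top : y ∈ W') v
  | add z z' hz hz' => exact add_mem (hz Submodule.mem_top) (hz' Submodule.mem_top)

end ProjRep
end LanglandsDatum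
end ExtendedDatum
end AffineHecke
end

noncomputable section
namespace AffineHecke
open scoped TensorProduct Pointwise

/-! ### Representations of `ℋ ⋊ Γ` generated by a Langlands datum -/

open BernsteinDatum RootPairing
namespace ExtendedDatum
variable {ι X Y Γ : Type*} [AddCommGroup X] [AddCommGroup Y] [Group Γ]
variable {S : ExtendedDatum ι X Y Γ} [Finite ι] [Finite Γ] [Module.Finite ℤ X]
variable {Q : Type*} [AddCommGroup Q] [Module ℂ Q] {Ψ : S.HΓ →ₐ[ℂ] Module.End ℂ Q}

lemma smul_subset_simple (γ : Γ) {P : Set ι} (h : P ⊆ S.simple) : S.act γ • P ⊆ S.simple := by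
  rw [← S.act_simple γ]; exact Set.smul_set_mono h

lemma aact_mem_posCone (γ : Γ) {P : Set ι} {μ : X →+ ℝ} (h : μ ∈ S.posCone P) :
    S.aact (S.act γ) μ ∈ S.posCone (S.act γ • P) := by
  refine ⟨?_, ?_⟩
  · rintro _ ⟨i, hi, rfl⟩
    exact (S.aact_root _ _ _).trans (h.1 i hi)
  · rintro i ⟨hi, hiP⟩
    rw [← S.act_simple γ] at hi
    obtain ⟨i, hi, rfl⟩ := hi
    exact (h.2 i ⟨hi, fun hi' => hiP (Set.smul_mem_smul_set hi')⟩).trans_eq (S.aact_root _ _ _).symm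

/-- An equivariant map composed with the action of `γ`. -/
lemma equivariant_op {P P' : Set ι} (hP : P ⊆ S.simple) (hP' : P' ⊆ S.simple) {γ : Γ}
    (h : S.act γ • P = P') {M : Type*} [AddCommGroup M] [Module ℂ M]
    {τ : (S.upper P).Hecke →ₐ[ℂ] Module.End ℂ M} {j : M →ₗ[ℂ] Q}
    (hj : Equivariant τ ((resH Ψ).comp (S.incl hP)) j) :
    Equivariant (τ.comp (S.psi γ⁻¹ (S.smul_inv_eq h))) ((resH Ψ).comp (S.incl hP'))
      (op Ψ γ ∘ₗ j) := fun a m => by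
  change op Ψ γ (j (τ (S.psi γ⁻¹ (S.smul_inv_eq h) a) m)) =
    resH Ψ (S.incl hP' a) (op Ψ γ (j m))
  rw [hj, AlgHom.comp_apply, op_resH, ← S.incl_psi_apply h hP hP', S.psi_psi_inv]

lemma equivariant_op_inv {P P' : Set ι} (hP : P ⊆ S.simple) (hP' : P' ⊆ S.simple) {γ : Γ}
    (h : S.act γ • P = P') {M : Type*} [AddCommGroup M] [Module ℂ M]
    {τ : (S.upper P).Hecke →ₐ[ℂ] Module.End ℂ M} {j : M →ₗ[ℂ] Q}
    (hj : Equivariant (τ.comp (S.psi γ⁻¹ (S.smul_inv_eq h))) ((resH Ψ).comp (S.incl hP')) j) :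
    Equivariant τ ((resH Ψ).comp (S.incl hP)) (op Ψ γ⁻¹ ∘ₗ j) := fun a m => by
  obtain ⟨b, rfl⟩ := S.psi_surjective (S.smul_inv_eq h) a
  change op Ψ γ⁻¹ (j ((τ.comp (S.psi γ⁻¹ (S.smul_inv_eq h))) b m)) = resH Ψ _ (op Ψ γ⁻¹ (j m))
  rw [hj, AlgHom.comp_apply, op_resH, ← S.incl_psi_apply (S.smul_inv_eq h) hP' hP]
  rfl

namespace LanglandsDatum
variable {L : LanglandsDatum.{v} S} {K : L.Cocycle} {ρ : ProjRep K}

/-- A map from `(σ ∘ φ_t) ⊗ ρ` to a representation of `ℋ ⋊ Γ`, equivariant for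
`ℋ^P ⋊ Γ_{P,σ,t}`. -/
abbrev ExtMap (ρ : ProjRep K) (Ψ : S.HΓ →ₐ[ℂ] Module.End ℂ Q) (J : L.V ⊗[ℂ] ρ.W →ₗ[ℂ] Q) : Prop :=
  Equivariant ρ.tensorRep (Ψ.comp L.inclHP) J

namespace ExtMap
variable {J : L.V ⊗[ℂ] ρ.W →ₗ[ℂ] Q}

lemma resRep (hJ : ExtMap ρ Ψ J) :
    Equivariant ρ.resRep ((resH Ψ).comp (S.incl L.P_subset)) J := fun a z => by
  rw [AlgHom.comp_apply, hJ, AlgHom.comp_apply, inclHP_of]; rfl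

lemma gp (hJ : ExtMap ρ Ψ J) (δ : L.isotropy) (v : L.V) (x : ρ.W) :
    J (K.I δ v ⊗ₜ ρ.ρ δ x) = op Ψ δ (J (v ⊗ₜ x)) := by
  rw [← ρ.tensorRep_gp, hJ, AlgHom.comp_apply, inclHP_gp]

lemma mk (h1 : Equivariant ρ.resRep ((resH Ψ).comp (S.incl L.P_subset)) J)
    (h2 : ∀ (δ : L.isotropy) v x, J (K.I δ v ⊗ₜ ρ.ρ δ x) = op Ψ δ (J (v ⊗ₜ x))) :
    ExtMap ρ Ψ J := by
  refine Crossed.equivariant _ (fun a z => ?_) fun δ z => ?_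
  · rw [h1, AlgHom.comp_apply, AlgHom.comp_apply, AlgHom.comp_apply, AlgHom.comp_apply, inclHP_of]
  · rw [AlgHom.comp_apply, inclHP_gp]
    induction z using TensorProduct.induction_on with
    | zero => simp
    | tmul v x => rw [ρ.tensorRep_gp, h2]
    | add z z' hz hz' => rw [map_add, map_add, hz, hz', map_add, map_add]

lemma equivariant_slice (hJ : ExtMap ρ Ψ J) (x : ρ.W) :
    Equivariant L.rep ((resH Ψ).comp (S.incl L.P_subset))
      (J ∘ₗ (TensorProduct.mk ℂ L.V ρ.W).flip x) := fun a v => by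
  change J ((TensorProduct.mk ℂ L.V ρ.W).flip x _) = _
  rw [ρ.equivariant_tmul, hJ.resRep]; rfl

lemma injective (hJ : ExtMap ρ Ψ J) (h0 : J ≠ 0) : Function.Injective J :=
  ρ.isIrred_tensorRep.injective hJ h0

/-- The image of `J` is stable under the isotropy group. -/
lemma op_mem_range (hJ : ExtMap ρ Ψ J) {γ : Γ} (hγ : γ ∈ L.isotropy) :
    LinearMap.range (op Ψ γ ∘ₗ J) ≤ LinearMap.range J := by
  rintro _ ⟨z, rfl⟩
  exact ⟨ρ.tensorRep (Crossed.gp _ ⟨γ, hγ⟩) z, by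
    rw [hJ, AlgHom.comp_apply, inclHP_gp]; rfl⟩

lemma exists_isEigen_slice (hJ : ExtMap ρ Ψ J) {z : L.V ⊗[ℂ] ρ.W} {t : AddChar X ℂ}
    (h : IsEigen (thetaRep _ (resH Ψ)) (wtHom t) (J z)) :
    ∃ v : L.V, IsEigen (thetaRep _ L.rep) (wtHom t) v := by
  have := ρ.finiteDimensional_tensor
  obtain ⟨z, hz0, hz⟩ := exists_isEigen_of_mem_range L.P_subset hJ.resRep h
  obtain ⟨φ, hφ⟩ := exists_coordMap_ne_zero hz0
  refine ⟨_, hφ, fun f => ?_⟩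
  rw [← map_smul, ← hz f, AlgHom.comp_apply, AlgHom.comp_apply, ρ.equivariant_coordMap]

lemma generated (hJ : ExtMap ρ Ψ J)
    (hgen : ∀ U, IsInvariant Ψ U → Set.range J ⊆ U → U = ⊤) :
    S.LanglandsGenerated (resH Ψ) (fun γ => S.act γ • L.P) (fun γ => LinearMap.range (op Ψ γ ∘ₗ J))
      (fun γ => S.aact (S.act γ) L.exponent) (S.nrm L.exponent) where
  subset γ := smul_subset_simple γ L.P_subset
  mem_posCone γ := aact_mem_posCone γ L.t_pos
  nrm_eq γ := S.nrm_aact (S.act_mem_sym γ) _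
  invariant γ := (equivariant_op L.P_subset (smul_subset_simple γ L.P_subset) rfl hJ.resRep).range
  weight := by
    rintro γ _ ⟨z, rfl⟩ t ht
    have h1 := isEigen_op ht γ⁻¹
    rw [LinearMap.comp_apply, op_inv_op, inv_inv] at h1
    obtain ⟨v, hv⟩ := hJ.exists_isEigen_slice h1
    have h2 := S.aact_mem_negC (g := S.act γ) rfl (L.weight_rep hv)
    rwa [map_sub, logAbs_charAct, ← aact_mul, mul_inv_cancel, aact_one] at h2
  span_eq U hU := eq_top_of_generates hgen (by
    rintro _ ⟨z, rfl⟩ b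
    induction b using Crossed.induction with
    | h0 => rw [map_zero]; exact zero_mem _
    | hadd b b' hb hb' => rw [map_add]; exact add_mem hb hb'
    | h a γ => rw [map_mul]; exact hU γ _ ⟨z, rfl⟩ a)

lemma finiteDimensional (hJ : ExtMap ρ Ψ J)
    (hgen : ∀ U, IsInvariant Ψ U → Set.range J ⊆ U → U = ⊤) : FiniteDimensional ℂ Q := by
  have := ρ.finiteDimensional_tensor
  exact (hJ.generated hgen).finiteDimensional fun _ => inferInstance

lemma smul_eq_of_aact_eq {γ : Γ} {P : Set ι} (hP : P ⊆ S.simple) {μ : X →+ ℝ}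
    (hμ : μ ∈ S.posCone P) (h : S.aact (S.act γ) L.exponent = μ) : S.act γ • L.P = P := by
  have h1 := aact_mem_posCone γ L.t_pos
  rw [show S.aact (S.act γ) (logAbs L.t) = μ from h] at h1
  exact eq_of_mem_posCone (smul_subset_simple γ L.P_subset) hP h1 hμ

/-- Irreducible `ℋ^P`-subrepresentations of the span of the `γ J(V ⊗ W)` with `γ μ = μ'` are, modulo
an invariant subspace `N`, conjugate to `σ ∘ φ_t`. -/
lemma exists_repEquiv (hJ : ExtMap ρ Ψ J) {P : Set ι} (hP : P ⊆ S.simple) {μ : X →+ ℝ}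
    (hμ : μ ∈ S.posCone P) {M : Type*} [AddCommGroup M] [Module ℂ M]
    {τ : (S.upper P).Hecke →ₐ[ℂ] Module.End ℂ M} (hτ : IsIrred τ) {F : M →ₗ[ℂ] Q}
    (hF : Equivariant τ ((resH Ψ).comp (S.incl hP)) F) {N : Submodule ℂ Q}
    (hN : IsInvariant ((resH Ψ).comp (S.incl hP)) N) {m : M} (hm : F m ∉ N)
    (hm' : F m ∈ ⨆ γ : {γ : Γ // S.aact (S.act γ) L.exponent = μ},
      LinearMap.range (op Ψ γ ∘ₗ J)) :
    ∃ (γ : Γ) (h : S.act γ • L.P = P), ¬ LinearMap.range (op Ψ γ ∘ₗ J) ≤ N ∧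
      RepEquiv τ (L.rep.comp (S.psi γ⁻¹ (S.smul_inv_eq h))) := by
  have hγP := fun (γ : Γ) (h : S.aact (S.act γ) L.exponent = μ) =>
    smul_eq_of_aact_eq (L := L) hP hμ h
  let T := {γ : Γ // S.aact (S.act γ) L.exponent = μ ∧ ¬ LinearMap.range (op Ψ γ ∘ₗ J) ≤ N} × ρ.W
  obtain ⟨⟨⟨γ, h1, h2⟩, x⟩, h3⟩ := exists_repEquiv_of_mem_iSup (κ := T) (E := fun _ => L.V)
    (ε := fun k => L.rep.comp (S.psi (k.1 : Γ)⁻¹ (S.smul_inv_eq (hγP k.1 k.1.2.1))))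
    (fun k => L.isIrred_rep.comp (S.psi_surjective _))
    (g := fun k => op Ψ k.1 ∘ₗ (J ∘ₗ (TensorProduct.mk ℂ L.V ρ.W).flip k.2))
    (fun k => equivariant_op L.P_subset hP (hγP k.1 k.1.2.1) (hJ.equivariant_slice k.2)) hτ hF hN hm (by
      refine (iSup_le (fun γ => ?_) : (⨆ γ : {γ : Γ // S.aact (S.act γ) L.exponent = μ},
        LinearMap.range (op Ψ γ ∘ₗ J)) ≤ _) hm'
      by_cases h : LinearMap.range (op Ψ γ ∘ₗ J) ≤ N
      · exact h.trans le_sup_left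
      · rintro _ ⟨z, rfl⟩
        refine Submodule.mem_sup_right ?_
        induction z using TensorProduct.induction_on with
        | zero => rw [map_zero]; exact zero_mem _
        | tmul v x => exact Submodule.mem_iSup_of_mem (⟨⟨γ, γ.2, h⟩, x⟩ : T) ⟨v, rfl⟩
        | add z z' hz hz' => rw [map_add]; exact add_mem hz hz')
  exact ⟨γ, hγP γ h1, h2, h3⟩

lemma moves_of_repEquiv {L L' : LanglandsDatum.{v} S} {γ : Γ} (h : S.act γ • L'.P = L.P)
    (H : RepEquiv L.rep (L'.rep.comp (S.psi γ⁻¹ (S.smul_inv_eq h)))) : Moves γ⁻¹ L L' := by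
  obtain ⟨e, he⟩ := H
  exact ⟨S.smul_inv_eq h, e, he⟩

/-- The image of `J` contains all images of `σ ∘ φ_t`. -/
lemma range_le (hJ : ExtMap ρ Ψ J)
    (hgen : ∀ U, IsInvariant Ψ U → Set.range J ⊆ U → U = ⊤) {F : L.V →ₗ[ℂ] Q}
    (hF : Equivariant L.rep ((resH Ψ).comp (S.incl L.P_subset)) F) :
    LinearMap.range F ≤ LinearMap.range J := by
  by_cases h0 : F = 0
  · rw [h0]
    rintro _ ⟨v, rfl⟩
    exact zero_mem _
  have G := hJ.generated hgen
  have := hJ.finiteDimensional hgen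
  have := L.finiteDimensional
  have := L.isIrred_rep.1
  have hinj := L.isIrred_rep.injective hF h0
  obtain ⟨t, ht⟩ := exists_isWeight (π := L.rep)
  obtain ⟨v, hv⟩ := isWeight_iff.1 ht
  have hv' := isEigen_map L.P_subset hF hv fun h => hv.1 (hinj (h.trans (map_zero F).symm))
  have hdom : S.dom (logAbs t) = L.exponent := by
    have := S.dom_add L.P_subset L.t_pos (L.weight_rep hv)
    rwa [add_sub_cancel] at this
  obtain ⟨-, -, h1⟩ := (G.weight_cases hv').resolve_left (by rw [size, hdom]; exact lt_irrefl _)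
  rw [hdom] at h1
  have hN : IsInvariant ((resH Ψ).comp (S.incl L.P_subset)) (LinearMap.range J) := hJ.resRep.range
  have h2 : F v ∈ LinearMap.range J := by
    by_contra h2
    obtain ⟨γ, h, h3, h4⟩ := hJ.exists_repEquiv L.P_subset L.t_pos L.isIrred_rep hF hN h2 h1
    refine h3 (hJ.op_mem_range ?_)
    exact inv_mem_iff.1 (moves_of_repEquiv h h4)
  have h3 : (LinearMap.range J).comap F = ⊤ := (L.isIrred_rep.2 _ (hF.comap hN)).resolve_left
    fun h => hv.1 (by
      have : v ∈ (LinearMap.range J).comap F := h2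
      rwa [h, Submodule.mem_bot] at this)
  rintro _ ⟨x, rfl⟩
  exact (h3 ▸ Submodule.mem_top : x ∈ (LinearMap.range J).comap F)

/-- The multiplicity space of `σ ∘ φ_t` in a representation generated by `J` is `ρ`. -/
lemma exists_eq_tmul (hJ : ExtMap ρ Ψ J) (h0 : J ≠ 0)
    (hgen : ∀ U, IsInvariant Ψ U → Set.range J ⊆ U → U = ⊤) {F : L.V →ₗ[ℂ] Q}
    (hF : Equivariant L.rep ((resH Ψ).comp (S.incl L.P_subset)) F) :
    ∃ x : ρ.W, ∀ v, F v = J (v ⊗ₜ x) := by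
  let e := LinearEquiv.ofInjective J (hJ.injective h0)
  have he : ∀ y, J (e.symm y) = y := fun y => congrArg Subtype.val (e.apply_symm_apply y)
  let f : L.V →ₗ[ℂ] L.V ⊗[ℂ] ρ.W :=
    e.symm.toLinearMap ∘ₗ F.codRestrict _ fun v => hJ.range_le hgen hF ⟨v, rfl⟩
  have hf : ∀ v, J (f v) = F v := fun v => he _
  obtain ⟨x, hx⟩ := ρ.exists_eq_tmul (f := f) fun a v => hJ.injective h0 (by
    rw [hf, hF, hJ.resRep, hf])
  exact ⟨x, fun v => by rw [← hx, hf]⟩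

/-- A weight vector `J(v ⊗ x)`, whose weight has the exponent of the datum as dominant part. -/
lemma exists_isEigen (hJ : ExtMap ρ Ψ J) (h0 : J ≠ 0) :
    ∃ t v x, IsEigen (thetaRep _ (resH Ψ)) (wtHom t) (J (v ⊗ₜ x)) ∧
      S.dom (logAbs t) = L.exponent := by
  have := L.finiteDimensional
  have := L.isIrred_rep.1
  have := ρ.nontrivial
  obtain ⟨t, ht⟩ := exists_isWeight (π := L.rep)
  obtain ⟨v, hv⟩ := isWeight_iff.1 ht
  obtain ⟨x, hx⟩ := exists_ne (0 : ρ.W)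
  refine ⟨t, v, x, isEigen_map L.P_subset (hJ.equivariant_slice x) hv fun h => ?_, ?_⟩
  · obtain ⟨φ, hφ⟩ := not_forall.1 (mt (Module.forall_dual_apply_eq_zero_iff ℂ x).1 hx)
    have h1 := congrArg (coordMap L.V φ) (hJ.injective h0 (h.trans (map_zero J).symm))
    change coordMap L.V φ (v ⊗ₜ x) = _ at h1
    rw [coordMap_tmul, map_zero] at h1
    exact (smul_ne_zero hφ hv.1) h1
  · have := S.dom_add L.P_subset L.t_pos (L.weight_rep hv)
    rwa [add_sub_cancel] at this

/-- The proper invariant subspaces of a representation generated by a Langlands datum have small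
weights. -/
lemma smallWeights (hJ : ExtMap ρ Ψ J)
    (hgen : ∀ U, IsInvariant Ψ U → Set.range J ⊆ U → U = ⊤) {U : Submodule ℂ Q}
    (hU : IsInvariant Ψ U) (hne : U ≠ ⊤) : S.SmallWeights (resH Ψ) (S.nrm L.exponent) U := by
  intro q hq t ht
  have G := hJ.generated hgen
  have := hJ.finiteDimensional hgen
  refine (G.weight_cases ht).resolve_right fun ⟨⟨γ₀, h1⟩, _, _⟩ => hne ?_
  -- move the weight to one with dominant part `μ`
  have hq' : op Ψ γ₀⁻¹ q ∈ U := hU _ q hq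
  have ht' := isEigen_op ht γ₀⁻¹
  have hdom : S.dom (logAbs (S.charAct (S.act γ₀⁻¹⁻¹) t)) = L.exponent := by
    rw [logAbs_charAct, ← map_inv, inv_inv, dom_act, ← h1, ← aact_mul, ← map_mul, inv_mul_cancel,
      map_one, aact_one]
  obtain ⟨-, -, h3⟩ := (G.weight_cases ht').resolve_left (by rw [size, hdom]; exact lt_irrefl _)
  rw [hdom] at h3
  set D := ⨆ γ : {γ : Γ // S.aact (S.act γ) L.exponent = L.exponent}, LinearMap.range (op Ψ γ ∘ₗ J)
    with hD
  have hDinv : IsInvariant ((resH Ψ).comp (S.incl L.P_subset)) D := IsInvariant.iSup fun γ =>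
    (equivariant_op L.P_subset L.P_subset (smul_eq_of_aact_eq L.P_subset L.t_pos γ.2)
      hJ.resRep).range
  have hUinv : IsInvariant ((resH Ψ).comp (S.incl L.P_subset)) U := fun a u hu => hU _ u hu
  obtain ⟨M, hMU, hM, hirr⟩ := exists_irred_sub (hUinv.inf hDinv) (fun h => ht'.1 (by
    have : op Ψ γ₀⁻¹ q ∈ U ⊓ D := ⟨hq', h3⟩
    rwa [h, Submodule.mem_bot] at this))
  have := hirr.1
  obtain ⟨m, hm⟩ := exists_ne (0 : M)
  obtain ⟨γ, h, -, e, he⟩ := hJ.exists_repEquiv L.P_subset L.t_pos hirr (equivariant_subtype hM)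
    (N := ⊥) isInvariant_bot (m := m) (by simpa using hm) (hMU m.2).2
  -- the irreducible subspace `M` of `U`, moved back by `γ⁻¹`, is an image of `σ ∘ φ_t`
  have hF := equivariant_op_inv (Ψ := Ψ) L.P_subset L.P_subset h (τ := L.rep)
    (j := M.subtype ∘ₗ e.symm.toLinearMap) fun a v => by
      change M.subtype (e.symm _) = _
      obtain ⟨v, rfl⟩ := e.surjective v
      rw [← he, e.symm_apply_apply, equivariant_subtype hM]
      change _ = ((resH Ψ).comp (S.incl L.P_subset)) a (M.subtype (e.symm (e v)))
      rw [e.symm_apply_apply]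
  have h4 := hJ.range_le hgen hF
  obtain ⟨z, hz⟩ := h4 ⟨e m, rfl⟩
  change J z = op Ψ γ⁻¹ (e.symm (e m) : M) at hz
  rw [e.symm_apply_apply] at hz
  have hzU : J z ∈ U := by rw [hz]; exact hU _ _ (hMU m.2).1
  have h5 : IsInvariant ρ.tensorRep (U.comap J) := hJ.comap fun a u hu => hU _ u hu
  refine hgen U hU ?_
  have h6 := (ρ.isIrred_tensorRep.2 _ h5).resolve_left fun h6 => hm (by
    have h7 : z ∈ U.comap J := hzU
    rw [h6, Submodule.mem_bot] at h7
    rw [h7, map_zero] at hz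
    have h8 := op_injective (Ψ := Ψ) γ⁻¹ (hz.symm.trans (map_zero _).symm)
    simpa using h8)
  rintro _ ⟨z, rfl⟩
  exact (h6 ▸ Submodule.mem_top : z ∈ U.comap J)

/-- A representation generated by a Langlands datum for `ℋ ⋊ Γ` has a unique irreducible quotient. -/
lemma hasUniqueIrredQuotient (hJ : ExtMap ρ Ψ J) (h0 : J ≠ 0)
    (hgen : ∀ U, IsInvariant Ψ U → Set.range J ⊆ U → U = ⊤) : HasUniqueIrredQuotient Ψ := by
  have := hJ.finiteDimensional hgen
  obtain ⟨t, v, x, hz, hdom⟩ := hJ.exists_isEigen h0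
  have : Nontrivial Q := ⟨_, _, hz.1⟩
  have hθ : ∀ {U : Submodule ℂ Q}, IsInvariant Ψ U → IsInvariant (thetaRep _ (resH Ψ)) U :=
    fun hU f v hv => hU _ v hv
  refine hasUniqueIrredQuotient_of_small (S.SmallWeights (resH Ψ) (S.nrm L.exponent))
    (fun U U' hU hU' => SmallWeights.sup (hθ hU) (hθ hU'))
    (fun U hU hne => hJ.smallWeights hgen hU hne) fun htop => ?_
  have h1 := htop _ Submodule.mem_top t hz
  rw [size, hdom] at h1
  exact lt_irrefl _ h1

/-- Temperedness means that the dominant part of the exponent vanishes. -/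
lemma isTempered_iff (hJ : ExtMap ρ Ψ J) (h0 : J ≠ 0)
    (hgen : ∀ U, IsInvariant Ψ U → Set.range J ⊆ U → U = ⊤) :
    S.IsTempered Ψ ↔ L.P = S.simple ∧ ∀ x : X, ‖L.t x‖ = 1 := by
  have := hJ.finiteDimensional hgen
  constructor
  · intro h
    obtain ⟨t, v, x, hz, hdom⟩ := hJ.exists_isEigen h0
    have h1 := S.size_eq_zero.2 (S.mem_negCone_upper.1 (h t (isWeight_iff.2 ⟨_, hz⟩)))
    rw [size, hdom, S.nrm_eq_zero] at h1
    refine ⟨L.P_subset.antisymm fun i hi => ?_, fun x => ?_⟩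
    · by_contra hiP
      have h2 := L.t_pos.2 i ⟨hi, hiP⟩
      rw [show logAbs L.t = 0 from h1] at h2
      exact lt_irrefl _ h2
    · exact Real.eq_one_of_pos_of_log_eq_zero (norm_pos_iff.2 (addChar_ne_zero L.t x))
        (DFunLike.congr_fun h1 x)
  · rintro ⟨-, hx⟩ t ht
    obtain ⟨q, hq⟩ := isWeight_iff.1 ht
    have h1 : L.exponent = 0 := by
      ext x
      change Real.log ‖L.t x‖ = 0
      rw [hx, Real.log_one]
    have h2 := (hJ.generated hgen).size_le hq
    rw [h1, S.nrm_eq_zero.2 rfl] at h2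
    exact S.mem_negCone_upper.2 (S.size_eq_zero.1 (le_antisymm h2 (S.size_nonneg _)))

end ExtMap
end LanglandsDatum
end ExtendedDatum
end AffineHecke
end

noncomputable section
namespace AffineHecke
open scoped TensorProduct Pointwise

/-! ### The Langlands classification for `ℋ ⋊ Γ` -/

open BernsteinDatum RootPairing

lemma tmul_right_cancel {V W : Type*} [AddCommGroup V] [Module ℂ V] [AddCommGroup W] [Module ℂ W]
    {v : V} (hv : v ≠ 0) {x y : W} (h : v ⊗ₜ[ℂ] x = v ⊗ₜ[ℂ] y) : x = y := by
  rw [← sub_eq_zero, ← Module.forall_dual_apply_eq_zero_iff ℂ]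
  intro φ
  have h1 := congrArg (coordMap V φ) h
  rw [coordMap_tmul, coordMap_tmul, ← sub_eq_zero, ← sub_smul, ← map_sub] at h1
  exact (smul_eq_zero.1 h1).resolve_right hv

namespace ExtendedDatum
variable {ι X Y Γ : Type*} [AddCommGroup X] [AddCommGroup Y] [Group Γ]
variable {S : ExtendedDatum ι X Y Γ} [Finite ι] [Finite Γ] [Module.Finite ℤ X]
variable {Q : Type*} [AddCommGroup Q] [Module ℂ Q] {Ψ : S.HΓ →ₐ[ℂ] Module.End ℂ Q}

namespace LanglandsDatum
variable {L : LanglandsDatum.{v} S} {K : L.Cocycle}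

namespace ProjRep
variable (ρ : ProjRep K)

lemma extMap_indUnit : ExtMap ρ ρ.standard (indUnit L.inclHP ρ.tensorRep) :=
  fun a z => indUnit_apply _ _ a z

lemma indUnit_ne_zero : indUnit L.inclHP ρ.tensorRep ≠ 0 := fun h => by
  have := ρ.nontrivial_tensor
  obtain ⟨z, hz⟩ := exists_ne (0 : L.V ⊗[ℂ] ρ.W)
  exact hz (indUnit_inclHP_injective ρ.tensorRep (by rw [h]; rfl))

lemma standard_generates (U) (hU : IsInvariant ρ.standard U)
    (h : Set.range (indUnit L.inclHP ρ.tensorRep) ⊆ U) : U = ⊤ := by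
  rw [eq_top_iff]
  intro x _
  refine (Submodule.span_le.2 ?_ : _ ≤ U) (ind_span L.inclHP ρ.tensorRep x)
  rintro _ ⟨a, z, rfl⟩
  exact hU a _ (h ⟨z, rfl⟩)

lemma hasUniqueIrredQuotient_standard : HasUniqueIrredQuotient ρ.standard :=
  ρ.extMap_indUnit.hasUniqueIrredQuotient ρ.indUnit_ne_zero ρ.standard_generates

/-- The map of `(σ ∘ φ_t) ⊗ ρ` to its Langlands quotient. -/
def toHead : L.V ⊗[ℂ] ρ.W →ₗ[ℂ] _ ⧸ radical ρ.standard :=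
  (radical ρ.standard).mkQ ∘ₗ indUnit L.inclHP ρ.tensorRep

lemma extMap_toHead : ExtMap ρ (headRep ρ.standard) ρ.toHead := fun a z => by
  change (radical ρ.standard).mkQ _ = _
  rw [ρ.extMap_indUnit]; rfl

lemma toHead_ne_zero : ρ.toHead ≠ 0 := fun h => by
  refine Submodule.Quotient.nontrivial_iff.1 ρ.hasUniqueIrredQuotient_standard.1.1
    (ρ.standard_generates _ (isInvariant_radical _) ?_)
  rintro _ ⟨v, rfl⟩
  exact (Submodule.Quotient.mk_eq_zero _).1 (LinearMap.congr_fun h v)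

lemma isTempered_standard_iff :
    S.IsTempered ρ.standard ↔ L.P = S.simple ∧ ∀ x : X, ‖L.t x‖ = 1 :=
  ρ.extMap_indUnit.isTempered_iff ρ.indUnit_ne_zero ρ.standard_generates

lemma generates_of_isIrred (hΨ : IsIrred Ψ) {M : Type*} [AddCommGroup M] [Module ℂ M]
    {J : M →ₗ[ℂ] Q} (h0 : J ≠ 0) (U) (hU : IsInvariant Ψ U) (h : Set.range J ⊆ U) : U = ⊤ := by
  refine (hΨ.2 U hU).resolve_left fun h1 => h0 (LinearMap.ext fun z => ?_)
  have : J z ∈ U := h ⟨z, rfl⟩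
  rwa [h1, Submodule.mem_bot] at this

lemma isTempered_head_iff :
    S.IsTempered (headRep ρ.standard) ↔ L.P = S.simple ∧ ∀ x : X, ‖L.t x‖ = 1 :=
  ρ.extMap_toHead.isTempered_iff ρ.toHead_ne_zero
    (generates_of_isIrred ρ.hasUniqueIrredQuotient_standard.1 ρ.toHead_ne_zero)

variable {ρ}

/-- Frobenius reciprocity for the Langlands quotient. -/
lemma repEquiv_head (hΨ : IsIrred Ψ) {J : L.V ⊗[ℂ] ρ.W →ₗ[ℂ] Q} (hJ : ExtMap ρ Ψ J) (h0 : J ≠ 0) :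
    RepEquiv Ψ (headRep ρ.standard) := by
  obtain ⟨F, hF1, hF2⟩ := exists_ind_lift (f := L.inclHP) (π := ρ.tensorRep) (τ := Ψ) J hJ
  refine ρ.hasUniqueIrredQuotient_standard.repEquiv hΨ (F := F) hF2 fun h => h0 ?_
  refine LinearMap.ext fun z => ?_
  rw [← hF1, h]; rfl

end ProjRep

section Existence

/-- A projective representation of `G` is in particular a family of endomorphisms indexed by `G`, that
is, a representation of the free algebra on `G`. The general facts about representations of algebras
apply to it in this way. -/
lemma isInvariant_of_freeAlgebra {G M : Type*} [AddCommGroup M] [Module ℂ M]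
    {π : FreeAlgebra ℂ G →ₐ[ℂ] Module.End ℂ M} {U : Submodule ℂ M}
    (h : ∀ g, ∀ u ∈ U, π (FreeAlgebra.ι ℂ g) u ∈ U) : IsInvariant π U := by
  intro a
  induction a using FreeAlgebra.induction with
  | grade0 r =>
    intro u hu
    rw [AlgHom.commutes]
    exact U.smul_mem r hu
  | grade1 g => exact h g
  | mul a b ha hb => intro u hu; rw [map_mul]; exact ha _ (hb u hu)
  | add a b ha hb => intro u hu; rw [map_add]; exact add_mem (ha u hu) (hb u hu)

variable (L Ψ) in
/-- The multiplicity space `Hom_{ℋ^P}(σ ∘ φ_t, Ψ)`. -/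
def homSpace : Submodule ℂ (L.V →ₗ[ℂ] Q) where
  carrier := {f | Equivariant L.rep ((resH Ψ).comp (S.incl L.P_subset)) f}
  add_mem' hf hg a v := by rw [LinearMap.add_apply, hf, hg, LinearMap.add_apply, map_add]
  zero_mem' a v := by simp
  smul_mem' c f hf a v := by rw [LinearMap.smul_apply, hf, LinearMap.smul_apply, map_smul]

variable (Ψ K) in
/-- The action `f ↦ δ ∘ f ∘ I_δ⁻¹` on linear maps `V_σ → Q`. -/
def homAct (δ : L.isotropy) : Module.End ℂ (L.V →ₗ[ℂ] Q) where
  toFun f := op Ψ δ ∘ₗ f ∘ₗ (K.I δ).symm.toLinearMap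
  map_add' f g := by ext v; simp
  map_smul' c f := by ext v; simp

lemma homAct_apply (δ : L.isotropy) (f : L.V →ₗ[ℂ] Q) (v : L.V) :
    homAct Ψ K δ f v = op Ψ δ (f ((K.I δ).symm v)) := rfl

lemma homAct_mem (δ : L.isotropy) {f : L.V →ₗ[ℂ] Q} (hf : f ∈ L.homSpace Ψ) :
    homAct Ψ K δ f ∈ L.homSpace Ψ := fun a v => by
  obtain ⟨b, rfl⟩ := S.psi_surjective (L.isotropy_smul δ) a
  obtain ⟨u, rfl⟩ := (K.I δ).surjective v
  rw [homAct_apply, homAct_apply, ← K.intertwines δ, LinearEquiv.symm_apply_apply,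
    LinearEquiv.symm_apply_apply, hf]
  refine (op_resH _ _ _).trans ?_
  change resH Ψ (S.psi δ (S.act_simple δ) (S.incl L.P_subset b)) _ = resH Ψ (S.incl L.P_subset _) _
  rw [L.incl_psi]

lemma homAct_injective (δ : L.isotropy) : Function.Injective (homAct Ψ K δ) := fun f g h => by
  ext v
  have := LinearMap.congr_fun h (K.I δ v)
  rw [homAct_apply, homAct_apply, LinearEquiv.symm_apply_apply] at this
  exact op_injective _ this

/-- The action on the multiplicity space is projective, with the cocycle `κ`. -/
lemma homAct_mul (δ ε : L.isotropy) (f : L.V →ₗ[ℂ] Q) :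
    homAct Ψ K δ (homAct Ψ K ε f) = (K.κ δ ε : ℂ) • homAct Ψ K (δ * ε) f := by
  ext v
  obtain ⟨u, rfl⟩ := (K.I δ).surjective v
  obtain ⟨u, rfl⟩ := (K.I ε).surjective u
  have h1 : (K.I (δ * ε)).symm (K.I δ (K.I ε u)) = ((K.κ δ ε)⁻¹ : ℂˣ) • u := by
    rw [LinearEquiv.symm_apply_eq, Units.smul_def, map_smul, K.I_mul, smul_smul, ← Units.val_mul,
      inv_mul_cancel, Units.val_one, one_smul]
  rw [homAct_apply, homAct_apply, LinearMap.smul_apply, homAct_apply, h1, Units.smul_def, map_smul,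
    map_smul, smul_smul, ← Units.val_mul, mul_inv_cancel, Units.val_one, one_smul,
    LinearEquiv.symm_apply_apply, LinearEquiv.symm_apply_apply, Subgroup.coe_mul, op_mul]

/-- An irreducible representation of `ℋ ⋊ Γ` that contains an image of `σ ∘ φ_t` is a Langlands
quotient for some `ρ`: take an irreducible subrepresentation of the multiplicity space. -/
lemma exists_projRep (hΨ : IsIrred Ψ) {f : L.V →ₗ[ℂ] Q} (hf : f ∈ L.homSpace Ψ) (h0 : f ≠ 0)
    (K : L.Cocycle) : ∃ ρ : ProjRep K, RepEquiv Ψ (headRep ρ.standard) := by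
  have := finiteDimensional_of_isIrred_crossed hΨ
  have := L.finiteDimensional
  let π : FreeAlgebra ℂ L.isotropy →ₐ[ℂ] Module.End ℂ (L.V →ₗ[ℂ] Q) :=
    FreeAlgebra.lift ℂ (homAct Ψ K)
  have hπ : ∀ δ, π (FreeAlgebra.ι ℂ δ) = homAct Ψ K δ := fun δ => FreeAlgebra.lift_ι_apply _ _
  have hinv : IsInvariant π (L.homSpace Ψ) := isInvariant_of_freeAlgebra fun δ g hg => by
    rw [hπ]; exact homAct_mem δ hg
  obtain ⟨M, hM, hMinv, hirr⟩ := exists_irred_sub hinv (fun h => h0 (by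
    rwa [h, Submodule.mem_bot] at hf))
  obtain ⟨W, _, _, σ, e, he⟩ := exists_transport.{v} (subRep π M hMinv)
  have hσ : IsIrred σ := hirr.of_repEquiv (RepEquiv.symm ⟨e, he⟩)
  have : FiniteDimensional ℂ W := Module.Finite.equiv e.symm
  have he' : ∀ δ w, (e (σ (FreeAlgebra.ι ℂ δ) w) : L.V →ₗ[ℂ] Q) = homAct Ψ K δ (e w) := fun δ w => by
    rw [he, coe_subRep, hπ]
  have hinj : ∀ δ, Function.Injective (σ (FreeAlgebra.ι ℂ δ)) := fun δ w w' h => by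
    have h1 := congrArg (fun w => (e w : L.V →ₗ[ℂ] Q)) h
    simp only [he'] at h1
    exact e.injective (Subtype.ext (homAct_injective δ h1))
  let ρ : ProjRep K :=
    { W := W
      ρ := fun δ => LinearEquiv.ofInjectiveEndo _ (hinj δ)
      ρ_mul := fun δ ε w => by
        apply e.injective
        apply Subtype.ext
        change (e (σ _ (σ _ w)) : L.V →ₗ[ℂ] Q) = (e ((K.κ δ ε : ℂ) • σ (FreeAlgebra.ι ℂ (δ * ε)) w) : M)
        rw [he', he', map_smul, Submodule.coe_smul, he', homAct_mul]
      nontrivial := hσ.1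
      irred := fun U hU => hσ.2 U (isInvariant_of_freeAlgebra hU) }
  let J : L.V ⊗[ℂ] ρ.W →ₗ[ℂ] Q := TensorProduct.lift (M.subtype ∘ₗ e.toLinearMap).flip
  have hJ : ∀ v w, J (v ⊗ₜ w) = (e w : L.V →ₗ[ℂ] Q) v := fun v w => rfl
  refine ⟨ρ, ProjRep.repEquiv_head hΨ (J := J) (ExtMap.mk (fun a z => ?_) fun δ v w => ?_) fun h => ?_⟩
  · induction z using TensorProduct.induction_on with
    | zero => simp
    | tmul v w =>
      rw [AlgHom.comp_apply, ρ.tensorRep_of, hJ, hJ]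
      exact hM (e w).2 a v
    | add z z' hz hz' => rw [map_add, map_add, hz, hz', map_add, map_add]
  · rw [hJ, hJ]
    change (e (σ (FreeAlgebra.ι ℂ δ) w) : L.V →ₗ[ℂ] Q) (K.I δ v) = _
    rw [he', homAct_apply, LinearEquiv.symm_apply_apply]
  · have := hσ.1
    obtain ⟨w, hw⟩ := exists_ne (0 : W)
    refine hw (e.map_eq_zero_iff.1 (Subtype.ext (LinearMap.ext fun v => ?_)))
    rw [← hJ, h]; rfl

end Existence

section Uniqueness

variable {L' : LanglandsDatum.{v} S} {K' : L'.Cocycle} {ρ : ProjRep K} {ρ' : ProjRep K'}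

/-- When `γ` moves `L` to `L'`, the comparison of the cocycles of `L` and `L'`. -/
lemma exists_conj_scalar (K : L.Cocycle) (K' : L'.Cocycle) {γ : Γ} {h : S.act γ • L.P = L'.P}
    {e : L.V ≃ₗ[ℂ] L'.V} (he : L.Intertwines L' γ h e) (δ : L.isotropy) :
    ∃ c : ℂˣ, ∀ v, e (K.I δ v) = (c : ℂ) • K'.I (conj ⟨h, e, he⟩ δ) (e v) :=
  Intertwines.exists_unit (γ := γ * δ) (h := S.smul_mul_eq (L.isotropy_smul δ) h)
    ((K.intertwines δ).trans he rfl _)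
    (he.trans (K'.intertwines (conj ⟨h, e, he⟩ δ))
      (by change _ = γ * δ * γ⁻¹ * γ; rw [inv_mul_cancel_right]) _)

/-- Two Langlands data for `ℋ ⋊ Γ` that map to the same irreducible representation are conjugate. -/
lemma conjugate_of_extMap (hΨ : IsIrred Ψ) {J : L.V ⊗[ℂ] ρ.W →ₗ[ℂ] Q} (hJ : ExtMap ρ Ψ J)
    (h0 : J ≠ 0) {J' : L'.V ⊗[ℂ] ρ'.W →ₗ[ℂ] Q} (hJ' : ExtMap ρ' Ψ J') (h0' : J' ≠ 0) :
    ρ.Conjugate ρ' := by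
  have hgen := ProjRep.generates_of_isIrred hΨ h0
  have hgen' := ProjRep.generates_of_isIrred hΨ h0'
  have G := hJ.generated hgen
  have G' := hJ'.generated hgen'
  have := hJ.finiteDimensional hgen
  have := L.isIrred_rep.1
  have := L'.isIrred_rep.1
  have := ρ.nontrivial
  obtain ⟨v₀, hv₀⟩ := exists_ne (0 : L.V)
  -- the exponents have the same norm, and this yields `γ`
  obtain ⟨t, v, x, ht, hdom⟩ := hJ.exists_isEigen h0
  obtain ⟨t', v', x', ht', hdom'⟩ := hJ'.exists_isEigen h0'
  have h1 : S.size (logAbs t') ≤ S.size (logAbs t) := by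
    have := G.size_le ht'
    rwa [← hdom] at this
  rw [size, hdom'] at h1
  obtain ⟨-, -, h2⟩ := (G'.weight_cases ht).resolve_left (not_lt.2 h1)
  rw [hdom] at h2
  obtain ⟨γ, hγ, -, H⟩ := hJ'.exists_repEquiv L.P_subset L.t_pos L.isIrred_rep
    (hJ.equivariant_slice x) (N := ⊥) isInvariant_bot (m := v) (by simpa using ht.1) h2
  obtain ⟨h, e, he⟩ := ExtMap.moves_of_repEquiv hγ H
  generalize γ⁻¹ = γ at h he
  clear H hγ
  -- the comparison of the multiplicity spaces
  have hg : ∀ x : ρ.W, ∃ y : ρ'.W, ∀ v, op Ψ γ (J (v ⊗ₜ x)) = J' (e v ⊗ₜ y) := fun x => by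
    have h3 := equivariant_op L.P_subset L'.P_subset h (hJ.equivariant_slice x)
    obtain ⟨y, hy⟩ := hJ'.exists_eq_tmul h0' hgen'
      (F := (op Ψ γ ∘ₗ (J ∘ₗ (TensorProduct.mk ℂ L.V ρ.W).flip x)) ∘ₗ e.symm.toLinearMap)
      fun a u => by
        rw [LinearMap.comp_apply, LinearMap.comp_apply _ e.symm.toLinearMap, ← h3]
        congr 1
        change e.symm _ = L.rep (S.psi γ⁻¹ (S.smul_inv_eq h) a) (e.symm u)
        rw [LinearEquiv.symm_apply_eq, he, S.psi_psi_inv, LinearEquiv.apply_symm_apply]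
    refine ⟨y, fun v => ?_⟩
    have := hy (e v)
    rw [← this]
    change _ = op Ψ γ (J (e.symm (e v) ⊗ₜ x))
    rw [e.symm_apply_apply]
  choose g hg using hg
  have hcancel : ∀ {u : L.V} (_ : u ≠ 0) {y y' : ρ'.W}, J' (e u ⊗ₜ y) = J' (e u ⊗ₜ y') → y = y' :=
    fun hu _ _ h => tmul_right_cancel (mt e.map_eq_zero_iff.1 hu) (hJ'.injective h0' h)
  let g' : ρ.W →ₗ[ℂ] ρ'.W :=
    { toFun := g
      map_add' := fun x y => hcancel hv₀ (by
        rw [← hg, TensorProduct.tmul_add, TensorProduct.tmul_add, map_add, map_add, map_add, hg, hg])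
      map_smul' := fun c x => hcancel hv₀ (by
        rw [← hg, RingHom.id_apply, TensorProduct.tmul_smul, TensorProduct.tmul_smul, map_smul,
          map_smul, map_smul, hg]) }
  choose c hc using exists_conj_scalar K K' he
  -- the map `g` intertwines the projective representations, up to the comparison of the cocycles
  have hgρ : ∀ δ x, g (ρ.ρ δ x) = ((c δ)⁻¹ : ℂˣ) • ρ'.ρ (conj ⟨h, e, he⟩ δ) (g x) := fun δ x => by
    refine hcancel (u := K.I δ v₀) (mt (K.I δ).map_eq_zero_iff.1 hv₀) ?_
    rw [← hg, hJ.gp, Units.smul_def, TensorProduct.tmul_smul, TensorProduct.smul_tmul', hc,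
      smul_smul, ← Units.val_mul, inv_mul_cancel, Units.val_one, one_smul, hJ'.gp, ← hg, ← op_mul,
      ← op_mul]
    congr 2
    change γ * δ = γ * δ * γ⁻¹ * γ
    rw [inv_mul_cancel_right]
  have hginj : Function.Injective g' := by
    rw [← LinearMap.ker_eq_bot, LinearMap.ker_eq_bot']
    intro x hx
    change g x = 0 at hx
    have h3 := hg x v₀
    rw [hx, TensorProduct.tmul_zero, map_zero] at h3
    have h4 := op_injective (Ψ := Ψ) γ (h3.trans (map_zero _).symm)
    have h5 := hJ.injective h0 (h4.trans (map_zero J).symm)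
    rw [← TensorProduct.tmul_zero _ v₀] at h5
    exact tmul_right_cancel hv₀ h5
  have hgsurj : Function.Surjective g' := by
    rw [← LinearMap.range_eq_top]
    refine (ρ'.irred (LinearMap.range g') ?_).resolve_left fun h3 => ?_
    · rintro δ _ ⟨x, rfl⟩
      have hm : Moves γ L L' := ⟨h, e, he⟩
      obtain ⟨ε, rfl⟩ : ∃ ε : L.isotropy, conj hm ε = δ := ⟨conj hm.symm δ, Subtype.ext (by
        change γ * (γ⁻¹ * δ * γ⁻¹⁻¹) * γ⁻¹ = δ
        group)⟩
      refine ⟨(c ε : ℂ) • ρ.ρ ε x, ?_⟩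
      rw [map_smul]
      change (c ε : ℂ) • g (ρ.ρ ε x) = _
      rw [hgρ, Units.smul_def, smul_smul, ← Units.val_mul, mul_inv_cancel, Units.val_one, one_smul]
      rfl
    · obtain ⟨x, hx⟩ := exists_ne (0 : ρ.W)
      exact hx (hginj ((LinearMap.congr_fun (LinearMap.range_eq_bot.1 h3) x).trans (map_zero g').symm))
  exact ⟨γ, h, e, he, LinearEquiv.ofBijective g' ⟨hginj, hgsurj⟩, c, fun δ => ⟨hc δ, hgρ δ⟩⟩

/-- Conjugate data map to the same representations. -/
lemma ProjRep.Conjugate.exists_extMap (H : ρ.Conjugate ρ') {J' : L'.V ⊗[ℂ] ρ'.W →ₗ[ℂ] Q}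
    (hJ' : ExtMap ρ' Ψ J') (h0' : J' ≠ 0) : ∃ J, ExtMap ρ Ψ J ∧ J ≠ 0 := by
  obtain ⟨γ, h, e, he, g, c, H⟩ := H
  let E : L.V ⊗[ℂ] ρ.W ≃ₗ[ℂ] L'.V ⊗[ℂ] ρ'.W := TensorProduct.congr e g
  have hE : ∀ v x, E (v ⊗ₜ x) = e v ⊗ₜ g x := fun v x => TensorProduct.congr_tmul _ _ _ _
  refine ⟨op Ψ γ⁻¹ ∘ₗ (J' ∘ₗ E.toLinearMap), ExtMap.mk ?_ ?_, fun h1 => h0' ?_⟩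
  · refine equivariant_op_inv L.P_subset L'.P_subset h fun a z => ?_
    induction z using TensorProduct.induction_on with
    | zero => simp
    | tmul v x =>
      change J' (E (ρ.tensorRep (Crossed.of _ (S.psi γ⁻¹ (S.smul_inv_eq h) a)) (v ⊗ₜ x))) =
        ((resH Ψ).comp (S.incl L'.P_subset)) a (J' (E (v ⊗ₜ x)))
      rw [ρ.tensorRep_of, hE, hE, he, S.psi_psi_inv, ← hJ'.resRep, AlgHom.comp_apply,
        ρ'.tensorRep_of]
    | add z z' hz hz' => rw [map_add, map_add, hz, hz', map_add, map_add]
  · intro δ v x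
    change op Ψ γ⁻¹ (J' (E _)) = op Ψ δ (op Ψ γ⁻¹ (J' (E _)))
    rw [hE, hE, (H δ).1, (H δ).2, Units.smul_def, TensorProduct.tmul_smul, TensorProduct.smul_tmul',
      smul_smul, ← Units.val_mul, inv_mul_cancel, Units.val_one, one_smul, hJ'.gp, ← op_mul, ← op_mul]
    congr 2
    change γ⁻¹ * (γ * δ * γ⁻¹) = δ * γ⁻¹
    group
  · refine LinearMap.ext fun z => ?_
    obtain ⟨z, rfl⟩ := E.surjective z
    exact op_injective (Ψ := Ψ) γ⁻¹ ((LinearMap.congr_fun h1 z).trans (map_zero _).symm)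

/-- Langlands quotients are isomorphic if and only if the data are conjugate. -/
lemma ProjRep.repEquiv_head_iff :
    RepEquiv (headRep ρ.standard) (headRep ρ'.standard) ↔ ρ.Conjugate ρ' := by
  constructor
  · rintro ⟨e, he⟩
    refine conjugate_of_extMap ρ'.hasUniqueIrredQuotient_standard.1 (J := e.toLinearMap ∘ₗ ρ.toHead)
      (fun a z => ?_) (fun h => ρ.toHead_ne_zero (LinearMap.ext fun z => ?_)) ρ'.extMap_toHead
      ρ'.toHead_ne_zero
    · change e (ρ.toHead _) = _
      rw [ρ.extMap_toHead]; exact he _ _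
    · exact e.map_eq_zero_iff.1 (LinearMap.congr_fun h z)
  · intro H
    obtain ⟨J, hJ, h0⟩ := H.exists_extMap ρ'.extMap_toHead ρ'.toHead_ne_zero
    exact (repEquiv_head ρ'.hasUniqueIrredQuotient_standard.1 hJ h0).symm

end Uniqueness

end LanglandsDatum

/-- Every irreducible representation of `ℋ ⋊ Γ` is a Langlands quotient, for any choice of the
cocycle. -/
lemma exists_repEquiv_head_crossed (hΨ : IsIrred Ψ) : ∃ L : LanglandsDatum.{v} S,
    ∀ K : L.Cocycle, ∃ ρ : LanglandsDatum.ProjRep K, RepEquiv Ψ (headRep ρ.standard) := by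
  have := finiteDimensional_of_isIrred_crossed hΨ
  have := hΨ.1
  obtain ⟨L, f, h0, hf⟩ := exists_langlandsDatum.{v} (resH Ψ)
  exact ⟨L, LanglandsDatum.exists_projRep hΨ hf h0⟩

end ExtendedDatum
end AffineHecke
end

theorem corollary2p8 {ι X Y Γ : Type*} [AddCommGroup X] [AddCommGroup Y] [Group Γ]
    [Finite ι] [Module.Finite ℤ X] [Module.Finite ℤ Y] [Finite Γ]
    (S : ExtendedDatum ι X Y Γ) :
    -- The Langlands classification for `ℋ`.
    ((∀ L : ExtendedDatum.LanglandsDatum.{v} S, HasUniqueIrredQuotient L.standard) ∧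
      (∀ (V : Type w) [AddCommGroup V] [Module ℂ V] (π : S.H →ₐ[ℂ] Module.End ℂ V),
        IsIrred π → ∃ L : ExtendedDatum.LanglandsDatum.{v} S, RepEquiv π (headRep L.standard)) ∧
      (∀ L L' : ExtendedDatum.LanglandsDatum.{v} S,
        RepEquiv (headRep L.standard) (headRep L'.standard) ↔ L.Equivalent L')) ∧
    -- Every Langlands datum for `ℋ` has a cocycle on its isotropy group.
    (∀ L : ExtendedDatum.LanglandsDatum.{v} S, Nonempty L.Cocycle) ∧
    -- (a) The standard module has a unique irreducible quotient.
    (∀ (L : ExtendedDatum.LanglandsDatum.{v} S) (K : L.Cocycle)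
      (ρ : ExtendedDatum.LanglandsDatum.ProjRep K), HasUniqueIrredQuotient ρ.standard) ∧
    -- (b) Every irreducible representation of `ℋ ⋊ Γ` is a Langlands quotient, with any choice of
    -- the cocycle; and the Langlands datum is unique modulo `Γ`.
    ((∀ (V : Type w) [AddCommGroup V] [Module ℂ V] (π : S.HΓ →ₐ[ℂ] Module.End ℂ V), IsIrred π →
        ∃ L : ExtendedDatum.LanglandsDatum.{v} S, ∀ K : L.Cocycle,
          ∃ ρ : ExtendedDatum.LanglandsDatum.ProjRep K, RepEquiv π (headRep ρ.standard)) ∧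
      (∀ (L L' : ExtendedDatum.LanglandsDatum.{v} S) (K : L.Cocycle) (K' : L'.Cocycle)
        (ρ : ExtendedDatum.LanglandsDatum.ProjRep K)
        (ρ' : ExtendedDatum.LanglandsDatum.ProjRep K'),
        RepEquiv (headRep ρ.standard) (headRep ρ'.standard) ↔ ρ.Conjugate ρ')) ∧
    -- (c) Temperedness of the Langlands quotient and of the standard module.
    (∀ (L : ExtendedDatum.LanglandsDatum.{v} S) (K : L.Cocycle)
      (ρ : ExtendedDatum.LanglandsDatum.ProjRep K),
      (S.IsTempered (headRep ρ.standard) ↔ L.P = S.simple ∧ ∀ x : X, ‖L.t x‖ = 1) ∧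
      (S.IsTempered ρ.standard ↔ L.P = S.simple ∧ ∀ x : X, ‖L.t x‖ = 1)) := by
  exact ⟨⟨fun L => L.hasUniqueIrredQuotient_standard,
      fun V _ _ π hπ => ExtendedDatum.exists_repEquiv_head hπ,
      fun L L' => ExtendedDatum.LanglandsDatum.repEquiv_head_iff⟩,
    fun L => L.nonempty_cocycle, fun L K ρ => ρ.hasUniqueIrredQuotient_standard,
    ⟨fun V _ _ π hπ => ExtendedDatum.exists_repEquiv_head_crossed hπ,
      fun L L' K K' ρ ρ' => ExtendedDatum.LanglandsDatum.ProjRep.repEquiv_head_iff⟩,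
    fun L K ρ => ⟨ρ.isTempered_head_iff, ρ.isTempered_standard_iff⟩⟩
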